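/- **Setting.** A CSS code $Q$ on $n$ qubits is given by full-rank matrices $H^X\in\mathbb F_2^{m_x\times n}$, $H^Z\in\mathbb F_2^{m_z\times n}$ with $H^X(H^Z)^T=0$; it encodes $k=n-m_x-m_z$ qubits and has distance $d$, the least weight of a vector in $(\ker H^Z\setminus \mathrm{row}\,H^X)\cup(\ker H^X\setminus \mathrm{row}\,H^Z)$. It is $\ell$-LDPC if its stabilizer group is generated by Pauli checks of weight at most $\ell$, with every qubit in the support of at most $\ell$ of them. Fix logical Pauli operators of $Q$. A unitary $G$ on the logical qubits of $r$ code blocks is a *transversal gate* if it is the action on the code space of some $U_1\otimes\cdots\otimes U_n$, where $U_i$ is a unitary on the $i$-th qubits of the $r$ blocks; it is a *transversal Clifford gate* if $G$ and all $U_i$ can moreover be taken Clifford. A logical circuit $C$ on $N$ blocks starts every block in $|0\rangle^{\otimes k}$ or in $|+\rangle^{\otimes k}$ or in a share of $k$ GHZ states held by a group of blocks, applies $D$ layers of gates, the gates of one layer acting on disjoint sets of at most $w$ blocks, and measures all logical qubits of each block in the standard or in the Hadamard basis. A random Pauli error $E$ is *local stochastic of rate $p$* if $\Pr[S\subseteq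 \mathrm{supp}(E)]\le p^{|S|}$ for every set $S$ of qubits; the same definition is used for a random set of qubits in place of $\mathrm{supp}(E)$. In a noisy circuit of rate $p$ such an error occurs before the first layer, after each layer, and so before the final measurements; errors of different times may be arbitrarily correlated. **Theorem.** For all $\ell,D,w$ there are $K\in\mathbb N$, $p^*\in(0,1)$ and $c,c_1,c_2>0$ such that for every $\ell$-LDPC CSS code $Q$ there is, for each of the two measurement bases, a classical readout rule $\mathbb F_2^n\to\mathbb F_2^k$ for single blocks, such that the following holds for all $N$, all $T\ge 1$ and every logical circuit $C$ on $N$ blocks with at most $D$ layers of gates on at most $w$ blocks each. Let $\varepsilon(p)=N\,n\,T\,(p/p^*)^{c\min(T,d)}$. (a) *Clifford gates.* Suppose that all gates of $C$ are transversal Clifford gates. Then there is a circuit $W$ of depth at most $K$, with gates on at most $\max(2,w)$ qubits, on the $Nn$ qubits of the $N$ code blocks and at most $K N n T$ ancillas, all initialized in $|0\rangle$, with no measurement before the end and no feedforward. At the end the ancillas are measured, with outcome $s$, each in the standard or Hadamard basis, and every qubit of a code block is measured in the basis in which $C$ measures that block. There are a Pauli frame $\mathrm{Rec}(s)$ on the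 code blocks, a Pauli error $\mathrm{Rep}(E)$ on the code blocks for each pattern $E$ of faults of $W$, and a set of good fault patterns, such that for good $E$ and every $s$ the (unnormalized) state of the code blocks given $s$, multiplied by $\mathrm{Rec}(s)$, is a multiple of $\mathrm{Rep}(E)$ applied to the encoded final state of $C$. Moreover, for $0\le p<p^*$ and all noise of rate $p$: the faults are good with probability at least $1-\varepsilon(p)$; $\mathrm{Rep}(E)$ is local stochastic of rate $c_1p^{c_2}$; and if the outcome bits of the code blocks are corrected by the flips that $\mathrm{Rec}(s)$ causes, and are then read out block by block, the result has a distribution within total variation distance $\varepsilon(p)$ of the output distribution of $C$. (b) *Arbitrary transversal gates, with one round of feedforward.* Suppose that all gates of $C$ are transversal. Then there are circuits $W$ on the code blocks and at most $KNnT$ ancillas, all initialized in $|0\rangle$, and $V$ on the code blocks, of total depth at most $K$ and with gates on at most $\max(2,w)$ qubits, such that the following noisy procedure implements $C$: run $W$, measure the ancillas (outcome $s$), apply a Pauli operator $\mathrm{Rec}(s)$ to the code blocks, run $V$, and measure the code blocks as in (a). For each good pattern $E$ of faults there is a unitary $F$, supported on a set $R(E)$ of qubits, such that for every $s$ the state before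 the last measurement is a multiple of $F$ applied to the encoded final state of $C$. For $0\le p<p^*$ and all noise of rate $p$: the faults are good with probability at least $1-\varepsilon(p)$; the random set $R(E)$ is local stochastic of rate $c_1p^{c_2}$; and the outcome bits of the code blocks, read out block by block, have a distribution within total variation distance $\varepsilon(p)$ of the output distribution of $C$. -/

import Mathlib

open scoped BigOperators Matrix

noncomputable section

namespace ShallowFT

/-! ### Qubits, Pauli operators, Clifford operators -/

/-- Bit strings indexed by `ι`; they label the computational basis of the qubits `ι`. -/
abbrev Bits (ι : Type) : Type := ι → ZMod 2

/-- Vectors of the Hilbert space of the qubits `ι`, by their computational-basis amplitudes. -/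
abbrev State (ι : Type) : Type := Bits ι → ℂ

/-- Operators on the qubits `ι`. -/
abbrev Op (ι : Type) : Type := Matrix (Bits ι) (Bits ι) ℂ

/-- `(a, b)` stands for the Pauli operator `X^a Z^b` (global phases play no role). -/
abbrev Pauli (ι : Type) : Type := Bits ι × Bits ι

/-- The sign `(-1)^b`. -/
def bsign (b : ZMod 2) : ℂ := if b = 0 then 1 else -1

/-- The operator `X^a Z^b`, that is `|x⟩ ↦ (-1)^(b ⬝ x) |x + a⟩`. -/
def pauliOp {ι : Type} [Fintype ι] [DecidableEq ι] (P : Pauli ι) : Op ι :=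
  Matrix.of fun y x => if y = x + P.1 then bsign (∑ i, P.2 i * x i) else 0

/-- The qubits on which a Pauli operator acts nontrivially. -/
def pauliSupp {ι : Type} [Fintype ι] [DecidableEq ι] (P : Pauli ι) : Finset ι :=
  Finset.univ.filter fun i => P.1 i ≠ 0 ∨ P.2 i ≠ 0

/-- A Clifford operator: a unitary that conjugates Paulis to Paulis, up to phases. -/
def IsClifford {ι : Type} [Fintype ι] [DecidableEq ι] (U : Op ι) : Prop :=
  U ∈ Matrix.unitaryGroup (Bits ι) ℂ ∧
    ∀ P : Pauli ι, ∃ (P' : Pauli ι) (c : ℂ), U * pauliOp P * star U = c • pauliOp P'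

open Classical in
/-- The operator on the qubits `ι` that acts as `U` on the qubits `e a` and as the identity on
all the other ones. -/
def liftOp {α ι : Type} (e : α ↪ ι) (U : Op α) : Op ι :=
  Matrix.of fun y x => if ∀ i, i ∉ Set.range e → y i = x i then U (y ∘ e) (x ∘ e) else 0

/-- `F` acts as the identity outside the set `R` of qubits. -/
def SupportedOn {ι : Type} (F : Op ι) (R : Finset ι) : Prop :=
  ∃ G : Op {i // i ∈ R}, F = liftOp (Function.Embedding.subtype _) G

open Classical in
/-- The normalized uniform superposition of the basis states in `A`. -/
def uniformState {ι : Type} (A : Set (Bits ι)) : State ι :=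
  fun x => if x ∈ A then (((Real.sqrt (A.ncard : ℝ))⁻¹ : ℝ) : ℂ) else 0

/-- The state `|0 ⋯ 0⟩`. -/
def zeroState (ι : Type) : State ι := uniformState {0}

/-! ### Single-qubit measurements -/

/-- The standard (`Z`) and the Hadamard (`X`) measurement basis. -/
inductive Basis : Type
  | std
  | had

/-- The amplitude `⟨t|s⟩` of the `s`-th vector of a basis: `|0⟩, |1⟩` or `|+⟩, |-⟩`. All these
amplitudes are real. -/
def Basis.ket : Basis → ZMod 2 → ZMod 2 → ℂ
  | .std, s, t => if s = t then 1 else 0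
  | .had, s, t => bsign (s * t) * (((Real.sqrt 2)⁻¹ : ℝ) : ℂ)

/-- The amplitude of the measurement outcome `z` in the state `φ`, when qubit `i` is measured in
the basis `m i`. -/
def amplitude {ι : Type} [Fintype ι] [DecidableEq ι] (m : ι → Basis) (φ : State ι) (z : Bits ι) :
    ℂ :=
  ∑ t : Bits ι, (∏ i, (m i).ket (z i) (t i)) * φ t

/-- The (Born) weight of the measurement outcome `z` in the possibly unnormalized state `φ`. -/
def weight {ι : Type} [Fintype ι] [DecidableEq ι] (m : ι → Basis) (φ : State ι) (z : Bits ι) : ℝ :=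
  ‖amplitude m φ z‖ ^ 2

/-- The unnormalized state of the qubits `δ` after the qubits `β` were measured, with outcome `s`,
in the bases `m`. -/
def postMeasure {δ β : Type} [Fintype β] [DecidableEq β] (m : β → Basis) (ψ : State (δ ⊕ β))
    (s : Bits β) : State δ :=
  fun z => amplitude m (fun t => ψ (Sum.elim z t)) s

/-- The outcome bits that a Pauli operator flips when it is followed by a measurement in the
bases `m`. -/
def flips {ι : Type} (m : ι → Basis) (P : Pauli ι) : Bits ι :=
  fun i => match m i with
    | .std => P.1 i
    | .had => P.2 i

/-! ### Noisy circuits -/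

/-- A unitary gate placed on finitely many of the qubits `ι`. -/
structure Gate (ι : Type) where
  arity : ℕ
  pos : Fin arity ↪ ι
  op : Op (Fin arity)
  unitary : op ∈ Matrix.unitaryGroup (Bits (Fin arity)) ℂ

/-- A circuit: `depth` layers of gates, where the gates of one layer act on disjoint qubits. There
are no measurements inside a circuit. -/
structure Circuit (ι : Type) where
  depth : ℕ
  layers : Fin depth → List (Gate ι)
  disjoint : ∀ t, (layers t).Pairwise fun g h => Disjoint (Set.range g.pos) (Set.range h.pos)

/-- All gates act on at most `w` qubits. -/
def Circuit.FanIn {ι : Type} (C : Circuit ι) (w : ℕ) : Prop :=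
  ∀ t, ∀ g ∈ C.layers t, g.arity ≤ w

/-- The unitary of layer `t`. -/
def Circuit.layerOp {ι : Type} [Fintype ι] [DecidableEq ι] (C : Circuit ι) (t : Fin C.depth) :
    Op ι :=
  ((C.layers t).map fun g => liftOp g.pos g.op).prod

/-- A Pauli error on all qubits before the first layer and after each layer. -/
abbrev Circuit.Faults {ι : Type} (C : Circuit ι) : Type := Fin (C.depth + 1) → Pauli ι

instance Circuit.fintypeFaults {ι : Type} [Fintype ι] [DecidableEq ι] (C : Circuit ι) :
    Fintype C.Faults :=
  inferInstanceAs (Fintype (Fin (C.depth + 1) → Pauli ι))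

/-- The state `E_D U_D ⋯ E_1 U_1 E_0 φ` computed by the circuit with the faults `E`. -/
def Circuit.run {ι : Type} [Fintype ι] [DecidableEq ι] (C : Circuit ι) (E : C.Faults)
    (φ : State ι) : State ι :=
  Fin.induction (motive := fun _ => State ι) (pauliOp (E 0) *ᵥ φ)
    (fun t ψ => pauliOp (E t.succ) *ᵥ (C.layerOp t *ᵥ ψ)) (Fin.last C.depth)

/-! ### Probability on finite sets -/

/-- The probability of an event. -/
def prob {Ω : Type} [Fintype Ω] (μ : PMF Ω) (A : Set Ω) : ℝ :=
  ∑ ω, A.indicator (fun ω => (μ ω).toReal) ω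

/-- The random set `R` of faulty qubits is local stochastic of rate `p`. -/
def LocalStochastic {Ω ι : Type} [Fintype Ω] (μ : PMF Ω) (R : Ω → Finset ι) (p : ℝ) : Prop :=
  ∀ S : Finset ι, prob μ {ω | S ⊆ R ω} ≤ p ^ S.card

/-- The total variation distance. -/
def tvDist {Y : Type} [Fintype Y] (f g : Y → ℝ) : ℝ := (1 / 2) * ∑ y, |f y - g y|

open Classical in
/-- The distribution of `out s z`, where the faults `E` are drawn from `μ` and, given `E`, the
measurement outcomes `(s, z)` have probability `q E s z`. -/
def outDist {Ω S Z Y : Type} [Fintype Ω] [Fintype S] [Fintype Z] (μ : PMF Ω) (q : Ω → S → Z → ℝ)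
    (out : S → Z → Y) (y : Y) : ℝ :=
  ∑ E, (μ E).toReal * ∑ s, ∑ z, if out s z = y then q E s z else 0

/-! ### CSS codes -/

/-- The row space of a parity check matrix. -/
def rowSpace {m n : ℕ} (H : Matrix (Fin m) (Fin n) (ZMod 2)) : Submodule (ZMod 2) (Bits (Fin n)) :=
  Submodule.span (ZMod 2) (Set.range fun c => H c)

/-- A CSS code on `n` qubits, given by full-rank parity check matrices. -/
structure CSSCode (n : ℕ) where
  mx : ℕ
  mz : ℕ
  HX : Matrix (Fin mx) (Fin n) (ZMod 2)
  HZ : Matrix (Fin mz) (Fin n) (ZMod 2)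
  rankX : LinearIndependent (ZMod 2) fun c => HX c
  rankZ : LinearIndependent (ZMod 2) fun c => HZ c
  orth : HX * HZᵀ = 0

/-- The number of logical qubits. -/
def CSSCode.k {n : ℕ} (Q : CSSCode n) : ℕ := n - Q.mx - Q.mz

/-- The distance: the least weight of a nontrivial logical operator of type `X` or `Z`. -/
def CSSCode.dist {n : ℕ} (Q : CSSCode n) : ℕ :=
  sInf {v | ∃ y : Bits (Fin n), hammingNorm y = v ∧
    ((Q.HZ *ᵥ y = 0 ∧ y ∉ rowSpace Q.HX) ∨ (Q.HX *ᵥ y = 0 ∧ y ∉ rowSpace Q.HZ))}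

/-- `Q` is `ℓ`-LDPC: its stabilizer group is generated by Pauli checks of weight at most `ℓ` such
that every qubit is in the support of at most `ℓ` of them. -/
def CSSCode.IsLDPC {n : ℕ} (Q : CSSCode n) (ℓ : ℕ) : Prop :=
  ∃ (m : ℕ) (g : Fin m → Pauli (Fin n)),
    Submodule.span (ZMod 2) (Set.range g) = (rowSpace Q.HX).prod (rowSpace Q.HZ) ∧
    (∀ c, (pauliSupp (g c)).card ≤ ℓ) ∧
    ∀ i, (Finset.univ.filter fun c => i ∈ pauliSupp (g c)).card ≤ ℓ

/-- A choice of the logical Pauli operators: the `j`-th logical `X` (resp. `Z`) is the product of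
the physical `X` (resp. `Z`) over the support of row `j` of `LX` (resp. `LZ`). -/
structure LogicalBasis {n : ℕ} (Q : CSSCode n) where
  LX : Matrix (Fin Q.k) (Fin n) (ZMod 2)
  LZ : Matrix (Fin Q.k) (Fin n) (ZMod 2)
  commX : Q.HZ * LXᵀ = 0
  commZ : Q.HX * LZᵀ = 0
  dual : LX * LZᵀ = 1

open Classical in
/-- The encoding isometry of the blocks `κ`. On one block it sends the logical basis state `|x⟩`
to the uniform superposition of the coset of the row space of `HX` that contains `x LX`. -/
def LogicalBasis.enc {n : ℕ} {Q : CSSCode n} (L : LogicalBasis Q) (κ : Type) [Fintype κ] :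
    Matrix (Bits (κ × Fin n)) (Bits (κ × Fin Q.k)) ℂ :=
  Matrix.of fun y x => ∏ b : κ,
    if (fun i => y (b, i)) - (fun j => x (b, j)) ᵥ* L.LX ∈ rowSpace Q.HX then
      (((Real.sqrt (2 ^ Q.mx))⁻¹ : ℝ) : ℂ) else 0

/-! ### Transversal gates and logical circuits -/

/-- The operator `U_1 ⊗ ⋯ ⊗ U_n` on `r` blocks of `n` qubits, where `U_i` acts on the `i`-th
qubits of the blocks. -/
def tensorOp {n r : ℕ} (U : Fin n → Op (Fin r)) : Op (Fin r × Fin n) :=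
  Matrix.of fun y x => ∏ i, U i (fun b => y (b, i)) (fun b => x (b, i))

/-- The logical gate `G` on `r` blocks is implemented by a transversal gate. -/
def LogicalBasis.IsTransversal {n : ℕ} {Q : CSSCode n} (L : LogicalBasis Q) {r : ℕ}
    (G : Op (Fin r × Fin Q.k)) : Prop :=
  G ∈ Matrix.unitaryGroup (Bits (Fin r × Fin Q.k)) ℂ ∧
    ∃ U : Fin n → Op (Fin r), (∀ i, U i ∈ Matrix.unitaryGroup (Bits (Fin r)) ℂ) ∧
      tensorOp U * L.enc (Fin r) = L.enc (Fin r) * G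

/-- The logical gate `G` on `r` blocks is Clifford and is implemented by a transversal gate with
Clifford factors. -/
def LogicalBasis.IsTransversalClifford {n : ℕ} {Q : CSSCode n} (L : LogicalBasis Q) {r : ℕ}
    (G : Op (Fin r × Fin Q.k)) : Prop :=
  IsClifford G ∧
    ∃ U : Fin n → Op (Fin r), (∀ i, IsClifford (U i)) ∧
      tensorOp U * L.enc (Fin r) = L.enc (Fin r) * G

/-- The initial state of a block of `k` logical qubits: all in `|0⟩`, all in `|+⟩`, or part of the
GHZ state shared by all blocks that carry the same label. -/
inductive BlockInit : Type
  | zero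
  | plus
  | ghz (label : ℕ)

/-- A gate on some of `N` blocks of `k` logical qubits. -/
structure BlockGate (N k : ℕ) where
  arity : ℕ
  pos : Fin arity ↪ Fin N
  op : Op (Fin arity × Fin k)

/-- An ideal circuit on `N` blocks of `k` logical qubits: initial states, layers of gates on
disjoint blocks, and the basis in which the qubits of each block are measured. -/
structure LogicalCircuit (N k : ℕ) where
  init : Fin N → BlockInit
  depth : ℕ
  layers : Fin depth → List (BlockGate N k)
  disjoint : ∀ t, (layers t).Pairwise fun g h => Disjoint (Set.range g.pos) (Set.range h.pos)
  meas : Fin N → Basis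

/-- All gates of the circuit act on at most `w` blocks. -/
def LogicalCircuit.FanIn {N k : ℕ} (C : LogicalCircuit N k) (w : ℕ) : Prop :=
  ∀ t, ∀ g ∈ C.layers t, g.arity ≤ w

/-- All gates of the circuit are transversal. -/
def LogicalCircuit.Transversal {n N : ℕ} {Q : CSSCode n} (C : LogicalCircuit N Q.k)
    (L : LogicalBasis Q) : Prop :=
  ∀ t, ∀ g ∈ C.layers t, L.IsTransversal g.op

/-- All gates of the circuit are Clifford and transversal. -/
def LogicalCircuit.TransversalClifford {n N : ℕ} {Q : CSSCode n} (C : LogicalCircuit N Q.k)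
    (L : LogicalBasis Q) : Prop :=
  ∀ t, ∀ g ∈ C.layers t, L.IsTransversalClifford g.op

/-- The initial state: the tensor product of `|0⟩` on the qubits of the `zero` blocks, of `|+⟩` on
the qubits of the `plus` blocks and, for each label and each `j`, of the state
`(|0 ⋯ 0⟩ + |1 ⋯ 1⟩) / √2` on the `j`-th qubits of the blocks with that label. -/
def LogicalCircuit.initState {N k : ℕ} (C : LogicalCircuit N k) : State (Fin N × Fin k) :=
  uniformState {x | (∀ b, C.init b = .zero → ∀ j, x (b, j) = 0) ∧
    ∀ b b' c, C.init b = .ghz c → C.init b' = .ghz c → ∀ j, x (b, j) = x (b', j)}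

/-- The unitary of layer `t`. -/
def LogicalCircuit.layerOp {N k : ℕ} (C : LogicalCircuit N k) (t : Fin C.depth) :
    Op (Fin N × Fin k) :=
  ((C.layers t).map fun g =>
    liftOp (g.pos.prodMap (Function.Embedding.refl (Fin k))) g.op).prod

/-- The state before the measurement. -/
def LogicalCircuit.finalState {N k : ℕ} (C : LogicalCircuit N k) : State (Fin N × Fin k) :=
  Fin.induction (motive := fun _ => State (Fin N × Fin k)) C.initState
    (fun t ψ => C.layerOp t *ᵥ ψ) (Fin.last C.depth)

/-- The ideal output distribution: all qubits of block `b` are measured in the basis `meas b`. -/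
def LogicalCircuit.idealDist {N k : ℕ} (C : LogicalCircuit N k) (y : Bits (Fin N × Fin k)) : ℝ :=
  weight (fun q => C.meas q.1) C.finalState y

/-! ### Fault-tolerant implementations -/

/-- The physical qubits of `N` code blocks. -/
abbrev Data (N n : ℕ) : Type := Fin N × Fin n

/-- A classical readout rule for single blocks, applied to all the blocks. -/
def decodeBlocks {N n k : ℕ} (dec : Basis → Bits (Fin n) → Bits (Fin k)) (m : Fin N → Basis)
    (z : Bits (Data N n)) : Bits (Fin N × Fin k) :=
  fun q => dec (m q.1) (fun i => z (q.1, i)) q.2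

/-- The measurement bases of the physical qubits of the code blocks. -/
def LogicalCircuit.dataBasis {N k : ℕ} (C : LogicalCircuit N k) (n : ℕ) : Data N n → Basis :=
  fun q => C.meas q.1

/-- The noisy circuit `W` on the code blocks and `b` ancillas, all initialized in `|0⟩`, in which
all qubits are measured at the end (the ancillas in the bases `m`), implements `C` below the noise
rate `pstar`, with failure probability `fail p` and residual noise of rate `res p`. After the
ancilla outcome `s`, and the correction `Rec s`, which is done classically on the outcomes, the
code blocks hold the encoded final state of `C` up to the residual Pauli error `Rep E`, unless the
faults `E` are outside `Good`; and the decoded outcomes are distributed like the output of `C`. -/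
def IsImplementation {n N b : ℕ} {Q : CSSCode n} (L : LogicalBasis Q)
    (dec : Basis → Bits (Fin n) → Bits (Fin Q.k)) (C : LogicalCircuit N Q.k)
    (W : Circuit (Data N n ⊕ Fin b)) (m : Fin b → Basis) (pstar : ℝ) (fail res : ℝ → ℝ) : Prop :=
  ∃ (Rec : Bits (Fin b) → Pauli (Data N n)) (Rep : W.Faults → Pauli (Data N n))
    (Good : Set W.Faults),
    (∀ E ∈ Good, ∀ s, ∃ γ : ℂ,
      pauliOp (Rec s) *ᵥ postMeasure m (W.run E (zeroState _)) s =
        γ • (pauliOp (Rep E) *ᵥ (L.enc (Fin N) *ᵥ C.finalState))) ∧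
    ∀ (p : ℝ) (μ : PMF W.Faults), 0 ≤ p → p < pstar →
      (∀ t, LocalStochastic μ (fun E => pauliSupp (E t)) p) →
      prob μ Goodᶜ ≤ fail p ∧
      LocalStochastic μ (fun E => pauliSupp (Rep E)) (res p) ∧
      tvDist
        (outDist μ
          (fun E s z => weight (C.dataBasis n) (postMeasure m (W.run E (zeroState _)) s) z)
          (fun s z => decodeBlocks dec C.meas (z + flips (C.dataBasis n) (Rec s))))
        C.idealDist ≤ fail p

/-- The same with one round of mid-circuit measurement and feedforward: the noisy circuit `W` is
run, the ancillas are measured with outcome `s`, the Pauli operator `Rec s` is applied to the code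
blocks, the noisy circuit `V` is run on them, and they are measured. The residual error on the
encoded final state of `C` is a unitary operator supported on the random set `R E` of qubits. -/
def IsAdaptiveImplementation {n N b : ℕ} {Q : CSSCode n} (L : LogicalBasis Q)
    (dec : Basis → Bits (Fin n) → Bits (Fin Q.k)) (C : LogicalCircuit N Q.k)
    (W : Circuit (Data N n ⊕ Fin b)) (V : Circuit (Data N n)) (m : Fin b → Basis)
    (pstar : ℝ) (fail res : ℝ → ℝ) : Prop :=
  ∃ (Rec : Bits (Fin b) → Pauli (Data N n)) (R : W.Faults × V.Faults → Finset (Data N n))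
    (Good : Set (W.Faults × V.Faults)),
    (∀ E ∈ Good, ∃ F ∈ Matrix.unitaryGroup (Bits (Data N n)) ℂ, SupportedOn F (R E) ∧
      ∀ s, ∃ γ : ℂ,
        V.run E.2 (pauliOp (Rec s) *ᵥ postMeasure m (W.run E.1 (zeroState _)) s) =
          γ • (F *ᵥ (L.enc (Fin N) *ᵥ C.finalState))) ∧
    ∀ (p : ℝ) (μ : PMF (W.Faults × V.Faults)), 0 ≤ p → p < pstar →
      (∀ t, LocalStochastic μ (fun E => pauliSupp (E.1 t)) p) →
      (∀ t, LocalStochastic μ (fun E => pauliSupp (E.2 t)) p) →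
      prob μ Goodᶜ ≤ fail p ∧
      LocalStochastic μ R (res p) ∧
      tvDist
        (outDist μ
          (fun E s z => weight (C.dataBasis n)
            (V.run E.2 (pauliOp (Rec s) *ᵥ postMeasure m (W.run E.1 (zeroState _)) s)) z)
          (fun _ z => decodeBlocks dec C.meas z))
        C.idealDist ≤ fail p

end ShallowFT

end

noncomputable section
set_option linter.unusedSectionVars false
namespace ShallowFT

/-! ### Signs and Pauli operators -/

/-! Time is traded for space. Instead of repeated rounds of syndrome measurement, the encoded
initial state is prepared by measuring the ancillas of a single CSS graph state on a foliated copy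
of the code. Each block gets a chain of `T` vertices and `T` edges. A vertex carries a copy of the
`n` qubits and the Z-type checks `B`, an edge carries a copy of the qubits and the X-type checks
`A`, and the last edge of a chain leads to the data. Junctions at the start of the chains pin a
block to logical zero or tie together the blocks of a GHZ group; a block in plus starts free. The
graph has bounded degree, so one layer of Hadamard gates and constantly many layers of CNOT gates
produce its state (`exists_graphCode_layers`). If all outcomes vanish, the strings on the vertices
have trivial Z-syndrome and agree along a chain modulo rows of `HX`, and the data hold exactly the
encoded initial state (`chain_code_iff`, `exists_enc_initState`). Any other possible outcome differs
from this by a stabilizer of the graph state (`exists_mem_graphCode_of_postMeasure_ne_zero`), whose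
data part is the Pauli correction.

The preparation is Clifford, so its faults amount to one Pauli operator at its end
(`Circuit.exists_run_eq_pauli`); the ancilla part of this operator flips the outcomes by some `e`.
Since `A` and `B` are orthogonal, the outcomes without errors obey local checks, which define a
space `Loc`. Minimum weight decoding modulo `Loc` makes the same guess for the observed outcome as
for `e`, so the residual `e + minWeight e` depends on `e` only. It splits into connected clusters,
each at least half filled by errors (`card_component_le`). A cluster of fewer than `min T d` sites
leaves a slice of every chain untouched. Cutting there, prefix sums solve the stabilizer equations
along the chains, and what is left over at the starts of the chains has weight below `d` and
satisfies all checks, hence is a stabilizer of the code (`chain_decode_X`, `chain_decode_Z`). So the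
cluster is explained by a stabilizer whose data part only meets the columns of sites beyond the last
untouched slice; the cluster is at least as large as the distance of such a site from the data.

A connected set of `s` sites is traversed by a walk of `2 (s - 1)` steps, so at most `Δ^(2s)` of
them contain a given site, and each is half filled by errors with probability at most `(2 √p)^s`.
Summing over the clusters of size at least `min T d` bounds the failure probability
(`prob_large_cluster_le`); summing over the clusters that are large compared to their distance from
the data shows that the residual error is local stochastic (`localStochastic_of_clusters`).
Arbitrary correlations between times cost only a root of `p` and a constant factor
(`LocalStochastic.spread`), hence the rates `a p^(1/a)`.

The logical gates are then applied transversally. In the Clifford case the correction can be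
conjugated to the end, so the gates may precede the ancilla measurement and no feedforward is
needed. In the general case the correction is applied first, and the residual error and later faults
spread through a circuit of constant depth to a unitary on a small set `R`. Such a unitary acts on
the final outcomes as a superposition of flips inside `R` (`amplitude_pauliSpan`). Minimum weight
decoding of each block undoes all of them unless `R` fills half of a cluster of size at least `d`,
so the decoded distribution is exactly the ideal one (`sum_weight_decode`). The total variation
distance is therefore at most the probability of the bad faults (`tvDist_outDist_le`). -/

theorem zmod2_cases (a : ZMod 2) : a = 0 ∨ a = 1 := by revert a; decide

@[simp] theorem bsign_zero : bsign 0 = 1 := by simp [bsign]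

@[simp] theorem bsign_one : bsign 1 = -1 := by simp [bsign]

theorem bsign_add (a b : ZMod 2) : bsign (a + b) = bsign a * bsign b := by
  have h : (1 + 1 : ZMod 2) = 0 := by decide
  rcases zmod2_cases a with rfl | rfl <;> rcases zmod2_cases b with rfl | rfl <;> simp [h]

theorem bsign_mul_self (a : ZMod 2) : bsign a * bsign a = 1 := by
  rcases zmod2_cases a with rfl | rfl <;> simp

theorem bsign_ne_zero (a : ZMod 2) : bsign a ≠ 0 := by
  rcases zmod2_cases a with rfl | rfl <;> simp

theorem star_bsign (a : ZMod 2) : star (bsign a) = bsign a := by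
  rcases zmod2_cases a with rfl | rfl <;> simp

theorem norm_bsign (a : ZMod 2) : ‖bsign a‖ = 1 := by
  rcases zmod2_cases a with rfl | rfl <;> simp

theorem bsign_sum {α : Type} (s : Finset α) (f : α → ZMod 2) :
    bsign (∑ i ∈ s, f i) = ∏ i ∈ s, bsign (f i) := by
  classical
  induction s using Finset.induction_on with
  | empty => simp
  | insert a s ha ih => rw [Finset.sum_insert ha, Finset.prod_insert ha, bsign_add, ih]

theorem bits_add_self {ι : Type} (a : Bits ι) : a + a = 0 := by
  funext i; exact CharTwo.add_self_eq_zero _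

theorem bits_add_cancel {ι : Type} (a b : Bits ι) : a + b + b = a := by
  rw [add_assoc, bits_add_self, add_zero]

theorem bits_eq_add_iff {ι : Type} (x y a : Bits ι) : y = x + a ↔ x = y + a := by
  constructor <;> (rintro rfl; rw [bits_add_cancel])

section
variable {ι : Type} [Fintype ι] [DecidableEq ι]

theorem pauliOp_mulVec (P : Pauli ι) (ψ : State ι) (y : Bits ι) :
    (pauliOp P *ᵥ ψ) y = bsign (∑ i, P.2 i * (y + P.1) i) * ψ (y + P.1) := by
  simp only [Matrix.mulVec, dotProduct, pauliOp, Matrix.of_apply]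
  rw [Finset.sum_eq_single (y + P.1)]
  · rw [if_pos (bits_add_cancel _ _).symm]
  · intro x _ hx
    rw [if_neg, zero_mul]
    rw [bits_eq_add_iff]; exact hx
  · simp

theorem pauliOp_mul (P Q : Pauli ι) :
    pauliOp P * pauliOp Q = bsign (∑ i, P.2 i * Q.1 i) • pauliOp (P + Q) := by
  refine Matrix.ext_of_mulVec_single fun x => ?_
  rw [← Matrix.mulVec_mulVec, Matrix.smul_mulVec]
  generalize (Pi.single x 1 : State ι) = ψ
  funext y
  rw [Pi.smul_apply, pauliOp_mulVec, pauliOp_mulVec, pauliOp_mulVec, smul_eq_mul, ← mul_assoc,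
    ← mul_assoc, ← bsign_add, ← bsign_add]
  have h1 : y + P.1 + Q.1 = y + (P + Q).1 := by simp [add_assoc]
  rw [h1]
  congr 2
  rw [← Finset.sum_add_distrib, ← Finset.sum_add_distrib]
  refine Finset.sum_congr rfl fun i _ => ?_
  simp only [Pi.add_apply, Prod.fst_add, Prod.snd_add]
  have : (2 : ZMod 2) = 0 := by decide
  linear_combination (-(P.2 i * Q.1 i)) * this

@[simp] theorem pauliOp_zero : pauliOp (0 : Pauli ι) = 1 := by
  ext y x
  simp [pauliOp, Matrix.one_apply]

theorem star_pauliOp (P : Pauli ι) : star (pauliOp P) = bsign (∑ i, P.2 i * P.1 i) • pauliOp P := by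
  ext y x
  simp only [Matrix.star_apply, pauliOp, Matrix.of_apply, Matrix.smul_apply, smul_eq_mul,
    apply_ite star, star_zero, star_bsign, mul_ite, mul_zero]
  by_cases h : y = x + P.1
  · rw [if_pos ((bits_eq_add_iff _ _ _).1 h), if_pos h, ← bsign_add, ← Finset.sum_add_distrib, h]
    congr 1
    refine Finset.sum_congr rfl fun i _ => ?_
    simp only [Pi.add_apply]; ring
  · rw [if_neg h, if_neg]
    rwa [bits_eq_add_iff] at h

theorem pauliOp_mul_self (P : Pauli ι) :
    pauliOp P * pauliOp P = bsign (∑ i, P.2 i * P.1 i) • 1 := by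
  rw [pauliOp_mul]
  have : P + P = 0 := by
    ext1 <;> simp [bits_add_self]
  rw [this, pauliOp_zero]

theorem star_pauliOp_mul (P : Pauli ι) : star (pauliOp P) * pauliOp P = 1 := by
  rw [star_pauliOp, smul_mul_assoc, pauliOp_mul_self, smul_smul, bsign_mul_self, one_smul]

theorem pauliOp_unitary (P : Pauli ι) : pauliOp P ∈ Matrix.unitaryGroup (Bits ι) ℂ :=
  Matrix.mem_unitaryGroup_iff'.2 (star_pauliOp_mul P)

theorem pauliOp_ne_zero (P : Pauli ι) : pauliOp P ≠ 0 := by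
  intro h
  have := star_pauliOp_mul P
  rw [h, mul_zero] at this
  exact zero_ne_one this

/-- Paulis commute up to a sign. -/
theorem pauliOp_comm (P Q : Pauli ι) :
    pauliOp P * pauliOp Q =
      (bsign (∑ i, P.2 i * Q.1 i) * bsign (∑ i, Q.2 i * P.1 i)) • (pauliOp Q * pauliOp P) := by
  rw [pauliOp_mul, pauliOp_mul, smul_smul, mul_assoc, bsign_mul_self, mul_one, add_comm]

theorem mem_pauliSupp {P : Pauli ι} {i : ι} : i ∈ pauliSupp P ↔ P.1 i ≠ 0 ∨ P.2 i ≠ 0 := by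
  simp [pauliSupp]

theorem notMem_pauliSupp {P : Pauli ι} {i : ι} : i ∉ pauliSupp P ↔ P.1 i = 0 ∧ P.2 i = 0 := by
  simp [pauliSupp]

theorem pauliSupp_add (P Q : Pauli ι) : pauliSupp (P + Q) ⊆ pauliSupp P ∪ pauliSupp Q := by
  intro i hi
  by_contra h
  rw [Finset.mem_union, not_or, notMem_pauliSupp, notMem_pauliSupp] at h
  rw [mem_pauliSupp] at hi
  simp [h] at hi

theorem pauliSupp_sum {α : Type} (s : Finset α) (P : α → Pauli ι) {i : ι}
    (hi : i ∈ pauliSupp (∑ a ∈ s, P a)) : ∃ a ∈ s, i ∈ pauliSupp (P a) := by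
  by_contra! h
  have h' : ∀ a ∈ s, (P a).1 i = 0 ∧ (P a).2 i = 0 := fun a ha => notMem_pauliSupp.1 (h a ha)
  rw [mem_pauliSupp, Prod.fst_sum, Prod.snd_sum, Finset.sum_apply, Finset.sum_apply,
    Finset.sum_eq_zero fun a ha => (h' a ha).1, Finset.sum_eq_zero fun a ha => (h' a ha).2] at hi
  simp at hi

theorem pauliOp_commute_of_disjoint {P Q : Pauli ι} (h : Disjoint (pauliSupp P) (pauliSupp Q)) :
    pauliOp P * pauliOp Q = pauliOp Q * pauliOp P := by
  have h1 : ∀ i, P.2 i * Q.1 i = 0 ∧ Q.2 i * P.1 i = 0 := by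
    intro i
    by_cases hi : i ∈ pauliSupp P
    · have := notMem_pauliSupp.1 (Finset.disjoint_left.1 h hi)
      simp [this]
    · have := notMem_pauliSupp.1 hi
      simp [this]
  rw [pauliOp_comm]
  simp [h1]

/-! ### Operators placed on some of the qubits -/

/-- The bit string `y`, overwritten by `u` on the range of `e`. -/
def overwrite {α ι : Type} (e : α ↪ ι) (u : Bits α) (y : Bits ι) : Bits ι := Function.extend e u y

@[simp] theorem overwrite_apply {α : Type} (e : α ↪ ι) (u : Bits α) (y : Bits ι) (a : α) :
    overwrite e u y (e a) = u a := e.injective.extend_apply _ _ _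

theorem overwrite_of_notMem {α : Type} (e : α ↪ ι) (u : Bits α) (y : Bits ι) {i : ι}
    (h : i ∉ Set.range e) : overwrite e u y i = y i :=
  Function.extend_apply' _ _ _ fun ⟨a, ha⟩ => h ⟨a, ha⟩

@[simp] theorem overwrite_comp {α : Type} (e : α ↪ ι) (u : Bits α) (y : Bits ι) :
    overwrite e u y ∘ e = u := by
  funext a; simp

theorem overwrite_overwrite {α : Type} (e : α ↪ ι) (u v : Bits α) (y : Bits ι) :
    overwrite e u (overwrite e v y) = overwrite e u y := by
  funext i
  by_cases h : i ∈ Set.range e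
  · obtain ⟨a, rfl⟩ := h; simp
  · simp [overwrite_of_notMem, h]

theorem overwrite_eq {α : Type} (e : α ↪ ι) {x y : Bits ι} (h : ∀ i, i ∉ Set.range e → y i = x i) :
    overwrite e (x ∘ e) y = x := by
  funext i
  by_cases hi : i ∈ Set.range e
  · obtain ⟨a, rfl⟩ := hi; simp
  · rw [overwrite_of_notMem _ _ _ hi, h i hi]

variable {α : Type} [Fintype α] [DecidableEq α]

/-- Sums over the bit strings that agree with `y` outside the range of `e`. -/
theorem sum_overwrite (e : α ↪ ι) (y : Bits ι) (f : Bits ι → ℂ)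
    (hf : ∀ x, (¬ ∀ i, i ∉ Set.range e → y i = x i) → f x = 0) :
    ∑ x, f x = ∑ u : Bits α, f (overwrite e u y) := by
  symm
  refine Fintype.sum_of_injective (fun u => overwrite e u y) ?_ _ _ ?_ fun _ => rfl
  · intro u v h
    have := congrArg (· ∘ e) h
    simpa using this
  · intro x hx
    refine hf x fun h => hx ⟨x ∘ e, overwrite_eq e h⟩

theorem liftOp_mulVec (e : α ↪ ι) (U : Op α) (ψ : State ι) (y : Bits ι) :
    (liftOp e U *ᵥ ψ) y = ∑ u : Bits α, U (y ∘ e) u * ψ (overwrite e u y) := by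
  simp only [Matrix.mulVec, dotProduct, liftOp, Matrix.of_apply]
  rw [sum_overwrite e y]
  · refine Finset.sum_congr rfl fun u _ => ?_
    rw [if_pos, overwrite_comp]
    intro i hi
    rw [overwrite_of_notMem _ _ _ hi]
  · intro x hx
    rw [if_neg hx, zero_mul]

theorem liftOp_mul (e : α ↪ ι) (U V : Op α) : liftOp e (U * V) = liftOp e U * liftOp e V := by
  refine Matrix.ext_of_mulVec_single fun x => ?_
  rw [← Matrix.mulVec_mulVec]
  generalize (Pi.single x 1 : State ι) = ψ
  funext y
  simp only [liftOp_mulVec, overwrite_comp, overwrite_overwrite, Matrix.mul_apply,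
    Finset.sum_mul, Finset.mul_sum]
  rw [Finset.sum_comm]
  simp only [mul_assoc]

theorem liftOp_one (e : α ↪ ι) : liftOp e (1 : Op α) = 1 := by
  refine Matrix.ext_of_mulVec_single fun x => ?_
  generalize (Pi.single x 1 : State ι) = ψ
  funext y
  rw [liftOp_mulVec, Matrix.one_mulVec, Finset.sum_eq_single (y ∘ e)]
  · rw [Matrix.one_apply_eq, one_mul, overwrite_eq e fun _ _ => rfl]
  · intro u _ hu
    rw [Matrix.one_apply_ne hu.symm, zero_mul]
  · simp

theorem liftOp_add (e : α ↪ ι) (U V : Op α) : liftOp e (U + V) = liftOp e U + liftOp e V := by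
  ext y x
  simp only [liftOp, Matrix.of_apply, Matrix.add_apply]
  split_ifs <;> simp

theorem liftOp_smul (e : α ↪ ι) (c : ℂ) (U : Op α) : liftOp e (c • U) = c • liftOp e U := by
  ext y x
  simp only [liftOp, Matrix.of_apply, Matrix.smul_apply]
  split_ifs <;> simp

/-- `liftOp` as a linear map. -/
def liftLin (e : α ↪ ι) : Op α →ₗ[ℂ] Op ι where
  toFun := liftOp e
  map_add' := liftOp_add e
  map_smul' := liftOp_smul e

theorem liftOp_star (e : α ↪ ι) (U : Op α) : liftOp e (star U) = star (liftOp e U) := by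
  ext y x
  simp only [liftOp, Matrix.of_apply, Matrix.star_apply]
  by_cases h : ∀ i, i ∉ Set.range e → y i = x i
  · rw [if_pos h, if_pos fun i hi => (h i hi).symm]
  · rw [if_neg h, if_neg fun h' => h fun i hi => (h' i hi).symm, star_zero]

theorem liftOp_unitary (e : α ↪ ι) {U : Op α} (hU : U ∈ Matrix.unitaryGroup (Bits α) ℂ) :
    liftOp e U ∈ Matrix.unitaryGroup (Bits ι) ℂ := by
  rw [Matrix.mem_unitaryGroup_iff'] at hU ⊢
  rw [← liftOp_star, ← liftOp_mul, hU, liftOp_one]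

/-- The Pauli operator `P`, placed on the range of `e`. -/
def extPauli {α ι : Type} (e : α ↪ ι) (P : Pauli α) : Pauli ι :=
  (overwrite e P.1 0, overwrite e P.2 0)

theorem sum_overwrite_mul (e : α ↪ ι) (a : Bits α) (y : Bits ι) :
    ∑ i, overwrite e a 0 i * y i = ∑ j, a j * y (e j) := by
  symm
  refine Fintype.sum_of_injective e e.injective _ _ ?_ ?_
  · intro i hi
    rw [overwrite_of_notMem _ _ _ hi]; simp
  · intro j; simp

theorem liftOp_pauliOp (e : α ↪ ι) (P : Pauli α) :
    liftOp e (pauliOp P) = pauliOp (extPauli e P) := by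
  refine Matrix.ext_of_mulVec_single fun x => ?_
  generalize (Pi.single x 1 : State ι) = ψ
  funext y
  have h1 : y + (extPauli e P).1 = overwrite e (y ∘ e + P.1) y := by
    funext i
    by_cases h : i ∈ Set.range e
    · obtain ⟨a, rfl⟩ := h; simp [extPauli]
    · simp [extPauli, overwrite_of_notMem, h]
  rw [pauliOp_mulVec, liftOp_mulVec, h1]
  simp only [extPauli]
  rw [sum_overwrite_mul, Finset.sum_eq_single (y ∘ e + P.1)]
  · simp only [overwrite_apply, pauliOp, Matrix.of_apply]
    rw [if_pos (bits_add_cancel _ _).symm]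
  · intro u _ hu
    simp only [pauliOp, Matrix.of_apply]
    rw [if_neg, zero_mul]
    rw [bits_eq_add_iff]; exact hu
  · simp

theorem mem_pauliSupp_extPauli {e : α ↪ ι} {P : Pauli α} {i : ι} :
    i ∈ pauliSupp (extPauli e P) ↔ ∃ a ∈ pauliSupp P, e a = i := by
  rw [mem_pauliSupp]
  by_cases h : i ∈ Set.range e
  · obtain ⟨a, rfl⟩ := h
    simp [extPauli, mem_pauliSupp]
  · simp only [extPauli, overwrite_of_notMem _ _ _ h, Pi.zero_apply, ne_eq, not_true, or_self,
      false_iff]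
    rintro ⟨a, -, rfl⟩
    exact h ⟨a, rfl⟩

theorem range_of_mem_pauliSupp_extPauli {e : α ↪ ι} {P : Pauli α} {i : ι}
    (h : i ∈ pauliSupp (extPauli e P)) : i ∈ Set.range e := by
  obtain ⟨a, -, rfl⟩ := mem_pauliSupp_extPauli.1 h
  exact ⟨a, rfl⟩

/-! ### The span of the Paulis with given support -/

/-- Translating `b` by a unit vector at a position where `x` is one negates every summand, so a
nontrivial character sums to zero. -/
theorem sum_bsign_dot (x : Bits ι) :
    ∑ b : Bits ι, bsign (∑ i, b i * x i) = if x = 0 then (Fintype.card (Bits ι) : ℂ) else 0 := by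
  split_ifs with h
  · simp [h]
  · obtain ⟨i, hi⟩ : ∃ i, x i ≠ 0 := by
      by_contra! h'
      exact h (funext h')
    have hi1 : x i = 1 := (zmod2_cases _).resolve_left hi
    have key : ∑ b : Bits ι, bsign (∑ j, b j * x j) =
        ∑ b : Bits ι, -bsign (∑ j, b j * x j) := by
      refine (Fintype.sum_equiv (Equiv.addRight (Pi.single i 1 : Bits ι)) _ _ fun b => ?_)
      simp only [Equiv.coe_addRight, Pi.add_apply, add_mul, Finset.sum_add_distrib, bsign_add,
        Pi.single_apply, ite_mul, zero_mul, one_mul, Finset.sum_ite_eq', Finset.mem_univ, if_true,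
        hi1]
      simp
    rw [Finset.sum_neg_distrib] at key
    have := self_eq_neg.1 key
    exact this

/-- The operators that are linear combinations of Paulis supported on `R`. -/
def pauliSpan (R : Set ι) : Submodule ℂ (Op ι) :=
  Submodule.span ℂ (pauliOp '' {P : Pauli ι | ↑(pauliSupp P) ⊆ R})

theorem pauliOp_mem_pauliSpan {R : Set ι} {P : Pauli ι} (h : ↑(pauliSupp P) ⊆ R) :
    pauliOp P ∈ pauliSpan R := Submodule.subset_span ⟨P, h, rfl⟩

theorem pauliSpan_mono {R S : Set ι} (h : R ⊆ S) : pauliSpan R ≤ pauliSpan S :=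
  Submodule.span_mono (Set.image_mono fun _ hP => Set.Subset.trans hP h)

theorem pauliSpan_mul {R : Set ι} {F G : Op ι} (hF : F ∈ pauliSpan R) (hG : G ∈ pauliSpan R) :
    F * G ∈ pauliSpan R := by
  induction hF, hG using Submodule.span_induction₂ with
  | mem_mem x y hx hy =>
    obtain ⟨P, hP, rfl⟩ := hx
    obtain ⟨Q, hQ, rfl⟩ := hy
    rw [pauliOp_mul]
    refine Submodule.smul_mem _ _ (pauliOp_mem_pauliSpan ?_)
    refine Set.Subset.trans (Finset.coe_subset.2 (pauliSupp_add P Q)) ?_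
    rw [Finset.coe_union]
    exact Set.union_subset hP hQ
  | zero_left y hy => simp
  | zero_right x hx => simp
  | add_left x y z _ _ _ h1 h2 => rw [add_mul]; exact Submodule.add_mem _ h1 h2
  | add_right x y z _ _ _ h1 h2 => rw [mul_add]; exact Submodule.add_mem _ h1 h2
  | smul_left r x y _ _ h => rw [smul_mul_assoc]; exact Submodule.smul_mem _ _ h
  | smul_right r x y _ _ h => rw [mul_smul_comm]; exact Submodule.smul_mem _ _ h

theorem pauliSpan_commute {R S : Set ι} (hRS : Disjoint R S) {F G : Op ι} (hF : F ∈ pauliSpan R)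
    (hG : G ∈ pauliSpan S) : F * G = G * F := by
  induction hF, hG using Submodule.span_induction₂ with
  | mem_mem x y hx hy =>
    obtain ⟨P, hP, rfl⟩ := hx
    obtain ⟨Q, hQ, rfl⟩ := hy
    refine pauliOp_commute_of_disjoint ?_
    rw [← Finset.disjoint_coe]
    exact Set.disjoint_of_subset hP hQ hRS
  | zero_left y hy => simp
  | zero_right x hx => simp
  | add_left x y z _ _ _ h1 h2 => rw [add_mul, mul_add, h1, h2]
  | add_right x y z _ _ _ h1 h2 => rw [add_mul, mul_add, h1, h2]
  | smul_left r x y _ _ h => rw [smul_mul_assoc, mul_smul_comm, h]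
  | smul_right r x y _ _ h => rw [smul_mul_assoc, mul_smul_comm, h]

theorem star_mem_pauliSpan {R : Set ι} {F : Op ι} (hF : F ∈ pauliSpan R) : star F ∈ pauliSpan R := by
  induction hF using Submodule.span_induction with
  | mem x hx =>
    obtain ⟨P, hP, rfl⟩ := hx
    rw [star_pauliOp]
    exact Submodule.smul_mem _ _ (pauliOp_mem_pauliSpan hP)
  | zero => simp
  | add x y _ _ h1 h2 => rw [star_add]; exact Submodule.add_mem _ h1 h2
  | smul r x _ h => rw [star_smul]; exact Submodule.smul_mem _ _ h

/-- A matrix unit is recovered from the operators `X^(y+x) Z^b` by Fourier inversion over `b`. Thus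
arbitrary gates, not only Clifford ones, can be treated as combinations of Paulis. -/
theorem mem_pauliSpan_univ (F : Op ι) : F ∈ pauliSpan (Set.univ : Set ι) := by
  classical
  rw [Matrix.matrix_eq_sum_single F]
  refine Submodule.sum_mem _ fun y _ => Submodule.sum_mem _ fun x _ => ?_
  have h : Matrix.single y x (F y x) = (F y x * (Fintype.card (Bits ι) : ℂ)⁻¹) •
      ∑ b : Bits ι, bsign (∑ i, b i * x i) • pauliOp (y + x, b) := by
    ext y' x'
    simp only [Matrix.single_apply, Matrix.smul_apply, Matrix.sum_apply, pauliOp, Matrix.of_apply,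
      smul_eq_mul, mul_ite, mul_zero]
    have hite : ∀ (p : Prop) [Decidable p] (f : Bits ι → ℂ),
        ∑ b, (if p then f b else 0) = if p then ∑ b, f b else 0 := by
      intro p _ f
      split_ifs <;> simp
    rw [hite]
    have hsum : ∑ b : Bits ι, bsign (∑ i, b i * x i) * bsign (∑ i, b i * x' i) =
        if x + x' = 0 then (Fintype.card (Bits ι) : ℂ) else 0 := by
      rw [← sum_bsign_dot]
      refine Finset.sum_congr rfl fun b _ => ?_
      rw [← bsign_add, ← Finset.sum_add_distrib]
      simp [mul_add]
    rw [hsum]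
    have hx : x + x' = 0 ↔ x = x' := by
      rw [← add_left_inj x', bits_add_cancel, zero_add]
    by_cases h1 : x = x'
    · subst h1
      rw [if_pos (hx.2 rfl)]
      have : y' = x + (y + x) ↔ y = y' := by
        rw [add_comm x, bits_add_cancel, eq_comm]
      simp only [this, and_true]
      split_ifs
      · rw [mul_assoc, inv_mul_cancel₀, mul_one]
        exact_mod_cast Fintype.card_ne_zero
      · simp
    · rw [if_neg (fun h => h1 (hx.1 h)), if_neg (fun h => h1 h.2)]
      simp
  rw [h]
  exact Submodule.smul_mem _ _ (Submodule.sum_mem _ fun b _ =>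
    Submodule.smul_mem _ _ (pauliOp_mem_pauliSpan (Set.subset_univ _)))

theorem liftOp_mem_pauliSpan (e : α ↪ ι) (U : Op α) : liftOp e U ∈ pauliSpan (Set.range e) := by
  have hU := mem_pauliSpan_univ U
  induction hU using Submodule.span_induction with
  | mem x hx =>
    obtain ⟨P, -, rfl⟩ := hx
    rw [liftOp_pauliOp]
    exact pauliOp_mem_pauliSpan fun i hi => range_of_mem_pauliSupp_extPauli hi
  | zero =>
    have : liftOp e (0 : Op α) = 0 := (liftLin e).map_zero
    rw [this]; exact Submodule.zero_mem _
  | add x y _ _ h1 h2 => rw [liftOp_add]; exact Submodule.add_mem _ h1 h2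
  | smul r x _ h => rw [liftOp_smul]; exact Submodule.smul_mem _ _ h

/-- Supports are tracked through `pauliSpan`, which is stable under products and conjugation; this
converts the result to the notion of support in the theorem. On a generator, the bits outside `R`
vanish, so restricting to `R` loses nothing. -/
theorem supportedOn_of_mem_pauliSpan {R : Finset ι} {F : Op ι} (hF : F ∈ pauliSpan (R : Set ι)) :
    SupportedOn F R := by
  have : pauliSpan (R : Set ι) ≤ LinearMap.range (liftLin (Function.Embedding.subtype (· ∈ R))) := by
    refine Submodule.span_le.2 ?_
    rintro _ ⟨P, hP, rfl⟩
    refine ⟨pauliOp (fun i => P.1 i, fun i => P.2 i), ?_⟩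
    change liftOp _ _ = _
    rw [liftOp_pauliOp]
    congr 1
    have h0 : ∀ i, i ∉ R → P.1 i = 0 ∧ P.2 i = 0 := fun i hi =>
      notMem_pauliSupp.1 fun h => hi (hP h)
    have hr : ∀ i, i ∉ R → i ∉ Set.range (Function.Embedding.subtype (· ∈ R)) := by
      rintro i hi ⟨⟨j, hj⟩, rfl⟩
      exact hi hj
    ext i
    · by_cases hi : i ∈ R
      · exact overwrite_apply (Function.Embedding.subtype (· ∈ R)) _ _ ⟨i, hi⟩
      · simp [extPauli, overwrite_of_notMem _ _ _ (hr i hi), h0 i hi]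
    · by_cases hi : i ∈ R
      · exact overwrite_apply (Function.Embedding.subtype (· ∈ R)) _ _ ⟨i, hi⟩
      · simp [extPauli, overwrite_of_notMem _ _ _ (hr i hi), h0 i hi]
  obtain ⟨G, hG⟩ := this hF
  exact ⟨G, hG.symm⟩

/-- For `i` outside `R` the Pauli commutes with both `X` and `Z` on the qubit `i`, and the two
commutation signs force its two bits at `i` to vanish. -/
theorem pauliSupp_subset_of_mem_pauliSpan {R : Set ι} {P : Pauli ι} (h : pauliOp P ∈ pauliSpan R) :
    ↑(pauliSupp P) ⊆ R := by
  intro i hi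
  by_contra hiR
  have hcomm : ∀ Q : Pauli ι, ↑(pauliSupp Q) ⊆ ({i} : Set ι) →
      bsign (∑ j, P.2 j * Q.1 j) * bsign (∑ j, Q.2 j * P.1 j) = 1 := by
    intro Q hQ
    have h1 := pauliSpan_commute (Set.disjoint_singleton_right.2 hiR) h (pauliOp_mem_pauliSpan hQ)
    have h2 := pauliOp_comm P Q
    rw [h1] at h2
    have h3 : pauliOp Q * pauliOp P ≠ 0 := by
      rw [pauliOp_mul]
      exact smul_ne_zero (bsign_ne_zero _) (pauliOp_ne_zero _)
    have h4 := sub_eq_zero.2 h2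
    rw [← one_smul ℂ (pauliOp Q * pauliOp P), smul_smul, mul_one, ← sub_smul] at h4
    exact (sub_eq_zero.1 ((smul_eq_zero.1 h4).resolve_right h3)).symm
  have hs : ∀ j, j ∈ ((pauliSupp ((Pi.single i 1, 0) : Pauli ι)) : Set ι) → j ∈ ({i} : Set ι) := by
    intro j hj
    simpa [mem_pauliSupp, Pi.single_apply] using hj
  have hs' : ∀ j, j ∈ ((pauliSupp ((0, Pi.single i 1) : Pauli ι)) : Set ι) → j ∈ ({i} : Set ι) := by
    intro j hj
    simpa [mem_pauliSupp, Pi.single_apply] using hj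
  have h1 := hcomm _ hs
  have h2 := hcomm _ hs'
  simp [Pi.single_apply] at h1 h2
  have key : ∀ a : ZMod 2, bsign a = 1 → a = 0 := by
    intro a ha
    rcases zmod2_cases a with rfl | rfl
    · rfl
    · norm_num at ha
  rw [Finset.mem_coe, mem_pauliSupp, key _ h1, key _ h2] at hi
  simp at hi

/-! ### Clifford operators -/

theorem IsClifford.mul {U V : Op ι} (hU : IsClifford U) (hV : IsClifford V) :
    IsClifford (U * V) := by
  refine ⟨mul_mem hU.1 hV.1, fun P => ?_⟩
  obtain ⟨P', c, h⟩ := hV.2 P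
  obtain ⟨P'', c', h'⟩ := hU.2 P'
  refine ⟨P'', c * c', ?_⟩
  rw [star_mul, show U * V * pauliOp P * (star V * star U) = U * (V * pauliOp P * star V) * star U by
    simp only [mul_assoc], h, mul_smul_comm, smul_mul_assoc, h', smul_smul]

theorem IsClifford.one : IsClifford (1 : Op ι) :=
  ⟨one_mem _, fun P => ⟨P, 1, by simp⟩⟩

theorem IsClifford.list_prod {l : List (Op ι)} (h : ∀ U ∈ l, IsClifford U) : IsClifford l.prod := by
  induction l with
  | nil => exact IsClifford.one
  | cons a l ih =>
    rw [List.prod_cons]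
    exact (h a (by simp)).mul (ih fun U hU => h U (by simp [hU]))

theorem unitary_mul_star {U : Op ι} (h : U ∈ Matrix.unitaryGroup (Bits ι) ℂ) : U * star U = 1 :=
  Matrix.mem_unitaryGroup_iff.1 h

theorem unitary_star_mul {U : Op ι} (h : U ∈ Matrix.unitaryGroup (Bits ι) ℂ) : star U * U = 1 :=
  Matrix.mem_unitaryGroup_iff'.1 h

/-- Split a Pauli into its part on the range of `e`, which is conjugated as by `U`, and its part
outside, which commutes with the placed gate. -/
theorem IsClifford.liftOp {U : Op α} (hU : IsClifford U) (e : α ↪ ι) :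
    IsClifford (liftOp e U) := by
  classical
  refine ⟨liftOp_unitary e hU.1, fun P => ?_⟩
  let Pin : Pauli α := (P.1 ∘ e, P.2 ∘ e)
  let Pout : Pauli ι := P + extPauli e Pin
  have hout : ((pauliSupp Pout : Finset ι) : Set ι) ⊆ (Set.range e)ᶜ := by
    rintro i hi ⟨a, rfl⟩
    rw [Finset.mem_coe, mem_pauliSupp] at hi
    simp [Pout, Pin, extPauli, CharTwo.add_self_eq_zero] at hi
  have hP : P = Pout + extPauli e Pin := by
    simp only [Pout]
    ext1 <;> simp [bits_add_cancel]
  obtain ⟨Q, c, hQ⟩ := hU.2 Pin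
  have hc : ShallowFT.liftOp e U * pauliOp Pout = pauliOp Pout * ShallowFT.liftOp e U :=
    pauliSpan_commute disjoint_compl_right (liftOp_mem_pauliSpan e U) (pauliOp_mem_pauliSpan hout)
  have hmul := pauliOp_mul Pout (extPauli e Pin)
  rw [← hP] at hmul
  set σ := bsign (∑ i, Pout.2 i * (extPauli e Pin).1 i)
  have h1 : pauliOp P = σ • (pauliOp Pout * ShallowFT.liftOp e (pauliOp Pin)) := by
    rw [liftOp_pauliOp, hmul, smul_smul, bsign_mul_self, one_smul]
  refine ⟨Pout + extPauli e Q, σ * c * bsign (∑ i, Pout.2 i * (extPauli e Q).1 i), ?_⟩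
  rw [mul_smul (σ * c), ← pauliOp_mul, h1, mul_smul_comm, smul_mul_assoc, ← mul_assoc, hc,
    mul_assoc, mul_assoc, ← mul_assoc (ShallowFT.liftOp e U), ← liftOp_star, ← liftOp_mul,
    ← liftOp_mul, hQ, liftOp_smul, liftOp_pauliOp, mul_smul_comm, smul_smul]

end

/-! ### Relations of bounded degree -/

/-- Every point is related to at most `Δ` points. -/
def BddRel {X Y : Type} (r : X → Y → Prop) (Δ : ℕ) : Prop :=
  ∀ x, ∃ s : Finset Y, s.card ≤ Δ ∧ ∀ y, r x y → y ∈ s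

/-- Chains of exactly `k` related steps. -/
def relPow {X : Type} (r : X → X → Prop) : ℕ → X → X → Prop
  | 0, x, y => x = y
  | k + 1, x, y => ∃ z, relPow r k x z ∧ r z y

theorem relPow_head {X : Type} (r : X → X → Prop) (k : ℕ) (x y : X) :
    relPow r (k + 1) x y ↔ ∃ z, r x z ∧ relPow r k z y := by
  induction k generalizing y with
  | zero =>
    simp only [relPow]
    constructor
    · rintro ⟨z, rfl, h⟩; exact ⟨y, h, rfl⟩
    · rintro ⟨z, h, rfl⟩; exact ⟨x, rfl, h⟩
  | succ k ih =>
    constructor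
    · rintro ⟨z, hz, h⟩
      obtain ⟨u, hu, hu'⟩ := (ih z).1 hz
      exact ⟨u, hu, z, hu', h⟩
    · rintro ⟨u, hu, z, hz, h⟩
      exact ⟨z, (ih z).2 ⟨u, hu, hz⟩, h⟩

theorem relPow_symm {X : Type} {r : X → X → Prop} (hr : ∀ x y, r x y → r y x) (k : ℕ) (x y : X)
    (h : relPow r k x y) : relPow r k y x := by
  induction k generalizing y with
  | zero => exact Eq.symm h
  | succ k ih =>
    obtain ⟨z, hz, hzy⟩ := h
    exact (relPow_head r k y x).2 ⟨z, hr _ _ hzy, ih z hz⟩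

theorem BddRel.biUnion {X Y Z : Type} {r : X → Y → Prop} {r' : Y → Z → Prop} {Δ Δ' : ℕ}
    (h : BddRel r Δ) (h' : BddRel r' Δ') : BddRel (fun x z => ∃ y, r x y ∧ r' y z) (Δ * Δ') := by
  classical
  intro x
  obtain ⟨s, hs, hs'⟩ := h x
  choose f hf hf' using h'
  refine ⟨s.biUnion f, ?_, ?_⟩
  · exact (Finset.card_biUnion_le_card_mul _ _ _ fun y _ => hf y).trans (Nat.mul_le_mul_right _ hs)
  · rintro z ⟨y, hy, hz⟩
    exact Finset.mem_biUnion.2 ⟨y, hs' y hy, hf' y z hz⟩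

theorem BddRel.relPow {X : Type} {r : X → X → Prop} {Δ : ℕ} (h : BddRel r Δ) (k : ℕ) :
    BddRel (relPow r k) (Δ ^ k) := by
  induction k with
  | zero =>
    intro x
    refine ⟨{x}, by simp, fun y hy => ?_⟩
    rw [Finset.mem_singleton]
    exact hy.symm
  | succ k ih => rw [pow_succ]; exact ih.biUnion h

theorem BddRel.mono {X Y : Type} {r r' : X → Y → Prop} {Δ Δ' : ℕ} (h : BddRel r Δ)
    (hr : ∀ x y, r' x y → r x y) (hΔ : Δ ≤ Δ') : BddRel r' Δ' := by
  intro x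
  obtain ⟨s, hs, hs'⟩ := h x
  exact ⟨s, hs.trans hΔ, fun y hy => hs' y (hr _ _ hy)⟩

theorem BddRel.or {X Y : Type} {r r' : X → Y → Prop} {Δ Δ' : ℕ} (h : BddRel r Δ)
    (h' : BddRel r' Δ') : BddRel (fun x y => r x y ∨ r' x y) (Δ + Δ') := by
  classical
  intro x
  obtain ⟨s, hs, hs'⟩ := h x
  obtain ⟨u, hu, hu'⟩ := h' x
  refine ⟨s ∪ u, (Finset.card_union_le _ _).trans (add_le_add hs hu), ?_⟩
  rintro y (hy | hy)
  · exact Finset.mem_union_left _ (hs' y hy)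
  · exact Finset.mem_union_right _ (hu' y hy)

theorem BddRel.exists {X Y S : Type} [Fintype S] {r : S → X → Y → Prop} {Δ : ℕ}
    (h : ∀ t, BddRel (r t) Δ) : BddRel (fun x y => ∃ t, r t x y) (Fintype.card S * Δ) := by
  classical
  intro x
  choose f hf hf' using fun t => h t x
  refine ⟨Finset.univ.biUnion f, ?_, ?_⟩
  · exact Finset.card_biUnion_le_card_mul _ _ _ fun t _ => hf t
  · rintro y ⟨t, hy⟩
    exact Finset.mem_biUnion.2 ⟨t, Finset.mem_univ _, hf' t y hy⟩

theorem BddRel.eq {X : Type} : BddRel (fun x y : X => x = y) 1 := fun x =>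
  ⟨{x}, by simp, fun y hy => by rw [Finset.mem_singleton]; exact hy.symm⟩

/-! ### The squared norm -/

/-- The squared norm of a vector. -/
def normSqSum {κ : Type} [Fintype κ] (ψ : κ → ℂ) : ℝ := ∑ x, ‖ψ x‖ ^ 2

theorem normSqSum_eq {κ : Type} [Fintype κ] (ψ : κ → ℂ) : (normSqSum ψ : ℂ) = star ψ ⬝ᵥ ψ := by
  simp only [normSqSum, dotProduct, Pi.star_apply, Complex.ofReal_sum]
  refine Finset.sum_congr rfl fun x _ => ?_
  rw [Complex.ofReal_pow, ← Complex.conj_mul']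
  rfl

theorem normSqSum_mulVec {κ κ' : Type} [Fintype κ] [Fintype κ'] [DecidableEq κ]
    {M : Matrix κ' κ ℂ} (h : Mᴴ * M = 1) (ψ : κ → ℂ) : normSqSum (M *ᵥ ψ) = normSqSum ψ := by
  have : (normSqSum (M *ᵥ ψ) : ℂ) = normSqSum ψ := by
    rw [normSqSum_eq, normSqSum_eq, Matrix.star_mulVec, Matrix.dotProduct_mulVec,
      Matrix.vecMul_vecMul, h, Matrix.vecMul_one]
  exact_mod_cast this

theorem normSqSum_unitary {ι : Type} [Fintype ι] [DecidableEq ι] {U : Op ι}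
    (h : U ∈ Matrix.unitaryGroup (Bits ι) ℂ) (ψ : State ι) :
    normSqSum (U *ᵥ ψ) = normSqSum ψ := normSqSum_mulVec (unitary_star_mul h) ψ

theorem normSqSum_uniformState {ι : Type} [Fintype ι] [DecidableEq ι] {A : Set (Bits ι)} (hA : A.Nonempty) :
    normSqSum (uniformState A) = 1 := by
  classical
  have hc : 0 < A.ncard := (Set.ncard_pos (Set.toFinite A)).2 hA
  have h : ∀ x, ‖uniformState A x‖ ^ 2 = if x ∈ A.toFinset then (A.ncard : ℝ)⁻¹ else 0 := by
    intro x
    simp only [uniformState, Set.mem_toFinset]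
    split_ifs
    · rw [Complex.norm_real, Real.norm_eq_abs, sq_abs, inv_pow, Real.sq_sqrt (by positivity)]
    · simp
  simp only [normSqSum, h, Finset.sum_ite_mem, Finset.univ_inter, Finset.sum_const,
    nsmul_eq_mul, ← Set.ncard_eq_toFinset_card']
  exact mul_inv_cancel₀ (by exact_mod_cast hc.ne')

/-! ### Circuits with faults -/

section
variable {ι : Type} [Fintype ι] [DecidableEq ι]

/-- Two qubits are in a common gate of the circuit, or equal. -/
def Circuit.touch (C : Circuit ι) (x y : ι) : Prop :=
  x = y ∨ ∃ t, ∃ g ∈ C.layers t, x ∈ Set.range g.pos ∧ y ∈ Set.range g.pos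

theorem Circuit.touch_symm (C : Circuit ι) (x y : ι) (h : C.touch x y) : C.touch y x := by
  rcases h with rfl | ⟨t, g, hg, hx, hy⟩
  · exact Or.inl rfl
  · exact Or.inr ⟨t, g, hg, hy, hx⟩

theorem Circuit.eq_of_mem_range (C : Circuit ι) {t : Fin C.depth} {g h : Gate ι}
    (hg : g ∈ C.layers t) (hh : h ∈ C.layers t) {x : ι} (hxg : x ∈ Set.range g.pos)
    (hxh : x ∈ Set.range h.pos) : g = h := by
  by_contra hne
  have hsym : Std.Symm fun g h : Gate ι => Disjoint (Set.range g.pos) (Set.range h.pos) :=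
    ⟨fun _ _ h => h.symm⟩
  exact Set.disjoint_left.1 ((C.disjoint t).forall hg hh hne) hxg hxh

/-- The gates of a layer are disjoint, so a layer gives a qubit at most `w` partners; the summand
one accounts for the qubit itself. -/
theorem Circuit.touch_bdd (C : Circuit ι) {w : ℕ} (hw : C.FanIn w) :
    BddRel C.touch (1 + C.depth * w) := by
  classical
  refine BddRel.mono (BddRel.or BddRel.eq ?_) (fun _ _ h => h) le_rfl
  have := BddRel.exists (S := Fin C.depth)
    (r := fun t (x y : ι) => ∃ g ∈ C.layers t, x ∈ Set.range g.pos ∧ y ∈ Set.range g.pos)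
    (Δ := w) ?_
  · simpa using this
  intro t x
  by_cases h : ∃ g ∈ C.layers t, x ∈ Set.range g.pos
  · obtain ⟨g, hg, hx⟩ := h
    refine ⟨Finset.univ.map g.pos, by simpa using hw t g hg, ?_⟩
    rintro y ⟨g', hg', hx', ⟨a, ha⟩⟩
    obtain rfl := C.eq_of_mem_range hg hg' hx hx'
    simp [← ha]
  · refine ⟨∅, by simp, ?_⟩
    rintro y ⟨g', hg', hx', -⟩
    exact absurd ⟨g', hg', hx'⟩ h

/-- The qubits within `k` gates of a fault. -/
def Circuit.spread (C : Circuit ι) (E : C.Faults) (k : ℕ) : Set ι :=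
  {x | ∃ t, ∃ y ∈ pauliSupp (E t), relPow C.touch k y x}

theorem layer_unitary (l : List (Gate ι)) :
    (l.map fun g => liftOp g.pos g.op).prod ∈ Matrix.unitaryGroup (Bits ι) ℂ := by
  refine Submonoid.list_prod_mem _ fun U hU => ?_
  obtain ⟨g, -, rfl⟩ := List.mem_map.1 hU
  exact liftOp_unitary _ g.unitary

/-- A gate inside `S` stays in the algebra of `S`; a gate disjoint from `S` commutes with the
operator and cancels against its adjoint. -/
theorem conj_layer_mem_pauliSpan {S : Set ι} {F : Op ι} (hF : F ∈ pauliSpan S) (l : List (Gate ι))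
    (hl : ∀ g ∈ l, Set.range g.pos ⊆ S ∨ Disjoint (Set.range g.pos) S) :
    (l.map fun g => liftOp g.pos g.op).prod * F * star (l.map fun g => liftOp g.pos g.op).prod ∈
      pauliSpan S := by
  induction l with
  | nil => simpa using hF
  | cons g l ih =>
    have ih' := ih fun g' hg' => hl g' (List.mem_cons_of_mem _ hg')
    rw [List.map_cons, List.prod_cons, star_mul]
    set L := (l.map fun g => liftOp g.pos g.op).prod
    rw [show liftOp g.pos g.op * L * F * (star L * star (liftOp g.pos g.op)) =
      liftOp g.pos g.op * (L * F * star L) * star (liftOp g.pos g.op) by simp only [mul_assoc]]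
    rcases hl g (List.mem_cons_self) with h | h
    · have hg := pauliSpan_mono h (liftOp_mem_pauliSpan g.pos g.op)
      exact pauliSpan_mul (pauliSpan_mul hg ih') (star_mem_pauliSpan hg)
    · rw [pauliSpan_commute h (liftOp_mem_pauliSpan g.pos g.op) ih', mul_assoc,
        unitary_mul_star (liftOp_unitary _ g.unitary), mul_one]
      exact ih'

theorem Circuit.conj_layerOp_mem_pauliSpan (C : Circuit ι) (E : C.Faults) (t : Fin C.depth) (k : ℕ)
    {F : Op ι} (hF : F ∈ pauliSpan (C.spread E k)) :
    C.layerOp t * F * star (C.layerOp t) ∈ pauliSpan (C.spread E (k + 1)) := by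
  set R := C.spread E k
  -- Completing `R` by all gates of the layer that meet it makes each gate either contained in `S`
  -- or disjoint from it.
  let S : Set ι := R ∪ {x | ∃ g ∈ C.layers t, x ∈ Set.range g.pos ∧ ∃ y ∈ R, y ∈ Set.range g.pos}
  have hS : S ⊆ C.spread E (k + 1) := by
    rintro x (⟨t', y, hy, hyx⟩ | ⟨g, hg, hx, y, ⟨t', z, hz, hzy⟩, hy⟩)
    · exact ⟨t', y, hy, x, hyx, Or.inl rfl⟩
    · exact ⟨t', z, hz, y, hzy, Or.inr ⟨t, g, hg, hy, hx⟩⟩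
  refine pauliSpan_mono hS (conj_layer_mem_pauliSpan
    (pauliSpan_mono Set.subset_union_left hF) _ fun g hg => ?_)
  by_cases h : ∃ y ∈ R, y ∈ Set.range g.pos
  · exact Or.inl fun x hx => Or.inr ⟨g, hg, hx, h⟩
  · refine Or.inr (Set.disjoint_left.2 ?_)
    rintro x hx (hxR | ⟨g', hg', hx', h'⟩)
    · exact h ⟨x, hxR, hx⟩
    · obtain rfl := C.eq_of_mem_range hg hg' hx hx'
      exact h h'

theorem Circuit.layerOp_unitary (C : Circuit ι) (t : Fin C.depth) :
    C.layerOp t ∈ Matrix.unitaryGroup (Bits ι) ℂ := layer_unitary _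

/-- All gates of the circuit are Clifford gates. -/
def Circuit.Clifford (C : Circuit ι) : Prop := ∀ t, ∀ g ∈ C.layers t, IsClifford g.op

theorem layer_clifford {l : List (Gate ι)} (h : ∀ g ∈ l, IsClifford g.op) :
    IsClifford (l.map fun g => liftOp g.pos g.op).prod := by
  refine IsClifford.list_prod fun U hU => ?_
  obtain ⟨g, hg, rfl⟩ := List.mem_map.1 hU
  exact (h g hg).liftOp _

/-- The unitary of the circuit without faults. -/
def Circuit.unitaryOp (C : Circuit ι) : Op ι :=
  Fin.induction (motive := fun _ => Op ι) 1 (fun t U => C.layerOp t * U) (Fin.last C.depth)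

/-- All faults are moved to the end layer by layer: conjugating the collected error by the next
layer spreads its support by one step of `touch`, and then the fault of that time is multiplied in.
One induction serves both general circuits and Clifford circuits, where the error stays a Pauli. -/
theorem Circuit.exists_run_eq (C : Circuit ι) (E : C.Faults) :
    ∃ F ∈ Matrix.unitaryGroup (Bits ι) ℂ, F ∈ pauliSpan (C.spread E C.depth) ∧
      (∀ φ, C.run E φ = F *ᵥ (C.unitaryOp *ᵥ φ)) ∧
      (C.Clifford → ∃ (P : Pauli ι) (c : ℂ), F = c • pauliOp P) := by
  suffices h : ∀ t : Fin (C.depth + 1), ∃ F ∈ Matrix.unitaryGroup (Bits ι) ℂ,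
      F ∈ pauliSpan (C.spread E t) ∧
      (∀ φ, Fin.induction (motive := fun _ => State ι) (pauliOp (E 0) *ᵥ φ)
        (fun t ψ => pauliOp (E t.succ) *ᵥ (C.layerOp t *ᵥ ψ)) t = F *ᵥ
        ((Fin.induction (motive := fun _ => Op ι) 1 (fun t U => C.layerOp t * U) t : Op ι) *ᵥ φ)) ∧
      (C.Clifford → ∃ (P : Pauli ι) (c : ℂ), F = c • pauliOp P) by
    exact h (Fin.last _)
  intro t
  have hmem : ∀ (t : Fin (C.depth + 1)) k, pauliOp (E t) ∈ pauliSpan (C.spread E k) := by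
    intro t k
    refine pauliOp_mem_pauliSpan fun x hx => ⟨t, x, hx, ?_⟩
    induction k with
    | zero => rfl
    | succ k ih => exact ⟨x, ih, Or.inl rfl⟩
  induction t using Fin.induction with
  | zero =>
    refine ⟨pauliOp (E 0), pauliOp_unitary _, hmem 0 0, fun φ => ?_, fun _ => ⟨E 0, 1, by simp⟩⟩
    simp
  | succ t ih =>
    obtain ⟨F, hF, hF', h, hC⟩ := ih
    refine ⟨pauliOp (E t.succ) * (C.layerOp t * F * star (C.layerOp t)), ?_, ?_, ?_, ?_⟩
    · exact mul_mem (pauliOp_unitary _)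
        (mul_mem (mul_mem (C.layerOp_unitary t) hF) (Unitary.star_mem (C.layerOp_unitary t)))
    · exact pauliSpan_mul (hmem _ _) (C.conj_layerOp_mem_pauliSpan E t _ hF')
    · intro φ
      rw [Fin.induction_succ, Fin.induction_succ, h φ]
      simp only [Matrix.mulVec_mulVec]
      congr 1
      rw [show pauliOp (E t.succ) * (C.layerOp t * F * star (C.layerOp t)) = pauliOp (E t.succ) *
        C.layerOp t * F * star (C.layerOp t) by simp only [mul_assoc]]
      simp only [mul_assoc]
      rw [← mul_assoc (star (C.layerOp t)), unitary_star_mul (C.layerOp_unitary t), one_mul]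
    · intro hcl
      obtain ⟨P, c, rfl⟩ := hC hcl
      obtain ⟨P', c', h'⟩ := (layer_clifford (hcl t)).2 P
      refine ⟨E t.succ + P', c * c' * bsign (∑ i, (E t.succ).2 i * P'.1 i), ?_⟩
      rw [mul_smul_comm, smul_mul_assoc]
      change pauliOp (E t.succ) * (c • (C.layerOp t * pauliOp P * star (C.layerOp t))) = _
      change C.layerOp t * pauliOp P * star (C.layerOp t) = _ at h'
      rw [h', mul_smul_comm, mul_smul_comm, pauliOp_mul, smul_smul, smul_smul, mul_assoc]

theorem Circuit.unitaryOp_unitary (C : Circuit ι) :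
    C.unitaryOp ∈ Matrix.unitaryGroup (Bits ι) ℂ := by
  suffices h : ∀ t : Fin (C.depth + 1), (Fin.induction (motive := fun _ => Op ι) 1
      (fun t U => C.layerOp t * U) t : Op ι) ∈ Matrix.unitaryGroup (Bits ι) ℂ by
    exact h (Fin.last _)
  intro t
  induction t using Fin.induction with
  | zero => exact one_mem _
  | succ t ih => exact mul_mem (C.layerOp_unitary t) ih

/-- The scalar is nonzero because the collected error is unitary; so the Pauli itself lies in
`pauliSpan`, which bounds its support. -/
theorem Circuit.exists_run_eq_pauli (C : Circuit ι) (hC : C.Clifford) (E : C.Faults) :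
    ∃ (P : Pauli ι) (c : ℂ), ↑(pauliSupp P) ⊆ C.spread E C.depth ∧
      ∀ φ, C.run E φ = c • (pauliOp P *ᵥ (C.unitaryOp *ᵥ φ)) := by
  obtain ⟨F, hF, hF', h, hP⟩ := C.exists_run_eq E
  obtain ⟨P, c, rfl⟩ := hP hC
  have hc : c ≠ 0 := by
    rintro rfl
    have := unitary_mul_star hF
    simp at this
  refine ⟨P, c, pauliSupp_subset_of_mem_pauliSpan ?_, fun φ => ?_⟩
  · have := Submodule.smul_mem _ c⁻¹ hF'
    rwa [smul_smul, inv_mul_cancel₀ hc, one_smul] at this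
  · rw [h, Matrix.smul_mulVec]

theorem Circuit.normSqSum_run (C : Circuit ι) (E : C.Faults) (φ : State ι) :
    normSqSum (C.run E φ) = normSqSum φ := by
  obtain ⟨F, hF, -, h, -⟩ := C.exists_run_eq E
  rw [h, normSqSum_unitary hF, normSqSum_unitary C.unitaryOp_unitary]

theorem Circuit.run_smul (C : Circuit ι) (E : C.Faults) (c : ℂ) (φ : State ι) :
    C.run E (c • φ) = c • C.run E φ := by
  obtain ⟨F, -, -, h, -⟩ := C.exists_run_eq E
  rw [h, h, Matrix.mulVec_smul, Matrix.mulVec_smul]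

/-- A Pauli error on the input of a circuit can be regarded as a fault. -/
theorem Circuit.run_pauliOp (C : Circuit ι) (E : C.Faults) (P : Pauli ι) (φ : State ι) :
    ∃ c : ℂ, C.run E (pauliOp P *ᵥ φ) = c • C.run (Function.update E 0 (E 0 + P)) φ := by
  refine ⟨bsign (∑ i, (E 0).2 i * P.1 i), ?_⟩
  unfold Circuit.run
  generalize Fin.last C.depth = t
  induction t using Fin.induction with
  | zero =>
    simp only [Fin.induction_zero, Function.update_self]
    rw [Matrix.mulVec_mulVec, pauliOp_mul, Matrix.smul_mulVec]
  | succ t ih =>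
    rw [Fin.induction_succ, Fin.induction_succ, ih, Matrix.mulVec_smul, Matrix.mulVec_smul,
      Function.update_of_ne (Fin.succ_ne_zero t)]

/-! ### Circuits from lists of layers -/

/-- Circuits are defined by recursion over `Fin`, but are built by appending lists of layers; a fold
turns concatenation into composition. -/
theorem fin_induction_last_eq_foldl {S : Type} (d : ℕ) (f : Fin d → S → S) (z : S) :
    Fin.induction (motive := fun _ => S) z (fun t ψ => f t ψ) (Fin.last d) =
      (List.ofFn f).foldl (fun ψ g => g ψ) z := by
  induction d with
  | zero => simp
  | succ d ih =>
    rw [List.ofFn_succ', List.concat_eq_append, List.foldl_append, List.foldl_cons, List.foldl_nil,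
      ← Fin.succ_last, Fin.induction_succ, ← ih (fun t => f t.castSucc)]
    congr 1
    have : ∀ t : Fin (d + 1), Fin.induction (motive := fun _ => S) z (fun t ψ => f t ψ) t.castSucc =
        Fin.induction (motive := fun _ => S) z (fun t ψ => f t.castSucc ψ) t := by
      intro t
      induction t using Fin.induction with
      | zero => simp
      | succ t ih2 => rw [← Fin.succ_castSucc, Fin.induction_succ, Fin.induction_succ, ih2]
    exact this (Fin.last d)

theorem foldl_ofFn_map {S A : Type} (d : ℕ) (f : Fin d → A) (h : A → S → S) (z : S) :
    (List.ofFn fun t => h (f t)).foldl (fun ψ g => g ψ) z =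
      (List.ofFn f).foldl (fun ψ a => h a ψ) z := by
  have : (List.ofFn fun t => h (f t)) = (List.ofFn f).map h := by
    rw [List.map_ofFn]; rfl
  rw [this, List.foldl_map]

/-- The operator of a layer. -/
def layerListOp (l : List (Gate ι)) : Op ι := (l.map fun g => liftOp g.pos g.op).prod

/-- The gates act on pairwise disjoint qubits. -/
def DisjointGates {ι : Type} (l : List (Gate ι)) : Prop :=
  l.Pairwise fun g h => Disjoint (Set.range g.pos) (Set.range h.pos)

/-- The circuit with the given layers. -/
def Circuit.ofLayers {ι : Type} (Ls : List (List (Gate ι))) (h : ∀ l ∈ Ls, DisjointGates l) :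
    Circuit ι where
  depth := Ls.length
  layers := Ls.get
  disjoint t := h _ (Ls.get_mem t)

theorem Circuit.unitaryOp_mulVec (C : Circuit ι) (φ : State ι) :
    C.unitaryOp *ᵥ φ = (List.ofFn C.layers).foldl (fun ψ l => layerListOp l *ᵥ ψ) φ := by
  rw [← foldl_ofFn_map (h := fun l ψ => layerListOp l *ᵥ ψ), ← fin_induction_last_eq_foldl]
  unfold Circuit.unitaryOp
  generalize Fin.last C.depth = t
  induction t using Fin.induction with
  | zero => simp
  | succ t ih =>
    rw [Fin.induction_succ, Fin.induction_succ, ← ih, Matrix.mulVec_mulVec]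
    rfl

theorem Circuit.unitaryOp_ofLayers (Ls : List (List (Gate ι))) (h : ∀ l ∈ Ls, DisjointGates l)
    (φ : State ι) : (Circuit.ofLayers Ls h).unitaryOp *ᵥ φ =
      Ls.foldl (fun ψ l => layerListOp l *ᵥ ψ) φ := by
  rw [Circuit.unitaryOp_mulVec]
  congr 1
  exact List.ofFn_get Ls

theorem Circuit.fanIn_ofLayers {w : ℕ} (Ls : List (List (Gate ι))) (h : ∀ l ∈ Ls, DisjointGates l)
    (hw : ∀ l ∈ Ls, ∀ g ∈ l, g.arity ≤ w) : (Circuit.ofLayers Ls h).FanIn w :=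
  fun t g hg => hw _ (Ls.get_mem t) g hg

theorem Circuit.clifford_ofLayers (Ls : List (List (Gate ι))) (h : ∀ l ∈ Ls, DisjointGates l)
    (hw : ∀ l ∈ Ls, ∀ g ∈ l, IsClifford g.op) : (Circuit.ofLayers Ls h).Clifford :=
  fun t g hg => hw _ (Ls.get_mem t) g hg

end

/-! ### Measurement amplitudes -/

section
variable {ι : Type} [Fintype ι] [DecidableEq ι]

/-- A Pauli in front of a single-qubit measurement only relabels the outcome: `X` matters in the
standard basis and `Z` in the Hadamard basis. The remaining sign must not depend on the state, so
`τ` is chosen before `t`. -/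
theorem ket_shift (m : Basis) (z a b : ZMod 2) : ∃ τ : ZMod 2, ∀ t : ZMod 2,
    m.ket z (t + a) * bsign (b * t) =
      bsign τ * m.ket (z + match m with | .std => a | .had => b) t := by
  cases m with
  | std =>
    refine ⟨b * (z + a), fun t => ?_⟩
    simp only [Basis.ket]
    have h : z = t + a ↔ z + a = t := by
      clear b; revert z t a; decide
    by_cases hz : z + a = t
    · rw [if_pos (h.2 hz), if_pos hz, ← hz]; ring
    · rw [if_neg fun h' => hz (h.1 h'), if_neg hz]; ring
  | had =>
    refine ⟨z * a, fun t => ?_⟩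
    simp only [Basis.ket]
    rw [mul_add, bsign_add, add_mul, bsign_add]
    ring

theorem amplitude_pauliOp (m : ι → Basis) (P : Pauli ι) (z : Bits ι) : ∃ τ : ZMod 2,
    ∀ ψ : State ι, amplitude m (pauliOp P *ᵥ ψ) z = bsign τ * amplitude m ψ (z + flips m P) := by
  choose τ hτ using fun i => ket_shift (m i) (z i) (P.1 i) (P.2 i)
  refine ⟨∑ i, τ i, fun ψ => ?_⟩
  simp only [amplitude, Finset.mul_sum]
  refine (Fintype.sum_equiv (Equiv.addRight P.1) _ _ fun t => ?_).symm
  rw [pauliOp_mulVec]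
  simp only [Equiv.coe_addRight, bits_add_cancel]
  rw [bsign_sum, bsign_sum, ← mul_assoc, ← mul_assoc, ← Finset.prod_mul_distrib,
    ← Finset.prod_mul_distrib]
  congr 1
  refine Finset.prod_congr rfl fun i _ => ?_
  rw [Pi.add_apply]
  exact (hτ i (t i)).symm

theorem flips_add (m : ι → Basis) (P Q : Pauli ι) : flips m (P + Q) = flips m P + flips m Q := by
  funext i
  simp only [flips, Pi.add_apply]
  cases m i <;> rfl

theorem flips_zero (m : ι → Basis) : flips m 0 = 0 := by
  funext i
  simp only [flips]
  cases m i <;> rfl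

theorem flips_sum {α : Type} (m : ι → Basis) (s : Finset α) (P : α → Pauli ι) :
    flips m (∑ a ∈ s, P a) = ∑ a ∈ s, flips m (P a) := by
  classical
  induction s using Finset.induction_on with
  | empty => simp [flips_zero]
  | insert a s ha ih => rw [Finset.sum_insert ha, Finset.sum_insert ha, flips_add, ih]

theorem mem_pauliSupp_of_flips {m : ι → Basis} {P : Pauli ι} {i : ι} (h : flips m P i ≠ 0) :
    i ∈ pauliSupp P := by
  rw [mem_pauliSupp]
  simp only [flips] at h
  cases hm : m i <;> rw [hm] at h
  · exact Or.inl h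
  · exact Or.inr h

theorem amplitude_smul (m : ι → Basis) (c : ℂ) (ψ : State ι) (z : Bits ι) :
    amplitude m (c • ψ) z = c * amplitude m ψ z := by
  simp only [amplitude, Pi.smul_apply, smul_eq_mul, Finset.mul_sum]
  refine Finset.sum_congr rfl fun t _ => by ring

theorem amplitude_add (m : ι → Basis) (φ ψ : State ι) (z : Bits ι) :
    amplitude m (φ + ψ) z = amplitude m φ z + amplitude m ψ z := by
  simp only [amplitude, Pi.add_apply, mul_add, Finset.sum_add_distrib]

/-- Each Pauli on `R` flips outcomes inside `R` only, so by linearity any operator on `R` acts on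
the amplitudes as a superposition of such flips. This reduces a non-Pauli residual error to
classical error patterns. -/
theorem amplitude_pauliSpan (m : ι → Basis) {R : Set ι} {F : Op ι} (hF : F ∈ pauliSpan R) :
    ∃ G : Bits ι → Bits ι → ℂ, (∀ z e, (∃ i, e i ≠ 0 ∧ i ∉ R) → G z e = 0) ∧
      ∀ z ψ, amplitude m (F *ᵥ ψ) z = ∑ e, G z e * amplitude m ψ (z + e) := by
  induction hF using Submodule.span_induction with
  | mem x hx =>
    obtain ⟨P, hP, rfl⟩ := hx
    choose τ hτ using amplitude_pauliOp m P
    refine ⟨fun z e => if e = flips m P then bsign (τ z) else 0, ?_, fun z ψ => ?_⟩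
    · rintro z e ⟨i, hi, hiR⟩
      refine if_neg ?_
      rintro rfl
      exact hiR (hP (mem_pauliSupp_of_flips hi))
    · simp [hτ]
  | zero =>
    refine ⟨0, fun _ _ _ => rfl, fun z ψ => ?_⟩
    simp [amplitude]
  | add x y _ _ h1 h2 =>
    obtain ⟨G, hG, h⟩ := h1
    obtain ⟨G', hG', h'⟩ := h2
    refine ⟨G + G', fun z e he => ?_, fun z ψ => ?_⟩
    · simp [hG z e he, hG' z e he]
    · rw [Matrix.add_mulVec, amplitude_add, h, h', ← Finset.sum_add_distrib]
      simp only [Pi.add_apply, add_mul]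
  | smul c x _ h1 =>
    obtain ⟨G, hG, h⟩ := h1
    refine ⟨c • G, fun z e he => ?_, fun z ψ => ?_⟩
    · simp [hG z e he]
    · rw [Matrix.smul_mulVec, amplitude_smul, h, Finset.mul_sum]
      simp only [Pi.smul_apply, smul_eq_mul, mul_assoc]

theorem ket_orthonormal (m : Basis) (t t' : ZMod 2) :
    ∑ z, star (m.ket z t) * m.ket z t' = if t = t' then 1 else 0 := by
  have hs : ((√2 : ℝ) : ℂ)⁻¹ * ((√2 : ℝ) : ℂ)⁻¹ = 1 / 2 := by
    rw [← mul_inv, ← Complex.ofReal_mul, Real.mul_self_sqrt (by norm_num)]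
    norm_num
  have h2 : ∀ f : ZMod 2 → ℂ, ∑ z, f z = f 0 + f 1 := fun f => Fin.sum_univ_two f
  rw [h2]
  cases m with
  | std =>
    rcases zmod2_cases t with rfl | rfl <;> rcases zmod2_cases t' with rfl | rfl <;>
      simp [Basis.ket]
  | had =>
    rcases zmod2_cases t with rfl | rfl <;> rcases zmod2_cases t' with rfl | rfl <;>
      simp [Basis.ket, hs] <;> norm_num

/-- The matrix of the measurement amplitudes. -/
def ketMatrix (m : ι → Basis) : Op ι := Matrix.of fun z t => ∏ i, (m i).ket (z i) (t i)

theorem amplitude_eq_mulVec (m : ι → Basis) (ψ : State ι) : amplitude m ψ = ketMatrix m *ᵥ ψ := rfl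

theorem ketMatrix_unitary (m : ι → Basis) : (ketMatrix m)ᴴ * ketMatrix m = 1 := by
  ext t t'
  simp only [Matrix.mul_apply, Matrix.conjTranspose_apply, ketMatrix, Matrix.of_apply, star_prod,
    ← Finset.prod_mul_distrib]
  have := (Finset.prod_univ_sum (fun _ : ι => (Finset.univ : Finset (ZMod 2)))
    fun i z => star ((m i).ket z (t i)) * (m i).ket z (t' i)).symm
  rw [Fintype.piFinset_univ] at this
  rw [this]
  simp only [ket_orthonormal, Matrix.one_apply]
  split_ifs with h
  · simp [h]
  · obtain ⟨i, hi⟩ := Function.ne_iff.1 h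
    exact Finset.prod_eq_zero (Finset.mem_univ i) (if_neg hi)

theorem sum_weight (m : ι → Basis) (ψ : State ι) : ∑ z, weight m ψ z = normSqSum ψ := by
  rw [← normSqSum_mulVec (ketMatrix_unitary m) ψ]
  rfl

theorem weight_nonneg (m : ι → Basis) (ψ : State ι) (z : Bits ι) : 0 ≤ weight m ψ z := by
  unfold weight; positivity

/-- Some vector has the measurement amplitude `1` at `y` and `0` elsewhere. -/
theorem exists_amplitude_single (m : ι → Basis) (y : Bits ι) :
    ∃ φ : State ι, amplitude m φ = Pi.single y 1 := by
  refine ⟨(ketMatrix m)ᴴ *ᵥ Pi.single y 1, ?_⟩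
  rw [amplitude_eq_mulVec, Matrix.mulVec_mulVec, mul_eq_one_comm.1 (ketMatrix_unitary m),
    Matrix.one_mulVec]

end

/-! ### Measuring the ancillas -/

section
variable {δ β : Type} [Fintype δ] [DecidableEq δ] [Fintype β] [DecidableEq β]

/-- The part of a Pauli operator on the data. -/
def Pauli.left (P : Pauli (δ ⊕ β)) : Pauli δ := (P.1 ∘ Sum.inl, P.2 ∘ Sum.inl)

/-- The part of a Pauli operator on the ancillas. -/
def Pauli.right (P : Pauli (δ ⊕ β)) : Pauli β := (P.1 ∘ Sum.inr, P.2 ∘ Sum.inr)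

theorem Pauli.left_add (P Q : Pauli (δ ⊕ β)) : (P + Q).left = P.left + Q.left := rfl

theorem Pauli.right_add (P Q : Pauli (δ ⊕ β)) : (P + Q).right = P.right + Q.right := rfl

theorem Pauli.left_sum {α : Type} (s : Finset α) (P : α → Pauli (δ ⊕ β)) :
    (∑ a ∈ s, P a).left = ∑ a ∈ s, (P a).left := by
  classical
  induction s using Finset.induction_on with
  | empty => rfl
  | insert a s ha ih => rw [Finset.sum_insert ha, Finset.sum_insert ha, Pauli.left_add, ih]

theorem Pauli.right_sum {α : Type} (s : Finset α) (P : α → Pauli (δ ⊕ β)) :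
    (∑ a ∈ s, P a).right = ∑ a ∈ s, (P a).right := by
  classical
  induction s using Finset.induction_on with
  | empty => rfl
  | insert a s ha ih => rw [Finset.sum_insert ha, Finset.sum_insert ha, Pauli.right_add, ih]

theorem mem_pauliSupp_left {P : Pauli (δ ⊕ β)} {i : δ} :
    i ∈ pauliSupp P.left ↔ Sum.inl i ∈ pauliSupp P := by
  rw [mem_pauliSupp, mem_pauliSupp]; rfl

theorem mem_pauliSupp_right {P : Pauli (δ ⊕ β)} {i : β} :
    i ∈ pauliSupp P.right ↔ Sum.inr i ∈ pauliSupp P := by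
  rw [mem_pauliSupp, mem_pauliSupp]; rfl

theorem postMeasure_smul (m : β → Basis) (c : ℂ) (ψ : State (δ ⊕ β)) (s : Bits β) :
    postMeasure m (c • ψ) s = c • postMeasure m ψ s := by
  funext z
  exact amplitude_smul m c _ s

/-- The ancilla part of an error relabels the outcome and the data part remains as an error on the
data. -/
theorem postMeasure_pauliOp (m : β → Basis) (P : Pauli (δ ⊕ β)) (s : Bits β) : ∃ τ : ZMod 2,
    ∀ ψ : State (δ ⊕ β), postMeasure m (pauliOp P *ᵥ ψ) s =
      bsign τ • (pauliOp P.left *ᵥ postMeasure m ψ (s + flips m P.right)) := by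
  obtain ⟨τ, hτ⟩ := amplitude_pauliOp m P.right s
  refine ⟨τ, fun ψ => ?_⟩
  funext z
  rw [Pi.smul_apply, pauliOp_mulVec, smul_eq_mul, mul_left_comm]
  simp only [postMeasure]
  rw [← hτ, ← amplitude_smul]
  congr 1
  funext t
  rw [pauliOp_mulVec, Pi.smul_apply, pauliOp_mulVec, Fintype.sum_sum_type, bsign_add, smul_eq_mul,
    mul_assoc]
  have : Sum.elim z t + P.1 = Sum.elim (z + P.left.1) (t + P.right.1) := by
    funext i
    cases i <;> rfl
  rw [this]
  rfl

theorem liftOp_trans {α γ ι : Type} [Fintype α] [DecidableEq α] [Fintype γ] [DecidableEq γ]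
    [Fintype ι] [DecidableEq ι] (e : α ↪ γ) (e' : γ ↪ ι) (U : Op α) :
    liftOp (e.trans e') U = liftOp e' (liftOp e U) := by
  refine Matrix.ext_of_mulVec_single fun x => ?_
  generalize (Pi.single x 1 : State ι) = ψ
  funext y
  rw [liftOp_mulVec, liftOp_mulVec]
  have := liftOp_mulVec e U (fun u => ψ (overwrite e' u y)) (y ∘ e')
  rw [Matrix.mulVec, dotProduct] at this
  rw [this]
  refine Finset.sum_congr rfl fun u _ => ?_
  congr 2
  funext i
  by_cases h : i ∈ Set.range e'
  · obtain ⟨a, rfl⟩ := h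
    rw [overwrite_apply]
    by_cases h' : a ∈ Set.range e
    · obtain ⟨b, rfl⟩ := h'
      rw [overwrite_apply]
      exact overwrite_apply (e.trans e') u y b
    · rw [overwrite_of_notMem _ _ _ h', overwrite_of_notMem]
      · rfl
      · rintro ⟨b, hb⟩
        exact h' ⟨b, e'.injective hb⟩
  · rw [overwrite_of_notMem _ _ _ h, overwrite_of_notMem]
    rintro ⟨b, rfl⟩
    exact h ⟨e b, rfl⟩

/-- Operations on the data commute with the measurement of the ancillas; in the Clifford case this
is why the logical gates may be performed before that measurement. -/
theorem postMeasure_liftOp_inl (m : β → Basis) (U : Op δ) (ψ : State (δ ⊕ β)) (s : Bits β) :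
    postMeasure m (liftOp Function.Embedding.inl U *ᵥ ψ) s = U *ᵥ postMeasure m ψ s := by
  funext z
  simp only [postMeasure, amplitude, Matrix.mulVec, dotProduct]
  have h : ∀ t, (liftOp Function.Embedding.inl U *ᵥ ψ) (Sum.elim z t) =
      ∑ u, U z u * ψ (Sum.elim u t) := by
    intro t
    rw [liftOp_mulVec]
    refine Finset.sum_congr rfl fun u _ => ?_
    congr 2
    funext i
    cases i with
    | inl i => exact overwrite_apply Function.Embedding.inl u _ i
    | inr i =>
      rw [overwrite_of_notMem]
      · rfl
      · rintro ⟨j, hj⟩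
        cases hj
  have h' : ∀ t, (∑ x, liftOp Function.Embedding.inl U (Sum.elim z t) x * ψ x) =
      ∑ u, U z u * ψ (Sum.elim u t) := h
  simp only [h', Finset.mul_sum]
  rw [Finset.sum_comm]
  refine Finset.sum_congr rfl fun u _ => Finset.sum_congr rfl fun t _ => by ring

theorem sum_normSqSum_postMeasure (m : β → Basis) (ψ : State (δ ⊕ β)) :
    ∑ s, normSqSum (postMeasure m ψ s) = normSqSum ψ := by
  simp only [normSqSum, postMeasure]
  rw [Finset.sum_comm]
  have h : ∀ z : Bits δ, ∑ s, ‖amplitude m (fun t => ψ (Sum.elim z t)) s‖ ^ 2 =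
      ∑ t, ‖ψ (Sum.elim z t)‖ ^ 2 := fun z => sum_weight m _
  simp only [h]
  rw [← Fintype.sum_prod_type']
  refine Fintype.sum_equiv (Equiv.sumArrowEquivProdArrow δ β (ZMod 2)).symm _ _ fun p => ?_
  rfl

end

/-! ### Linear algebra of CSS codes -/

section
variable {n : ℕ} {Q : CSSCode n}

theorem mulVec_eq_zero_of_mem_rowSpace {m m' : ℕ} {H : Matrix (Fin m) (Fin n) (ZMod 2)}
    {M : Matrix (Fin m') (Fin n) (ZMod 2)} (h : H * Mᵀ = 0) {y : Bits (Fin n)}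
    (hy : y ∈ rowSpace H) : M *ᵥ y = 0 := by
  induction hy using Submodule.span_induction with
  | mem x hx =>
    obtain ⟨c, rfl⟩ := hx
    funext r
    have := congrFun (congrFun h c) r
    rw [Matrix.mul_apply] at this
    simpa [Matrix.mulVec, dotProduct, mul_comm] using this
  | zero => exact Matrix.mulVec_zero _
  | add x y _ _ h1 h2 => rw [Matrix.mulVec_add, h1, h2, add_zero]
  | smul r x _ h => rw [Matrix.mulVec_smul, h, smul_zero]

theorem CSSCode.orth' (Q : CSSCode n) : Q.HZ * Q.HXᵀ = 0 := by
  have := congrArg Matrix.transpose Q.orth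
  rwa [Matrix.transpose_mul, Matrix.transpose_transpose, Matrix.transpose_zero] at this

theorem finrank_rowSpace {m : ℕ} {H : Matrix (Fin m) (Fin n) (ZMod 2)}
    (h : LinearIndependent (ZMod 2) fun c => H c) :
    Module.finrank (ZMod 2) (rowSpace H) = m := by
  rw [rowSpace, finrank_span_eq_card h, Fintype.card_fin]

theorem finrank_ker_mulVec {m : Type} [Fintype m] [DecidableEq m]
    {H : Matrix m (Fin n) (ZMod 2)} (h : LinearIndependent (ZMod 2) fun c => H c) :
    Fintype.card m + Module.finrank (ZMod 2) (LinearMap.ker H.mulVecLin) = n := by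
  have h1 : H.rank = Fintype.card m := LinearIndependent.rank_matrix h
  have h2 := LinearMap.finrank_range_add_finrank_ker H.mulVecLin
  rw [← h1, Matrix.rank, h2]
  simp

namespace LogicalBasis
variable (L : LogicalBasis Q)

theorem dual' : L.LZ * L.LXᵀ = 1 := by
  have := congrArg Matrix.transpose L.dual
  rwa [Matrix.transpose_mul, Matrix.transpose_transpose, Matrix.transpose_one] at this

theorem HZ_mulVec_vecMul (x : Bits (Fin Q.k)) : Q.HZ *ᵥ (x ᵥ* L.LX) = 0 := by
  rw [← Matrix.mulVec_transpose, Matrix.mulVec_mulVec, L.commX, Matrix.zero_mulVec]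

theorem LZ_mulVec_vecMul (x : Bits (Fin Q.k)) : L.LZ *ᵥ (x ᵥ* L.LX) = x := by
  rw [← Matrix.mulVec_transpose, Matrix.mulVec_mulVec, L.dual', Matrix.one_mulVec]

/-- Row space and joint kernel have the same dimension: the rows of `HZ` and `LZ` together are
independent and there are `mz + k = n - mx` of them. -/
theorem mem_rowSpace_iff (y : Bits (Fin n)) :
    y ∈ rowSpace Q.HX ↔ Q.HZ *ᵥ y = 0 ∧ L.LZ *ᵥ y = 0 := by
  constructor
  · intro h
    exact ⟨mulVec_eq_zero_of_mem_rowSpace Q.orth h, mulVec_eq_zero_of_mem_rowSpace L.commZ h⟩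
  · let M : Matrix (Fin Q.mz ⊕ Fin Q.k) (Fin n) (ZMod 2) := Matrix.fromRows Q.HZ L.LZ
    -- Pairing a relation with `LX` kills the rows of `HZ` and reads off the coefficients of `LZ`;
    -- the rest is the full rank of `HZ`.
    have hM : LinearIndependent (ZMod 2) fun c => M c := by
      have hi : Function.Injective M.vecMulLinear := by
        rw [injective_iff_map_eq_zero]
        intro v h
        change v ᵥ* M = 0 at h
        obtain ⟨a, b, rfl⟩ : ∃ a b, v = Sum.elim a b := ⟨v ∘ Sum.inl, v ∘ Sum.inr, by simp⟩
        rw [Matrix.sumElim_vecMul_fromRows] at h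
        have hb : b = 0 := by
          have := congrArg (fun u => u ᵥ* L.LXᵀ) h
          simpa [Matrix.add_vecMul, Matrix.vecMul_vecMul, L.commX, L.dual'] using this
        subst hb
        have ha : a = 0 := by
          have := Matrix.vecMul_injective_iff.2 Q.rankZ
          apply this
          simpa using h
        subst ha
        funext i; cases i <;> rfl
      exact Matrix.vecMul_injective_iff.1 hi
    have h1 := finrank_ker_mulVec hM
    have h2 := finrank_ker_mulVec Q.rankZ
    have hX := finrank_rowSpace Q.rankX
    have hle : rowSpace Q.HX ≤ LinearMap.ker Q.HZ.mulVecLin := fun y hy =>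
      mulVec_eq_zero_of_mem_rowSpace Q.orth hy
    have hle' : rowSpace Q.HX ≤ LinearMap.ker M.mulVecLin := by
      intro y hy
      change M *ᵥ y = 0
      rw [Matrix.fromRows_mulVec, mulVec_eq_zero_of_mem_rowSpace Q.orth hy,
        mulVec_eq_zero_of_mem_rowSpace L.commZ hy]
      funext i; cases i <;> rfl
    -- `k` is a truncated difference; this inequality makes the dimension count exact.
    have h3 : Q.mx ≤ n - Q.mz :=
      calc Q.mx = Module.finrank (ZMod 2) (rowSpace Q.HX) := hX.symm
        _ ≤ Module.finrank (ZMod 2) (LinearMap.ker Q.HZ.mulVecLin) := Submodule.finrank_mono hle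
        _ = n - Q.mz := by rw [Fintype.card_fin] at h2; exact Nat.eq_sub_of_add_eq' h2
    have heq : rowSpace Q.HX = LinearMap.ker M.mulVecLin := by
      refine Submodule.eq_of_le_of_finrank_eq hle' (hX.trans ?_)
      rw [Fintype.card_sum, Fintype.card_fin, Fintype.card_fin] at h1
      rw [Fintype.card_fin] at h2
      refine Eq.trans ?_ (Nat.eq_sub_of_add_eq' h1).symm
      have : Q.k = n - Q.mx - Q.mz := rfl
      omega
    rintro ⟨ha, hb⟩
    rw [heq]
    change M *ᵥ y = 0
    rw [Matrix.fromRows_mulVec, ha, hb]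
    funext i; cases i <;> rfl

/-- The parity checks that are measured along with the qubits of a block. -/
def _root_.ShallowFT.CSSCode.inKer (Q : CSSCode n) : Basis → Bits (Fin n) → Prop
  | .std, z => Q.HZ *ᵥ z = 0
  | .had, z => Q.HX *ᵥ z = 0

/-- The logical outcome that belongs to an outcome without errors. -/
def read : Basis → Bits (Fin n) → Bits (Fin Q.k)
  | .std, z => L.LZ *ᵥ z
  | .had, z => L.LX *ᵥ z

open Classical in
/-- The matrix elements of the encoding of one block. -/
def encBlock (y : Bits (Fin n)) (x : Bits (Fin Q.k)) : ℂ :=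
  if y - x ᵥ* L.LX ∈ rowSpace Q.HX then (((Real.sqrt (2 ^ Q.mx))⁻¹ : ℝ) : ℂ) else 0

theorem sub_mem_rowSpace_iff (y : Bits (Fin n)) (x : Bits (Fin Q.k)) :
    y - x ᵥ* L.LX ∈ rowSpace Q.HX ↔ Q.HZ *ᵥ y = 0 ∧ x = L.LZ *ᵥ y := by
  rw [L.mem_rowSpace_iff, Matrix.mulVec_sub, Matrix.mulVec_sub, L.HZ_mulVec_vecMul,
    L.LZ_mulVec_vecMul, sub_zero, sub_eq_zero, eq_comm (a := x)]

theorem encBlock_eq (y : Bits (Fin n)) (x : Bits (Fin Q.k)) : L.encBlock y x =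
    if Q.HZ *ᵥ y = 0 ∧ x = L.LZ *ᵥ y then (((Real.sqrt (2 ^ Q.mx))⁻¹ : ℝ) : ℂ) else 0 := by
  unfold encBlock
  simp only [L.sub_mem_rowSpace_iff]

theorem enc_apply {κ : Type} [Fintype κ] (y : Bits (κ × Fin n)) (x : Bits (κ × Fin Q.k)) :
    L.enc κ y x = ∏ b, L.encBlock (fun i => y (b, i)) fun j => x (b, j) := rfl

theorem card_rowSpace (Q : CSSCode n) : Nat.card (rowSpace Q.HX) = 2 ^ Q.mx := by
  rw [Module.natCard_eq_pow_finrank (K := ZMod 2), finrank_rowSpace Q.rankX]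
  simp

theorem sum_encBlock (x x' : Bits (Fin Q.k)) :
    ∑ t, star (L.encBlock t x) * L.encBlock t x' = if x = x' then 1 else 0 := by
  classical
  split_ifs with h
  · subst h
    have h1 : ∀ t, star (L.encBlock t x) * L.encBlock t x =
        if t - x ᵥ* L.LX ∈ rowSpace Q.HX then (((2 : ℝ) ^ Q.mx)⁻¹ : ℂ) else 0 := by
      intro t
      unfold encBlock
      split_ifs
      · rw [Complex.star_def, Complex.conj_ofReal, ← Complex.ofReal_mul, ← mul_inv,
          Real.mul_self_sqrt (by positivity)]
        push_cast; rfl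
      · simp
    simp only [h1]
    refine (Fintype.sum_equiv (Equiv.subRight (x ᵥ* L.LX)) _
      (fun t => if t ∈ rowSpace Q.HX then (((2 : ℝ) ^ Q.mx)⁻¹ : ℂ) else 0) fun t => rfl).trans ?_
    rw [← Finset.sum_filter, Finset.sum_const, ← Fintype.card_subtype]
    have := card_rowSpace Q
    rw [Nat.card_eq_fintype_card] at this
    change Fintype.card (rowSpace Q.HX) • _ = _
    rw [this, nsmul_eq_mul]
    push_cast
    exact mul_inv_cancel₀ (pow_ne_zero _ two_ne_zero)
  · refine Finset.sum_eq_zero fun t _ => ?_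
    rw [encBlock_eq, encBlock_eq]
    by_cases h1 : Q.HZ *ᵥ t = 0 ∧ x = L.LZ *ᵥ t
    · rw [if_neg (c := _ ∧ x' = _), mul_zero]
      rintro ⟨-, h2⟩
      exact h (h1.2.trans h2.symm)
    · rw [if_neg h1, star_zero, zero_mul]

theorem sum_prod_blocks {κ : Type} [Fintype κ] [DecidableEq κ] {k : ℕ}
    (f : κ → Bits (Fin k) → ℂ) :
    ∑ y : Bits (κ × Fin k), ∏ b, f b (fun i => y (b, i)) = ∏ b, ∑ u, f b u := by
  rw [Finset.prod_univ_sum, Fintype.piFinset_univ]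
  exact Fintype.sum_equiv (Equiv.curry κ (Fin k) (ZMod 2)) _ _ fun y => rfl

theorem enc_isometry (κ : Type) [Fintype κ] [DecidableEq κ] : (L.enc κ)ᴴ * L.enc κ = 1 := by
  ext x x'
  simp only [Matrix.mul_apply, Matrix.conjTranspose_apply, enc_apply, star_prod,
    ← Finset.prod_mul_distrib]
  rw [sum_prod_blocks (fun b t => star (L.encBlock t fun j => x (b, j)) *
    L.encBlock t fun j => x' (b, j))]
  simp only [sum_encBlock, Matrix.one_apply]
  split_ifs with h
  · simp [h]
  · obtain ⟨⟨b, j⟩, hi⟩ := Function.ne_iff.1 h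
    exact Finset.prod_eq_zero (Finset.mem_univ b) (if_neg fun h' => hi (congrFun h' j))

/-! ### Transversal readout -/

/-- Translation by the vector `u` of `W` permutes `W` and negates every term. -/
theorem _root_.ShallowFT.sum_bsign_submodule (W : Submodule (ZMod 2) (Bits (Fin n)))
    [DecidablePred (· ∈ W)] (z : Bits (Fin n)) (h : ∃ u ∈ W, z ⬝ᵥ u ≠ 0) :
    ∑ t, (if t ∈ W then bsign (z ⬝ᵥ t) else 0) = 0 := by
  obtain ⟨u, hu, hzu⟩ := h
  have hzu1 := (zmod2_cases _).resolve_left hzu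
  have key : ∑ t, (if t ∈ W then bsign (z ⬝ᵥ t) else 0) =
      ∑ t, -(if t ∈ W then bsign (z ⬝ᵥ t) else 0) := by
    refine Fintype.sum_equiv (Equiv.addRight u) _ _ fun t => ?_
    change (if t ∈ W then bsign (z ⬝ᵥ t) else 0) =
      -(if t + u ∈ W then bsign (z ⬝ᵥ (t + u)) else 0)
    have : t + u ∈ W ↔ t ∈ W := by
      refine ⟨fun h => ?_, fun h => W.add_mem h hu⟩
      have := W.add_mem h hu
      rwa [bits_add_cancel] at this
    by_cases ht : t ∈ W
    · rw [if_pos ht, if_pos (this.2 ht), dotProduct_add, hzu1, bsign_add, bsign_one]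
      simp
    · rw [if_neg ht, if_neg fun h => ht (this.1 h), neg_zero]
  rw [Finset.sum_neg_distrib] at key
  exact self_eq_neg.1 key

/-- In the standard basis a string of the code determines its logical label through `LZ`. In the
Hadamard basis the Fourier transform of a coset of the row space of `HX` lives on the kernel of
`HX`, and the character of the coset representative is the logical character of `LX z`. That `c` is
independent of `z` and `x` makes transversal measurement a logical measurement. -/
theorem sum_ket_encBlock (m : Basis) : ∃ c : ℂ, ∀ (z : Bits (Fin n)) (x : Bits (Fin Q.k)),
    (Q.inKer m z → ∑ t : Bits (Fin n), (∏ i, m.ket (z i) (t i)) * L.encBlock t x =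
      c * ∏ j, m.ket (L.read m z j) (x j)) ∧
    (¬ Q.inKer m z → ∑ t : Bits (Fin n), (∏ i, m.ket (z i) (t i)) * L.encBlock t x = 0) := by
  classical
  cases m with
  | std =>
    refine ⟨(((Real.sqrt (2 ^ Q.mx))⁻¹ : ℝ) : ℂ), fun z x => ?_⟩
    have h1 : ∀ {k : ℕ} (z t : Bits (Fin k)), ∏ i, Basis.std.ket (z i) (t i) =
        if z = t then 1 else 0 := by
      intro k z t
      simp only [Basis.ket]
      split_ifs with h
      · simp [h]
      · obtain ⟨i, hi⟩ := Function.ne_iff.1 h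
        exact Finset.prod_eq_zero (Finset.mem_univ i) (if_neg hi)
    simp only [h1, ite_mul, one_mul, zero_mul, Finset.sum_ite_eq, Finset.mem_univ, if_true,
      encBlock_eq, CSSCode.inKer, read]
    constructor
    · intro h
      simp only [h, true_and, eq_comm (a := x), mul_ite, mul_one, mul_zero]
    · intro h
      simp [h]
  | had =>
    let r : ℂ := (((Real.sqrt 2)⁻¹ : ℝ) : ℂ)
    have hr : r ≠ 0 := by
      simp only [r]
      exact_mod_cast (inv_ne_zero (Real.sqrt_ne_zero'.2 (by norm_num)))
    have h1 : ∀ {k : ℕ} (z t : Bits (Fin k)), ∏ i, Basis.had.ket (z i) (t i) =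
        bsign (z ⬝ᵥ t) * r ^ k := by
      intro k z t
      simp only [Basis.ket, Finset.prod_mul_distrib, ← bsign_sum, Finset.prod_const,
        Finset.card_univ, Fintype.card_fin]
      rfl
    let q : ℂ := (((Real.sqrt (2 ^ Q.mx))⁻¹ : ℝ) : ℂ)
    have h2 : ∀ z x, ∑ t : Bits (Fin n), (∏ i, Basis.had.ket (z i) (t i)) * L.encBlock t x =
        r ^ n * q * bsign (z ⬝ᵥ (x ᵥ* L.LX)) *
          ∑ t, if t ∈ rowSpace Q.HX then bsign (z ⬝ᵥ t) else 0 := by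
      intro z x
      rw [Finset.mul_sum]
      refine Fintype.sum_equiv (Equiv.subRight (x ᵥ* L.LX)) _ _ fun t => ?_
      simp only [h1, encBlock, Equiv.subRight_apply, mul_ite, mul_zero]
      refine if_congr Iff.rfl ?_ rfl
      rw [mul_assoc _ (bsign _), ← bsign_add, ← dotProduct_add, add_sub_cancel]
      ring
    refine ⟨r ^ n * q * ((rowSpace Q.HX : Set (Bits (Fin n))).ncard : ℂ) * (r ^ Q.k)⁻¹,
      fun z x => ⟨fun h => ?_, fun h => ?_⟩⟩
    · rw [h2, h1]
      have h3 : ∀ t ∈ rowSpace Q.HX, z ⬝ᵥ t = 0 := by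
        intro t ht
        have : Q.HX *ᵥ z = 0 := h
        induction ht using Submodule.span_induction with
        | mem x hx =>
          obtain ⟨c, rfl⟩ := hx
          rw [dotProduct_comm]
          exact congrFun this c
        | zero => simp
        | add x y _ _ h1 h2 => rw [dotProduct_add, h1, h2, add_zero]
        | smul r x _ h => rw [dotProduct_smul, h, smul_zero]
      have h4 : ∑ t, (if t ∈ rowSpace Q.HX then bsign (z ⬝ᵥ t) else 0) =
          ((rowSpace Q.HX : Set (Bits (Fin n))).ncard : ℂ) := by
        rw [Set.ncard_eq_toFinset_card', Finset.card_eq_sum_ones, Nat.cast_sum, Finset.sum_congr rfl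
          (g := fun t => if t ∈ rowSpace Q.HX then (1 : ℂ) else 0)]
        · rw [← Finset.sum_filter]
          refine (Finset.sum_congr ?_ fun _ _ => by simp)
          ext; simp
        · intro t _
          split_ifs with ht
          · rw [h3 t ht, bsign_zero]
          · rfl
      have h5 : z ⬝ᵥ (x ᵥ* L.LX) = L.read .had z ⬝ᵥ x := by
        rw [← Matrix.mulVec_transpose, Matrix.dotProduct_mulVec, Matrix.vecMul_transpose]
        rfl
      rw [h4, h5]
      field_simp
    · rw [h2, sum_bsign_submodule, mul_zero]
      obtain ⟨c, hc⟩ := Function.ne_iff.1 (show Q.HX *ᵥ z ≠ 0 from h)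
      refine ⟨Q.HX c, Submodule.subset_span ⟨c, rfl⟩, ?_⟩
      rw [dotProduct_comm]
      exact hc

variable {κ : Type} [Fintype κ] [DecidableEq κ]

/-- The logical outcome that belongs to an outcome without errors. -/
def readBlocks (m : κ → Basis) (z : Bits (κ × Fin n)) : Bits (κ × Fin Q.k) :=
  fun q => L.read (m q.1) (fun i => z (q.1, i)) q.2

/-- The encoder is a product over the blocks and amplitudes are linear in the state, so the
statement for one block extends to states that are entangled between blocks. -/
theorem amplitude_enc (m : κ → Basis) : ∃ c : ℂ, ∀ (φ : State (κ × Fin Q.k)) (z : Bits (κ × Fin n)),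
    ((∀ b, Q.inKer (m b) fun i => z (b, i)) →
      amplitude (fun q => m q.1) (L.enc κ *ᵥ φ) z =
        c * amplitude (fun q => m q.1) φ (L.readBlocks m z)) ∧
    ((¬ ∀ b, Q.inKer (m b) fun i => z (b, i)) →
      amplitude (fun q => m q.1) (L.enc κ *ᵥ φ) z = 0) := by
  choose c hc using fun b => L.sum_ket_encBlock (m b)
  have h1 : ∀ (φ : State (κ × Fin Q.k)) (z : Bits (κ × Fin n)),
      amplitude (fun q => m q.1) (L.enc κ *ᵥ φ) z = ∑ x, (∏ b, ∑ t : Bits (Fin n),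
        (∏ i, (m b).ket (z (b, i)) (t i)) * L.encBlock t fun j => x (b, j)) * φ x := by
    intro φ z
    simp only [amplitude, Matrix.mulVec, dotProduct, Finset.mul_sum]
    rw [Finset.sum_comm]
    refine Finset.sum_congr rfl fun x _ => ?_
    rw [← sum_prod_blocks (fun b t => (∏ i, (m b).ket (z (b, i)) (t i)) *
      L.encBlock t fun j => x (b, j)), Finset.sum_mul]
    refine Finset.sum_congr rfl fun y _ => ?_
    rw [enc_apply, Finset.prod_mul_distrib, Fintype.prod_prod_type, mul_assoc]
  refine ⟨∏ b, c b, fun φ z => ⟨fun h => ?_, fun h => ?_⟩⟩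
  · rw [h1, amplitude, Finset.mul_sum]
    refine Finset.sum_congr rfl fun x _ => ?_
    rw [Fintype.prod_prod_type, ← mul_assoc, ← Finset.prod_mul_distrib]
    congr 1
    exact Finset.prod_congr rfl fun b _ => (hc b _ _).1 (h b)
  · rw [h1]
    push Not at h
    obtain ⟨b, hb⟩ := h
    refine Finset.sum_eq_zero fun x _ => ?_
    rw [Finset.prod_eq_zero (Finset.mem_univ b) ((hc b _ _).2 hb), zero_mul]

open Classical in
/-- A decoder that corrects all errors on `R` returns the logical outcome distribution. -/
theorem sum_weight_decode (m : κ → Basis) {R : Set (κ × Fin n)} {F : Op (κ × Fin n)}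
    (hF : F ∈ pauliSpan R) (hU : F ∈ Matrix.unitaryGroup (Bits (κ × Fin n)) ℂ)
    (D : Bits (κ × Fin n) → Bits (κ × Fin Q.k))
    (hD : ∀ z e : Bits (κ × Fin n), (∀ q, e q ≠ 0 → q ∈ R) →
      (∀ b, Q.inKer (m b) fun i => (z + e) (b, i)) → L.readBlocks m (z + e) = D z)
    (φ : State (κ × Fin Q.k)) (y : Bits (κ × Fin Q.k)) :
    ∑ z, (if D z = y then weight (fun q => m q.1) (F *ᵥ (L.enc κ *ᵥ φ)) z else 0) =
      weight (fun q => m q.1) φ y := by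
  obtain ⟨G, hG, hGF⟩ := amplitude_pauliSpan (fun q : κ × Fin n => m q.1) hF
  obtain ⟨c, hc⟩ := L.amplitude_enc m
  -- All error patterns that contribute at `z` lead to the same logical outcome `D z`, so the
  -- logical amplitude factors out; the remaining factor `H z` does not depend on `φ`.
  let H : Bits (κ × Fin n) → ℂ := fun z =>
    ∑ e, if ∀ b, Q.inKer (m b) fun i => (z + e) (b, i) then G z e * c else 0
  have h1 : ∀ φ z, amplitude (fun q => m q.1) (F *ᵥ (L.enc κ *ᵥ φ)) z =
      H z * amplitude (fun q => m q.1) φ (D z) := by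
    intro φ z
    rw [hGF, Finset.sum_mul]
    refine Finset.sum_congr rfl fun e _ => ?_
    split_ifs with h
    · rw [(hc φ _).1 h]
      by_cases he : ∃ i, e i ≠ 0 ∧ i ∉ R
      · rw [hG z e he]; ring
      · push Not at he
        rw [hD z e he h, mul_assoc]
    · rw [(hc φ _).2 h, mul_zero, zero_mul]
  have h2 : ∀ φ, ∑ z, (if D z = y then weight (fun q => m q.1) (F *ᵥ (L.enc κ *ᵥ φ)) z else 0) =
      (∑ z, if D z = y then ‖H z‖ ^ 2 else 0) * weight (fun q => m q.1) φ y := by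
    intro φ
    rw [Finset.sum_mul]
    refine Finset.sum_congr rfl fun z _ => ?_
    split_ifs with h
    · rw [weight, h1, norm_mul, mul_pow, h]; rfl
    · simp
  rw [h2]
  have h3 : ∑ z, (if D z = y then ‖H z‖ ^ 2 else 0) = 1 := by
    -- Because the total of `‖H z‖ ^ 2` is independent of `φ`, it can be computed for a test vector
    -- whose only logical outcome is `y`, where conservation of the norm gives the value one.
    obtain ⟨φ, hφ⟩ := exists_amplitude_single (fun q : κ × Fin Q.k => m q.1) y
    have h4 := sum_weight (fun q : κ × Fin n => m q.1) (F *ᵥ (L.enc κ *ᵥ φ))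
    rw [normSqSum_unitary hU, normSqSum_mulVec (L.enc_isometry κ),
      ← sum_weight (fun q => m q.1) φ] at h4
    have h5 : ∀ x, weight (fun q => m q.1) φ x = if x = y then 1 else 0 := by
      intro x
      rw [weight, hφ, Pi.single_apply]
      split_ifs <;> simp
    rw [Finset.sum_congr rfl fun x _ => h5 x] at h4
    simp only [Finset.sum_ite_eq', Finset.mem_univ, if_true] at h4
    rw [← h4]
    refine Finset.sum_congr rfl fun z _ => ?_
    rw [weight, h1, hφ, Pi.single_apply]
    split_ifs <;> simp
  rw [h3, one_mul]

end LogicalBasis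
end

/-! ### Transversal gates on encoded blocks -/

/-- The `i`-th qubits of the blocks selected by `e`. -/
def rowEmb {α κ : Type} {n : ℕ} (e : α ↪ κ) (i : Fin n) : α ↪ κ × Fin n :=
  ⟨fun a => (e a, i), fun _ _ h => e.injective (Prod.ext_iff.1 h).1⟩

/-- The qubits of the blocks selected by `e`. -/
def blockEmb {α κ : Type} (e : α ↪ κ) (n : ℕ) : α × Fin n ↪ κ × Fin n :=
  e.prodMap (Function.Embedding.refl (Fin n))

theorem mem_range_blockEmb {α κ : Type} {e : α ↪ κ} {n : ℕ} {q : κ × Fin n} :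
    q ∈ Set.range (blockEmb e n) ↔ q.1 ∈ Set.range e := by
  constructor
  · rintro ⟨⟨a, i⟩, rfl⟩; exact ⟨a, rfl⟩
  · rintro ⟨a, ha⟩; exact ⟨(a, q.2), Prod.ext ha rfl⟩

section
variable {κ : Type} [Fintype κ] [DecidableEq κ] {n r : ℕ}

open Classical in
-- The tensor product is built one row at a time. The row factors act on disjoint qubits, so in the
-- product each intermediate sum has a single surviving term.
theorem prod_rowEmb_apply (e : Fin r ↪ κ) (U : Fin n → Op (Fin r)) (l : List (Fin n))
    (hl : l.Nodup) (y x : Bits (κ × Fin n)) :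
    (l.map fun i => liftOp (rowEmb e i) (U i)).prod y x =
      if ∀ q : κ × Fin n, ¬ (q.2 ∈ l ∧ q.1 ∈ Set.range e) → y q = x q then
        (l.map fun i => U i (fun a => y (e a, i)) (fun a => x (e a, i))).prod else 0 := by
  induction l generalizing y with
  | nil =>
    simp only [List.map_nil, List.prod_nil, Matrix.one_apply, List.not_mem_nil, false_and,
      not_false_eq_true, forall_const]
    exact if_congr funext_iff rfl rfl
  | cons i l ih =>
    rw [List.nodup_cons] at hl
    have h1 : ((i :: l).map fun i => liftOp (rowEmb e i) (U i)).prod y x =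
        (liftOp (rowEmb e i) (U i) *ᵥ fun z =>
          (l.map fun i => liftOp (rowEmb e i) (U i)).prod z x) y := by
      rw [List.map_cons, List.prod_cons]; rfl
    rw [h1, liftOp_mulVec]
    have hrow : ∀ q : κ × Fin n, q ∈ Set.range (rowEmb e i) ↔ q.2 = i ∧ q.1 ∈ Set.range e := by
      rintro ⟨b, j⟩
      constructor
      · rintro ⟨a, ha⟩
        obtain ⟨rfl, rfl⟩ := Prod.ext_iff.1 ha
        exact ⟨rfl, a, rfl⟩
      · rintro ⟨rfl, a, rfl⟩
        exact ⟨a, rfl⟩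
    rw [Finset.sum_eq_single (x ∘ rowEmb e i)]
    · rw [ih hl.2]
      have hcond : (∀ q : κ × Fin n, ¬(q.2 ∈ l ∧ q.1 ∈ Set.range e) →
          overwrite (rowEmb e i) (x ∘ rowEmb e i) y q = x q) ↔
          ∀ q : κ × Fin n, ¬(q.2 ∈ i :: l ∧ q.1 ∈ Set.range e) → y q = x q := by
        constructor
        · intro h q hq
          have hq' : q ∉ Set.range (rowEmb e i) := fun hm => hq
            ⟨by rw [((hrow q).1 hm).1]; exact List.mem_cons_self, ((hrow q).1 hm).2⟩
          rw [← h q fun h' => hq ⟨List.mem_cons_of_mem _ h'.1, h'.2⟩,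
            overwrite_of_notMem _ _ _ hq']
        · intro h q hq
          by_cases hm : q ∈ Set.range (rowEmb e i)
          · obtain ⟨a, rfl⟩ := hm
            rw [overwrite_apply]; rfl
          · rw [overwrite_of_notMem _ _ _ hm]
            refine h q ?_
            rintro ⟨h1, h2⟩
            rcases List.mem_cons.1 h1 with h3 | h3
            · exact hm ((hrow q).2 ⟨h3, h2⟩)
            · exact hq ⟨h3, h2⟩
      by_cases hc : ∀ q : κ × Fin n, ¬(q.2 ∈ i :: l ∧ q.1 ∈ Set.range e) → y q = x q
      · rw [if_pos (hcond.2 hc), if_pos hc, List.map_cons, List.prod_cons]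
        congr 1
        refine congrArg List.prod (List.map_congr_left fun j hj => ?_)
        congr 1
        funext a
        rw [overwrite_of_notMem]
        rw [hrow]
        rintro ⟨rfl, -⟩
        exact hl.1 hj
      · rw [if_neg fun h => hc (hcond.1 h), if_neg hc, mul_zero]
    · intro u _ hu
      rw [ih hl.2, if_neg, mul_zero]
      intro h
      apply hu
      funext a
      have := h (rowEmb e i a) fun h' => hl.1 h'.1
      rwa [overwrite_apply] at this
    · simp

theorem prod_rowEmb (e : Fin r ↪ κ) (U : Fin n → Op (Fin r)) :
    ((List.finRange n).map fun i => liftOp (rowEmb e i) (U i)).prod =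
      liftOp (blockEmb e n) (tensorOp U) := by
  classical
  ext y x
  rw [prod_rowEmb_apply _ _ _ (List.nodup_finRange n)]
  simp only [List.mem_finRange, true_and, liftOp, Matrix.of_apply, mem_range_blockEmb, tensorOp]
  refine if_congr Iff.rfl ?_ rfl
  rw [← List.ofFn_eq_map, List.prod_ofFn]
  rfl

variable {Q : CSSCode n} (L : LogicalBasis Q)

theorem prod_split {α : Type} [Fintype α] (e : α ↪ κ) (f : κ → ℂ) :
    ∏ b, f b = (∏ b ∈ (Finset.univ.map e)ᶜ, f b) * ∏ a, f (e a) := by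
  rw [← Finset.prod_compl_mul_prod (Finset.univ.map e), Finset.prod_map]

/-- The encoder factors over blocks; the factor `rest` of the blocks that the gate does not touch is
the same on both sides and splits off. -/
theorem LogicalBasis.liftOp_mul_enc (e : Fin r ↪ κ) (V : Op (Fin r × Fin n))
    (G : Op (Fin r × Fin Q.k)) (h : V * L.enc (Fin r) = L.enc (Fin r) * G) :
    liftOp (blockEmb e n) V * L.enc κ = L.enc κ * liftOp (blockEmb e Q.k) G := by
  classical
  let rest : Bits (κ × Fin n) → Bits (κ × Fin Q.k) → ℂ := fun y x =>
    ∏ b ∈ (Finset.univ.map e)ᶜ, L.encBlock (fun i => y (b, i)) fun j => x (b, j)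
  have henc : ∀ y x, L.enc κ y x = rest y x * L.enc (Fin r) (y ∘ blockEmb e n)
      (x ∘ blockEmb e Q.k) := by
    intro y x
    rw [L.enc_apply, prod_split e]
    rfl
  have hrest : ∀ y x y' x', (∀ q, q ∉ Set.range (blockEmb e n) → y q = y' q) →
      (∀ q, q ∉ Set.range (blockEmb e Q.k) → x q = x' q) → rest y x = rest y' x' := by
    intro y x y' x' hy hx
    refine Finset.prod_congr rfl fun b hb => ?_
    have hb' : b ∉ Set.range e := by simpa using hb
    congr 1
    · funext i
      exact hy _ fun hm => hb' (mem_range_blockEmb.1 hm)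
    · funext j
      exact hx _ fun hm => hb' (mem_range_blockEmb.1 hm)
  ext y x
  have h1 : (liftOp (blockEmb e n) V * L.enc κ) y x =
      rest y x * (V * L.enc (Fin r)) (y ∘ blockEmb e n) (x ∘ blockEmb e Q.k) := by
    change (liftOp (blockEmb e n) V *ᵥ fun z => L.enc κ z x) y = _
    rw [liftOp_mulVec, Matrix.mul_apply, Finset.mul_sum]
    refine Finset.sum_congr rfl fun u _ => ?_
    rw [henc, overwrite_comp, hrest (overwrite (blockEmb e n) u y) x y x
      (fun q hq => overwrite_of_notMem _ _ _ hq) fun _ _ => rfl]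
    ring
  have h2 : (L.enc κ * liftOp (blockEmb e Q.k) G) y x =
      rest y x * (L.enc (Fin r) * G) (y ∘ blockEmb e n) (x ∘ blockEmb e Q.k) := by
    rw [Matrix.mul_apply, sum_overwrite (blockEmb e Q.k) x, Matrix.mul_apply, Finset.mul_sum]
    · refine Finset.sum_congr rfl fun u _ => ?_
      rw [henc, overwrite_comp, hrest y (overwrite (blockEmb e Q.k) u x) y x (fun _ _ => rfl)
        fun q hq => overwrite_of_notMem _ _ _ hq, liftOp, Matrix.of_apply, if_pos
        fun q hq => overwrite_of_notMem _ _ _ hq, overwrite_comp]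
      ring
    · intro x' hx'
      rw [liftOp, Matrix.of_apply, if_neg fun h' => hx' fun i hi => (h' i hi).symm, mul_zero]
  rw [h1, h2, h]

end

/-! ### Transversal circuits -/

section
variable {n N : ℕ} {Q : CSSCode n} (L : LogicalBasis Q)

theorem foldl_enc_of_layers {A B : Type} {S S' : Type} (enc : S → S') (f : S → A → S)
    (f' : S' → B → S') (d : ℕ) (a : Fin d → A) (b : Fin d → B)
    (h : ∀ t φ, f' (enc φ) (b t) = enc (f φ (a t))) (φ : S) :
    (List.ofFn b).foldl f' (enc φ) = enc ((List.ofFn a).foldl f φ) := by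
  induction d generalizing φ with
  | zero => simp
  | succ d ih =>
    rw [List.ofFn_succ, List.ofFn_succ, List.foldl_cons, List.foldl_cons, h]
    exact ih _ _ (fun t => h t.succ) _

/-- A transversal logical circuit is implemented by layers of physical gates. -/
theorem LogicalBasis.exists_layers (C : LogicalCircuit N Q.k) {w : ℕ} (hw : C.FanIn w)
    (Pr : ∀ r : ℕ, Op (Fin r) → Prop)
    (hPr : ∀ r U, Pr r U → U ∈ Matrix.unitaryGroup (Bits (Fin r)) ℂ)
    (hC : ∀ t, ∀ g ∈ C.layers t, ∃ U : Fin n → Op (Fin g.arity), (∀ i, Pr _ (U i)) ∧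
      tensorOp U * L.enc (Fin g.arity) = L.enc (Fin g.arity) * g.op) :
    ∃ Ls : List (List (Gate (Data N n))), Ls.length = C.depth ∧
      (∀ l ∈ Ls, DisjointGates l) ∧ (∀ l ∈ Ls, ∀ g ∈ l, g.arity ≤ w ∧ Pr _ g.op) ∧
      Ls.foldl (fun ψ l => layerListOp l *ᵥ ψ) (L.enc (Fin N) *ᵥ C.initState) =
        L.enc (Fin N) *ᵥ C.finalState := by
  classical
  -- Each block gate is replaced by `n` physical gates, one per row. A gate that does not occur in
  -- `C` gets the empty list, only to make the choice function total.
  have hgate : ∀ g : BlockGate N Q.k, ∃ l : List (Gate (Data N n)),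
      (∃ t, g ∈ C.layers t) → DisjointGates l ∧
        (∀ h ∈ l, h.arity ≤ w ∧ Pr _ h.op ∧ Set.range h.pos ⊆ {q | q.1 ∈ Set.range g.pos}) ∧
        layerListOp l * L.enc (Fin N) = L.enc (Fin N) * liftOp (blockEmb g.pos Q.k) g.op := by
    intro g
    by_cases hg : ∃ t, g ∈ C.layers t
    · obtain ⟨t, ht⟩ := hg
      obtain ⟨U, hU, hUG⟩ := hC t g ht
      refine ⟨(List.finRange n).map fun i =>
        ⟨g.arity, rowEmb g.pos i, U i, hPr _ _ (hU i)⟩, fun _ => ⟨?_, ?_, ?_⟩⟩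
      · rw [DisjointGates, List.pairwise_map]
        refine (List.nodup_finRange n).imp fun {i j} hij => Set.disjoint_left.2 ?_
        rintro _ ⟨a, rfl⟩ ⟨b, hb⟩
        exact hij (Prod.ext_iff.1 hb).2.symm
      · intro h hh
        obtain ⟨i, -, rfl⟩ := List.mem_map.1 hh
        refine ⟨hw t g ht, hU i, ?_⟩
        rintro _ ⟨a, rfl⟩
        exact ⟨a, rfl⟩
      · rw [layerListOp, List.map_map]
        change ((List.finRange n).map fun i => liftOp (rowEmb g.pos i) (U i)).prod * L.enc (Fin N) = _
        rw [prod_rowEmb, L.liftOp_mul_enc _ _ _ hUG]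
    · exact ⟨[], fun h => absurd h hg⟩
  choose f hf using hgate
  refine ⟨List.ofFn fun t => (C.layers t).flatMap f, by simp, ?_, ?_, ?_⟩
  · intro l hl
    obtain ⟨t, rfl⟩ := (List.mem_ofFn' _ _).1 hl
    rw [DisjointGates, List.pairwise_flatMap]
    refine ⟨fun g hg => (hf g ⟨t, hg⟩).1, ?_⟩
    have hd := C.disjoint t
    rw [List.pairwise_iff_forall_sublist] at hd ⊢
    intro g g' hgg' h hh h' hh'
    have hmem : g ∈ C.layers t ∧ g' ∈ C.layers t :=
      ⟨hgg'.subset (by simp), hgg'.subset (by simp)⟩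
    refine Set.disjoint_left.2 fun q hq hq' => ?_
    have h1 : q.1 ∈ Set.range g.pos := ((hf g ⟨t, hmem.1⟩).2.1 h hh).2.2 hq
    have h2 : q.1 ∈ Set.range g'.pos := ((hf g' ⟨t, hmem.2⟩).2.1 h' hh').2.2 hq'
    exact Set.disjoint_left.1 (hd hgg') h1 h2
  · intro l hl g hg
    obtain ⟨t, rfl⟩ := (List.mem_ofFn' _ _).1 hl
    obtain ⟨g', hg', hgg'⟩ := List.mem_flatMap.1 hg
    have := (hf g' ⟨t, hg'⟩).2.1 g hgg'
    exact ⟨this.1, this.2.1⟩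
  · rw [foldl_enc_of_layers (fun φ => L.enc (Fin N) *ᵥ φ)
      (fun φ (l : List (BlockGate N Q.k)) =>
        (l.map fun g => liftOp (blockEmb g.pos Q.k) g.op).prod *ᵥ φ) _ _ C.layers]
    · congr 1
      rw [← foldl_ofFn_map (h := fun (l : List (BlockGate N Q.k)) φ =>
        (l.map fun g => liftOp (blockEmb g.pos Q.k) g.op).prod *ᵥ φ), ← fin_induction_last_eq_foldl]
      rfl
    · intro t φ
      have key : ∀ l : List (BlockGate N Q.k), (∀ g ∈ l, g ∈ C.layers t) →
          layerListOp (l.flatMap f) * L.enc (Fin N) =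
            L.enc (Fin N) * (l.map fun g => liftOp (blockEmb g.pos Q.k) g.op).prod := by
        intro l hl
        induction l with
        | nil => simp [layerListOp]
        | cons g l ih =>
          have h1 := (hf g ⟨t, hl g (by simp)⟩).2.2
          have h2 := ih fun g' hg' => hl g' (by simp [hg'])
          have h3 : layerListOp ((g :: l).flatMap f) =
              layerListOp (f g) * layerListOp (l.flatMap f) := by
            rw [List.flatMap_cons, layerListOp, List.map_append, List.prod_append]; rfl
          rw [h3, Matrix.mul_assoc, h2, ← Matrix.mul_assoc, h1, List.map_cons, List.prod_cons,
            Matrix.mul_assoc]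
      rw [Matrix.mulVec_mulVec, Matrix.mulVec_mulVec, key _ fun _ h => h]

theorem LogicalCircuit.normSqSum_finalState {k : ℕ} (C : LogicalCircuit N k)
    (hC : ∀ t, ∀ g ∈ C.layers t, g.op ∈ Matrix.unitaryGroup (Bits (Fin g.arity × Fin k)) ℂ) :
    normSqSum C.finalState = 1 := by
  suffices h : ∀ t : Fin (C.depth + 1), normSqSum
      (Fin.induction (motive := fun _ => State (Fin N × Fin k)) C.initState
        (fun t ψ => C.layerOp t *ᵥ ψ) t : State (Fin N × Fin k)) = 1 by
    exact h (Fin.last _)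
  intro t
  induction t using Fin.induction with
  | zero =>
    change normSqSum C.initState = 1
    refine normSqSum_uniformState ⟨0, ?_⟩
    exact ⟨fun _ _ _ => rfl, fun _ _ _ _ _ _ => rfl⟩
  | succ t ih =>
    rw [Fin.induction_succ, normSqSum_unitary, ih]
    refine Submonoid.list_prod_mem _ fun U hU => ?_
    obtain ⟨g, hg, rfl⟩ := List.mem_map.1 hU
    exact liftOp_unitary _ (hC t g hg)

open Classical in
/-- The encoded initial state is a multiple of the indicator function of a classical code. -/
theorem LogicalBasis.exists_enc_initState (C : LogicalCircuit N Q.k) : ∃ c : ℂ, c ≠ 0 ∧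
    L.enc (Fin N) *ᵥ C.initState = fun y : Bits (Data N n) =>
      if (∀ b, Q.HZ *ᵥ (fun i => y (b, i)) = 0) ∧
        (∀ b, C.init b = .zero → L.LZ *ᵥ (fun i => y (b, i)) = 0) ∧
        (∀ b b' c, C.init b = .ghz c → C.init b' = .ghz c →
          L.LZ *ᵥ (fun i => y (b, i)) = L.LZ *ᵥ (fun i => y (b', i)))
      then c else 0 := by
  let A : Set (Bits (Fin N × Fin Q.k)) := {x | (∀ b, C.init b = .zero → ∀ j, x (b, j) = 0) ∧
    ∀ b b' c, C.init b = .ghz c → C.init b' = .ghz c → ∀ j, x (b, j) = x (b', j)}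
  have hA : A.Nonempty := ⟨0, fun _ _ _ => rfl, fun _ _ _ _ _ _ => rfl⟩
  have hc : 0 < A.ncard := (Set.ncard_pos (Set.toFinite A)).2 hA
  let r : ℂ := (((Real.sqrt (2 ^ Q.mx))⁻¹ : ℝ) : ℂ)
  let a : ℂ := (((Real.sqrt (A.ncard : ℝ))⁻¹ : ℝ) : ℂ)
  refine ⟨r ^ N * a, ?_, ?_⟩
  · refine mul_ne_zero (pow_ne_zero _ ?_) ?_
    · exact Complex.ofReal_ne_zero.2 (inv_ne_zero (Real.sqrt_ne_zero'.2 (by positivity)))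
    · exact Complex.ofReal_ne_zero.2 (inv_ne_zero (Real.sqrt_ne_zero'.2 (by exact_mod_cast hc)))
  · funext y
    -- A string that passes the Z-checks lies in exactly one logical coset, the one read off by
    -- `LZ`; so the sum over logical strings has a single term.
    let x₀ : Bits (Fin N × Fin Q.k) := fun q => (L.LZ *ᵥ fun i => y (q.1, i)) q.2
    have h1 : ∀ x, L.enc (Fin N) y x =
        if (∀ b, Q.HZ *ᵥ (fun i => y (b, i)) = 0) ∧ x = x₀ then r ^ N else 0 := by
      intro x
      rw [L.enc_apply]
      split_ifs with h
      · rw [Finset.prod_congr rfl fun b _ => (L.encBlock_eq _ _).trans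
          (if_pos ⟨h.1 b, by rw [h.2]⟩)]
        simp [r]
      · have : ∃ b, ¬ (Q.HZ *ᵥ (fun i => y (b, i)) = 0 ∧
            (fun j => x (b, j)) = L.LZ *ᵥ fun i => y (b, i)) := by
          by_contra! h'
          exact h ⟨fun b => (h' b).1, funext fun q => congrFun (h' q.1).2 q.2⟩
        obtain ⟨b, hb⟩ := this
        refine Finset.prod_eq_zero (Finset.mem_univ b) ?_
        rw [L.encBlock_eq, if_neg hb]
    have h2 : (L.enc (Fin N) *ᵥ C.initState) y =
        if (∀ b, Q.HZ *ᵥ (fun i => y (b, i)) = 0) then r ^ N * C.initState x₀ else 0 := by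
      simp only [Matrix.mulVec, dotProduct, h1]
      rw [Finset.sum_eq_single x₀]
      · simp
      · intro x _ hx
        rw [if_neg fun h => hx h.2, zero_mul]
      · simp
    have h3 : C.initState x₀ = if x₀ ∈ A then a else 0 := by
      unfold LogicalCircuit.initState uniformState
      by_cases h : x₀ ∈ A
      · exact (if_pos h).trans (if_pos h).symm
      · exact (if_neg h).trans (if_neg h).symm
    have h4 : x₀ ∈ A ↔ (∀ b, C.init b = .zero → L.LZ *ᵥ (fun i => y (b, i)) = 0) ∧
        (∀ b b' c, C.init b = .ghz c → C.init b' = .ghz c →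
          L.LZ *ᵥ (fun i => y (b, i)) = L.LZ *ᵥ (fun i => y (b', i))) := by
      refine and_congr ?_ ?_
      · exact forall_congr' fun b => imp_congr_right fun _ => ⟨fun h => funext h, fun h j =>
          congrFun h j⟩
      · exact forall_congr' fun b => forall_congr' fun b' => forall_congr' fun c =>
          imp_congr_right fun _ => imp_congr_right fun _ => ⟨fun h => funext h, fun h j =>
          congrFun h j⟩
    rw [h2, h3, ite_and (P := ∀ b, Q.HZ *ᵥ (fun i => y (b, i)) = 0)]
    refine if_congr Iff.rfl ?_ rfl
    rw [mul_ite, mul_zero]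
    exact if_congr h4 rfl rfl

end

/-! ### Local stochastic noise -/

section
variable {Ω : Type} [Fintype Ω] (μ : PMF Ω)

theorem prob_mono {A B : Set Ω} (h : A ⊆ B) : prob μ A ≤ prob μ B :=
  Finset.sum_le_sum fun _ _ => Set.indicator_le_indicator_of_subset h
    (fun _ => ENNReal.toReal_nonneg) _

theorem sum_toReal_pmf : ∑ ω, (μ ω).toReal = 1 := by
  have h := μ.tsum_coe
  rw [tsum_fintype] at h
  rw [← ENNReal.toReal_sum fun ω _ => μ.apply_ne_top ω, h, ENNReal.toReal_one]

theorem prob_le_one (A : Set Ω) : prob μ A ≤ 1 := by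
  rw [← sum_toReal_pmf μ]
  exact Finset.sum_le_sum fun ω _ => Set.indicator_le_self' (fun _ _ => ENNReal.toReal_nonneg) ω

theorem prob_le_sum {α : Type} (s : Finset α) (A : α → Set Ω) {B : Set Ω}
    (h : ∀ ω ∈ B, ∃ a ∈ s, ω ∈ A a) : prob μ B ≤ ∑ a ∈ s, prob μ (A a) := by
  classical
  simp only [prob]
  rw [Finset.sum_comm]
  refine Finset.sum_le_sum fun ω _ => ?_
  by_cases hω : ω ∈ B
  · obtain ⟨a, ha, hωa⟩ := h ω hω
    rw [Set.indicator_of_mem hω]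
    refine le_trans ?_ (Finset.single_le_sum (f := fun a => (A a).indicator
      (fun ω => (μ ω).toReal) ω) (fun _ _ => Set.indicator_nonneg
      (fun _ _ => ENNReal.toReal_nonneg) _) ha)
    simp [Set.indicator_of_mem hωa]
  · rw [Set.indicator_of_notMem hω]
    exact Finset.sum_nonneg fun _ _ => Set.indicator_nonneg (fun _ _ => ENNReal.toReal_nonneg) _

theorem LocalStochastic.mono {ι : Type} {R R' : Ω → Finset ι} {p p' : ℝ}
    (h : LocalStochastic μ R p) (hR : ∀ ω, R' ω ⊆ R ω) (hp : 0 ≤ p) (hpp : p ≤ p') :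
    LocalStochastic μ R' p' := fun S =>
  (prob_mono μ fun ω (hω : S ⊆ R' ω) => hω.trans (hR ω)).trans
    ((h S).trans (pow_le_pow_left₀ hp hpp _))

/-- The rate `a p^(1/a)`. -/
def rate (a : ℕ) (p : ℝ) : ℝ := a * p ^ ((1 : ℝ) / a)

theorem rate_nonneg (a : ℕ) {p : ℝ} (hp : 0 ≤ p) : 0 ≤ rate a p := by
  unfold rate; positivity

theorem one_le_rate {a : ℕ} (ha : 1 ≤ a) {p : ℝ} (hp : 1 ≤ p) : 1 ≤ rate a p := by
  unfold rate
  have h1 : (1 : ℝ) ≤ a := by exact_mod_cast ha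
  have h2 : (1 : ℝ) ≤ p ^ ((1 : ℝ) / a) := Real.one_le_rpow hp (by positivity)
  nlinarith

theorem pow_le_root_pow {a : ℕ} (ha : 1 ≤ a) {p : ℝ} (hp : 0 ≤ p) (hp1 : p ≤ 1) {k m : ℕ}
    (h : m ≤ a * k) : p ^ k ≤ (p ^ ((1 : ℝ) / a)) ^ m := by
  have h0 : 0 ≤ p ^ ((1 : ℝ) / a) := by positivity
  have h1 : p ^ ((1 : ℝ) / a) ≤ 1 := Real.rpow_le_one hp hp1 (by positivity)
  have h2 : (p ^ ((1 : ℝ) / a)) ^ a = p := by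
    rw [← Real.rpow_natCast, ← Real.rpow_mul hp, one_div, inv_mul_cancel₀, Real.rpow_one]
    exact_mod_cast (by omega : a ≠ 0)
  calc p ^ k = (p ^ ((1 : ℝ) / a)) ^ (a * k) := by rw [pow_mul, h2]
    _ ≤ _ := pow_le_pow_of_le_one h0 h1 h

/-- Using one number as prefactor and inverse exponent makes these rates stable under composition,
as `b ^ (1/a) ≤ b`. Every later loss can then be absorbed by enlarging a single integer. -/
theorem rate_rate {a b : ℕ} (ha : 1 ≤ a) (hb : 1 ≤ b) {p : ℝ} (hp : 0 ≤ p) :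
    rate a (rate b p) ≤ rate (a * b) p := by
  have hb1 : (1 : ℝ) ≤ b := by exact_mod_cast hb
  unfold rate
  rw [Real.mul_rpow (by positivity) (by positivity), ← Real.rpow_mul hp, Nat.cast_mul,
    show (1 : ℝ) / b * (1 / a) = 1 / (a * b) by rw [div_mul_div_comm, mul_one, mul_comm], ← mul_assoc]
  refine mul_le_mul_of_nonneg_right ?_ (by positivity)
  refine mul_le_mul_of_nonneg_left ?_ (by positivity)
  calc (b : ℝ) ^ ((1 : ℝ) / a) ≤ (b : ℝ) ^ (1 : ℝ) := by
        refine Real.rpow_le_rpow_of_exponent_le hb1 ?_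
        have ha' : (1 : ℝ) ≤ a := by exact_mod_cast ha
        rw [div_le_one (by linarith)]
        exact ha'
    _ = b := Real.rpow_one _

theorem rate_mono (a : ℕ) {p q : ℝ} (hp : 0 ≤ p) (h : p ≤ q) : rate a p ≤ rate a q :=
  mul_le_mul_of_nonneg_left (Real.rpow_le_rpow hp h (by positivity)) (by positivity)

theorem rate_mono_left {a b : ℕ} (ha : 1 ≤ a) (hab : a ≤ b) {p : ℝ} (hp : 0 ≤ p) (hp1 : p ≤ 1) :
    rate a p ≤ rate b p := by
  have hab' : (a : ℝ) ≤ b := by exact_mod_cast hab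
  have ha' : (0 : ℝ) < a := by exact_mod_cast ha
  refine mul_le_mul hab' ?_ (by positivity) (by positivity)
  have hb' : (0 : ℝ) < b := ha'.trans_le hab'
  rcases hp.eq_or_lt with rfl | hp0
  · rw [Real.zero_rpow (by positivity), Real.zero_rpow (by positivity)]
  · exact Real.rpow_le_rpow_of_exponent_ge hp0 hp1 (one_div_le_one_div_of_le ha' hab')

/-- Every point of `R'` is close to a point of one of the sets `R t`. -/
theorem LocalStochastic.spread {S ι ι' : Type} [Fintype S] [DecidableEq ι] [DecidableEq ι']
    [DecidableEq S]
    {R : S → Ω → Finset ι} {p : ℝ} (hp : 0 ≤ p) (h : ∀ t, LocalStochastic μ (R t) p)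
    {r : ι' → ι → Prop} {Δ : ℕ} (hr : BddRel r Δ) (hr' : BddRel (fun y x => r x y) Δ)
    {R' : Ω → Finset ι'} (hR' : ∀ ω, ∀ x ∈ R' ω, ∃ t, ∃ y ∈ R t ω, r x y)
    {a : ℕ} (ha : 1 ≤ a) (haΔ : Fintype.card S * Δ ≤ a) : LocalStochastic μ R' (rate a p) := by
  classical
  intro T
  -- For `p > 1` the claimed rate is at least one and nothing has to be shown.
  rcases lt_or_ge 1 p with hp1 | hp1
  · exact (prob_le_one μ _).trans (one_le_pow₀ (one_le_rate ha hp1.le))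
  choose f hf hf' using hr
  -- A choice function names, for each point of `T`, a time and a faulty point close to it; there
  -- are at most `a` possibilities per point.
  let C : Finset (T → S × ι) := Fintype.piFinset fun x => Finset.univ ×ˢ f x
  have hcover : ∀ ω ∈ {ω | T ⊆ R' ω}, ∃ c ∈ C, ω ∈ {ω | ∀ x : T, (c x).2 ∈ R (c x).1 ω ∧ r x (c x).2} := by
    intro ω hω
    choose t ht using fun x : T => hR' ω x (hω x.2)
    choose y hy using ht
    refine ⟨fun x => (t x, y x), ?_, hy⟩
    rw [Fintype.mem_piFinset]
    intro x
    rw [Finset.mem_product]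
    exact ⟨Finset.mem_univ _, hf' _ _ (hy x).2⟩
  refine (prob_le_sum μ C _ hcover).trans ?_
  have hcard : C.card ≤ a ^ T.card := by
    rw [Fintype.card_piFinset]
    refine (Finset.prod_le_pow_card _ _ a fun x _ => ?_).trans (by simp)
    rw [Finset.card_product, Finset.card_univ]
    exact (Nat.mul_le_mul_left _ (hf _)).trans haΔ
  have hterm : ∀ c ∈ C, prob μ {ω | ∀ x : T, (c x).2 ∈ R (c x).1 ω ∧ r x (c x).2} ≤
      (p ^ ((1 : ℝ) / a)) ^ T.card := by
    intro c _
    rcases T.eq_empty_or_nonempty with rfl | hT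
    · simpa using prob_le_one μ _
    by_cases hrc : ∀ x : T, r x (c x).2
    swap
    · push Not at hrc
      obtain ⟨x, hx⟩ := hrc
      have : {ω | ∀ x : T, (c x).2 ∈ R (c x).1 ω ∧ r x (c x).2} = ∅ := by
        ext ω
        simp only [Set.mem_ofPred_eq, Set.mem_empty_iff_false, iff_false]
        exact fun h => hx (h x).2
      rw [this]
      simp only [prob, Set.indicator_empty, Finset.sum_const_zero]
      positivity
    let Y : S → Finset ι := fun t => (Finset.univ.filter fun x : T => (c x).1 = t).image fun x =>
      (c x).2
    -- Different times may be arbitrarily correlated, so only the time with the most faults is used.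
    -- By pigeonhole it has at least `T.card / a` distinct ones, since a fault serves at most `Δ`
    -- points.
    have hY : ∃ t, T.card ≤ a * (Y t).card := by
      by_contra! hcon
      have h1 : T.card ≤ ∑ t, (Y t).card * Δ := by
        calc T.card = (Finset.univ : Finset T).card := by simp
          _ = ∑ t, (Finset.univ.filter fun x : T => (c x).1 = t).card :=
            Finset.card_eq_sum_card_fiberwise fun x _ => Finset.mem_univ _
          _ ≤ _ := by
            refine Finset.sum_le_sum fun t _ => ?_
            rw [mul_comm]
            refine Finset.card_le_mul_card_image _ Δ fun y _ => ?_
            obtain ⟨s, hs, hs'⟩ := hr' y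
            refine le_trans (Finset.card_le_card_of_injOn (fun x : T => (x : ι')) ?_ ?_) hs
            · intro x hx
              have hx' := (Finset.mem_filter.1 hx).2
              exact hs' _ (hx' ▸ hrc x)
            · intro x _ y _ hxy
              exact Subtype.ext hxy
      obtain ⟨x0, hx0⟩ := hT
      have hS : Nonempty S := ⟨(c ⟨x0, hx0⟩).1⟩
      have h2 : ∑ t : S, Fintype.card S * Δ * (Y t).card < ∑ _t : S, T.card :=
        Finset.sum_lt_sum_of_nonempty Finset.univ_nonempty fun t _ =>
          lt_of_le_of_lt (Nat.mul_le_mul_right _ haΔ) (hcon t)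
      rw [Finset.sum_const, Finset.card_univ, smul_eq_mul] at h2
      have h3 := Nat.mul_le_mul_left (Fintype.card S) h1
      rw [Finset.mul_sum] at h3
      have h4 : ∑ t : S, Fintype.card S * ((Y t).card * Δ) =
          ∑ t : S, Fintype.card S * Δ * (Y t).card :=
        Finset.sum_congr rfl fun t _ => by ring
      omega
    obtain ⟨t, ht⟩ := hY
    refine le_trans (prob_mono μ ?_) ((h t (Y t)).trans (pow_le_root_pow ha hp hp1 ht))
    intro ω hω y hy
    obtain ⟨x, hx, rfl⟩ := Finset.mem_image.1 hy
    have := (hω x).1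
    rwa [(Finset.mem_filter.1 hx).2] at this
  refine (Finset.sum_le_card_nsmul _ _ _ hterm).trans ?_
  rw [nsmul_eq_mul, rate, mul_pow]
  refine mul_le_mul_of_nonneg_right ?_ (by positivity)
  exact_mod_cast hcard

/-- Union bound over the at most `2 ^ K.card` subsets of `K` that contain half of it, each of
probability at most `p ^ (K.card / 2)`. -/
theorem prob_half_le {β : Type} [DecidableEq β] {e : Ω → Finset β} {p : ℝ} (hp : 0 ≤ p)
    (he : LocalStochastic μ e p) (K : Finset β) :
    prob μ {ω | K.card ≤ 2 * (e ω ∩ K).card} ≤ (rate 2 p) ^ K.card := by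
  rcases lt_or_ge 1 p with hp1 | hp1
  · exact (prob_le_one μ _).trans (one_le_pow₀ (one_le_rate (by norm_num) hp1.le))
  refine (prob_le_sum μ (K.powerset.filter fun Y => K.card ≤ 2 * Y.card)
    (fun Y => {ω | Y ⊆ e ω}) ?_).trans ?_
  · intro ω hω
    refine ⟨e ω ∩ K, ?_, Finset.inter_subset_left⟩
    rw [Finset.mem_filter, Finset.mem_powerset]
    exact ⟨Finset.inter_subset_right, hω⟩
  · refine (Finset.sum_le_card_nsmul _ _ ((p ^ ((1 : ℝ) / (2 : ℕ))) ^ K.card) ?_).trans ?_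
    · intro Y hY
      exact (he Y).trans (pow_le_root_pow (by norm_num) hp hp1 (Finset.mem_filter.1 hY).2)
    · rw [nsmul_eq_mul, rate, mul_pow]
      refine mul_le_mul_of_nonneg_right ?_ (by positivity)
      have := Finset.card_filter_le K.powerset fun Y => K.card ≤ 2 * Y.card
      rw [Finset.card_powerset] at this
      exact_mod_cast this

end

/-! ### Clusters -/

section
variable {β : Type} [DecidableEq β]

/-- The walks of `k` steps from `v`, along the edges given by the sets `f u` of neighbours. -/
def walks (f : β → Finset β) : ℕ → β → Finset (List β)
  | 0, v => {[v]}
  | k + 1, v => (f v).biUnion fun u => (walks f k u).image (List.cons v)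

theorem card_walks_le {f : β → Finset β} {Δ : ℕ} (hf : ∀ v, (f v).card ≤ Δ) (k : ℕ) (v : β) :
    (walks f k v).card ≤ Δ ^ k := by
  induction k generalizing v with
  | zero => simp [walks]
  | succ k ih =>
    rw [pow_succ, mul_comm]
    refine (Finset.card_biUnion_le_card_mul _ _ (Δ ^ k) fun u _ => ?_).trans
      (Nat.mul_le_mul_right _ (hf v))
    exact Finset.card_image_le.trans (ih u)

/-- Inserting the detour to `y` and back at a visit of `x` costs two steps and adds exactly `y` to
the visited set. -/
theorem exists_walk_insert {f : β → Finset β} (hsymm : ∀ x y, y ∈ f x → x ∈ f y) {k : ℕ} {v x y : β}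
    {l : List β} (hl : l ∈ walks f k v) (hx : x ∈ l) (hy : y ∈ f x) :
    ∃ l' ∈ walks f (k + 2) v, l'.toFinset = insert y l.toFinset := by
  induction k generalizing v l with
  | zero =>
    rw [walks, Finset.mem_singleton] at hl
    subst hl
    rw [List.mem_singleton] at hx
    subst hx
    refine ⟨[x, y, x], ?_, ?_⟩
    · simp only [walks, Finset.mem_biUnion, Finset.mem_image, Finset.mem_singleton]
      exact ⟨y, hy, [y, x], ⟨x, hsymm _ _ hy, [x], rfl, rfl⟩, rfl⟩
    · ext z; simp
  | succ k ih =>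
    have hl' := hl
    rw [walks, Finset.mem_biUnion] at hl
    obtain ⟨u, hu, hl⟩ := hl
    obtain ⟨l₁, hl₁, rfl⟩ := Finset.mem_image.1 hl
    rcases List.mem_cons.1 hx with rfl | hx'
    · refine ⟨x :: y :: x :: l₁, ?_, ?_⟩
      · rw [walks, Finset.mem_biUnion]
        refine ⟨y, hy, Finset.mem_image.2 ⟨y :: x :: l₁, ?_, rfl⟩⟩
        rw [walks, Finset.mem_biUnion]
        exact ⟨x, hsymm _ _ hy, Finset.mem_image.2 ⟨x :: l₁, hl', rfl⟩⟩
      · ext z; simp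
    · obtain ⟨l', hl', h'⟩ := ih hl₁ hx'
      refine ⟨v :: l', ?_, ?_⟩
      · rw [walks, Finset.mem_biUnion]
        exact ⟨u, hu, Finset.mem_image.2 ⟨l', hl', rfl⟩⟩
      · rw [List.toFinset_cons, h', List.toFinset_cons, Finset.insert_comm]

/-- `K` is connected and contains `v`. -/
def IsCluster (f : β → Finset β) (K : Finset β) (v : β) : Prop :=
  v ∈ K ∧ ∀ L ⊆ K, v ∈ L → L ≠ K → ∃ x ∈ L, ∃ y ∈ K, y ∉ L ∧ y ∈ f x

/-- The connected sets of size `s` that contain `v`, and possibly other sets of size `s`. -/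
def clusters (f : β → Finset β) (v : β) (s : ℕ) : Finset (Finset β) :=
  ((walks f (2 * (s - 1)) v).image List.toFinset).filter fun K => K.card = s

theorem card_clusters_le {f : β → Finset β} {Δ : ℕ} (hΔ : 1 ≤ Δ) (hf : ∀ v, (f v).card ≤ Δ)
    (v : β) (s : ℕ) : (clusters f v s).card ≤ (Δ ^ 2) ^ s := by
  refine (Finset.card_filter_le _ _).trans (Finset.card_image_le.trans
    ((card_walks_le hf _ v).trans ?_))
  rw [← pow_mul]
  exact Nat.pow_le_pow_right hΔ (by omega)

/-- The cluster is explored from `v` by adding one neighbour at a time; with two steps per new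
point, a walk of `2 * (K.card - 1)` steps visits exactly `K`. -/
theorem IsCluster.mem_clusters {f : β → Finset β} (hsymm : ∀ x y, y ∈ f x → x ∈ f y)
    {K : Finset β} {v : β} (h : IsCluster f K v) : K ∈ clusters f v K.card := by
  have key : ∀ k < K.card, ∃ l ∈ walks f (2 * k) v, l.toFinset ⊆ K ∧ v ∈ l.toFinset ∧
      l.toFinset.card = k + 1 := by
    intro k
    induction k with
    | zero =>
      intro _
      exact ⟨[v], by simp [walks], by simpa using h.1, by simp, by simp⟩
    | succ k ih =>
      intro hk
      obtain ⟨l, hl, hlK, hv, hc⟩ := ih (by omega)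
      obtain ⟨x, hx, y, hy, hyl, hxy⟩ := h.2 _ hlK hv (by rintro h'; rw [h'] at hc; omega)
      obtain ⟨l', hl', h'⟩ := exists_walk_insert hsymm hl (List.mem_toFinset.1 hx) hxy
      refine ⟨l', hl', ?_, ?_, ?_⟩
      · rw [h']; exact Finset.insert_subset hy hlK
      · rw [h']; exact Finset.mem_insert_of_mem hv
      · rw [h', Finset.card_insert_of_notMem hyl, hc]
  have hpos : 0 < K.card := Finset.card_pos.2 ⟨v, h.1⟩
  obtain ⟨l, hl, hlK, -, hc⟩ := key (K.card - 1) (by omega)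
  have hlK' : l.toFinset = K := Finset.eq_of_subset_of_card_le hlK (by omega)
  exact Finset.mem_filter.2 ⟨Finset.mem_image.2 ⟨l, hl, hlK'⟩, rfl⟩

theorem sum_Ico_pow_le {y : ℝ} (hy : 0 ≤ y) (hy2 : y ≤ 1 / 2) (t M : ℕ) :
    ∑ s ∈ Finset.Ico t M, y ^ s ≤ 2 * y ^ t := by
  refine (geom_sum_Ico_le_of_lt_one hy (by linarith)).trans ?_
  rw [div_le_iff₀ (by linarith)]
  nlinarith [pow_nonneg hy t]

theorem sum_clusters_le {f : β → Finset β} {Δ : ℕ} (hΔ : 1 ≤ Δ) (hf : ∀ v, (f v).card ≤ Δ)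
    {q : ℝ} (hq : 0 ≤ q) (hq2 : Δ ^ 2 * q ≤ 1 / 2) (v : β) (t M : ℕ) :
    ∑ s ∈ Finset.Ico t M, ∑ K ∈ clusters f v s, q ^ K.card ≤ 2 * (Δ ^ 2 * q) ^ t := by
  refine le_trans (Finset.sum_le_sum fun s _ => ?_) (sum_Ico_pow_le (by positivity) hq2 t M)
  calc ∑ K ∈ clusters f v s, q ^ K.card = ∑ K ∈ clusters f v s, q ^ s :=
        Finset.sum_congr rfl fun K hK => by rw [(Finset.mem_filter.1 hK).2]
    _ = (clusters f v s).card * q ^ s := by rw [Finset.sum_const, nsmul_eq_mul]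
    _ ≤ ((Δ : ℝ) ^ 2) ^ s * q ^ s := by
        refine mul_le_mul_of_nonneg_right ?_ (by positivity)
        exact_mod_cast card_clusters_le hΔ hf v s
    _ = _ := by rw [mul_pow]

theorem sum_biUnion_le_sum {α γ : Type} [DecidableEq γ] (s : Finset α) (t : α → Finset γ)
    (g : γ → ℝ) (hg : ∀ K, 0 ≤ g K) : ∑ K ∈ s.biUnion t, g K ≤ ∑ a ∈ s, ∑ K ∈ t a, g K := by
  classical
  induction s using Finset.induction_on with
  | empty => simp
  | insert a s ha ih =>
    rw [Finset.biUnion_insert, Finset.sum_insert ha]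
    have := Finset.sum_union_inter (s₁ := t a) (s₂ := s.biUnion t) (f := g)
    have h2 : 0 ≤ ∑ K ∈ t a ∩ s.biUnion t, g K := Finset.sum_nonneg fun K _ => hg K
    linarith

variable [Fintype β] {Ω : Type} [Fintype Ω] (μ : PMF Ω)

/-- Large clusters, half of whose points are in a local stochastic set, are unlikely. -/
theorem prob_large_cluster_le {f : β → Finset β} {Δ : ℕ} (hΔ : 1 ≤ Δ) (hf : ∀ v, (f v).card ≤ Δ)
    (hsymm : ∀ x y, y ∈ f x → x ∈ f y) {e : Ω → Finset β} {p : ℝ} (hp : 0 ≤ p)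
    (he : LocalStochastic μ e p) (hsmall : Δ ^ 2 * rate 2 p ≤ 1 / 2) (t : ℕ) :
    prob μ {ω | ∃ K v, IsCluster f K v ∧ t ≤ K.card ∧ K.card ≤ 2 * (e ω ∩ K).card} ≤
      Fintype.card β * (2 * (Δ ^ 2 * rate 2 p) ^ t) := by
  have h1 : ∀ ω ∈ {ω | ∃ K v, IsCluster f K v ∧ t ≤ K.card ∧ K.card ≤ 2 * (e ω ∩ K).card},
      ∃ v ∈ (Finset.univ : Finset β), ω ∈ {ω | ∃ K, IsCluster f K v ∧ t ≤ K.card ∧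
        K.card ≤ 2 * (e ω ∩ K).card} := by
    rintro ω ⟨K, v, h⟩
    exact ⟨v, Finset.mem_univ _, K, h⟩
  refine (prob_le_sum μ _ _ h1).trans ?_
  refine (Finset.sum_le_card_nsmul _ _ (2 * (Δ ^ 2 * rate 2 p) ^ t) fun v _ => ?_).trans
    (by rw [nsmul_eq_mul, Finset.card_univ])
  refine le_trans ?_ (sum_clusters_le hΔ hf (rate_nonneg 2 hp) hsmall v t (Fintype.card β + 1))
  rw [Finset.sum_sigma']
  refine (prob_le_sum μ ((Finset.Ico t (Fintype.card β + 1)).sigma fun s => clusters f v s)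
    (fun x => {ω | x.2.card ≤ 2 * (e ω ∩ x.2).card}) ?_).trans
    (Finset.sum_le_sum fun x _ => prob_half_le μ hp he x.2)
  rintro ω ⟨K, hK, htK, hKe⟩
  refine ⟨⟨K.card, K⟩, ?_, hKe⟩
  rw [Finset.mem_sigma, Finset.mem_Ico]
  exact ⟨⟨htK, Nat.lt_succ_of_le (Finset.card_le_univ K)⟩, hK.mem_clusters hsymm⟩

/-- The points that are hit by clusters which are large compared to their depth form a local
stochastic set. -/
theorem localStochastic_of_clusters {δ : Type} [Fintype δ] [DecidableEq δ]
    {f : β → Finset β} {Δ : ℕ} (hΔ : 1 ≤ Δ) (hf : ∀ v, (f v).card ≤ Δ)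
    (hsymm : ∀ x y, y ∈ f x → x ∈ f y) {e : Ω → Finset β} {p : ℝ} (hp : 0 ≤ p)
    (he : LocalStochastic μ e p)
    (root : δ → β → Prop) (hroot : ∀ i i' v, root i v → root i' v → i = i') (dep : β → ℕ)
    (hdep : ∀ v, 1 ≤ dep v) (hdeg : ∀ k, BddRel (fun i v => root i v ∧ dep v = k) 2)
    (R : Ω → Finset δ) (𝒦 : Ω → Set (Finset β))
    (hdisj : ∀ ω, ∀ K ∈ 𝒦 ω, ∀ K' ∈ 𝒦 ω, K ≠ K' → Disjoint K K')
    (h𝒦 : ∀ ω, ∀ K ∈ 𝒦 ω, (∀ v ∈ K, IsCluster f K v) ∧ K.card ≤ 2 * (e ω ∩ K).card)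
    (hR : ∀ ω, ∀ i ∈ R ω, ∃ K ∈ 𝒦 ω, ∃ v ∈ K, root i v ∧ dep v ≤ K.card)
    (hsmall : Δ ^ 2 * rate 2 (rate 2 p) ≤ 1 / 8) :
    LocalStochastic μ R (2 * rate 2 (rate 2 p)) := by
  classical
  intro S
  set x := rate 2 p with hx
  have hx0 : 0 ≤ x := rate_nonneg 2 hp
  set q := rate 2 x with hq
  have hq0 : 0 ≤ q := rate_nonneg 2 hx0
  have hq1 : q ≤ 1 := by
    have : (1 : ℝ) ≤ Δ ^ 2 := by exact_mod_cast Nat.one_le_pow _ _ hΔ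
    nlinarith
  -- This splits the weight of a union of clusters in two: one power of `q` yields the bound in
  -- terms of `S.card`, the other pays for the sum over all families of clusters.
  have hxq : x ≤ q * q := by
    have : q * q = 4 * x := by
      rw [hq, rate, show ((2 : ℕ) : ℝ) = 2 by norm_num, ← Real.sqrt_eq_rpow]
      have := Real.mul_self_sqrt hx0
      nlinarith
    rw [this]; linarith
  choose g hg hg' using hdeg
  let M := Fintype.card β + 1
  let 𝒞 : δ → Finset (Finset β) := fun i => (Finset.Ico 1 M).biUnion fun k =>
    (g k i).biUnion fun v => (Finset.Ico k M).biUnion fun s => clusters f v s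
  -- There are at most two sites of each depth `k` rooted at `i`, and only clusters of size at least
  -- `k` through them count, so the total is a convergent geometric sum even though `i` has
  -- arbitrarily many rooted sites.
  have hW : ∀ i, ∑ K ∈ 𝒞 i, q ^ K.card ≤ 1 := by
    intro i
    have hnn : ∀ K : Finset β, 0 ≤ q ^ K.card := fun K => by positivity
    calc ∑ K ∈ 𝒞 i, q ^ K.card
        ≤ ∑ k ∈ Finset.Ico 1 M, ∑ v ∈ g k i, ∑ s ∈ Finset.Ico k M, ∑ K ∈ clusters f v s,
          q ^ K.card := by
          refine (sum_biUnion_le_sum _ _ _ (fun _ => hnn _)).trans ?_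
          refine Finset.sum_le_sum fun k _ => ?_
          refine (sum_biUnion_le_sum _ _ _ (fun _ => hnn _)).trans ?_
          refine Finset.sum_le_sum fun v _ => ?_
          exact sum_biUnion_le_sum _ _ _ (fun _ => hnn _)
      _ ≤ ∑ k ∈ Finset.Ico 1 M, 4 * (Δ ^ 2 * q) ^ k := by
          refine Finset.sum_le_sum fun k _ => ?_
          refine (Finset.sum_le_card_nsmul _ _ (2 * (Δ ^ 2 * q) ^ k) fun v _ =>
            sum_clusters_le hΔ hf hq0 (by linarith) v k M).trans ?_
          rw [nsmul_eq_mul, show (4 : ℝ) * (Δ ^ 2 * q) ^ k = (2 : ℕ) * (2 * (Δ ^ 2 * q) ^ k) by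
            push_cast; ring]
          refine mul_le_mul_of_nonneg_right ?_ (by positivity)
          exact_mod_cast hg k i
      _ ≤ 4 * (2 * (Δ ^ 2 * q) ^ 1) := by
          rw [← Finset.mul_sum]
          exact mul_le_mul_of_nonneg_left (sum_Ico_pow_le (by positivity) (by linarith) 1 M)
            (by norm_num)
      _ ≤ 1 := by linarith
  let t : δ → Finset (Finset β) := fun i => if i ∈ S then insert ∅ (𝒞 i) else {∅}
  -- Families of disjoint clusters, indexed by the points of `S`; the empty set marks a point whose
  -- cluster is already represented by another one.
  let P : Finset (δ → Finset β) := (Fintype.piFinset t).filter fun κ =>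
    (∀ i j, i ≠ j → Disjoint (κ i) (κ j)) ∧ S.card ≤ ∑ i, (κ i).card
  have hcover : ∀ ω ∈ {ω | S ⊆ R ω}, ∃ κ ∈ P, ω ∈ {ω | (Finset.univ.biUnion κ).card ≤
      2 * (e ω ∩ Finset.univ.biUnion κ).card} := by
    intro ω hω
    have h1 : ∀ i : δ, ∃ K : Finset β, i ∈ S → K ∈ 𝒦 ω ∧ ∃ v ∈ K, root i v ∧ dep v ≤ K.card := by
      intro i
      by_cases hi : i ∈ S
      · obtain ⟨K, hK⟩ := hR ω i (hω hi)
        exact ⟨K, fun _ => hK⟩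
      · exact ⟨∅, fun h => absurd h hi⟩
    choose Kf hKf using h1
    -- One cluster may hit several points of `S`; a single representative ensures that its weight is
    -- counted only once.
    have h2 : ∀ K : Finset β, ∃ j : Option δ, ∀ i ∈ S, Kf i = K → ∃ j' ∈ S, j = some j' ∧
        Kf j' = K := by
      intro K
      by_cases h : ∃ i ∈ S, Kf i = K
      · obtain ⟨i, hi, hiK⟩ := h
        exact ⟨some i, fun _ _ _ => ⟨i, hi, rfl, hiK⟩⟩
      · exact ⟨none, fun i hi hiK => absurd ⟨i, hi, hiK⟩ h⟩
    choose rep hrep using h2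
    let κ : δ → Finset β := fun i => if i ∈ S ∧ rep (Kf i) = some i then Kf i else ∅
    have hκ𝒦 : ∀ i, κ i = ∅ ∨ (i ∈ S ∧ κ i = Kf i ∧ rep (Kf i) = some i) := by
      intro i
      by_cases h : i ∈ S ∧ rep (Kf i) = some i
      · exact Or.inr ⟨h.1, if_pos h, h.2⟩
      · exact Or.inl (if_neg h)
    have hdis : ∀ i j, i ≠ j → Disjoint (κ i) (κ j) := by
      intro i j hij
      rcases hκ𝒦 i with h | ⟨hi, hi', hi''⟩
      · rw [h]; exact Finset.disjoint_empty_left _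
      rcases hκ𝒦 j with h | ⟨hj, hj', hj''⟩
      · rw [h]; exact Finset.disjoint_empty_right _
      rw [hi', hj']
      refine hdisj ω _ (hKf i hi).1 _ (hKf j hj).1 fun h => hij ?_
      rw [h, hj''] at hi''
      exact (Option.some_injective _ hi'').symm
    have hcardU : (Finset.univ.biUnion κ).card = ∑ i, (κ i).card :=
      Finset.card_biUnion fun i _ j _ hij => hdis i j hij
    -- Distinct points of `S` have distinct rooted sites in the union, by the injectivity of roots.
    have hSU : S.card ≤ (Finset.univ.biUnion κ).card := by
      choose v hv using fun i : S => (hKf i i.2).2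
      rw [← Finset.card_attach]
      refine Finset.card_le_card_of_injOn v ?_ ?_
      · rintro ⟨i, hi⟩ -
        obtain ⟨j, hj, hj', hjK⟩ := hrep (Kf i) i hi rfl
        refine Finset.mem_biUnion.2 ⟨j, Finset.mem_univ _, ?_⟩
        simp only [κ]
        rw [if_pos ⟨hj, by rw [hjK, hj']⟩, hjK]
        exact (hv ⟨i, hi⟩).1
      · intro i _ j _ hij
        refine Subtype.ext (hroot i j (v i) (hv i).2.1 ?_)
        have : v i = v j := hij
        rw [this]
        exact (hv j).2.1
    refine ⟨κ, ?_, ?_⟩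
    · rw [Finset.mem_filter, Fintype.mem_piFinset]
      refine ⟨fun i => ?_, hdis, hcardU ▸ hSU⟩
      simp only [t]
      rcases hκ𝒦 i with h | ⟨hi, hi', -⟩
      · rw [h]; split_ifs <;> simp
      · rw [if_pos hi, hi']
        refine Finset.mem_insert_of_mem ?_
        obtain ⟨hK, v, hv, hvr, hvd⟩ := hKf i hi
        have hle : (Kf i).card < M := Nat.lt_succ_of_le (Finset.card_le_univ _)
        refine Finset.mem_biUnion.2 ⟨dep v, Finset.mem_Ico.2 ⟨hdep v, by omega⟩,
          Finset.mem_biUnion.2 ⟨v, hg' _ _ _ ⟨hvr, rfl⟩, Finset.mem_biUnion.2 ⟨(Kf i).card,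
          Finset.mem_Ico.2 ⟨hvd, hle⟩, ((h𝒦 ω _ hK).1 v hv).mem_clusters hsymm⟩⟩⟩
    · have h3 : (e ω ∩ Finset.univ.biUnion κ).card = ∑ i, (e ω ∩ κ i).card := by
        rw [Finset.inter_biUnion, Finset.card_biUnion]
        intro i _ j _ hij
        exact (hdis i j hij).mono Finset.inter_subset_right Finset.inter_subset_right
      rw [Set.mem_ofPred_eq, hcardU, h3, Finset.mul_sum]
      refine Finset.sum_le_sum fun i _ => ?_
      rcases hκ𝒦 i with h | ⟨hi, hi', -⟩
      · rw [h]; simp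
      · rw [hi']; exact (h𝒦 ω _ (hKf i hi).1).2
  refine (prob_le_sum μ P _ hcover).trans ?_
  calc ∑ κ ∈ P, prob μ {ω | (Finset.univ.biUnion κ).card ≤ 2 * (e ω ∩ Finset.univ.biUnion κ).card}
      ≤ ∑ κ ∈ P, q ^ S.card * ∏ i, q ^ (κ i).card := by
        refine Finset.sum_le_sum fun κ hκ => ?_
        obtain ⟨-, hdis, hS⟩ := Finset.mem_filter.1 hκ
        refine (prob_half_le μ hp he _).trans ?_
        rw [← hx, Finset.card_biUnion fun i _ j _ hij => hdis i j hij, Finset.prod_pow_eq_pow_sum]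
        refine (pow_le_pow_left₀ hx0 hxq _).trans ?_
        rw [mul_pow]
        exact mul_le_mul_of_nonneg_right (pow_le_pow_of_le_one hq0 hq1 hS) (by positivity)
    _ ≤ ∑ κ ∈ Fintype.piFinset t, q ^ S.card * ∏ i, q ^ (κ i).card :=
        Finset.sum_le_sum_of_subset_of_nonneg (Finset.filter_subset _ _) fun _ _ _ => by positivity
    _ = q ^ S.card * ∏ i, ∑ K ∈ t i, q ^ K.card := by
        rw [← Finset.mul_sum, Finset.prod_univ_sum]
    _ ≤ q ^ S.card * ∏ i, (if i ∈ S then 2 else 1) := by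
        refine mul_le_mul_of_nonneg_left (Finset.prod_le_prod (fun i _ => ?_) fun i _ => ?_)
          (by positivity)
        · exact Finset.sum_nonneg fun _ _ => by positivity
        · simp only [t]
          split_ifs with hi
          · have h1 : ∑ K ∈ insert ∅ (𝒞 i), q ^ K.card ≤ q ^ (∅ : Finset β).card +
                ∑ K ∈ 𝒞 i, q ^ K.card := by
              by_cases h : ∅ ∈ 𝒞 i
              · rw [Finset.insert_eq_of_mem h]
                have : 0 ≤ q ^ (∅ : Finset β).card := by positivity
                linarith
              · rw [Finset.sum_insert h]
            have := hW i
            rw [Finset.card_empty, pow_zero] at h1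
            linarith
          · simp
    _ = (2 * q) ^ S.card := by
        rw [Finset.prod_ite_mem, Finset.univ_inter, Finset.prod_const, mul_pow, mul_comm]

end

/-! ### Minimum weight decoding -/

section
variable {β : Type} [Fintype β] [DecidableEq β]

/-- The positions where a bit string is nonzero. -/
def bitSupp (f : Bits β) : Finset β := Finset.univ.filter fun v => f v ≠ 0

theorem mem_bitSupp {f : Bits β} {v : β} : v ∈ bitSupp f ↔ f v ≠ 0 := by simp [bitSupp]

/-- The restriction of a bit string to a set. -/
def restr (f : Bits β) (K : Finset β) : Bits β := fun v => if v ∈ K then f v else 0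

theorem exists_min_weight (C : Set (Bits β)) :
    ∃ x, C.Nonempty → x ∈ C ∧ ∀ y ∈ C, (bitSupp x).card ≤ (bitSupp y).card := by
  by_cases h : C.Nonempty
  · obtain ⟨x, hx, hmin⟩ := Set.exists_min_image C (fun x => (bitSupp x).card) (Set.toFinite C) h
    exact ⟨x, fun _ => ⟨hx, hmin⟩⟩
  · exact ⟨0, fun h' => absurd h' h⟩

/-- An element of minimum weight of the coset of `e`. -/
def minWeight (Loc : Submodule (ZMod 2) (Bits β)) (e : Bits β) : Bits β :=
  (exists_min_weight {x | e + x ∈ Loc}).choose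

theorem minWeight_spec (Loc : Submodule (ZMod 2) (Bits β)) (e : Bits β) :
    e + minWeight Loc e ∈ Loc ∧ ∀ y, e + y ∈ Loc → (bitSupp (minWeight Loc e)).card ≤
      (bitSupp y).card :=
  (exists_min_weight {x | e + x ∈ Loc}).choose_spec ⟨e, by
    rw [Set.mem_ofPred_eq, bits_add_self]; exact Loc.zero_mem⟩

/-- The minimizer is chosen from a set that only depends on the coset, so the decoder makes the same
guess for an observed outcome and for the error in it. -/
theorem minWeight_add {Loc : Submodule (ZMod 2) (Bits β)} {l : Bits β} (hl : l ∈ Loc)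
    (e : Bits β) : minWeight Loc (l + e) = minWeight Loc e := by
  have : {x | l + e + x ∈ Loc} = {x | e + x ∈ Loc} := by
    ext x
    rw [Set.mem_ofPred_eq, Set.mem_ofPred_eq, add_assoc]
    exact Loc.add_mem_iff_right hl
  unfold minWeight
  simp only [this]

/-- Membership in `Loc` can be checked on the connected components of the support. -/
def IsLocal (f : β → Finset β) (Loc : Submodule (ZMod 2) (Bits β)) : Prop :=
  ∀ b ∈ Loc, ∀ K ⊆ bitSupp b, (∀ x ∈ K, ∀ y ∈ bitSupp b, y ∈ f x → y ∈ K) → restr b K ∈ Loc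

open Classical in
/-- The connected component of `v` in `F`. -/
def component (f : β → Finset β) (F : Finset β) (v : β) : Finset β :=
  F.filter fun u => Relation.ReflTransGen (fun a b => b ∈ F ∧ b ∈ f a) v u

theorem mem_component {f : β → Finset β} {F : Finset β} {u v : β} : u ∈ component f F v ↔
    u ∈ F ∧ Relation.ReflTransGen (fun a b => b ∈ F ∧ b ∈ f a) v u := by
  classical
  simp [component]

theorem component_subset (f : β → Finset β) (F : Finset β) (v : β) : component f F v ⊆ F :=
  fun _ hu => (mem_component.1 hu).1

theorem mem_component_self {f : β → Finset β} {F : Finset β} {v : β} (hv : v ∈ F) :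
    v ∈ component f F v := mem_component.2 ⟨hv, Relation.ReflTransGen.refl⟩

theorem isCluster_component {f : β → Finset β} {F : Finset β} {v : β} (hv : v ∈ F) :
    IsCluster f (component f F v) v := by
  refine ⟨mem_component_self hv, fun L hL hvL hne => ?_⟩
  by_contra! hcon
  apply hne
  refine Finset.Subset.antisymm hL fun u hu => ?_
  have hu' := (mem_component.1 hu).2
  clear hu
  induction hu' with
  | refl => exact hvL
  | tail hab hbc ih =>
    by_contra hc
    exact hcon _ ih _ (mem_component.2 ⟨hbc.1, hab.tail hbc⟩) hc hbc.2

theorem component_eq {f : β → Finset β} (hsymm : ∀ x y, y ∈ f x → x ∈ f y) {F : Finset β} {u v : β}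
    (hv : v ∈ F) (hu : u ∈ component f F v) : component f F u = component f F v := by
  obtain ⟨huF, huv⟩ := mem_component.1 hu
  have hback : Relation.ReflTransGen (fun a b => b ∈ F ∧ b ∈ f a) u v := by
    clear hu
    induction huv with
    | refl => exact Relation.ReflTransGen.refl
    | @tail b c hab hbc ih =>
      have hb : b ∈ F := by
        rcases Relation.ReflTransGen.cases_tail hab with h | ⟨d, -, h⟩
        · rw [h]; exact hv
        · exact h.1
      exact Relation.ReflTransGen.head ⟨hb, hsymm _ _ hbc.2⟩ (ih hb)
  ext w
  simp only [mem_component]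
  exact ⟨fun h => ⟨h.1, huv.trans h.2⟩, fun h => ⟨h.1, hback.trans h.2⟩⟩

/-- The connected components of `F`. -/
def components (f : β → Finset β) (F : Finset β) : Finset (Finset β) := F.image (component f F)

theorem isCluster_of_mem_components {f : β → Finset β} (hsymm : ∀ x y, y ∈ f x → x ∈ f y)
    {F K : Finset β} (hK : K ∈ components f F) {v : β} (hv : v ∈ K) : IsCluster f K v := by
  obtain ⟨u, hu, rfl⟩ := Finset.mem_image.1 hK
  rw [← component_eq hsymm hu hv]
  exact isCluster_component (component_subset _ _ _ hv)

theorem components_disjoint {f : β → Finset β} (hsymm : ∀ x y, y ∈ f x → x ∈ f y)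
    {F K K' : Finset β} (hK : K ∈ components f F) (hK' : K' ∈ components f F) (hne : K ≠ K') :
    Disjoint K K' := by
  obtain ⟨u, hu, rfl⟩ := Finset.mem_image.1 hK
  obtain ⟨u', hu', rfl⟩ := Finset.mem_image.1 hK'
  refine Finset.disjoint_left.2 fun w hw hw' => hne ?_
  rw [← component_eq hsymm hu hw, ← component_eq hsymm hu' hw']

theorem subset_of_mem_components {f : β → Finset β} {F K : Finset β} (hK : K ∈ components f F) :
    K ⊆ F := by
  obtain ⟨u, hu, rfl⟩ := Finset.mem_image.1 hK
  exact component_subset _ _ _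

theorem closed_of_mem_components {f : β → Finset β} {F K : Finset β} (hK : K ∈ components f F) :
    ∀ x ∈ K, ∀ y ∈ F, y ∈ f x → y ∈ K := by
  obtain ⟨u, hu, rfl⟩ := Finset.mem_image.1 hK
  intro x hx y hy hxy
  exact mem_component.2 ⟨hy, (mem_component.1 hx).2.tail ⟨hy, hxy⟩⟩

theorem sum_restr_components {f : β → Finset β} (hsymm : ∀ x y, y ∈ f x → x ∈ f y) (b : Bits β) :
    ∑ K ∈ components f (bitSupp b), restr b K = b := by
  funext v
  rw [Finset.sum_apply]
  by_cases hv : v ∈ bitSupp b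
  · rw [Finset.sum_eq_single (component f (bitSupp b) v)]
    · exact if_pos (mem_component_self hv)
    · intro K hK hne
      refine if_neg fun hvK => hne ?_
      obtain ⟨u, hu, rfl⟩ := Finset.mem_image.1 hK
      exact (component_eq hsymm hu hvK).symm
    · intro h
      exact absurd (Finset.mem_image_of_mem _ hv) h
  · have hv0 : b v = 0 := by simpa [mem_bitSupp] using hv
    rw [hv0]
    refine Finset.sum_eq_zero fun K _ => ?_
    simp only [restr, hv0, ite_self]

theorem bitSupp_restr {b : Bits β} {K : Finset β} (hK : K ⊆ bitSupp b) :
    bitSupp (restr b K) = K := by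
  ext v
  simp only [mem_bitSupp, restr]
  constructor
  · intro h
    by_contra hv
    exact h (if_neg hv)
  · intro h
    rw [if_pos h]
    exact mem_bitSupp.1 (hK h)

variable {f : β → Finset β} {Loc : Submodule (ZMod 2) (Bits β)}

theorem restr_mem_of_mem_components (hloc : IsLocal f Loc) {b : Bits β} (hb : b ∈ Loc)
    {K : Finset β} (hK : K ∈ components f (bitSupp b)) : restr b K ∈ Loc :=
  hloc b hb K (subset_of_mem_components hK) (closed_of_mem_components hK)

/-- In each component of the residual of minimum weight decoding, at least half of the points are
errors. -/
theorem card_component_le (hloc : IsLocal f Loc) (e : Bits β) {K : Finset β}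
    (hK : K ∈ components f (bitSupp (e + minWeight Loc e))) :
    K.card ≤ 2 * (bitSupp e ∩ K).card := by
  set x := minWeight Loc e with hx
  obtain ⟨hmem, hmin⟩ := minWeight_spec Loc e
  rw [← hx] at hmem hmin
  have hr := restr_mem_of_mem_components hloc hmem hK
  have hKs := subset_of_mem_components hK
  -- The competitor agrees with `e` on `K` and with `x` elsewhere, and it belongs to the same coset
  -- by locality. Minimality gives that `x` has at most as many points in `K` as `e`, while together
  -- they cover `K`.
  have h1 := hmin (x + restr (e + x) K) (by rw [← add_assoc]; exact Loc.add_mem hmem hr)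
  have hs1 : bitSupp x = (bitSupp x ∩ K) ∪ (bitSupp x \ K) := by
    rw [Finset.union_comm]; exact (Finset.sdiff_union_inter _ _).symm
  have hs2 : bitSupp (x + restr (e + x) K) = (bitSupp e ∩ K) ∪ (bitSupp x \ K) := by
    ext v
    simp only [mem_bitSupp, Finset.mem_union, Finset.mem_inter, Finset.mem_sdiff, restr,
      Pi.add_apply]
    by_cases hv : v ∈ K
    · simp only [hv, if_true, and_true, not_true, and_false, or_false]
      rw [show x v + (e v + x v) = e v by
        rw [add_comm (e v), ← add_assoc, CharTwo.add_self_eq_zero, zero_add]]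
    · simp [hv]
  have hd1 : Disjoint (bitSupp x ∩ K) (bitSupp x \ K) :=
    Finset.disjoint_left.2 fun v h h' => (Finset.mem_sdiff.1 h').2 (Finset.mem_inter.1 h).2
  have hd2 : Disjoint (bitSupp e ∩ K) (bitSupp x \ K) :=
    Finset.disjoint_left.2 fun v h h' => (Finset.mem_sdiff.1 h').2 (Finset.mem_inter.1 h).2
  rw [hs2, Finset.card_union_of_disjoint hd2] at h1
  have h2 : (bitSupp x).card = (bitSupp x ∩ K).card + (bitSupp x \ K).card := by
    conv_lhs => rw [hs1]
    exact Finset.card_union_of_disjoint hd1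
  have h3 : K ⊆ (bitSupp e ∩ K) ∪ (bitSupp x ∩ K) := by
    intro v hv
    have := hKs hv
    rw [mem_bitSupp, Pi.add_apply] at this
    simp only [Finset.mem_union, Finset.mem_inter, mem_bitSupp, hv, and_true]
    by_contra! h
    rw [h.1, h.2, add_zero] at this
    exact this rfl
  have h4 := (Finset.card_le_card h3).trans (Finset.card_union_le _ _)
  omega

end

/-! ### Decoding of a block -/

section
variable {n : ℕ}

/-- The neighbours of `i` in the graph where two bits are adjacent if they are in a common check. -/
def checkNbrs {γ κ : Type} [Fintype γ] [DecidableEq γ] [Fintype κ] (H : κ → Finset γ) (i : γ) :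
    Finset γ := (Finset.univ.filter fun c => i ∈ H c).biUnion H

theorem mem_checkNbrs {γ κ : Type} [Fintype γ] [DecidableEq γ] [Fintype κ] {H : κ → Finset γ}
    {i j : γ} : j ∈ checkNbrs H i ↔ ∃ c, i ∈ H c ∧ j ∈ H c := by
  simp [checkNbrs]

theorem card_checkNbrs_le {γ κ : Type} [Fintype γ] [DecidableEq γ] [Fintype κ] {H : κ → Finset γ}
    {a b : ℕ} (ha : ∀ i, (Finset.univ.filter fun c => i ∈ H c).card ≤ a) (hb : ∀ c, (H c).card ≤ b)
    (i : γ) : (checkNbrs H i).card ≤ a * b :=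
  (Finset.card_biUnion_le_card_mul _ _ b fun c _ => hb c).trans (Nat.mul_le_mul_right _ (ha i))

/-- The common kernel of parity checks with the given supports is local. -/
theorem isLocal_of_checks {γ κ : Type} [Fintype γ] [DecidableEq γ] [Fintype κ]
    {H : κ → Finset γ} {τ : Type} (h : τ → Bits γ) (hh : ∀ t, ∃ c, bitSupp (h t) ⊆ H c)
    {Loc : Submodule (ZMod 2) (Bits γ)} (hLoc : ∀ b, b ∈ Loc ↔ ∀ t, h t ⬝ᵥ b = 0) :
    IsLocal (checkNbrs H) Loc := by
  intro b hb K hK hclosed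
  rw [hLoc] at hb ⊢
  intro t
  obtain ⟨c, hc⟩ := hh t
  -- A check that meets `K` sees no other point of the support of `b`, because `K` is closed under
  -- adjacency; so its value on the restriction is its value on `b`. Any other check gives zero.
  by_cases hex : ∃ x ∈ K, h t x ≠ 0
  · obtain ⟨x, hx, hx'⟩ := hex
    rw [← hb t]
    refine Finset.sum_congr rfl fun y _ => ?_
    by_cases hy : h t y = 0
    · rw [hy, zero_mul, zero_mul]
    · congr 1
      unfold restr
      split_ifs with hyK
      · rfl
      · by_contra hne
        exact hyK (hclosed x hx y (mem_bitSupp.2 (Ne.symm hne))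
          (mem_checkNbrs.2 ⟨c, hc (mem_bitSupp.2 hx'), hc (mem_bitSupp.2 hy)⟩))
  · push Not at hex
    refine Finset.sum_eq_zero fun y _ => ?_
    unfold restr
    split_ifs with hy
    · rw [hex y hy, zero_mul]
    · rw [mul_zero]

variable {Q : CSSCode n} (L : LogicalBasis Q)

/-- The outcomes without errors, of a block that is measured in the basis `m`. -/
def CSSCode.outcomes (Q : CSSCode n) : Basis → Submodule (ZMod 2) (Bits (Fin n))
  | .std => LinearMap.ker Q.HZ.mulVecLin
  | .had => LinearMap.ker Q.HX.mulVecLin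

theorem CSSCode.mem_outcomes (Q : CSSCode n) (m : Basis) (z : Bits (Fin n)) :
    z ∈ Q.outcomes m ↔ Q.inKer m z := by
  cases m <;> rfl

theorem LogicalBasis.read_add (m : Basis) (y z : Bits (Fin n)) :
    L.read m (y + z) = L.read m y + L.read m z := by
  cases m <;> exact Matrix.mulVec_add _ _ _

theorem CSSCode.mem_rowSpace_HX_of_card_lt (Q : CSSCode n) {y : Bits (Fin n)}
    (hy : Q.HZ *ᵥ y = 0) (hlt : (bitSupp y).card < Q.dist) : y ∈ rowSpace Q.HX := by
  by_contra h
  exact Nat.notMem_of_lt_sInf hlt ⟨y, rfl, Or.inl ⟨hy, h⟩⟩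

theorem CSSCode.mem_rowSpace_HZ_of_card_lt (Q : CSSCode n) {y : Bits (Fin n)}
    (hy : Q.HX *ᵥ y = 0) (hlt : (bitSupp y).card < Q.dist) : y ∈ rowSpace Q.HZ := by
  by_contra h
  exact Nat.notMem_of_lt_sInf hlt ⟨y, rfl, Or.inr ⟨hy, h⟩⟩

theorem LogicalBasis.read_eq_zero {m : Basis} {z : Bits (Fin n)} (h : Q.inKer m z)
    (hlt : (bitSupp z).card < Q.dist) : L.read m z = 0 := by
  cases m with
  | std => exact mulVec_eq_zero_of_mem_rowSpace L.commZ (Q.mem_rowSpace_HX_of_card_lt h hlt)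
  | had => exact mulVec_eq_zero_of_mem_rowSpace L.commX (Q.mem_rowSpace_HZ_of_card_lt h hlt)

/-- Minimum weight decoding of a block. -/
def LogicalBasis.decoder (m : Basis) (z : Bits (Fin n)) : Bits (Fin Q.k) :=
  L.read m (z + minWeight (Q.outcomes m) z)

/-- The minimum weight decoder succeeds unless the errors fill half of a large cluster. -/
theorem LogicalBasis.decoder_eq {f : Fin n → Finset (Fin n)}
    (hsymm : ∀ x y, y ∈ f x → x ∈ f y) (m : Basis) (hloc : IsLocal f (Q.outcomes m))
    {R : Finset (Fin n)}
    (hR : ¬ ∃ K v, IsCluster f K v ∧ Q.dist ≤ K.card ∧ K.card ≤ 2 * (R ∩ K).card)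
    {z e : Bits (Fin n)} (he : bitSupp e ⊆ R) (hz : Q.inKer m (z + e)) :
    L.decoder m z = L.read m (z + e) := by
  set y := z + e with hy
  have hz' : z = y + e := by rw [hy, bits_add_cancel]
  have hyk := (Q.mem_outcomes m y).2 hz
  -- The error-free outcome drops out of the decoder's guess. It remains to see that the residual is
  -- read as zero, which holds because each of its components is smaller than the distance.
  rw [LogicalBasis.decoder, hz', minWeight_add hyk, add_assoc, L.read_add]
  convert add_zero _
  set b := e + minWeight (Q.outcomes m) e with hb
  have hbm : b ∈ Q.outcomes m := (minWeight_spec _ e).1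
  have hsum := sum_restr_components hsymm b
  have hread : ∀ s : Finset (Finset (Fin n)), (∀ K ∈ s, L.read m (restr b K) = 0) →
      L.read m (∑ K ∈ s, restr b K) = 0 := by
    intro s
    induction s using Finset.induction_on with
    | empty => intro _; cases m <;> exact Matrix.mulVec_zero _
    | insert a s ha ih =>
      intro h
      rw [Finset.sum_insert ha, L.read_add, h a (Finset.mem_insert_self _ _),
        ih fun K hK => h K (Finset.mem_insert_of_mem hK), add_zero]
  rw [← hsum]
  refine hread _ fun K hK => L.read_eq_zero
    ((Q.mem_outcomes m _).1 (restr_mem_of_mem_components hloc hbm hK)) ?_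
  rw [bitSupp_restr (subset_of_mem_components hK)]
  by_contra! hlt
  obtain ⟨v, hv⟩ : K.Nonempty := by
    obtain ⟨u, hu, rfl⟩ := Finset.mem_image.1 hK
    exact ⟨u, mem_component_self hu⟩
  refine hR ⟨K, v, isCluster_of_mem_components hsymm hK hv, hlt,
    (card_component_le hloc e hK).trans ?_⟩
  exact Nat.mul_le_mul_left _ (Finset.card_le_card (Finset.inter_subset_inter_right he))

end

/-! ### Hadamard and CNOT gates -/

theorem pauliOp_conj_of_mul_eq {ι : Type} [Fintype ι] [DecidableEq ι] {U : Op ι}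
    (hU : U ∈ Matrix.unitaryGroup (Bits ι) ℂ)
    (h : ∀ P : Pauli ι, ∃ (P' : Pauli ι) (c : ℂ), U * pauliOp P = c • (pauliOp P' * U)) :
    IsClifford U := by
  refine ⟨hU, fun P => ?_⟩
  obtain ⟨P', c, h⟩ := h P
  exact ⟨P', c, by rw [h, smul_mul_assoc, mul_assoc, unitary_mul_star hU, mul_one]⟩

/-- The Hadamard gate. -/
def hadamard : Op (Fin 1) := ketMatrix fun _ => .had

theorem hadamard_unitary : hadamard ∈ Matrix.unitaryGroup (Bits (Fin 1)) ℂ :=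
  Matrix.mem_unitaryGroup_iff'.2 (ketMatrix_unitary _)

theorem hadamard_apply (y x : Bits (Fin 1)) :
    hadamard y x = bsign (y 0 * x 0) * (((Real.sqrt 2)⁻¹ : ℝ) : ℂ) := by
  simp [hadamard, ketMatrix, Basis.ket]

theorem hadamard_clifford : IsClifford hadamard := by
  refine pauliOp_conj_of_mul_eq hadamard_unitary fun P => ?_
  refine ⟨(P.2, P.1), bsign (P.1 0 * P.2 0), Matrix.ext_of_mulVec_single fun x => ?_⟩
  rw [Matrix.smul_mulVec, ← Matrix.mulVec_mulVec, ← Matrix.mulVec_mulVec]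
  generalize (Pi.single x 1 : State (Fin 1)) = ψ
  funext y
  have key : ∀ (φ : State (Fin 1)) y, (hadamard *ᵥ φ) y =
      ∑ t, bsign (y 0 * t 0) * (((Real.sqrt 2)⁻¹ : ℝ) : ℂ) * φ t := by
    intro φ y
    simp only [Matrix.mulVec, dotProduct, hadamard_apply]
  rw [Pi.smul_apply, pauliOp_mulVec, key, key, smul_eq_mul, Finset.mul_sum, Finset.mul_sum]
  refine Fintype.sum_equiv (Equiv.addRight P.1) _ _ fun t => ?_
  rw [pauliOp_mulVec]
  simp only [Fin.sum_univ_one, Equiv.coe_addRight, Pi.add_apply]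
  have h : ∀ a b y t : ZMod 2, bsign (y * t) * bsign (b * (t + a)) =
      bsign (a * b) * (bsign (a * (y + b)) * bsign ((y + b) * (t + a))) := by
    intro a b y t
    rw [← bsign_add, ← bsign_add, ← bsign_add]
    congr 1
    revert a b y t
    decide
  linear_combination (((Real.sqrt 2)⁻¹ : ℝ) : ℂ) * ψ (t + P.1) * h (P.1 0) (P.2 0) (y 0) (t 0)

/-- The CNOT gate, with control `0` and target `1`. -/
def cnot : Op (Fin 2) :=
  Matrix.of fun y x => if x = ![y 0, y 1 + y 0] then 1 else 0

theorem cnot_mulVec (ψ : State (Fin 2)) (y : Bits (Fin 2)) :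
    (cnot *ᵥ ψ) y = ψ ![y 0, y 1 + y 0] := by
  simp [cnot, Matrix.mulVec, dotProduct]

theorem cnot_mul_cnot : cnot * cnot = 1 := by
  refine Matrix.ext_of_mulVec_single fun x => ?_
  rw [← Matrix.mulVec_mulVec, Matrix.one_mulVec]
  generalize (Pi.single x 1 : State (Fin 2)) = ψ
  funext y
  rw [cnot_mulVec, cnot_mulVec]
  congr 1
  funext i
  fin_cases i
  · rfl
  · simp [add_assoc, CharTwo.add_self_eq_zero]

theorem cnot_unitary : cnot ∈ Matrix.unitaryGroup (Bits (Fin 2)) ℂ := by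
  have h : star cnot = cnot := by
    ext y x
    simp only [Matrix.star_apply, cnot, Matrix.of_apply, apply_ite star, star_one, star_zero]
    refine if_congr ?_ rfl rfl
    revert x y
    decide
  rw [Matrix.mem_unitaryGroup_iff', h, cnot_mul_cnot]

theorem cnot_clifford : IsClifford cnot := by
  refine pauliOp_conj_of_mul_eq cnot_unitary fun P => ?_
  refine ⟨(![P.1 0, P.1 1 + P.1 0], ![P.2 0 + P.2 1, P.2 1]), 1,
    Matrix.ext_of_mulVec_single fun x => ?_⟩
  rw [one_smul, ← Matrix.mulVec_mulVec, ← Matrix.mulVec_mulVec]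
  generalize (Pi.single x 1 : State (Fin 2)) = ψ
  funext y
  rw [pauliOp_mulVec, cnot_mulVec, cnot_mulVec, pauliOp_mulVec]
  have h2 : (2 : ZMod 2) = 0 := by decide
  congr 2
  · simp [Fin.sum_univ_two]
    linear_combination (-(P.2 1 * P.1 0)) * h2
  · funext i
    fin_cases i
    · simp
    · simp
      linear_combination (-(P.1 0)) * h2

section
variable {ι : Type} [Fintype ι] [DecidableEq ι]

/-- The Hadamard gate on the qubit `i`. -/
def hadamardGate (i : ι) : Gate ι where
  arity := 1
  pos := ⟨fun _ => i, fun _ _ _ => Subsingleton.elim _ _⟩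
  op := hadamard
  unitary := hadamard_unitary

/-- The CNOT gate with control `e.1` and target `e.2`. -/
def cnotGate (e : {e : ι × ι // e.1 ≠ e.2}) : Gate ι where
  arity := 2
  pos := ⟨![e.1.1, e.1.2], by
    intro a b h
    fin_cases a <;> fin_cases b
    · rfl
    · exact absurd h e.2
    · exact absurd h.symm e.2
    · rfl⟩
  op := cnot
  unitary := cnot_unitary

open Classical in
/-- The indicator function of a set of bit strings. -/
def indicatorState (A : Set (Bits ι)) : State ι := fun x => if x ∈ A then 1 else 0

theorem indicatorState_congr {ι' : Type} {A : Set (Bits ι)} {B : Set (Bits ι')} {x : Bits ι}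
    {y : Bits ι'} (h : x ∈ A ↔ y ∈ B) : indicatorState A x = indicatorState B y := by
  by_cases hx : x ∈ A
  · exact (if_pos hx).trans (if_pos (h.1 hx)).symm
  · exact (if_neg hx).trans (if_neg (mt h.2 hx)).symm

/-- On the support of the input the qubit `i` is zero, so only one term of the Hadamard sum
survives, with a constant amplitude. -/
theorem hadamardGate_mulVec (i : ι) (S : Set ι) (hi : i ∉ S) :
    liftOp (hadamardGate i).pos (hadamardGate i).op *ᵥ
      indicatorState {x : Bits ι | ∀ j, j ∉ S → x j = 0} =
    (((Real.sqrt 2)⁻¹ : ℝ) : ℂ) • indicatorState {x : Bits ι | ∀ j, j ∉ insert i S → x j = 0} := by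
  funext y
  rw [liftOp_mulVec]
  have hov : ∀ (u : Bits (Fin (hadamardGate i).arity)) j,
      j ≠ i → overwrite (hadamardGate i).pos u y j = y j := by
    intro u j hj
    refine overwrite_of_notMem _ _ _ ?_
    rintro ⟨a, ha⟩
    exact hj ha.symm
  have hov' : ∀ u : Bits (Fin (hadamardGate i).arity),
      overwrite (hadamardGate i).pos u y i = u (0 : Fin 1) :=
    fun u => overwrite_apply (hadamardGate i).pos u y (0 : Fin 1)
  refine (Finset.sum_eq_single (0 : Bits (Fin 1)) ?_ ?_).trans ?_
  · intro u _ hu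
    have : overwrite (hadamardGate i).pos u y ∉ {x : Bits ι | ∀ j, j ∉ S → x j = 0} := by
      intro h
      apply hu
      funext a
      obtain rfl : a = 0 := Subsingleton.elim _ _
      have := h i hi
      exact (hov' u).symm.trans this
    rw [indicatorState, if_neg this, mul_zero]
  · intro h
    exact absurd (Finset.mem_univ _) h
  · have h1 : (hadamardGate i).op (y ∘ (hadamardGate i).pos) (0 : Bits (Fin 1)) =
        (((Real.sqrt 2)⁻¹ : ℝ) : ℂ) := by
      refine (hadamard_apply _ _).trans ?_
      simp
    rw [h1, Pi.smul_apply, smul_eq_mul]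
    congr 1
    refine indicatorState_congr ?_
    simp only [Set.mem_ofPred_eq, Set.mem_insert_iff, not_or]
    constructor
    · intro h j hj
      rw [← hov 0 j hj.1]
      exact h j hj.2
    · intro h j hj
      by_cases hji : j = i
      · subst hji; exact hov' 0
      · exact (hov 0 j hji).trans (h j ⟨hji, hj⟩)

theorem hadamard_layer (l : List ι) (hl : l.Nodup) : ∃ c : ℂ,
    layerListOp (l.map hadamardGate) *ᵥ zeroState ι =
      c • indicatorState {x : Bits ι | ∀ j, j ∉ l → x j = 0} := by
  induction l with
  | nil =>
    refine ⟨(((Real.sqrt ((({0} : Set (Bits ι))).ncard : ℝ))⁻¹ : ℝ) : ℂ), ?_⟩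
    funext x
    simp only [layerListOp, List.map_nil, List.prod_nil, Matrix.one_mulVec, zeroState]
    have hx : x ∈ {x : Bits ι | ∀ j, j ∉ ([] : List ι) → x j = 0} ↔ x ∈ ({0} : Set (Bits ι)) := by
      simp [funext_iff]
    rw [Pi.smul_apply, indicatorState_congr hx, smul_eq_mul]
    by_cases h0 : x ∈ ({0} : Set (Bits ι))
    · refine (if_pos h0).trans ?_
      rw [indicatorState, if_pos h0, mul_one]
    · refine (if_neg h0).trans ?_
      rw [indicatorState, if_neg h0, mul_zero]
  | cons i l ih =>
    rw [List.nodup_cons] at hl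
    obtain ⟨c, hc⟩ := ih hl.2
    refine ⟨c * (((Real.sqrt 2)⁻¹ : ℝ) : ℂ), ?_⟩
    have h : layerListOp ((i :: l).map hadamardGate) =
      liftOp (hadamardGate i).pos (hadamardGate i).op * layerListOp (l.map hadamardGate) := by
      simp [layerListOp]
    rw [h, ← Matrix.mulVec_mulVec, hc, Matrix.mulVec_smul]
    have h2 := hadamardGate_mulVec i {j | j ∈ l} hl.1
    have h3 : ∀ j, j ∉ insert i {j | j ∈ l} ↔ j ∉ i :: l := by
      intro j; simp
    simp only [h3] at h2
    change c • (_ *ᵥ indicatorState {x : Bits ι | ∀ j, j ∉ {j | j ∈ l} → x j = 0}) = _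
    rw [h2, smul_smul]

theorem cnotGate_mulVec (e : {e : ι × ι // e.1 ≠ e.2}) (ψ : State ι) (y : Bits ι) :
    (liftOp (cnotGate e).pos (cnotGate e).op *ᵥ ψ) y =
      ψ (Function.update y e.1.2 (y e.1.2 + y e.1.1)) := by
  rw [liftOp_mulVec]
  have h := cnot_mulVec (fun u => ψ (overwrite (cnotGate e).pos u y)) (y ∘ (cnotGate e).pos)
  refine h.trans ?_
  congr 1
  funext j
  by_cases h1 : j = e.1.1
  · have : j = (cnotGate e).pos (0 : Fin 2) := h1
    rw [Function.update_of_ne (by rw [h1]; exact e.2), this]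
    exact overwrite_apply (cnotGate e).pos _ y (0 : Fin 2)
  · by_cases h2 : j = e.1.2
    · subst h2
      rw [Function.update_self]
      exact overwrite_apply (cnotGate e).pos _ y (1 : Fin 2)
    · rw [Function.update_of_ne h2]
      refine overwrite_of_notMem (cnotGate e).pos _ y ?_
      rintro ⟨a, ha⟩
      have : ∀ a : Fin 2, (cnotGate e).pos a = e.1.1 ∨ (cnotGate e).pos a = e.1.2 := by
        intro a
        fin_cases a
        · exact Or.inl rfl
        · exact Or.inr rfl
      rcases this a with h | h
      · exact h1 (ha.symm.trans h)
      · exact h2 (ha.symm.trans h)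

variable (ctrl : ι → Prop)

/-- The bit strings whose target bits are given by the control bits through a list of edges. -/
def edgeCode (l : List {e : ι × ι // e.1 ≠ e.2}) : Set (Bits ι) :=
  {x | ∀ t, ¬ ctrl t → x t = (l.map fun e => if e.1.2 = t then x e.1.1 else 0).sum}

/-- No control is ever a target, so a CNOT leaves all the sums over the other edges unchanged and
only adds its own term. -/
theorem cnot_layer (l L : List {e : ι × ι // e.1 ≠ e.2})
    (hl : ∀ e ∈ l, ctrl e.1.1 ∧ ¬ ctrl e.1.2) (hL : ∀ e ∈ L, ctrl e.1.1 ∧ ¬ ctrl e.1.2) :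
    layerListOp (l.map cnotGate) *ᵥ indicatorState (edgeCode ctrl L) =
      indicatorState (edgeCode ctrl (l ++ L)) := by
  induction l with
  | nil => simp [layerListOp]
  | cons e l ih =>
    have hl' : ∀ e ∈ l ++ L, ctrl e.1.1 ∧ ¬ ctrl e.1.2 := by
      intro e' he'
      rcases List.mem_append.1 he' with h | h
      · exact hl e' (List.mem_cons_of_mem _ h)
      · exact hL e' h
    have h : layerListOp ((e :: l).map cnotGate) =
      liftOp (cnotGate e).pos (cnotGate e).op * layerListOp (l.map cnotGate) := by
      simp [layerListOp]
    rw [h, ← Matrix.mulVec_mulVec, ih fun e' he' => hl e' (List.mem_cons_of_mem _ he')]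
    funext y
    rw [cnotGate_mulVec]
    refine indicatorState_congr ?_
    have he := hl e List.mem_cons_self
    have hsum : ∀ t, ((l ++ L).map fun e' => if e'.1.2 = t then
        Function.update y e.1.2 (y e.1.2 + y e.1.1) e'.1.1 else 0).sum =
        ((l ++ L).map fun e' => if e'.1.2 = t then y e'.1.1 else 0).sum := by
      intro t
      congr 1
      refine List.map_congr_left fun e' he' => ?_
      rw [Function.update_of_ne]
      intro heq
      exact he.2 (heq ▸ (hl' e' he').1)
    simp only [edgeCode, Set.mem_ofPred_eq, hsum, List.cons_append, List.map_cons, List.sum_cons]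
    refine forall_congr' fun t => imp_congr_right fun _ => ?_
    by_cases ht : e.1.2 = t
    · subst ht
      rw [Function.update_self, if_pos rfl]
      generalize ((l ++ L).map fun e' => if e'.1.2 = e.1.2 then y e'.1.1 else 0).sum = s
      generalize y e.1.2 = a
      generalize y e.1.1 = b
      revert a b s
      decide
    · rw [Function.update_of_ne (Ne.symm ht), if_neg ht, zero_add]

end

/-! ### CSS states of bipartite graphs -/

section
variable {ι : Type} [Fintype ι] [DecidableEq ι]

/-- The bit strings whose target bits are the sums of the adjacent control bits. -/
def graphCode (ctrl : ι → Prop) (M : ι → ι → ZMod 2) : Set (Bits ι) :=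
  {x | ∀ t, ¬ ctrl t → x t = ∑ y, M t y * x y}

theorem range_cnotGate (e : {e : ι × ι // e.1 ≠ e.2}) :
    Set.range (cnotGate e).pos = {e.1.1, e.1.2} := by
  ext i
  simp only [Set.mem_range, Set.mem_insert_iff, Set.mem_singleton_iff]
  constructor
  · rintro ⟨a, rfl⟩
    have : ∀ a : Fin 2, (cnotGate e).pos a = e.1.1 ∨ (cnotGate e).pos a = e.1.2 := by
      intro a
      fin_cases a
      · exact Or.inl rfl
      · exact Or.inr rfl
    exact this a
  · rintro (rfl | rfl)
    · exact ⟨(0 : Fin 2), rfl⟩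
    · exact ⟨(1 : Fin 2), rfl⟩

theorem range_hadamardGate (i : ι) : Set.range (hadamardGate i).pos = {i} := by
  ext j
  simp only [Set.mem_range, Set.mem_singleton_iff]
  exact ⟨fun ⟨_, ha⟩ => ha.symm, fun h => ⟨(0 : Fin 1), h.symm⟩⟩

/-- The resulting list is described only through sums over it, since the order in which the edges
were applied is irrelevant. -/
theorem foldl_cnot_layers {κ : Type} (ctrl : ι → Prop)
    (E : κ → Finset {e : ι × ι // e.1 ≠ e.2})
    (hE : ∀ k, ∀ e ∈ E k, ctrl e.1.1 ∧ ¬ ctrl e.1.2) (ks : List κ)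
    (L : List {e : ι × ι // e.1 ≠ e.2}) (hL : ∀ e ∈ L, ctrl e.1.1 ∧ ¬ ctrl e.1.2) :
    ∃ L' : List {e : ι × ι // e.1 ≠ e.2},
      (ks.map fun k => (E k).toList.map cnotGate).foldl (fun ψ l => layerListOp l *ᵥ ψ)
        (indicatorState (edgeCode ctrl L)) = indicatorState (edgeCode ctrl L') ∧
      ∀ f : {e : ι × ι // e.1 ≠ e.2} → ZMod 2, (L'.map f).sum =
        (ks.map fun k => ∑ e ∈ E k, f e).sum + (L.map f).sum := by
  induction ks generalizing L with
  | nil => exact ⟨L, rfl, fun f => by simp⟩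
  | cons k ks ih =>
    have hk : ∀ e ∈ (E k).toList, ctrl e.1.1 ∧ ¬ ctrl e.1.2 := fun e he =>
      hE k e (Finset.mem_toList.1 he)
    obtain ⟨L', h1, h2⟩ := ih ((E k).toList ++ L) (by
      intro e he
      rcases List.mem_append.1 he with he | he
      · exact hk e he
      · exact hL e he)
    refine ⟨L', ?_, fun f => ?_⟩
    · rw [List.map_cons, List.foldl_cons, cnot_layer ctrl _ _ hk hL, h1]
    · rw [h2, List.map_append, List.sum_append, Finset.sum_map_toList, List.map_cons,
        List.sum_cons]
      abel

/-- The local numbers serve to colour the edges: an edge is determined by one endpoint and its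
number there. -/
theorem exists_neighbour_numbering (r : ι → ι → Prop) (Δ : ℕ)
    (hΔ : ∀ x, ∃ s : Finset ι, (∀ y, r x y → y ∈ s) ∧ s.card ≤ Δ) :
    ∃ f : ι → ι → ℕ, (∀ x y, r x y → f x y < Δ) ∧
      ∀ x y z, r x y → r x z → f x y = f x z → y = z := by
  classical
  choose s hs hcard using hΔ
  refine ⟨fun x y => if h : y ∈ s x then (s x).equivFin ⟨y, h⟩ else 0, fun x y h => ?_,
    fun x y z hy hz h => ?_⟩
  · simp only [dif_pos (hs x y h)]
    exact lt_of_lt_of_le (Fin.is_lt _) (hcard x)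
  · simp only [dif_pos (hs x y hy), dif_pos (hs x z hz)] at h
    have := (s x).equivFin.injective (Fin.ext h)
    exact congrArg Subtype.val this

/-- Colour an edge by the pair of its numbers at its two ends. Two edges of one colour that share an
endpoint coincide, so each of the `Δ * Δ` colours is a layer of disjoint CNOT gates; one layer of
Hadamard gates on the controls comes first. -/
theorem exists_graphCode_layers (ctrl : ι → Prop) (M : ι → ι → ZMod 2)
    (hsymm : ∀ x y, M x y = M y x) (hbip : ∀ x y, M x y ≠ 0 → (ctrl x ↔ ¬ ctrl y)) (Δ : ℕ)
    (hΔ : ∀ x, ∃ s : Finset ι, (∀ y, M x y ≠ 0 → y ∈ s) ∧ s.card ≤ Δ) :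
    ∃ Ls : List (List (Gate ι)), Ls.length ≤ 1 + Δ * Δ ∧
      (∀ l ∈ Ls, DisjointGates l ∧ ∀ g ∈ l, g.arity ≤ 2 ∧ IsClifford g.op) ∧
      ∃ c : ℂ, Ls.foldl (fun ψ l => layerListOp l *ᵥ ψ) (zeroState ι) =
        c • indicatorState (graphCode ctrl M) := by
  classical
  obtain ⟨f, hf1, hf2⟩ := exists_neighbour_numbering (fun x y => M x y ≠ 0) Δ hΔ
  let E : ℕ × ℕ → Finset {e : ι × ι // e.1 ≠ e.2} := fun k => Finset.univ.filter fun e =>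
    (ctrl e.1.1 ∧ ¬ ctrl e.1.2) ∧ M e.1.1 e.1.2 ≠ 0 ∧ (f e.1.1 e.1.2, f e.1.2 e.1.1) = k
  have hE : ∀ k, ∀ e ∈ E k, ctrl e.1.1 ∧ ¬ ctrl e.1.2 := fun k e he =>
    (Finset.mem_filter.1 he).2.1
  have hsw : ∀ x y, M x y ≠ 0 → M y x ≠ 0 := fun x y h => by rwa [hsymm]
  obtain ⟨c, hc⟩ := hadamard_layer (Finset.univ.filter ctrl).toList (Finset.nodup_toList _)
  obtain ⟨L', h1, h2⟩ := foldl_cnot_layers ctrl E hE (Finset.range Δ ×ˢ Finset.range Δ).toList []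
    (by simp)
  refine ⟨(Finset.univ.filter ctrl).toList.map hadamardGate ::
    (Finset.range Δ ×ˢ Finset.range Δ).toList.map fun k => (E k).toList.map cnotGate, ?_, ?_, c, ?_⟩
  · simp [add_comm]
  · intro l hl
    rcases List.mem_cons.1 hl with rfl | hl
    · constructor
      · refine List.pairwise_map.2 (List.Nodup.pairwise_of_forall_ne (Finset.nodup_toList _) ?_)
        intro i _ j _ hij
        rw [range_hadamardGate, range_hadamardGate]
        simpa using hij
      · intro g hg
        obtain ⟨i, -, rfl⟩ := List.mem_map.1 hg
        exact ⟨by simp [hadamardGate], hadamard_clifford⟩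
    · obtain ⟨k, -, rfl⟩ := List.mem_map.1 hl
      constructor
      · refine List.pairwise_map.2 (List.Nodup.pairwise_of_forall_ne (Finset.nodup_toList _) ?_)
        intro e he e' he' hee
        rw [Finset.mem_toList, Finset.mem_filter] at he he'
        obtain ⟨-, he1, he2, he3⟩ := he
        obtain ⟨-, he1', he2', he3'⟩ := he'
        rw [range_cnotGate, range_cnotGate, Set.disjoint_left]
        have h3 := he3.trans he3'.symm
        simp only [Prod.mk.injEq] at h3
        rintro i hi hi'
        simp only [Set.mem_insert_iff, Set.mem_singleton_iff] at hi hi'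
        rcases hi with hi | hi <;> rcases hi' with hi' | hi'
        · have h4 : e.1.1 = e'.1.1 := hi.symm.trans hi'
          rw [← h4] at he2' h3
          exact hee (Subtype.ext (Prod.ext h4 (hf2 _ _ _ he2 he2' h3.1)))
        · exact he1'.2 (hi' ▸ hi ▸ he1.1)
        · exact he1.2 (hi ▸ hi' ▸ he1'.1)
        · have h4 : e.1.2 = e'.1.2 := hi.symm.trans hi'
          rw [← h4] at he2' h3
          exact hee (Subtype.ext (Prod.ext (hf2 _ _ _ (hsw _ _ he2) (hsw _ _ he2') h3.2) h4))
      · intro g hg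
        obtain ⟨e, -, rfl⟩ := List.mem_map.1 hg
        exact ⟨by simp [cnotGate], cnot_clifford⟩
  · rw [List.foldl_cons, hc]
    have h3 : ∀ (Ls : List (List (Gate ι))) (c : ℂ) (φ : State ι),
        Ls.foldl (fun ψ l => layerListOp l *ᵥ ψ) (c • φ) =
          c • Ls.foldl (fun ψ l => layerListOp l *ᵥ ψ) φ := by
      intro Ls
      induction Ls with
      | nil => intros; rfl
      | cons l Ls ih => intro c φ; rw [List.foldl_cons, List.foldl_cons, Matrix.mulVec_smul, ih]
    rw [h3]
    have h4 : {x : Bits ι | ∀ j, j ∉ (Finset.univ.filter ctrl).toList → x j = 0} =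
        edgeCode ctrl [] := by
      ext x
      simp [edgeCode]
    rw [h4, h1]
    congr 2
    ext x
    refine forall_congr' fun t => imp_congr_right fun ht => ?_
    rw [h2]
    have h5 : (List.map (fun k => ∑ e ∈ E k, if e.1.2 = t then x e.1.1 else 0)
        (Finset.range Δ ×ˢ Finset.range Δ).toList).sum + (List.map
          (fun e : {e : ι × ι // e.1 ≠ e.2} => if e.1.2 = t then x e.1.1 else 0) []).sum =
          ∑ y, M t y * x y := by
      rw [Finset.sum_map_toList, List.map_nil, List.sum_nil, add_zero]
      have h6 : ∀ k, E k = (Finset.univ.filter fun e : {e : ι × ι // e.1 ≠ e.2} =>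
          (ctrl e.1.1 ∧ ¬ ctrl e.1.2) ∧ M e.1.1 e.1.2 ≠ 0).filter
            fun e => (f e.1.1 e.1.2, f e.1.2 e.1.1) = k := by
        intro k
        ext e
        simp [E, and_assoc]
      simp_rw [h6]
      rw [Finset.sum_fiberwise_of_maps_to]
      swap
      · intro e he
        simp only [Finset.mem_filter, Finset.mem_univ, true_and] at he
        simp only [Finset.mem_product, Finset.mem_range]
        exact ⟨hf1 _ _ he.2, hf1 _ _ (hsw _ _ he.2)⟩
      rw [Finset.sum_ite, Finset.sum_const_zero, add_zero, Finset.filter_filter]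
      symm
      rw [← Finset.sum_filter_of_ne (s := Finset.univ) (p := fun y => M t y ≠ 0)
        (fun y _ h hM => h (by rw [hM, zero_mul]))]
      refine Finset.sum_bij' (fun y hy => (⟨(y, t), fun h : y = t => by
          subst h
          have := hbip _ _ (Finset.mem_filter.1 hy).2
          tauto⟩ : {e : ι × ι // e.1 ≠ e.2})) (fun e _ => e.1.1) ?_ ?_ ?_ ?_ ?_
      · intro y hy
        have hM := (Finset.mem_filter.1 hy).2
        have hb := hbip _ _ hM
        have hM' := hsw _ _ hM
        simp only [Finset.mem_filter, Finset.mem_univ, true_and]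
        tauto
      · intro e he
        simp only [Finset.mem_filter, Finset.mem_univ, true_and] at he ⊢
        rw [← he.2]
        exact hsw _ _ he.1.2
      · intros; rfl
      · intro e he
        simp only [Finset.mem_filter, Finset.mem_univ, true_and] at he
        exact Subtype.ext (Prod.ext rfl he.2.symm)
      · intro y hy
        have hM := (Finset.mem_filter.1 hy).2
        rcases zmod2_cases (M t y) with h | h
        · exact absurd h hM
        · rw [h, one_mul]
    rw [h5]

end

/-! ### Stabilizers of the CSS state of a bipartite graph -/

section
variable {ι : Type} [Fintype ι] [DecidableEq ι]

theorem add_mem_graphCode {ctrl : ι → Prop} {M : ι → ι → ZMod 2} {a b : Bits ι}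
    (ha : a ∈ graphCode ctrl M) (hb : b ∈ graphCode ctrl M) : a + b ∈ graphCode ctrl M := by
  intro t ht
  simp only [Pi.add_apply, mul_add, Finset.sum_add_distrib]
  rw [ha t ht, hb t ht]

theorem zero_mem_graphCode (ctrl : ι → Prop) (M : ι → ι → ZMod 2) : 0 ∈ graphCode ctrl M := by
  intro t _
  simp

theorem sum_mem_graphCode {ctrl : ι → Prop} {M : ι → ι → ZMod 2} {α : Type} (s : Finset α)
    (f : α → Bits ι) (h : ∀ a ∈ s, f a ∈ graphCode ctrl M) :
    ∑ a ∈ s, f a ∈ graphCode ctrl M := by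
  classical
  induction s using Finset.induction_on with
  | empty => exact zero_mem_graphCode _ _
  | insert a s ha ih =>
    rw [Finset.sum_insert ha]
    exact add_mem_graphCode (h a (Finset.mem_insert_self _ _))
      (ih fun b hb => h b (Finset.mem_insert_of_mem hb))

/-- At a control, expand the bit of `b` over the neighbours; at a target, expand the bit of `a`.
Every edge then contributes the same term twice. -/
theorem graphCode_dot (ctrl : ι → Prop) (M : ι → ι → ZMod 2) (hsymm : ∀ x y, M x y = M y x)
    (hbip : ∀ x y, M x y ≠ 0 → (ctrl x ↔ ¬ ctrl y)) {a b : Bits ι}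
    (ha : a ∈ graphCode ctrl M) (hb : b ∈ graphCode (fun x => ¬ ctrl x) M) :
    ∑ i, b i * a i = 0 := by
  classical
  have h1 : ∀ i, b i * a i = ∑ y, ((if ctrl i then M i y * b y * a i else 0) +
      if ctrl y then M i y * b i * a y else 0) := by
    intro i
    by_cases hi : ctrl i
    · rw [hb i (not_not.2 hi), Finset.sum_mul]
      refine Finset.sum_congr rfl fun y _ => ?_
      rw [if_pos hi]
      by_cases hM : M i y = 0
      · simp [hM]
      · rw [if_neg ((hbip _ _ hM).1 hi), add_zero]
    · rw [ha i hi, Finset.mul_sum]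
      refine Finset.sum_congr rfl fun y _ => ?_
      rw [if_neg hi, zero_add]
      by_cases hM : M i y = 0
      · simp [hM]
      · rw [if_pos (by by_contra hy; exact hi ((hbip _ _ hM).2 hy))]
        ring
  simp_rw [h1, Finset.sum_add_distrib]
  rw [Finset.sum_comm (f := fun i y => if ctrl y then M i y * b i * a y else 0),
    ← Finset.sum_add_distrib]
  refine Finset.sum_eq_zero fun i _ => ?_
  rw [← Finset.sum_add_distrib]
  refine Finset.sum_eq_zero fun y _ => ?_
  rw [hsymm y i]
  exact CharTwo.add_self_eq_zero _

/-- The `X` part translates the code by one of its elements, and the `Z` part is orthogonal to the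
code. -/
theorem pauliOp_graphCode (ctrl : ι → Prop) (M : ι → ι → ZMod 2) (hsymm : ∀ x y, M x y = M y x)
    (hbip : ∀ x y, M x y ≠ 0 → (ctrl x ↔ ¬ ctrl y)) {P : Pauli ι}
    (ha : P.1 ∈ graphCode ctrl M) (hb : P.2 ∈ graphCode (fun x => ¬ ctrl x) M) :
    pauliOp P *ᵥ indicatorState (graphCode ctrl M) = indicatorState (graphCode ctrl M) := by
  funext y
  rw [pauliOp_mulVec]
  have h : indicatorState (graphCode ctrl M) (y + P.1) = indicatorState (graphCode ctrl M) y := by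
    refine indicatorState_congr ⟨fun h => ?_, fun h => add_mem_graphCode h ha⟩
    have := add_mem_graphCode h ha
    rwa [bits_add_cancel] at this
  by_cases hy : y + P.1 ∈ graphCode ctrl M
  · rw [graphCode_dot ctrl M hsymm hbip hy hb, h]
    simp [bsign]
  · rw [← h, indicatorState, if_neg hy, mul_zero]

end

/-! ### Outcomes of the measured qubits of a graph state -/

section
variable {δ β : Type} [Fintype δ] [DecidableEq δ] [Fintype β] [DecidableEq β]

/-- The support of the state is invariant under translation by `a`. Translating the summation
variable shifts the standard outcomes and produces a sign from the Hadamard ones. -/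
theorem postMeasure_graphCode_shift (m : β → Basis) (ctrl : δ ⊕ β → Prop)
    (M : δ ⊕ β → δ ⊕ β → ZMod 2) {a : Bits (δ ⊕ β)} (ha : a ∈ graphCode ctrl M) (s : Bits β)
    (z : Bits δ) :
    postMeasure m (indicatorState (graphCode ctrl M)) s z =
      bsign (∑ v, match m v with | .std => 0 | .had => s v * a (Sum.inr v)) *
        postMeasure m (indicatorState (graphCode ctrl M))
          (s + flips m (a ∘ Sum.inr, 0)) (z + a ∘ Sum.inl) := by
  simp only [postMeasure, amplitude, Finset.mul_sum]
  refine Fintype.sum_equiv (Equiv.addRight (a ∘ Sum.inr)) _ _ fun t => ?_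
  have h : indicatorState (graphCode ctrl M) (Sum.elim z t) =
      indicatorState (graphCode ctrl M)
        (Sum.elim (z + a ∘ Sum.inl) (Equiv.addRight (a ∘ Sum.inr) t)) := by
    have h1 : (Sum.elim (z + a ∘ Sum.inl) (Equiv.addRight (a ∘ Sum.inr) t) : Bits (δ ⊕ β)) =
        Sum.elim z t + a := by
      funext i
      cases i <;> rfl
    rw [h1]
    refine indicatorState_congr ⟨fun h => add_mem_graphCode h ha, fun h => ?_⟩
    have := add_mem_graphCode h ha
    rwa [bits_add_cancel] at this
  rw [h, ← mul_assoc, bsign_sum, ← Finset.prod_mul_distrib]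
  congr 1
  refine Finset.prod_congr rfl fun v _ => ?_
  simp only [flips, Pi.add_apply, Equiv.coe_addRight, Function.comp]
  cases m v
  · simp [Basis.ket, bsign]
  · simp only [Basis.ket, Pi.zero_apply, add_zero, mul_add, bsign_add]
    linear_combination (-(bsign (s v * t v) * (((Real.sqrt 2)⁻¹ : ℝ) : ℂ))) *
      bsign_mul_self (s v * a (Sum.inr v))

/-- The `X` part is any string of the code that contributes to the amplitude. If no `Z` part matched
the Hadamard outcomes, a linear functional would separate them from all matching patterns; it
defines a code word on the measured controls alone, and translating by this word changes the sign of
the amplitude, which would then vanish. -/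
theorem exists_mem_graphCode_of_postMeasure_ne_zero (m : β → Basis) (ctrl : δ ⊕ β → Prop)
    (M : δ ⊕ β → δ ⊕ β → ZMod 2) (hsymm : ∀ x y, M x y = M y x)
    (hbip : ∀ x y, M x y ≠ 0 → (ctrl x ↔ ¬ ctrl y)) (hδ : ∀ i, ctrl (Sum.inl i))
    (hm : ∀ v, m v = .had ↔ ctrl (Sum.inr v)) {s : Bits β}
    (hs : postMeasure m (indicatorState (graphCode ctrl M)) s ≠ 0) :
    ∃ P : Pauli (δ ⊕ β), P.1 ∈ graphCode ctrl M ∧ P.2 ∈ graphCode (fun x => ¬ ctrl x) M ∧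
      flips m P.right = s := by
  classical
  obtain ⟨z, hz⟩ := Function.ne_iff.1 hs
  have hz' := hz
  simp only [postMeasure, amplitude, Pi.zero_apply] at hz'
  obtain ⟨t, -, ht⟩ := Finset.exists_ne_zero_of_sum_ne_zero hz'
  have ha : (Sum.elim z t : Bits (δ ⊕ β)) ∈ graphCode ctrl M := by
    by_contra h
    exact ht (by rw [indicatorState, if_neg h, mul_zero])
  have hts : ∀ v, m v = .std → t v = s v := by
    intro v hv
    have := Finset.prod_ne_zero_iff.1 (left_ne_zero_of_mul ht) v (Finset.mem_univ _)
    rw [hv] at this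
    by_contra h
    exact this (if_neg (Ne.symm h))
  suffices hb : ∃ b ∈ graphCode (fun x => ¬ ctrl x) M, ∀ v, ctrl (Sum.inr v) →
      s v = b (Sum.inr v) by
    obtain ⟨b, hb, hbs⟩ := hb
    refine ⟨(Sum.elim z t, b), ha, hb, ?_⟩
    funext v
    simp only [flips, Pauli.right, Function.comp]
    rcases h : m v with _ | _
    · exact hts v h
    · exact (hbs v ((hm v).1 h)).symm
  -- Only the bits on measured controls are constrained; the others are free, so a functional that
  -- vanishes on `p` ignores them.
  let p : Submodule (ZMod 2) (Bits β) :=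
    { carrier := {v | ∃ b ∈ graphCode (fun x => ¬ ctrl x) M, ∀ q, ctrl (Sum.inr q) →
        v q = b (Sum.inr q)}
      add_mem' := by
        rintro v v' ⟨b, hb, h⟩ ⟨b', hb', h'⟩
        exact ⟨b + b', add_mem_graphCode hb hb', fun q hq => by
          rw [Pi.add_apply, h q hq, h' q hq]; rfl⟩
      zero_mem' := ⟨0, zero_mem_graphCode _ _, fun _ _ => rfl⟩
      smul_mem' := by
        rintro c v ⟨b, hb, h⟩
        rcases zmod2_cases c with rfl | rfl
        · rw [zero_smul]
          exact ⟨0, zero_mem_graphCode _ _, fun _ _ => rfl⟩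
        · rw [one_smul]
          exact ⟨b, hb, h⟩ }
  by_contra hcon
  have hsp : s ∉ p := hcon
  obtain ⟨f, hf, hfp⟩ := Submodule.exists_dual_map_eq_bot_of_notMem hsp inferInstance
  have hfp' : ∀ v ∈ p, f v = 0 := by
    intro v hv
    have : f v ∈ p.map f := Submodule.mem_map_of_mem hv
    rwa [hfp, Submodule.mem_bot] at this
  have hfsum : ∀ v : Bits β, f v = ∑ q, v q * f (Pi.single q 1) := by
    intro v
    conv_lhs => rw [← Finset.univ_sum_single v]
    rw [map_sum]
    refine Finset.sum_congr rfl fun q _ => ?_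
    have : (Pi.single q (v q) : Bits β) = v q • Pi.single q 1 := by
      rw [← Pi.single_smul, smul_eq_mul, mul_one]
    rw [this, map_smul, smul_eq_mul]
  have hf0 : ∀ q, ¬ ctrl (Sum.inr q) → f (Pi.single q 1) = 0 := by
    intro q hq
    refine hfp' _ ⟨0, zero_mem_graphCode _ _, fun q' hq' => ?_⟩
    rw [Pi.single_eq_of_ne]
    · rfl
    · rintro rfl
      exact hq hq'
  -- The coefficients of the functional, read as a bit string without data part.
  let a : Bits (δ ⊕ β) := Sum.elim 0 fun q => f (Pi.single q 1)
  have haC : a ∈ graphCode ctrl M := by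
    intro t ht
    rcases t with i | t
    · exact absurd (hδ i) ht
    change f (Pi.single t 1) = _
    rw [hf0 t ht, Fintype.sum_sum_type]
    simp only [a, Sum.elim_inl, Pi.zero_apply, mul_zero, Finset.sum_const_zero, zero_add,
      Sum.elim_inr]
    -- The element of the dual code generated by the single target `t` consists of `t` and its
    -- neighbours. Vanishing of the functional on it is the code equation of `a` at `t`.
    have hb : (fun y => if ctrl y then M y (Sum.inr t) else if y = Sum.inr t then 1 else 0) ∈
        graphCode (fun x => ¬ ctrl x) M := by
      intro q hq
      rw [not_not] at hq
      simp only [if_pos hq]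
      rw [Finset.sum_eq_single (Sum.inr t)]
      · rw [if_neg ht, if_pos rfl, mul_one]
      · intro y _ hy
        by_cases hM : M q y = 0
        · rw [hM, zero_mul]
        · rw [if_neg ((hbip _ _ hM).1 hq), if_neg hy, mul_zero]
      · intro h
        exact absurd (Finset.mem_univ _) h
    have h2 := hfp' (fun q => if ctrl (Sum.inr q) then M (Sum.inr q) (Sum.inr t) else 0)
      ⟨_, hb, fun q hq => by simp only [if_pos hq]⟩
    rw [hfsum] at h2
    rw [← h2]
    refine Finset.sum_congr rfl fun q _ => ?_
    by_cases hq : ctrl (Sum.inr q)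
    · rw [if_pos hq, hsymm]
    · rw [hf0 q hq, mul_zero, mul_zero]
  have h3 := postMeasure_graphCode_shift m ctrl M haC s z
  have h4 : flips m (a ∘ Sum.inr, 0) = 0 := by
    funext v
    simp only [flips, Function.comp]
    rcases h : m v with _ | _
    · refine hf0 v fun hc => ?_
      rw [(hm v).2 hc] at h
      cases h
    · rfl
  have h5 : a ∘ Sum.inl = 0 := rfl
  have h6 : (∑ v, match m v with | .std => 0 | .had => s v * a (Sum.inr v)) = f s := by
    rw [hfsum]
    refine Finset.sum_congr rfl fun v _ => ?_
    rcases h : m v with _ | _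
    · have : f (Pi.single v 1) = 0 := hf0 v fun hc => by
        rw [(hm v).2 hc] at h
        cases h
      rw [this, mul_zero]
    · rfl
  rw [h4, h5, add_zero, add_zero, h6] at h3
  have h7 : bsign (f s) = -1 := if_neg hf
  rw [h7] at h3
  refine hz ?_
  have h8 : (2 : ℂ) * postMeasure m (indicatorState (graphCode ctrl M)) s z = 0 := by
    linear_combination h3
  simpa using h8

/-- The state of the qubits `δ` after all measurements of the others gave outcome `0`. -/
theorem postMeasure_graphCode_zero (m : β → Basis) (ctrl : δ ⊕ β → Prop)
    (M : δ ⊕ β → δ ⊕ β → ZMod 2) : ∃ c : ℂ,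
    postMeasure m (indicatorState (graphCode ctrl M)) 0 = c • indicatorState
      {z : Bits δ | ∃ a ∈ graphCode ctrl M, a ∘ Sum.inl = z ∧ ∀ v, m v = .std → a (Sum.inr v) = 0}
    := by
  -- The scalar is the amplitude at zero: code words with vanishing standard bits translate any `z`
  -- of the set to zero without a sign, the outcomes being zero.
  refine ⟨postMeasure m (indicatorState (graphCode ctrl M)) 0 0, funext fun z => ?_⟩
  rw [Pi.smul_apply, smul_eq_mul]
  by_cases hz : z ∈ {z : Bits δ | ∃ a ∈ graphCode ctrl M, a ∘ Sum.inl = z ∧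
      ∀ v, m v = .std → a (Sum.inr v) = 0}
  · refine Eq.trans ?_ (congrArg _ (if_pos hz : indicatorState _ z = 1)).symm
    rw [mul_one]
    obtain ⟨a, ha, rfl, ha0⟩ := hz
    have h := postMeasure_graphCode_shift m ctrl M ha 0 (a ∘ Sum.inl)
    have h1 : flips m (a ∘ Sum.inr, 0) = 0 := by
      funext v
      simp only [flips, Function.comp]
      rcases h : m v with _ | _
      · exact ha0 v h
      · rfl
    have h2 : (∑ v, match m v with | .std => 0 | .had => (0 : Bits β) v * a (Sum.inr v)) = 0 := by
      refine Finset.sum_eq_zero fun v _ => ?_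
      cases m v
      · rfl
      · exact zero_mul _
    have h3 : (a ∘ Sum.inl : Bits δ) + a ∘ Sum.inl = 0 := bits_add_self _
    rw [h1, h2, h3] at h
    rw [h]
    simp [bsign]
  · refine Eq.trans ?_ (congrArg _ (if_neg hz : indicatorState _ z = 0)).symm
    rw [mul_zero]
    refine Finset.sum_eq_zero fun t _ => ?_
    by_contra ht
    refine hz ⟨Sum.elim z t, ?_, rfl, fun v hv => ?_⟩
    · by_contra h
      exact ht ((congrArg _ (if_neg h : indicatorState _ _ = 0)).trans (mul_zero _))
    · have := Finset.prod_ne_zero_iff.1 (left_ne_zero_of_mul ht) v (Finset.mem_univ _)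
      rw [hv] at this
      by_contra h
      exact this (if_neg (Ne.symm h))

end

/-! ### Foliated graphs -/

section
variable {n : ℕ} {κ V E γ : Type} [Fintype κ] [DecidableEq κ] [Fintype V] [DecidableEq V]
  [Fintype E] [DecidableEq E] [Fintype γ] [DecidableEq γ]

/-- The ancillas: a copy of the code for each vertex and for each edge. -/
abbrev Sites (n : ℕ) (κ V E : Type) : Type := (V ⊕ E) × (Fin n ⊕ κ)

/-- The control qubits. -/
def foliCtrl : (γ × Fin n) ⊕ Sites n κ V E → Prop
  | .inl _ => True
  | .inr (.inl _, .inl _) => True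
  | .inr (.inr _, .inr _) => True
  | _ => False

/-- The coefficients of the edges from the control to the target qubits. -/
def foliEdge (A B : Matrix κ (Fin n) (ZMod 2)) (inc : V → E → ZMod 2) (lst : γ → E → ZMod 2) :
    (γ × Fin n) ⊕ Sites n κ V E → (γ × Fin n) ⊕ Sites n κ V E → ZMod 2
  | .inl (b, i), .inr (.inr e, .inl j) => if j = i then lst b e else 0
  | .inr (.inl v, .inl i), .inr (.inr e, .inl j) => if j = i then inc v e else 0
  | .inr (.inl v, .inl i), .inr (.inl v', .inr c) => if v' = v then B c i else 0
  | .inr (.inr e, .inr c), .inr (.inr e', .inl i) => if e' = e then A c i else 0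
  | _, _ => 0

/-- The adjacency matrix of the foliated graph. -/
def foliGraph (A B : Matrix κ (Fin n) (ZMod 2)) (inc : V → E → ZMod 2) (lst : γ → E → ZMod 2)
    (x y : (γ × Fin n) ⊕ Sites n κ V E) : ZMod 2 :=
  foliEdge A B inc lst x y + foliEdge A B inc lst y x

variable (A B : Matrix κ (Fin n) (ZMod 2)) (inc : V → E → ZMod 2) (lst : γ → E → ZMod 2)

theorem foliGraph_symm (x y : (γ × Fin n) ⊕ Sites n κ V E) :
    foliGraph A B inc lst x y = foliGraph A B inc lst y x := add_comm _ _

theorem foliEdge_ctrl {x y : (γ × Fin n) ⊕ Sites n κ V E} (h : foliEdge A B inc lst x y ≠ 0) :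
    foliCtrl x ∧ ¬ foliCtrl y := by
  rcases x with ⟨b, i⟩ | ⟨v | e, i | c⟩ <;> rcases y with ⟨b', i'⟩ | ⟨v' | e', i' | c'⟩ <;>
    simp_all [foliEdge, foliCtrl]

theorem foliGraph_bipartite (x y : (γ × Fin n) ⊕ Sites n κ V E)
    (h : foliGraph A B inc lst x y ≠ 0) : foliCtrl x ↔ ¬ foliCtrl y := by
  by_cases h1 : foliEdge A B inc lst x y = 0
  · have h2 : foliEdge A B inc lst y x ≠ 0 := by
      intro h2
      exact h (by rw [foliGraph, h1, h2, add_zero])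
    have := foliEdge_ctrl A B inc lst h2
    tauto
  · have := foliEdge_ctrl A B inc lst h1
    tauto

section
variable (a : Bits ((γ × Fin n) ⊕ Sites n κ V E))

theorem foliGraph_sum_vertex_check (v : V) (c : κ) :
    ∑ y, foliGraph A B inc lst (.inr (.inl v, .inr c)) y * a y =
      (B *ᵥ fun i => a (.inr (.inl v, .inl i))) c := by
  simp [Fintype.sum_sum_type, Fintype.sum_prod_type, foliGraph, foliEdge, Matrix.mulVec, dotProduct]

theorem foliGraph_sum_edge (e : E) (i : Fin n) :
    ∑ y, foliGraph A B inc lst (.inr (.inr e, .inl i)) y * a y =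
      (∑ b, lst b e • (fun i => a (.inl (b, i))) +
        ∑ v, inc v e • (fun i => a (.inr (.inl v, .inl i))) +
        (fun c => a (.inr (.inr e, .inr c))) ᵥ* A) i := by
  simp [Fintype.sum_sum_type, Fintype.sum_prod_type, foliGraph, foliEdge, Matrix.vecMul,
    dotProduct, add_assoc, mul_comm]

theorem foliGraph_sum_data (b : γ) (i : Fin n) :
    ∑ y, foliGraph A B inc lst (.inl (b, i)) y * a y =
      (∑ e, lst b e • (fun i => a (.inr (.inr e, .inl i)))) i := by
  simp [Fintype.sum_sum_type, Fintype.sum_prod_type, foliGraph, foliEdge]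

theorem foliGraph_sum_edge_check (e : E) (c : κ) :
    ∑ y, foliGraph A B inc lst (.inr (.inr e, .inr c)) y * a y =
      (A *ᵥ fun i => a (.inr (.inr e, .inl i))) c := by
  simp [Fintype.sum_sum_type, Fintype.sum_prod_type, foliGraph, foliEdge, Matrix.mulVec, dotProduct]

theorem foliGraph_sum_vertex (v : V) (i : Fin n) :
    ∑ y, foliGraph A B inc lst (.inr (.inl v, .inl i)) y * a y =
      (∑ e, inc v e • (fun i => a (.inr (.inr e, .inl i))) +
        (fun c => a (.inr (.inl v, .inr c))) ᵥ* B) i := by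
  rw [add_comm]
  simp [Fintype.sum_sum_type, Fintype.sum_prod_type, foliGraph, foliEdge, Matrix.vecMul,
    dotProduct, mul_comm]

/-- The `X`-type stabilizers in block form: a vertex check records the `B`-syndrome of its vertex,
and the qubits of an edge record the sum of the strings at its ends, up to a combination of rows of
`A`. -/
theorem mem_foliCode_iff :
    a ∈ graphCode foliCtrl (foliGraph A B inc lst) ↔
      (∀ v, (fun c => a (.inr (.inl v, .inr c))) = B *ᵥ fun i => a (.inr (.inl v, .inl i))) ∧
      ∀ e, (fun i => a (.inr (.inr e, .inl i))) =
        ∑ b, lst b e • (fun i => a (.inl (b, i))) +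
        ∑ v, inc v e • (fun i => a (.inr (.inl v, .inl i))) +
        (fun c => a (.inr (.inr e, .inr c))) ᵥ* A := by
  constructor
  · exact fun h => ⟨fun v => funext fun c =>
      (h _ (by simp [foliCtrl])).trans (foliGraph_sum_vertex_check A B inc lst a v c),
      fun e => funext fun i =>
        (h _ (by simp [foliCtrl])).trans (foliGraph_sum_edge A B inc lst a e i)⟩
  · rintro ⟨h1, h2⟩ t ht
    rcases t with ⟨b, i⟩ | ⟨v | e, i | c⟩
    · simp [foliCtrl] at ht
    · simp [foliCtrl] at ht
    · exact (congrFun (h1 v) c).trans (foliGraph_sum_vertex_check A B inc lst a v c).symm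
    · exact (congrFun (h2 e) i).trans (foliGraph_sum_edge A B inc lst a e i).symm
    · simp [foliCtrl] at ht

/-- The `Z`-type stabilizers have the same form with vertices and edges, and `A` and `B`, exchanged;
the data are determined by the last edges. -/
theorem mem_foliCode_dual_iff :
    a ∈ graphCode (fun x => ¬ foliCtrl x) (foliGraph A B inc lst) ↔
      (∀ b, (fun i => a (.inl (b, i))) = ∑ e, lst b e • (fun i => a (.inr (.inr e, .inl i)))) ∧
      (∀ e, (fun c => a (.inr (.inr e, .inr c))) = A *ᵥ fun i => a (.inr (.inr e, .inl i))) ∧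
      ∀ v, (fun i => a (.inr (.inl v, .inl i))) =
        ∑ e, inc v e • (fun i => a (.inr (.inr e, .inl i))) +
        (fun c => a (.inr (.inl v, .inr c))) ᵥ* B := by
  constructor
  · exact fun h => ⟨fun b => funext fun i =>
      (h _ (by simp [foliCtrl])).trans (foliGraph_sum_data A B inc lst a b i),
      fun e => funext fun c =>
        (h _ (by simp [foliCtrl])).trans (foliGraph_sum_edge_check A B inc lst a e c),
      fun v => funext fun i =>
        (h _ (by simp [foliCtrl])).trans (foliGraph_sum_vertex A B inc lst a v i)⟩
  · rintro ⟨h1, h2, h3⟩ t ht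
    rcases t with ⟨b, i⟩ | ⟨v | e, i | c⟩
    · exact (congrFun (h1 b) i).trans (foliGraph_sum_data A B inc lst a b i).symm
    · exact (congrFun (h3 v) i).trans (foliGraph_sum_vertex A B inc lst a v i).symm
    · simp [foliCtrl] at ht
    · simp [foliCtrl] at ht
    · exact (congrFun (h2 e) c).trans (foliGraph_sum_edge_check A B inc lst a e c).symm

end

/-- The parity checks on the measurement outcomes. -/
def foliCheck : (V ⊕ E) × κ → Bits (Sites n κ V E)
  | (.inl v, c), (.inl v', .inl i) => if v' = v then A c i else 0
  | (.inl v, c), (.inr e, .inr c') => if c' = c then inc v e else 0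
  | (.inr e, c), (.inr e', .inl i) => if e' = e then B c i else 0
  | (.inr e, c), (.inl v, .inr c') => if c' = c then inc v e else 0
  | _, _ => 0

/-- The outcomes that satisfy all checks. -/
def foliLoc : Submodule (ZMod 2) (Bits (Sites n κ V E)) where
  -- Edges that lead to the data carry no check: the data are not measured, so the syndrome there
  -- has nothing to be compared with.
  carrier := {f | ∀ t : {t : (V ⊕ E) × κ // ∀ e, t.1 = .inr e → ∀ b, lst b e = 0},
    foliCheck A B inc t ⬝ᵥ f = 0}
  add_mem' h h' t := by rw [dotProduct_add, h t, h' t, add_zero]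
  zero_mem' t := dotProduct_zero _
  smul_mem' c f h t := by rw [dotProduct_smul, h t, smul_zero]

theorem mem_foliLoc_iff (f : Bits (Sites n κ V E)) : f ∈ foliLoc A B inc lst ↔
    (∀ v, (A *ᵥ fun i => f (.inl v, .inl i)) = ∑ e, inc v e • fun c => f (.inr e, .inr c)) ∧
    ∀ e, (∀ b, lst b e = 0) → (B *ᵥ fun i => f (.inr e, .inl i)) =
      ∑ v, inc v e • fun c => f (.inl v, .inr c) := by
  have hadd : ∀ a b : ZMod 2, a + b = 0 ↔ a = b := by decide
  have h1 : ∀ v c, foliCheck A B inc (.inl v, c) ⬝ᵥ f = 0 ↔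
      (A *ᵥ fun i => f (.inl v, .inl i)) c = (∑ e, inc v e • fun c => f (.inr e, .inr c)) c := by
    intro v c
    simp [dotProduct, Fintype.sum_sum_type, Fintype.sum_prod_type, foliCheck, Matrix.mulVec, hadd]
  have h2 : ∀ e c, foliCheck A B inc (.inr e, c) ⬝ᵥ f = 0 ↔
      (B *ᵥ fun i => f (.inr e, .inl i)) c = (∑ v, inc v e • fun c => f (.inl v, .inr c)) c := by
    intro e c
    simp [dotProduct, Fintype.sum_sum_type, Fintype.sum_prod_type, foliCheck, Matrix.mulVec, hadd,
      eq_comm]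
  constructor
  · intro h
    refine ⟨fun v => funext fun c => (h1 v c).1 (h ⟨(.inl v, c), by simp⟩),
      fun e he => funext fun c => (h2 e c).1 (h ⟨(.inr e, c), ?_⟩)⟩
    intro e' he'
    obtain rfl : e = e' := by simpa using he'
    exact he
  · rintro ⟨h3, h4⟩ ⟨⟨v | e, c⟩, ht⟩
    · exact (h1 v c).2 (congrFun (h3 v) c)
    · exact (h2 e c).2 (congrFun (h4 e (ht e rfl)) c)

/-- Two outcomes are adjacent if they are in a common check. -/
def foliNbrs : Sites n κ V E → Finset (Sites n κ V E) :=
  checkNbrs fun t => bitSupp (foliCheck A B inc t)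

theorem foliNbrs_symm (x y : Sites n κ V E) (h : y ∈ foliNbrs A B inc x) :
    x ∈ foliNbrs A B inc y := by
  obtain ⟨c, h1, h2⟩ := mem_checkNbrs.1 h
  exact mem_checkNbrs.2 ⟨c, h2, h1⟩

theorem isLocal_foliLoc : IsLocal (foliNbrs A B inc) (foliLoc A B inc lst) :=
  isLocal_of_checks (H := fun t => bitSupp (foliCheck A B inc t))
    (fun t : {t : (V ⊕ E) × κ // ∀ e, t.1 = .inr e → ∀ b, lst b e = 0} => foliCheck A B inc t)
    (fun t => ⟨t, Finset.Subset.refl _⟩) fun _ => Iff.rfl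

variable {ℓ d : ℕ}

theorem foliCheck_bdd (hA : ∀ c, (bitSupp (A c)).card ≤ ℓ) (hB : ∀ c, (bitSupp (B c)).card ≤ ℓ)
    (hv : BddRel (fun v e => inc v e ≠ 0) d) (he : BddRel (fun e v => inc v e ≠ 0) d) :
    BddRel (fun t x => foliCheck A B inc t x ≠ 0) (ℓ + d) := by
  classical
  rintro ⟨v | e, c⟩
  · obtain ⟨s, hs, hs'⟩ := hv v
    refine ⟨(bitSupp (A c)).image (fun i => (Sum.inl v, Sum.inl i)) ∪
      s.image fun e => (Sum.inr e, Sum.inr c), ?_, ?_⟩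
    · exact (Finset.card_union_le _ _).trans (add_le_add (Finset.card_image_le.trans (hA c))
        (Finset.card_image_le.trans hs))
    · rintro ⟨v' | e', i | c'⟩ h
      · simp only [foliCheck, ne_eq, ite_eq_right_iff, Classical.not_imp] at h
        simp [h.1, mem_bitSupp, h.2]
      · simp [foliCheck] at h
      · simp [foliCheck] at h
      · simp only [foliCheck, ne_eq, ite_eq_right_iff, Classical.not_imp] at h
        simp [h.1, hs' _ h.2]
  · obtain ⟨s, hs, hs'⟩ := he e
    refine ⟨(bitSupp (B c)).image (fun i => (Sum.inr e, Sum.inl i)) ∪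
      s.image fun v => (Sum.inl v, Sum.inr c), ?_, ?_⟩
    · exact (Finset.card_union_le _ _).trans (add_le_add (Finset.card_image_le.trans (hB c))
        (Finset.card_image_le.trans hs))
    · rintro ⟨v' | e', i | c'⟩ h
      · simp [foliCheck] at h
      · simp only [foliCheck, ne_eq, ite_eq_right_iff, Classical.not_imp] at h
        simp [h.1, hs' _ h.2]
      · simp only [foliCheck, ne_eq, ite_eq_right_iff, Classical.not_imp] at h
        simp [h.1, mem_bitSupp, h.2]
      · simp [foliCheck] at h

theorem foliCheck_bdd' (hA : BddRel (fun i c => A c i ≠ 0) ℓ) (hB : BddRel (fun i c => B c i ≠ 0) ℓ)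
    (hv : BddRel (fun v e => inc v e ≠ 0) d) (he : BddRel (fun e v => inc v e ≠ 0) d) :
    BddRel (fun x t => foliCheck A B inc t x ≠ 0) (ℓ + d) := by
  classical
  rintro ⟨v | e, i | c⟩
  · obtain ⟨s, hs, hs'⟩ := hA i
    refine ⟨s.image fun c => (Sum.inl v, c), Finset.card_image_le.trans (by omega), ?_⟩
    rintro ⟨v' | e', c'⟩ h
    · simp only [foliCheck, ne_eq, ite_eq_right_iff, Classical.not_imp] at h
      simp [h.1, hs' _ h.2]
    · simp [foliCheck] at h
  · obtain ⟨s, hs, hs'⟩ := hv v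
    refine ⟨s.image fun e => (Sum.inr e, c), Finset.card_image_le.trans (by omega), ?_⟩
    rintro ⟨v' | e', c'⟩ h
    · simp [foliCheck] at h
    · simp only [foliCheck, ne_eq, ite_eq_right_iff, Classical.not_imp] at h
      simp [h.1, hs' _ h.2]
  · obtain ⟨s, hs, hs'⟩ := hB i
    refine ⟨s.image fun c => (Sum.inr e, c), Finset.card_image_le.trans (by omega), ?_⟩
    rintro ⟨v' | e', c'⟩ h
    · simp [foliCheck] at h
    · simp only [foliCheck, ne_eq, ite_eq_right_iff, Classical.not_imp] at h
      simp [h.1, hs' _ h.2]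
  · obtain ⟨s, hs, hs'⟩ := he e
    refine ⟨s.image fun v => (Sum.inl v, c), Finset.card_image_le.trans (by omega), ?_⟩
    rintro ⟨v' | e', c'⟩ h
    · simp only [foliCheck, ne_eq, ite_eq_right_iff, Classical.not_imp] at h
      simp [h.1, hs' _ h.2]
    · simp [foliCheck] at h

theorem card_foliNbrs_le (hA : ∀ c, (bitSupp (A c)).card ≤ ℓ) (hB : ∀ c, (bitSupp (B c)).card ≤ ℓ)
    (hA' : BddRel (fun i c => A c i ≠ 0) ℓ) (hB' : BddRel (fun i c => B c i ≠ 0) ℓ)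
    (hv : BddRel (fun v e => inc v e ≠ 0) d) (he : BddRel (fun e v => inc v e ≠ 0) d)
    (x : Sites n κ V E) : (foliNbrs A B inc x).card ≤ (ℓ + d) * (ℓ + d) := by
  refine card_checkNbrs_le (fun i => ?_) (fun c => ?_) x
  · obtain ⟨s, hs, hs'⟩ := foliCheck_bdd' A B inc hA' hB' hv he i
    exact (Finset.card_le_card fun t ht =>
      hs' t (mem_bitSupp.1 (Finset.mem_filter.1 ht).2)).trans hs
  · obtain ⟨s, hs, hs'⟩ := foliCheck_bdd A B inc hA hB hv he c
    exact (Finset.card_le_card fun t ht => hs' t (mem_bitSupp.1 ht)).trans hs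

theorem foliEdge_bdd (hB : BddRel (fun i c => B c i ≠ 0) ℓ) (hA : ∀ c, (bitSupp (A c)).card ≤ ℓ)
    (hv : BddRel (fun v e => inc v e ≠ 0) d) (hl : BddRel (fun b e => lst b e ≠ 0) d) :
    BddRel (fun x y => foliEdge A B inc lst x y ≠ 0) (ℓ + d) := by
  classical
  rintro (⟨b, i⟩ | ⟨v | e, i | c⟩)
  · obtain ⟨s, hs, hs'⟩ := hl b
    refine ⟨s.image fun e => Sum.inr (Sum.inr e, Sum.inl i),
      Finset.card_image_le.trans (by omega), ?_⟩
    rintro (⟨b', i'⟩ | ⟨v' | e', i' | c'⟩) h <;> simp [foliEdge] at h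
    simp [h.1, hs' _ h.2]
  · obtain ⟨s, hs, hs'⟩ := hv v
    obtain ⟨r, hr, hr'⟩ := hB i
    refine ⟨s.image (fun e => Sum.inr (Sum.inr e, Sum.inl i)) ∪
      r.image fun c => Sum.inr (Sum.inl v, Sum.inr c), ?_, ?_⟩
    · have := Finset.card_union_le (s.image fun e : E =>
        (Sum.inr (Sum.inr e, Sum.inl i) : (γ × Fin n) ⊕ Sites n κ V E))
        (r.image fun c => Sum.inr (Sum.inl v, Sum.inr c))
      have h1 := Finset.card_image_le (s := s) (f := fun e : E =>
        (Sum.inr (Sum.inr e, Sum.inl i) : (γ × Fin n) ⊕ Sites n κ V E))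
      have h2 := Finset.card_image_le (s := r) (f := fun c : κ =>
        (Sum.inr (Sum.inl v, Sum.inr c) : (γ × Fin n) ⊕ Sites n κ V E))
      omega
    · rintro (⟨b', i'⟩ | ⟨v' | e', i' | c'⟩) h <;> simp [foliEdge] at h
      · simp [h.1, hr' _ h.2]
      · simp [h.1, hs' _ h.2]
  · refine ⟨∅, by simp, ?_⟩
    rintro (⟨b', i'⟩ | ⟨v' | e', i' | c'⟩) h <;> simp [foliEdge] at h
  · refine ⟨∅, by simp, ?_⟩
    rintro (⟨b', i'⟩ | ⟨v' | e', i' | c'⟩) h <;> simp [foliEdge] at h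
  · refine ⟨(bitSupp (A c)).image fun i => Sum.inr (Sum.inr e, Sum.inl i),
      Finset.card_image_le.trans ((hA c).trans (by omega)), ?_⟩
    rintro (⟨b', i'⟩ | ⟨v' | e', i' | c'⟩) h <;> simp [foliEdge] at h
    simp [h.1, mem_bitSupp, h.2]

theorem foliEdge_bdd' (hB : ∀ c, (bitSupp (B c)).card ≤ ℓ) (hA : BddRel (fun i c => A c i ≠ 0) ℓ)
    (he : BddRel (fun e v => inc v e ≠ 0) d) (hl : BddRel (fun e b => lst b e ≠ 0) d) :
    BddRel (fun y x => foliEdge A B inc lst x y ≠ 0) (ℓ + d + d) := by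
  classical
  rintro (⟨b, i⟩ | ⟨v | e, i | c⟩)
  · refine ⟨∅, by simp, ?_⟩
    rintro (⟨b', i'⟩ | ⟨v' | e', i' | c'⟩) h <;> simp [foliEdge] at h
  · refine ⟨∅, by simp, ?_⟩
    rintro (⟨b', i'⟩ | ⟨v' | e', i' | c'⟩) h <;> simp [foliEdge] at h
  · refine ⟨(bitSupp (B c)).image fun i => Sum.inr (Sum.inl v, Sum.inl i),
      Finset.card_image_le.trans ((hB c).trans (by omega)), ?_⟩
    rintro (⟨b', i'⟩ | ⟨v' | e', i' | c'⟩) h <;> simp [foliEdge] at h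
    simp [h.1, mem_bitSupp, h.2]
  · obtain ⟨s, hs, hs'⟩ := he e
    obtain ⟨r, hr, hr'⟩ := hA i
    obtain ⟨q, hq, hq'⟩ := hl e
    refine ⟨(s.image (fun v => Sum.inr (Sum.inl v, Sum.inl i)) ∪
      r.image fun c => Sum.inr (Sum.inr e, Sum.inr c)) ∪ q.image fun b => Sum.inl (b, i), ?_, ?_⟩
    · refine (Finset.card_union_le _ _).trans (add_le_add ((Finset.card_union_le _ _).trans ?_)
        (Finset.card_image_le.trans hq))
      rw [add_comm ℓ]
      exact add_le_add (Finset.card_image_le.trans hs) (Finset.card_image_le.trans hr)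
    · rintro (⟨b', i'⟩ | ⟨v' | e', i' | c'⟩) h <;> simp [foliEdge] at h
      · simp [h.1, hq' _ h.2]
      · simp [h.1, hs' _ h.2]
      · simp [h.1, hr' _ h.2]
  · refine ⟨∅, by simp, ?_⟩
    rintro (⟨b', i'⟩ | ⟨v' | e', i' | c'⟩) h <;> simp [foliEdge] at h

theorem foliGraph_bdd (hA : ∀ c, (bitSupp (A c)).card ≤ ℓ) (hB : ∀ c, (bitSupp (B c)).card ≤ ℓ)
    (hA' : BddRel (fun i c => A c i ≠ 0) ℓ) (hB' : BddRel (fun i c => B c i ≠ 0) ℓ)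
    (hv : BddRel (fun v e => inc v e ≠ 0) d) (he : BddRel (fun e v => inc v e ≠ 0) d)
    (hl : BddRel (fun b e => lst b e ≠ 0) d) (hl' : BddRel (fun e b => lst b e ≠ 0) d) :
    BddRel (fun x y => foliGraph A B inc lst x y ≠ 0) ((ℓ + d) + (ℓ + d + d)) :=
  BddRel.mono ((foliEdge_bdd A B inc lst hB' hA hv hl).or
    (foliEdge_bdd' A B inc lst hB hA' he hl')) (fun x y h => by
      by_contra! hc
      exact h (by rw [foliGraph, hc.1, hc.2, add_zero])) le_rfl

end

/-! ### Sparse generators of the stabilizer group -/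

section
variable {n : ℕ} {Q : CSSCode n} {ℓ : ℕ}

/-- The `X` and the `Z` parts of the sparse generators separately span the two row spaces, because
the stabilizer group is their product. Zero generators are dropped so that the number of generators
is bounded in terms of `n`. -/
theorem CSSCode.IsLDPC.exists_checks (h : Q.IsLDPC ℓ) :
    ∃ (κ : Type) (_ : Fintype κ) (_ : DecidableEq κ) (A B : Matrix κ (Fin n) (ZMod 2)),
      Fintype.card κ ≤ ℓ * n ∧
      (∀ c, (bitSupp (A c)).card ≤ ℓ) ∧ (∀ c, (bitSupp (B c)).card ≤ ℓ) ∧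
      BddRel (fun i c => A c i ≠ 0) ℓ ∧ BddRel (fun i c => B c i ≠ 0) ℓ ∧
      Submodule.span (ZMod 2) (Set.range A.row) = rowSpace Q.HX ∧
      Submodule.span (ZMod 2) (Set.range B.row) = rowSpace Q.HZ := by
  classical
  obtain ⟨m, g, hspan, hrow, hcol⟩ := h
  have hsub : ∀ (F : Pauli (Fin n) →ₗ[ZMod 2] Bits (Fin n)),
      Submodule.span (ZMod 2)
        (Set.range fun c : {c : Fin m // (pauliSupp (g c)).Nonempty} => F (g c)) =
      (Submodule.span (ZMod 2) (Set.range g)).map F := by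
    intro F
    rw [Submodule.map_span]
    refine le_antisymm (Submodule.span_mono ?_) (Submodule.span_le.2 ?_)
    · rintro _ ⟨c, rfl⟩
      exact ⟨_, ⟨c, rfl⟩, rfl⟩
    · rintro _ ⟨_, ⟨c, rfl⟩, rfl⟩
      by_cases hc : (pauliSupp (g c)).Nonempty
      · exact Submodule.subset_span ⟨⟨c, hc⟩, rfl⟩
      · have : g c = 0 := by
          rw [Finset.not_nonempty_iff_eq_empty] at hc
          have h0 : ∀ i, i ∉ pauliSupp (g c) := by simp [hc]
          exact Prod.ext (funext fun i => (notMem_pauliSupp.1 (h0 i)).1)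
            (funext fun i => (notMem_pauliSupp.1 (h0 i)).2)
        rw [this, map_zero]
        exact Submodule.zero_mem _
  have hbdd : ∀ F : Pauli (Fin n) → Bits (Fin n), (∀ P i, F P i ≠ 0 → i ∈ pauliSupp P) →
      BddRel (fun (i : Fin n) (c : {c : Fin m // (pauliSupp (g c)).Nonempty}) => F (g c) i ≠ 0) ℓ := by
    intro F hF i
    refine ⟨(Finset.univ.filter fun c => i ∈ pauliSupp (g c)).subtype _,
      (Finset.card_subtype _ _).le.trans ((Finset.card_filter_le _ _).trans (hcol i)), ?_⟩
    intro c hc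
    simpa using hF _ _ hc
  have h1 : ∀ (P : Pauli (Fin n)) i, P.1 i ≠ 0 → i ∈ pauliSupp P := fun P i h =>
    mem_pauliSupp.2 (Or.inl h)
  have h2 : ∀ (P : Pauli (Fin n)) i, P.2 i ≠ 0 → i ∈ pauliSupp P := fun P i h =>
    mem_pauliSupp.2 (Or.inr h)
  refine ⟨{c : Fin m // (pauliSupp (g c)).Nonempty}, inferInstance, inferInstance,
    Matrix.of fun c => (g c).1, Matrix.of fun c => (g c).2, ?_, ?_, ?_, hbdd Prod.fst h1,
    hbdd Prod.snd h2, ?_, ?_⟩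
  -- Each generator is charged to one qubit of its support, and a qubit receives at most `ℓ`
  -- charges.
  · have := Finset.card_le_mul_card_image
      (s := (Finset.univ : Finset {c : Fin m // (pauliSupp (g c)).Nonempty}))
      (f := fun c => c.2.choose) ℓ (fun i _ => ?_)
    · rw [Finset.card_univ] at this
      exact this.trans (Nat.mul_le_mul_left _ ((Finset.card_le_univ _).trans (by simp)))
    · have h3 : ((Finset.univ : Finset {c : Fin m // (pauliSupp (g c)).Nonempty}).filter
          fun c => c.2.choose = i).map (Function.Embedding.subtype _) ⊆
          Finset.univ.filter fun c => i ∈ pauliSupp (g c) := by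
        intro c hc
        simp only [Finset.mem_map, Finset.mem_filter, Finset.mem_univ, true_and,
          Function.Embedding.subtype_apply] at hc ⊢
        obtain ⟨c, rfl, rfl⟩ := hc
        exact c.2.choose_spec
      have := (Finset.card_le_card h3).trans (hcol i)
      rwa [Finset.card_map] at this
  · exact fun c => (Finset.card_le_card fun i hi => h1 _ i (mem_bitSupp.1 hi)).trans (hrow c)
  · exact fun c => (Finset.card_le_card fun i hi => h2 _ i (mem_bitSupp.1 hi)).trans (hrow c)
  · refine (hsub (LinearMap.fst _ _ _)).trans ?_
    rw [hspan, Submodule.prod_map_fst]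
  · refine (hsub (LinearMap.snd _ _ _)).trans ?_
    rw [hspan, Submodule.prod_map_snd]

/-- Orthogonality to the generators is orthogonality to the row space. -/
theorem mulVec_eq_zero_iff_of_span {κ : Type} [Fintype κ] {m : ℕ} {A : Matrix κ (Fin n) (ZMod 2)}
    {H : Matrix (Fin m) (Fin n) (ZMod 2)}
    (h : Submodule.span (ZMod 2) (Set.range A.row) = rowSpace H) (y : Bits (Fin n)) :
    A *ᵥ y = 0 ↔ H *ᵥ y = 0 := by
  have key : ∀ {κ' : Type} (S : κ' → Bits (Fin n)), (∀ c, S c ⬝ᵥ y = 0) ↔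
      ∀ z ∈ Submodule.span (ZMod 2) (Set.range S), z ⬝ᵥ y = 0 := by
    intro κ' S
    constructor
    · intro hS z hz
      induction hz using Submodule.span_induction with
      | mem z hz => obtain ⟨c, rfl⟩ := hz; exact hS c
      | zero => exact zero_dotProduct y
      | add a b _ _ ha hb => rw [add_dotProduct, ha, hb, add_zero]
      | smul c a _ ha => rw [smul_dotProduct, ha, smul_zero]
    · exact fun hS c => hS _ (Submodule.subset_span ⟨c, rfl⟩)
  rw [funext_iff, funext_iff]
  refine (key A.row).trans (Iff.trans ?_ (key fun c => H c).symm)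
  rw [h]
  rfl

theorem mem_span_row_iff {κ : Type} [Fintype κ] (A : Matrix κ (Fin n) (ZMod 2)) (y : Bits (Fin n)) :
    y ∈ Submodule.span (ZMod 2) (Set.range A.row) ↔ ∃ r, r ᵥ* A = y := by
  rw [← range_vecMulLinear]
  rfl

end

/-! ### Chains of code blocks -/

section
variable {N : ℕ} (init : Fin N → BlockInit)

/-- The blocks are equal or share GHZ states. -/
def SameClass (b b' : Fin N) : Prop := b = b' ∨ ∃ c, init b = .ghz c ∧ init b' = .ghz c

/-- `b` is the next block after `j` in its class. -/
def IsNext (j b : Fin N) : Prop :=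
  j < b ∧ SameClass init j b ∧ ∀ c, j < c → c < b → ¬ SameClass init c b

/-- There is a junction with label `j`: it fixes the block `j`, if this starts in `0`, and links it to the next
block of its class, if there is one. -/
def HasJunction (j : Fin N) : Prop := init j = .zero ∨ ∃ b, IsNext init j b

theorem SameClass.symm {b b' : Fin N} (h : SameClass init b b') : SameClass init b' b := by
  rcases h with h | ⟨c, h, h'⟩
  · exact Or.inl h.symm
  · exact Or.inr ⟨c, h', h⟩

theorem SameClass.trans {a b c : Fin N} (h : SameClass init a b) (h' : SameClass init b c) :
    SameClass init a c := by
  rcases h with rfl | ⟨x, h1, h2⟩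
  · exact h'
  · rcases h' with rfl | ⟨y, h3, h4⟩
    · exact Or.inr ⟨x, h1, h2⟩
    · rw [h2] at h3
      cases h3
      exact Or.inr ⟨x, h1, h4⟩

theorem IsNext.unique_left {j j' b : Fin N} (h : IsNext init j b) (h' : IsNext init j' b) :
    j = j' := by
  rcases lt_trichotomy j j' with hlt | rfl | hlt
  · exact absurd h'.2.1 (h.2.2 j' hlt h'.1)
  · rfl
  · exact absurd h.2.1 (h'.2.2 j hlt h.1)

theorem IsNext.unique_right {j b b' : Fin N} (h : IsNext init j b) (h' : IsNext init j b') :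
    b = b' := by
  have hs : SameClass init b b' := h.2.1.symm.trans init h'.2.1
  rcases lt_trichotomy b b' with hlt | rfl | hlt
  · exact absurd hs (h'.2.2 b h.1 hlt)
  · rfl
  · exact absurd hs.symm (h.2.2 b' h'.1 hlt)

theorem exists_isNext {b b' : Fin N} (h : b' < b) (hs : SameClass init b' b) :
    ∃ j, IsNext init j b := by
  classical
  obtain ⟨j, hj, hmax⟩ := Finset.exists_max_image
    (Finset.univ.filter fun j => j < b ∧ SameClass init j b) id
    ⟨b', Finset.mem_filter.2 ⟨Finset.mem_univ _, h, hs⟩⟩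
  rw [Finset.mem_filter] at hj
  refine ⟨j, hj.2.1, hj.2.2, fun c hjc hcb hc => ?_⟩
  exact absurd (hmax c (Finset.mem_filter.2 ⟨Finset.mem_univ _, hcb, hc⟩)) (not_le.2 hjc)

variable {M : Type} [AddCommGroup M]

open Classical in
/-- The sum over the blocks of the class up to `b`. -/
def classSum (g : Fin N → M) (b : Fin N) : M :=
  ∑ b' ∈ Finset.univ.filter fun b' => b' ≤ b ∧ SameClass init b' b, g b'

open Classical in
-- A class is linearly ordered by `IsNext`, so these are partial sums along it; the sum over `j` has
-- at most one nonzero term, the predecessor.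
theorem classSum_eq (g : Fin N → M) (b : Fin N) :
    classSum init g b = g b + ∑ j, if IsNext init j b then classSum init g j else 0 := by
  by_cases h : ∃ j, IsNext init j b
  · obtain ⟨j, hj⟩ := h
    rw [Finset.sum_eq_single j]
    · rw [if_pos hj]
      unfold classSum
      have : (Finset.univ.filter fun b' => b' ≤ b ∧ SameClass init b' b) =
          insert b (Finset.univ.filter fun b' => b' ≤ j ∧ SameClass init b' j) := by
        ext c
        simp only [Finset.mem_filter, Finset.mem_univ, true_and, Finset.mem_insert]
        constructor
        · rintro ⟨h1, h2⟩
          rcases h1.lt_or_eq with h1 | h1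
          · right
            refine ⟨?_, h2.trans init hj.2.1.symm⟩
            by_contra hlt
            exact hj.2.2 c (not_le.1 hlt) h1 h2
          · exact Or.inl h1
        · rintro (rfl | ⟨h1, h2⟩)
          · exact ⟨le_rfl, Or.inl rfl⟩
          · exact ⟨h1.trans hj.1.le, h2.trans init hj.2.1⟩
      rw [this, Finset.sum_insert]
      simp only [Finset.mem_filter, Finset.mem_univ, true_and, not_and]
      exact fun h => absurd (h.trans_lt hj.1) (lt_irrefl _)
    · intro j' _ hne
      exact if_neg fun h => hne (h.unique_left init hj)
    · exact fun h => absurd (Finset.mem_univ _) h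
  · rw [Finset.sum_eq_zero fun j _ => if_neg fun hj => h ⟨j, hj⟩, add_zero]
    unfold classSum
    rw [Finset.sum_eq_single b]
    · intro c hc hne
      rw [Finset.mem_filter] at hc
      exact absurd (exists_isNext init (lt_of_le_of_ne hc.2.1 hne) hc.2.2) h
    · intro hb
      exact absurd (Finset.mem_filter.2 ⟨Finset.mem_univ _, le_rfl, Or.inl rfl⟩) hb

instance fintypeJunctions : Fintype {j // HasJunction init j} := Fintype.ofFinite _

open Classical in
-- The junctions at `b` are the one labelled `b` and the one of its predecessor. A predecessor
-- always has a junction, so the last sum needs no such condition.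
theorem sum_junctions (F : Fin N → M) (b : Fin N) :
    ∑ j : {j // HasJunction init j}, (if j.1 = b ∨ IsNext init j b then F j else 0) =
      (if HasJunction init b then F b else 0) + ∑ j, if IsNext init j b then F j else 0 := by
  have h1 : ∀ j : Fin N, (if j = b ∨ IsNext init j b then F j else 0) =
      (if j = b then F j else 0) + if IsNext init j b then F j else 0 := by
    intro j
    by_cases hj : j = b
    · rw [if_pos (Or.inl hj), if_pos hj, if_neg, add_zero]
      exact fun h => h.1.ne hj
    · simp [hj]
  rw [← Finset.sum_subtype (Finset.univ.filter fun j => HasJunction init j) (by simp)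
    fun j => if j = b ∨ IsNext init j b then F j else 0, Finset.sum_filter]
  have h2 : ∀ j : Fin N, (if HasJunction init j then
      (if j = b ∨ IsNext init j b then F j else 0) else 0) =
      (if j = b then (if HasJunction init b then F b else 0) else 0) +
        if IsNext init j b then F j else 0 := by
    intro j
    rw [h1]
    by_cases hj : j = b
    · subst hj
      by_cases hu : HasJunction init j
      · simp [hu]
      · have : ¬ IsNext init j j := fun h => lt_irrefl _ h.1
        simp [hu, this]
    · by_cases hn : IsNext init j b
      · have : HasJunction init j := Or.inr ⟨b, hn⟩
        simp [hj, this]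
      · simp [hj, hn]
  simp_rw [h2]
  rw [Finset.sum_add_distrib, Finset.sum_ite_eq' Finset.univ b, if_pos (Finset.mem_univ _)]

end

/-! ### The foliated graph of chains that are linked by junctions -/

section
variable {N T : ℕ} (init : Fin N → BlockInit)

/-- The vertices: `T` copies of each block. -/
abbrev ChainV (N T : ℕ) : Type := Fin N × Fin T

/-- The edges: from each copy of a block to the next one, and the junctions. -/
abbrev ChainE {N : ℕ} (T : ℕ) (init : Fin N → BlockInit) : Type :=
  (Fin N × Fin T) ⊕ {j // HasJunction init j}

open Classical in
/-- The incidence matrix. -/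
def chainInc : ChainV N T → ChainE T init → ZMod 2
  | (b, s), .inl (b', s') => if b = b' ∧ (s = s' ∨ s.val = s'.val + 1) then 1 else 0
  | (b, s), .inr j => if s.val = 0 ∧ (j.1 = b ∨ IsNext init j b) then 1 else 0

open Classical in
/-- The last edge of a chain leads to the data. -/
def chainLst : Fin N → ChainE T init → ZMod 2
  | b, .inl (b', s) => if b = b' ∧ s.val + 1 = T then 1 else 0
  | _, .inr _ => 0

variable {M : Type} [AddCommGroup M] [Module (ZMod 2) M]

open Classical in
theorem sum_chainInc_zero (F : ChainE T init → M) (b : Fin N) (h : 0 < T) :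
    ∑ e, chainInc init (b, ⟨0, h⟩) e • F e = F (.inl (b, ⟨0, h⟩)) +
      ∑ j : {j // HasJunction init j}, if j.1 = b ∨ IsNext init j b then F (.inr j) else 0 := by
  rw [Fintype.sum_sum_type]
  congr 1
  · rw [Finset.sum_eq_single (b, ⟨0, h⟩)]
    · simp [chainInc]
    · rintro ⟨b', s'⟩ _ hne
      simp only [chainInc]
      rw [if_neg, zero_smul]
      rintro ⟨rfl, rfl | h'⟩
      · exact hne rfl
      · exact absurd h' (Nat.succ_ne_zero _).symm
    · exact fun h => absurd (Finset.mem_univ _) h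
  · refine Finset.sum_congr rfl fun j _ => ?_
    simp [chainInc]

theorem sum_chainInc_succ (F : ChainE T init → M) (b : Fin N) (k : ℕ) (h : k + 1 < T) :
    ∑ e, chainInc init (b, ⟨k + 1, h⟩) e • F e =
      F (.inl (b, ⟨k + 1, h⟩)) + F (.inl (b, ⟨k, by omega⟩)) := by
  classical
  rw [Fintype.sum_sum_type, Finset.sum_eq_zero (s := (Finset.univ :
    Finset {j // HasJunction init j})), add_zero]
  · rw [Fintype.sum_eq_add (b, ⟨k + 1, h⟩) (b, ⟨k, by omega⟩)]
    · simp [chainInc]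
    · simp
    · rintro ⟨b', s'⟩ ⟨h1, h2⟩
      simp only [chainInc]
      rw [if_neg, zero_smul]
      rintro ⟨rfl, rfl | h'⟩
      · exact h1 rfl
      · refine h2 (Prod.ext rfl (Fin.ext ?_))
        change s'.val = k
        have : k + 1 = s'.val + 1 := h'
        omega
  · intro j _
    simp [chainInc]

theorem sum_chainInc_edge_last (F : ChainV N T → M) (b : Fin N) (s : Fin T) (h : s.val + 1 = T) :
    ∑ v, chainInc init v (.inl (b, s)) • F v = F (b, s) := by
  classical
  rw [Finset.sum_eq_single (b, s)]
  · simp [chainInc]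
  · rintro ⟨b', s'⟩ _ hne
    simp only [chainInc]
    rw [if_neg, zero_smul]
    rintro ⟨rfl, rfl | h'⟩
    · exact hne rfl
    · have := s'.2
      omega
  · exact fun h => absurd (Finset.mem_univ _) h

theorem sum_chainInc_edge (F : ChainV N T → M) (b : Fin N) (k : ℕ) (h : k + 1 < T) :
    ∑ v, chainInc init v (.inl (b, ⟨k, by omega⟩)) • F v =
      F (b, ⟨k, by omega⟩) + F (b, ⟨k + 1, h⟩) := by
  classical
  rw [Fintype.sum_eq_add (b, ⟨k, by omega⟩) (b, ⟨k + 1, h⟩)]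
  · simp [chainInc]
  · simp
  · rintro ⟨b', s'⟩ ⟨h1, h2⟩
    simp only [chainInc]
    rw [if_neg, zero_smul]
    rintro ⟨rfl, rfl | h'⟩
    · exact h1 rfl
    · exact h2 (Prod.ext rfl (Fin.ext h'))

open Classical in
theorem sum_chainInc_junction (F : ChainV N T → M) (h : 0 < T) (j : {j // HasJunction init j}) :
    ∑ v, chainInc init v (.inr j) • F v =
      F (j.1, ⟨0, h⟩) + ∑ b, if IsNext init j b then F (b, ⟨0, h⟩) else 0 := by
  have h1 : ∀ b, ∑ s, chainInc init (b, s) (.inr j : ChainE T init) • F (b, s) =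
      (if j.1 = b then F (b, ⟨0, h⟩) else 0) + if IsNext init j b then F (b, ⟨0, h⟩) else 0 := by
    intro b
    rw [Finset.sum_eq_single ⟨0, h⟩]
    · simp only [chainInc, true_and]
      by_cases hj : j.1 = b
      · rw [if_pos (Or.inl hj), if_pos hj, if_neg, add_zero, one_smul]
        exact fun h => h.1.ne hj
      · simp [hj]
    · intro s _ hs
      simp only [chainInc]
      rw [if_neg, zero_smul]
      rintro ⟨h0, -⟩
      exact hs (Fin.ext h0)
    · exact fun h => absurd (Finset.mem_univ _) h
  rw [Fintype.sum_prod_type]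
  simp_rw [h1]
  rw [Finset.sum_add_distrib, Finset.sum_ite_eq, if_pos (Finset.mem_univ _)]

theorem sum_chainLst (F : ChainE T init → M) (b : Fin N) (s : Fin T) (h : s.val + 1 = T) :
    ∑ e, chainLst init b e • F e = F (.inl (b, s)) := by
  classical
  rw [Finset.sum_eq_single (Sum.inl (b, s))]
  · simp [chainLst, h]
  · rintro (⟨b', s'⟩ | j) _ hne
    · simp only [chainLst]
      rw [if_neg, zero_smul]
      rintro ⟨rfl, h'⟩
      exact hne (congrArg Sum.inl (Prod.ext rfl (Fin.ext (by simp only; omega))))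
    · simp [chainLst]
  · exact fun h => absurd (Finset.mem_univ _) h

theorem sum_chainLst_edge (F : Fin N → M) (b : Fin N) (s : Fin T) :
    ∑ b', chainLst init b' (.inl (b, s)) • F b' = if s.val + 1 = T then F b else 0 := by
  classical
  rw [Finset.sum_eq_single b]
  · simp [chainLst]
  · intro b' _ hne
    simp [chainLst, hne]
  · exact fun h => absurd (Finset.mem_univ _) h

theorem BddRel.of_unique {X Y : Type} {r : X → Y → Prop} (h : ∀ x y y', r x y → r x y' → y = y') :
    BddRel r 1 := by
  intro x
  by_cases hx : ∃ y, r x y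
  · obtain ⟨y, hy⟩ := hx
    exact ⟨{y}, by simp, fun y' hy' => by rw [Finset.mem_singleton]; exact h x y' y hy' hy⟩
  · exact ⟨∅, by simp, fun y hy => absurd ⟨y, hy⟩ hx⟩

/-- The four ways in which a vertex and an edge can be incident. -/
def chainRel : Fin 4 → ChainV N T → ChainE T init → Prop
  | 0, v, e => e = .inl v
  | 1, v, e => ∃ s : Fin T, v.2.val = s.val + 1 ∧ e = .inl (v.1, s)
  | 2, v, e => ∃ j, v.2.val = 0 ∧ e = .inr j ∧ j.1 = v.1
  | 3, v, e => ∃ j, v.2.val = 0 ∧ e = .inr j ∧ IsNext init j v.1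

theorem exists_chainRel (v : ChainV N T) (e : ChainE T init) (h : chainInc init v e ≠ 0) :
    ∃ k, chainRel init k v e := by
  obtain ⟨b, s⟩ := v
  rcases e with ⟨b', s'⟩ | j
  · simp only [chainInc, ne_eq, ite_eq_right_iff, Classical.not_imp] at h
    obtain ⟨⟨rfl, rfl | h⟩, -⟩ := h
    · exact ⟨0, rfl⟩
    · exact ⟨1, s', h, rfl⟩
  · simp only [chainInc, ne_eq, ite_eq_right_iff, Classical.not_imp] at h
    obtain ⟨⟨h0, h | h⟩, -⟩ := h
    · exact ⟨2, j, h0, rfl, h⟩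
    · exact ⟨3, j, h0, rfl, h⟩

/-- In each of the four kinds of incidence, the vertex determines the edge. -/
theorem chainInc_bdd : BddRel (fun v e => chainInc (T := T) init v e ≠ 0) 4 := by
  refine (BddRel.exists (S := Fin 4) (Δ := 1) (r := chainRel init) fun k =>
    BddRel.of_unique ?_).mono (exists_chainRel init) (by simp)
  rintro v e e' h h'
  fin_cases k
  · exact Eq.trans h (Eq.symm h')
  · obtain ⟨s, hs, rfl⟩ := h
    obtain ⟨s', hs', rfl⟩ := h'
    have : s = s' := Fin.ext (by omega)
    rw [this]
  · obtain ⟨j, -, rfl, hj⟩ := h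
    obtain ⟨j', -, rfl, hj'⟩ := h'
    have : j = j' := Subtype.ext (hj.trans hj'.symm)
    rw [this]
  · obtain ⟨j, -, rfl, hj⟩ := h
    obtain ⟨j', -, rfl, hj'⟩ := h'
    have : j = j' := Subtype.ext (hj.unique_left init hj')
    rw [this]

theorem chainInc_bdd' : BddRel (fun e v => chainInc (T := T) init v e ≠ 0) 4 := by
  refine (BddRel.exists (S := Fin 4) (Δ := 1) (r := fun k e v => chainRel init k v e) fun k =>
    BddRel.of_unique ?_).mono (fun e v => exists_chainRel init v e) (by simp)
  rintro e ⟨b, s⟩ ⟨b', s'⟩ h h'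
  fin_cases k
  · exact Sum.inl_injective (Eq.trans (Eq.symm h) h')
  · obtain ⟨t, ht, rfl⟩ := h
    obtain ⟨t', ht', heq⟩ := h'
    simp only [Sum.inl.injEq, Prod.mk.injEq] at heq ht ht'
    obtain ⟨rfl, rfl⟩ := heq
    exact Prod.ext rfl (Fin.ext (ht.trans ht'.symm))
  · obtain ⟨j, hs, rfl, hj⟩ := h
    obtain ⟨j', hs', heq, hj'⟩ := h'
    obtain rfl := Sum.inr_injective heq
    exact Prod.ext (hj.symm.trans hj') (Fin.ext (hs.trans hs'.symm))
  · obtain ⟨j, hs, rfl, hj⟩ := h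
    obtain ⟨j', hs', heq, hj'⟩ := h'
    obtain rfl := Sum.inr_injective heq
    exact Prod.ext (hj.unique_right init hj') (Fin.ext (hs.trans hs'.symm))

theorem chainLst_ne_zero {b : Fin N} {e : ChainE T init} (h : chainLst init b e ≠ 0) :
    ∃ s : Fin T, s.val + 1 = T ∧ e = .inl (b, s) := by
  rcases e with ⟨b', s⟩ | j
  · simp only [chainLst, ne_eq, ite_eq_right_iff, Classical.not_imp] at h
    obtain ⟨⟨rfl, h⟩, -⟩ := h
    exact ⟨s, h, rfl⟩
  · simp [chainLst] at h

theorem chainLst_bdd : BddRel (fun b e => chainLst (T := T) init b e ≠ 0) 4 := by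
  refine (BddRel.of_unique (fun b e e' h h' => ?_)).mono (fun _ _ h => h) (by norm_num)
  obtain ⟨s, hs, rfl⟩ := chainLst_ne_zero init h
  obtain ⟨s', hs', rfl⟩ := chainLst_ne_zero init h'
  have : s = s' := Fin.ext (by omega)
  rw [this]

theorem chainLst_bdd' : BddRel (fun e b => chainLst (T := T) init b e ≠ 0) 4 := by
  refine (BddRel.of_unique (fun e b b' h h' => ?_)).mono (fun _ _ h => h) (by norm_num)
  obtain ⟨s, hs, rfl⟩ := chainLst_ne_zero init h
  obtain ⟨s', hs', heq⟩ := chainLst_ne_zero init h'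
  exact (Prod.mk.inj (Sum.inl_injective heq)).1

end

/-! ### Decoding of chains -/

section
variable {n : ℕ} {T : ℕ}

/-- The sum of the first `k` vectors. -/
def prefixSum {M : Type} [AddCommMonoid M] (F : Fin T → M) (k : ℕ) : M :=
  ∑ s ∈ Finset.univ.filter fun s : Fin T => s.val < k, F s

theorem prefixSum_zero {M : Type} [AddCommMonoid M] (F : Fin T → M) : prefixSum F 0 = 0 := by
  simp [prefixSum]

theorem prefixSum_succ {M : Type} [AddCommMonoid M] (F : Fin T → M) {k : ℕ} (h : k < T) :
    prefixSum F (k + 1) = prefixSum F k + F ⟨k, h⟩ := by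
  have : (Finset.univ.filter fun s : Fin T => s.val < k + 1) =
      insert ⟨k, h⟩ (Finset.univ.filter fun s : Fin T => s.val < k) := by
    ext s
    simp only [Finset.mem_filter, Finset.mem_univ, true_and, Finset.mem_insert, Fin.ext_iff]
    omega
  rw [prefixSum, this, Finset.sum_insert (by simp), add_comm]
  rfl

theorem exists_ne_zero_of_prefixSum {F : Fin T → Bits (Fin n)} {k : ℕ} {i : Fin n}
    (h : prefixSum F k i ≠ 0) : ∃ s, F s i ≠ 0 := by
  by_contra! hc
  apply h
  rw [prefixSum, Finset.sum_apply]
  exact Finset.sum_eq_zero fun s _ => hc s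

/-- Modulo two, the sum of two prefix sums is the sum over the positions from `a` on. -/
theorem exists_ne_zero_of_prefixSum_add {F : Fin T → Bits (Fin n)} {a : ℕ} (ha : a ≤ T)
    {i : Fin n} (h : (prefixSum F T + prefixSum F a) i ≠ 0) :
    ∃ s : Fin T, a ≤ s.val ∧ F s i ≠ 0 := by
  by_contra! hc
  have key : ∀ k, a ≤ k → k ≤ T → prefixSum F k i = prefixSum F a i := by
    intro k hk
    induction k, hk using Nat.le_induction with
    | base => exact fun _ => rfl
    | succ k hk ih =>
      intro hT
      rw [prefixSum_succ F (by omega), Pi.add_apply, ih (by omega), hc ⟨k, by omega⟩ hk, add_zero]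
  apply h
  rw [Pi.add_apply, key T ha le_rfl]
  exact CharTwo.add_self_eq_zero _

theorem two_eq_zero_bits {X : Type} : (2 : Bits X) = 0 := by
  funext x
  exact CharTwo.two_eq_zero

end

section
variable {n N T : ℕ} {init : Fin N → BlockInit} {κ : Type} [Fintype κ]
  {A B : Matrix κ (Fin n) (ZMod 2)}

/-- The flips along a chain are integrated: a prefix sum of `φ` has the syndrome `σ` up to the value
at the start, and normalizing at the untouched slice `st b` removes this constant. The data then
only see the flips beyond that slice. -/
theorem chain_decode_X (hT : 0 < T) (φ : ChainE T init → Bits (Fin n)) (σ : ChainV N T → Bits κ)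
    (hloc : ∀ e, (∀ b, chainLst init b e = 0) → B *ᵥ φ e = ∑ v, chainInc init v e • σ v)
    (st : Fin N → Fin T) (hφ : ∀ b, φ (.inl (b, st b)) = 0) (hσ : ∀ b, σ (b, st b) = 0)
    (hsmall : ∀ y, (∀ i, y i ≠ 0 → ∃ e, φ e i ≠ 0) → B *ᵥ y = 0 → ∃ r, r ᵥ* A = y) :
    ∃ (P : ChainV N T → Bits (Fin n)) (r : ChainE T init → Bits κ) (D : Fin N → Bits (Fin n)),
      (∀ v, σ v = B *ᵥ P v) ∧
      (∀ e, φ e = ∑ b, chainLst init b e • D b + ∑ v, chainInc init v e • P v + r e ᵥ* A) ∧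
      ∀ b i, D b i ≠ 0 → ∃ s, st b < s ∧ φ (.inl (b, s)) i ≠ 0 := by
  classical
  let pre : Fin N → ℕ → Bits (Fin n) := fun b => prefixSum fun s => φ (.inl (b, s))
  have hpre : ∀ b k (h : k < T), pre b (k + 1) = pre b k + φ (.inl (b, ⟨k, h⟩)) :=
    fun b k h => prefixSum_succ _ h
  have hB : ∀ b k (h : k < T), B *ᵥ pre b k = σ (b, ⟨0, hT⟩) + σ (b, ⟨k, h⟩) := by
    intro b k
    induction k with
    | zero =>
      intro h
      rw [bits_add_self]
      exact (congrArg _ (prefixSum_zero _)).trans (Matrix.mulVec_zero _)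
    | succ k ih =>
      intro h
      rw [hpre b k (by omega), Matrix.mulVec_add, ih (by omega), hloc, sum_chainInc_edge init σ b k h]
      · linear_combination σ (b, ⟨k, by omega⟩) * two_eq_zero_bits
      · intro b'
        by_contra hne
        obtain ⟨s, hs, heq⟩ := chainLst_ne_zero init hne
        obtain ⟨-, rfl⟩ := Prod.mk.inj (Sum.inl_injective heq)
        simp only at hs
        omega
  -- The sum of the flips between the slice of `v` and the untouched slice, on whichever side of it
  -- `v` lies.
  let P : ChainV N T → Bits (Fin n) := fun v => pre v.1 v.2 + pre v.1 (st v.1)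
  have hP : ∀ v, σ v = B *ᵥ P v := by
    rintro ⟨b, s⟩
    rw [Matrix.mulVec_add, hB b s s.2, hB b (st b) (st b).2, Fin.eta, Fin.eta, hσ]
    linear_combination (-(σ (b, ⟨0, hT⟩))) * two_eq_zero_bits
  let D : Fin N → Bits (Fin n) := fun b => pre b T + pre b (st b)
  have hr : ∀ e, ∃ r : Bits κ,
      φ e = ∑ b, chainLst init b e • D b + ∑ v, chainInc init v e • P v + r ᵥ* A := by
    rintro (⟨b, s⟩ | j)
    · refine ⟨0, ?_⟩
      rw [Matrix.zero_vecMul, add_zero, sum_chainLst_edge]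
      by_cases hs : s.val + 1 = T
      · rw [if_pos hs, sum_chainInc_edge_last init P b s hs]
        have h1 := hpre b s.val s.2
        rw [Fin.eta, hs] at h1
        change φ _ = pre b T + pre b (st b) + (pre b s + pre b (st b))
        rw [h1]
        linear_combination (-(pre b s + pre b (st b))) * two_eq_zero_bits
      · rw [if_neg hs, zero_add]
        obtain ⟨k, hk⟩ := s
        have hk' : k + 1 < T := by simp only at hs; omega
        rw [sum_chainInc_edge init P b k hk']
        change φ _ = pre b k + pre b (st b) + (pre b (k + 1) + pre b (st b))
        rw [hpre b k hk]
        linear_combination (-(pre b k + pre b (st b))) * two_eq_zero_bits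
    · have hl : ∀ b, chainLst init b (.inr j : ChainE T init) = 0 := fun b => rfl
      -- At a junction the integrated strings need not fit together, but the mismatch has zero
      -- syndrome and lies in the columns of the flips. Hence it is a combination of rows of `A`,
      -- absorbed by the check qubits of the junction.
      obtain ⟨r, hr⟩ := hsmall (φ (.inr j) + ∑ v, chainInc init v (.inr j) • P v) (by
        intro i hi
        by_contra! hc
        apply hi
        rw [Pi.add_apply, hc, zero_add, Finset.sum_apply]
        refine Finset.sum_eq_zero fun v _ => ?_
        have h0 : ∀ b k, pre b k i = 0 := by
          intro b k
          by_contra hne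
          obtain ⟨s, hs⟩ := exists_ne_zero_of_prefixSum hne
          exact hs (hc _)
        simp [P, h0]) (by
        rw [Matrix.mulVec_add, hloc _ hl, Matrix.mulVec_sum]
        simp_rw [Matrix.mulVec_smul, ← hP]
        exact bits_add_self _)
      refine ⟨r, ?_⟩
      rw [hr, Finset.sum_eq_zero fun b _ => by rw [hl, zero_smul]]
      linear_combination (-(∑ v, chainInc init v (.inr j) • P v)) * two_eq_zero_bits
  choose r hr using hr
  refine ⟨P, r, D, hP, hr, fun b i hi => ?_⟩
  obtain ⟨s, hs, hs'⟩ := exists_ne_zero_of_prefixSum_add (st b).2.le hi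
  refine ⟨s, lt_of_le_of_ne hs ?_, hs'⟩
  rintro rfl
  exact hs' (congrFun (hφ b) i)

/-- Dual to the other decoding, but now the unknowns live on edges, so those of the junctions must
be found too. The equations at the first vertices determine them recursively along each class, as
partial sums of the strings `g` that the chains deliver at their starts. -/
theorem chain_decode_Z (hT : 0 < T) (φ : ChainV N T → Bits (Fin n)) (σ : ChainE T init → Bits κ)
    (hloc : ∀ v, A *ᵥ φ v = ∑ e, chainInc init v e • σ e)
    (st : Fin N → Fin T) (hσ : ∀ b, σ (.inl (b, st b)) = 0)
    (hsmall : ∀ y, (∀ i, y i ≠ 0 → ∃ v, φ v i ≠ 0) → A *ᵥ y = 0 → ∃ q, q ᵥ* B = y) :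
    ∃ (Q : ChainE T init → Bits (Fin n)) (q : ChainV N T → Bits κ),
      (∀ e, σ e = A *ᵥ Q e) ∧
      (∀ v, φ v = ∑ e, chainInc init v e • Q e + q v ᵥ* B) ∧
      ∀ b i, (∑ e, chainLst init b e • Q e) i ≠ 0 → ∃ s, st b < s ∧ φ (b, s) i ≠ 0 := by
  classical
  let pre : Fin N → ℕ → Bits (Fin n) := fun b => prefixSum fun s => φ (b, s)
  have hpre : ∀ b k (h : k < T), pre b (k + 1) = pre b k + φ (b, ⟨k, h⟩) :=
    fun b k h => prefixSum_succ _ h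
  -- The value zero without a junction lets the recursion run uniformly over all blocks and
  -- expresses that the end of a class carries no syndrome.
  let τ : Fin N → Bits κ := fun j => if h : HasJunction init j then σ (.inr ⟨j, h⟩) else 0
  have hτ : ∀ b, (∑ j : {j // HasJunction init j},
      if j.1 = b ∨ IsNext init j b then σ (.inr j) else 0) =
      τ b + ∑ j, if IsNext init j b then τ j else 0 := by
    intro b
    have h1 := sum_junctions init τ b
    have h2 : (if HasJunction init b then τ b else 0) = τ b := by
      by_cases hb : HasJunction init b
      · exact if_pos hb
      · simp [τ, hb]
    rw [h2] at h1
    rw [← h1]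
    refine Finset.sum_congr rfl fun j _ => ?_
    simp only [τ, dif_pos j.2]
  let c : Fin N → Bits κ := fun b => τ b + ∑ j, if IsNext init j b then τ j else 0
  have hA : ∀ b k (h : k < T), A *ᵥ pre b (k + 1) = c b + σ (.inl (b, ⟨k, h⟩)) := by
    intro b k
    induction k with
    | zero =>
      intro h
      have h0 : pre b 0 = 0 := prefixSum_zero _
      rw [hpre b 0 h, h0, zero_add, hloc, sum_chainInc_zero, hτ, add_comm]
    | succ k ih =>
      intro h
      rw [hpre b (k + 1) h, Matrix.mulVec_add, ih (by omega), hloc, sum_chainInc_succ init σ b k h]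
      linear_combination σ (.inl (b, ⟨k, by omega⟩)) * two_eq_zero_bits
  -- Flips up to and including the slice `st b`, as the edge of this slice is the one with vanishing
  -- syndrome.
  let g : Fin N → Bits (Fin n) := fun b => pre b (st b + 1)
  have hg : ∀ b, A *ᵥ g b = c b := by
    intro b
    change A *ᵥ pre b (st b + 1) = c b
    rw [hA b (st b) (st b).2, Fin.eta, hσ, add_zero]
  let G := classSum init g
  have hGrec : ∀ b, G b = g b + ∑ j, if IsNext init j b then G j else 0 := classSum_eq init g
  have hG : ∀ b, A *ᵥ G b = τ b := by
    intro b
    induction b using WellFoundedLT.induction with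
    | ind b ih =>
      rw [hGrec, Matrix.mulVec_add, hg, Matrix.mulVec_sum]
      have : (∑ j, A *ᵥ (if IsNext init j b then G j else 0)) =
          ∑ j, if IsNext init j b then τ j else 0 := by
        refine Finset.sum_congr rfl fun j _ => ?_
        by_cases hj : IsNext init j b
        · rw [if_pos hj, if_pos hj, ih j hj.1]
        · rw [if_neg hj, if_neg hj, Matrix.mulVec_zero]
      rw [this]
      linear_combination (∑ j, if IsNext init j b then τ j else 0) * two_eq_zero_bits
  let Qe : ChainE T init → Bits (Fin n) := fun e => match e with
    | .inl (b, s) => pre b (s + 1) + g b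
    | .inr j => G j
  have hq : ∀ v, ∃ q : Bits κ, φ v = ∑ e, chainInc init v e • Qe e + q ᵥ* B := by
    rintro ⟨b, ⟨k, hk⟩⟩
    rcases k with _ | k
    · have h0 : pre b 0 = 0 := prefixSum_zero _
      have h1 : (∑ j : {j // HasJunction init j},
          if j.1 = b ∨ IsNext init j b then Qe (.inr j) else 0) = _ := sum_junctions init G b
      have h2 : Qe (.inl (b, ⟨0, hk⟩)) = φ (b, ⟨0, hk⟩) + g b := by
        change pre b (0 + 1) + g b = _
        rw [hpre b 0 hk, h0, zero_add]
      rw [sum_chainInc_zero, h1, h2]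
      have h3 := hGrec b
      by_cases hb : HasJunction init b
      · refine ⟨0, ?_⟩
        rw [Matrix.zero_vecMul, add_zero, if_pos hb]
        linear_combination (-(g b + ∑ j, if IsNext init j b then G j else 0)) * two_eq_zero_bits - h3
      -- The class ends at `b`, or the block starts in plus: no junction can absorb `G b`. But its
      -- syndrome is zero and its support lies in the columns of the flips, so it is a combination
      -- of rows of `B`, absorbed at the first vertex.
      · obtain ⟨q, hq⟩ := hsmall (G b) (by
          intro i hi
          by_contra! hc
          apply hi
          refine (Finset.sum_apply i _ g).trans ?_
          refine Finset.sum_eq_zero fun b' _ => ?_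
          by_contra hne
          obtain ⟨s, hs⟩ := exists_ne_zero_of_prefixSum hne
          exact hs (hc _)) (by
          rw [hG]
          exact dif_neg hb)
        refine ⟨q, ?_⟩
        rw [hq, if_neg hb]
        linear_combination (-(g b + ∑ j, if IsNext init j b then G j else 0)) * two_eq_zero_bits - h3
    · refine ⟨0, ?_⟩
      rw [sum_chainInc_succ, Matrix.zero_vecMul, add_zero]
      change φ _ = pre b (k + 1 + 1) + g b + (pre b (k + 1) + g b)
      rw [hpre b (k + 1) hk]
      linear_combination (-(pre b (k + 1) + g b)) * two_eq_zero_bits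
  choose q hq using hq
  refine ⟨Qe, q, ?_, hq, fun b i hi => ?_⟩
  · rintro (⟨b, s⟩ | j)
    · change _ = A *ᵥ (pre b (s + 1) + g b)
      rw [Matrix.mulVec_add, hA b s s.2, hg, Fin.eta]
      linear_combination (-(c b)) * two_eq_zero_bits
    · change _ = A *ᵥ G j
      rw [hG]
      simp only [τ, dif_pos j.2]
  · have hT1 : (⟨T - 1, by omega⟩ : Fin T).val + 1 = T := by simp only; omega
    rw [sum_chainLst init Qe b ⟨T - 1, by omega⟩ hT1] at hi
    have h1 : Qe (.inl (b, ⟨T - 1, by omega⟩)) = pre b T + pre b (st b + 1) := by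
      change pre b (T - 1 + 1) + g b = _
      rw [show T - 1 + 1 = T by omega]
    rw [h1] at hi
    obtain ⟨s, hs, hs'⟩ := exists_ne_zero_of_prefixSum_add (by have := (st b).2; omega) hi
    exact ⟨s, Fin.lt_def.2 (by omega), hs'⟩

end

/-! ### The states that are prepared by chains -/

section
variable {n N T : ℕ} {init : Fin N → BlockInit} {κ : Type} [Fintype κ]
  {A B : Matrix κ (Fin n) (ZMod 2)}

/-- With zero standard outcomes, each edge forces the strings at its ends to agree modulo `W`.
Following a chain transports the string on the data to its first vertex, where the junctions impose
exactly the constraints of the initial state. -/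
theorem chain_code_iff (hT : 0 < T) (hBA : ∀ r, B *ᵥ (r ᵥ* A) = 0)
    {W : Submodule (ZMod 2) (Bits (Fin n))} (hW : ∀ y, y ∈ W ↔ ∃ r, r ᵥ* A = y)
    (D : Fin N → Bits (Fin n)) :
    (∃ (P : ChainV N T → Bits (Fin n)) (r : ChainE T init → Bits κ), (∀ v, 0 = B *ᵥ P v) ∧
      ∀ e, 0 = ∑ b, chainLst init b e • D b + ∑ v, chainInc init v e • P v + r e ᵥ* A) ↔
    (∀ b, B *ᵥ D b = 0) ∧ (∀ b, init b = .zero → D b ∈ W) ∧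
      ∀ b b', SameClass init b' b → D b' + D b ∈ W := by
  classical
  have hadd : ∀ a b : Bits (Fin n), 0 = a + b → a = b := by
    intro a b h
    linear_combination (-b) * two_eq_zero_bits - h
  have hadd' : ∀ a b c : Bits (Fin n), a + b ∈ W → b + c ∈ W → a + c ∈ W := by
    intro a b c h h'
    have := W.add_mem h h'
    convert this using 1
    linear_combination (-b) * two_eq_zero_bits
  have hBW : ∀ y ∈ W, B *ᵥ y = 0 := by
    intro y hy
    obtain ⟨r, rfl⟩ := (hW y).1 hy
    exact hBA r
  constructor
  · rintro ⟨P, r, hP, he⟩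
    have hlast : ∀ b, D b + P (b, ⟨T - 1, by omega⟩) ∈ W := by
      intro b
      have hs : (⟨T - 1, by omega⟩ : Fin T).val + 1 = T := by simp only; omega
      have := he (.inl (b, ⟨T - 1, by omega⟩))
      rw [sum_chainLst_edge, if_pos hs, sum_chainInc_edge_last init P b _ hs] at this
      exact (hW _).2 ⟨_, (hadd _ _ this).symm⟩
    have hstep : ∀ b k (h : k + 1 < T), P (b, ⟨k, by omega⟩) + P (b, ⟨k + 1, h⟩) ∈ W := by
      intro b k h
      have := he (.inl (b, ⟨k, by omega⟩))
      rw [sum_chainLst_edge, if_neg (by simp only; omega), sum_chainInc_edge init P b k h,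
        zero_add] at this
      exact (hW _).2 ⟨_, (hadd _ _ this).symm⟩
    have hfirst : ∀ b k (h : k < T), P (b, ⟨k, h⟩) + P (b, ⟨0, hT⟩) ∈ W := by
      intro b k
      induction k with
      | zero => intro h; rw [bits_add_self]; exact W.zero_mem
      | succ k ih =>
        intro h
        refine hadd' _ _ _ ?_ (ih (by omega))
        rw [add_comm]
        exact hstep b k h
    have hD : ∀ b, D b + P (b, ⟨0, hT⟩) ∈ W := fun b =>
      hadd' _ _ _ (hlast b) (hfirst b _ _)
    have hj : ∀ j : {j // HasJunction init j},
        P (j.1, ⟨0, hT⟩) + ∑ b, (if IsNext init j b then P (b, ⟨0, hT⟩) else 0) ∈ W := by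
      intro j
      have h := he (.inr j)
      rw [sum_chainInc_junction init P hT j, Finset.sum_eq_zero (s := Finset.univ)
        (f := fun b => chainLst init b (.inr j : ChainE T init) • D b)
        (fun b _ => zero_smul _ _), zero_add] at h
      exact (hW _).2 ⟨_, (hadd _ _ h).symm⟩
    have hnext : ∀ j b, IsNext init j b → D j + D b ∈ W := by
      intro j b h
      have h1 := hj ⟨j, Or.inr ⟨b, h⟩⟩
      rw [Finset.sum_eq_single b, if_pos h] at h1
      · refine hadd' _ _ _ (hD j) (hadd' _ _ _ h1 ?_)
        rw [add_comm]
        exact hD b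
      · intro b' _ hne
        exact if_neg fun h' => hne (h'.unique_right init h)
      · exact fun h => absurd (Finset.mem_univ _) h
    refine ⟨fun b => ?_, fun b hb => ?_, ?_⟩
    · have := hBW _ (hlast b)
      rwa [Matrix.mulVec_add, ← hP, add_zero] at this
    · have h1 := hj ⟨b, Or.inl hb⟩
      rw [Finset.sum_eq_zero, add_zero] at h1
      · have := W.add_mem (hD b) h1
        convert this using 1
        linear_combination (-(P (b, ⟨0, hT⟩))) * two_eq_zero_bits
      · intro b' _
        refine if_neg fun h => ?_
        rcases h.2.1 with h' | ⟨c, h', -⟩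
        · exact h.1.ne h'
        · simp only [hb] at h'
          cases h'
    -- Junctions only link consecutive blocks of a class; agreement of all its blocks follows by
    -- induction.
    · have key : ∀ b b', b' ≤ b → SameClass init b' b → D b' + D b ∈ W := by
        intro b
        induction b using WellFoundedLT.induction with
        | ind b ih =>
          intro b' hle hs
          rcases hle.lt_or_eq with hlt | rfl
          · obtain ⟨j, hj⟩ := exists_isNext init hlt hs
            have h1 : b' ≤ j := by
              by_contra h
              exact hj.2.2 b' (not_le.1 h) hlt hs
            exact hadd' _ _ _ (ih j hj.1 b' h1 (hs.trans init hj.2.1.symm)) (hnext j b hj)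
          · rw [bits_add_self]
            exact W.zero_mem
      intro b b' hs
      rcases le_total b' b with h | h
      · exact key b b' h hs
      · rw [add_comm]
        exact key b' b h hs.symm
  · rintro ⟨hB, hz, hs⟩
    -- For the converse the string on the data is repeated along its whole chain.
    have hr : ∀ e : ChainE T init, ∃ r : Bits κ,
        0 = ∑ b, chainLst init b e • D b + ∑ v : ChainV N T, chainInc init v e • D v.1 +
          r ᵥ* A := by
      have hr' : ∀ y ∈ W, ∃ r : Bits κ, 0 = y + r ᵥ* A := by
        intro y hy
        obtain ⟨r, rfl⟩ := (hW y).1 hy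
        exact ⟨r, (bits_add_self _).symm⟩
      rintro (⟨b, s⟩ | j)
      · apply hr'
        rw [sum_chainLst_edge]
        by_cases h : s.val + 1 = T
        · rw [if_pos h, sum_chainInc_edge_last init _ b s h, bits_add_self]
          exact W.zero_mem
        · obtain ⟨k, hk⟩ := s
          rw [if_neg h, zero_add, sum_chainInc_edge init _ b k (by simp only at h; omega),
            bits_add_self]
          exact W.zero_mem
      · apply hr'
        rw [sum_chainInc_junction init _ hT j, Finset.sum_eq_zero (s := Finset.univ)
          (f := fun b => chainLst init b (.inr j : ChainE T init) • D b)
          (fun b _ => zero_smul _ _), zero_add]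
        by_cases h : ∃ b, IsNext init j b
        · obtain ⟨b, h⟩ := h
          rw [Finset.sum_eq_single b, if_pos h]
          · exact hs _ _ h.2.1
          · intro b' _ hne
            exact if_neg fun h' => hne (h'.unique_right init h)
          · exact fun h => absurd (Finset.mem_univ _) h
        · rw [Finset.sum_eq_zero fun b _ => if_neg fun hb => h ⟨b, hb⟩, add_zero]
          exact hz _ (j.2.resolve_right h)
    choose r hr using hr
    exact ⟨fun v => D v.1, r, fun v => (hB _).symm, hr⟩

end

/-! ### Preparation gadgets -/

/-- A bipartite graph whose state, after the measurement of the ancillas, prepares the uniform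
superposition of `𝒟` on the qubits `δ`; its outcomes satisfy local checks, by which clusters of
fewer than `τ` errors can be decoded. -/
structure Gadget (δ : Type) [Fintype δ] [DecidableEq δ] (τ Δ : ℕ) (𝒟 : Set (Bits δ)) where
  α : Type
  fin : Fintype α
  dec : DecidableEq α
  ctrl : δ ⊕ α → Prop
  graph : δ ⊕ α → δ ⊕ α → ZMod 2
  basis : α → Basis
  symm : ∀ x y, graph x y = graph y x
  bipartite : ∀ x y, graph x y ≠ 0 → (ctrl x ↔ ¬ ctrl y)
  data : ∀ i, ctrl (.inl i)
  had_iff : ∀ v, basis v = .had ↔ ctrl (.inr v)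
  bdd : BddRel (fun x y => graph x y ≠ 0) Δ
  nbrs : α → Finset α
  nbrs_symm : ∀ x y, y ∈ nbrs x → x ∈ nbrs y
  card_nbrs : ∀ x, (nbrs x).card ≤ Δ
  Loc : Submodule (ZMod 2) (Bits α)
  isLocal : IsLocal nbrs Loc
  flips_mem : ∀ P : Pauli (δ ⊕ α), P.1 ∈ graphCode ctrl graph →
    P.2 ∈ graphCode (fun x => ¬ ctrl x) graph → flips basis P.right ∈ Loc
  root : δ → α → Prop
  dep : α → ℕ
  root_inj : ∀ i i' v, root i v → root i' v → i = i'
  one_le_dep : ∀ v, 1 ≤ dep v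
  root_bdd : ∀ k, BddRel (fun i v => root i v ∧ dep v = k) 2
  exists_stabilizer : ∀ f ∈ Loc, (bitSupp f).card < τ → ∃ P : Pauli (δ ⊕ α),
    P.1 ∈ graphCode ctrl graph ∧ P.2 ∈ graphCode (fun x => ¬ ctrl x) graph ∧
    flips basis P.right = f ∧
    ∀ q ∈ pauliSupp P.left, ∃ v ∈ bitSupp f, root q v ∧ dep v ≤ (bitSupp f).card
  code_eq : {z : Bits δ | ∃ a ∈ graphCode ctrl graph, a ∘ Sum.inl = z ∧
    ∀ v, basis v = .std → a (.inr v) = 0} = 𝒟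

attribute [instance] Gadget.fin Gadget.dec

section
variable {n N T : ℕ} {init : Fin N → BlockInit} {κ : Type}

/-- The measurement bases of the ancillas. -/
def foliBasis {V E : Type} : Sites n κ V E → Basis
  | (.inl _, .inl _) => .had
  | (.inr _, .inr _) => .had
  | _ => .std

/-- The block and the slice of a site. -/
def slice : Sites n κ (ChainV N T) (ChainE T init) → Option (Fin N × Fin T)
  | (.inl v, _) => some v
  | (.inr (.inl v), _) => some v
  | (.inr (.inr _), _) => none

/-- The distance of a site from the data. -/
def depth (v : Sites n κ (ChainV N T) (ChainE T init)) : ℕ :=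
  match slice v with
  | some (_, s) => T - s
  | none => T

/-- The qubit of the code blocks on the same line as a site. -/
def IsRoot (q : Data N n) (v : Sites n κ (ChainV N T) (ChainE T init)) : Prop :=
  v.2 = .inl q.2 ∧ ∃ s, slice v = some (q.1, s)

theorem IsRoot.inj {q q' : Data N n} {v : Sites n κ (ChainV N T) (ChainE T init)}
    (h : IsRoot q v) (h' : IsRoot q' v) : q = q' := by
  obtain ⟨h1, s, h2⟩ := h
  obtain ⟨h1', s', h2'⟩ := h'
  refine Prod.ext ?_ (Sum.inl_injective (h1.symm.trans h1'))
  exact (Prod.mk.inj (Option.some_injective _ (h2.symm.trans h2'))).1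

theorem one_le_depth (hT : 0 < T) (v : Sites n κ (ChainV N T) (ChainE T init)) : 1 ≤ depth v := by
  unfold depth
  split
  · omega
  · exact hT

theorem root_depth_bdd (k : ℕ) :
    BddRel (fun q (v : Sites n κ (ChainV N T) (ChainE T init)) => IsRoot q v ∧ depth v = k) 2 := by
  classical
  rintro ⟨b, i⟩
  by_cases hk : ∃ s : Fin T, T - s = k
  · obtain ⟨s, rfl⟩ := hk
    refine ⟨{(.inl (b, s), .inl i), (.inr (.inl (b, s)), .inl i)}, Finset.card_le_two, ?_⟩
    rintro ⟨x, y⟩ ⟨⟨h1, s', h2⟩, h3⟩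
    simp only at h1 h2
    subst h1
    rw [depth, h2] at h3
    simp only at h3
    have hs : s' = s := Fin.ext (by omega)
    subst hs
    rcases x with v | v | j
    · simp only [slice, Option.some.injEq] at h2
      simp [h2]
    · simp only [slice, Option.some.injEq] at h2
      simp [h2]
    · simp [slice] at h2
  · refine ⟨∅, by simp, ?_⟩
    rintro v ⟨⟨h1, s', h2⟩, h3⟩
    rw [depth, h2] at h3
    exact absurd ⟨s', h3⟩ hk

variable [Fintype κ] [DecidableEq κ]

/-- Fewer than `T` errors leave some slice of each block untouched. -/
theorem exists_last_empty_slice (f : Bits (Sites n κ (ChainV N T) (ChainE T init)))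
    (hf : (bitSupp f).card < T) (b : Fin N) : ∃ s : Fin T,
      (∀ v, slice v = some (b, s) → f v = 0) ∧ ∀ s', s < s' → T - s' ≤ (bitSupp f).card := by
  classical
  have hcard : ∀ S : Finset (Fin T), (∀ s ∈ S, ∃ v, slice v = some (b, s) ∧ f v ≠ 0) →
      S.card ≤ (bitSupp f).card := by
    intro S hS
    have h1 : S.image (fun s => some (b, s)) ⊆ (bitSupp f).image slice := by
      intro x hx
      obtain ⟨s, hs, rfl⟩ := Finset.mem_image.1 hx
      obtain ⟨v, hv, hfv⟩ := hS s hs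
      exact Finset.mem_image.2 ⟨v, mem_bitSupp.2 hfv, hv⟩
    have h2 := (Finset.card_le_card h1).trans Finset.card_image_le
    rwa [Finset.card_image_of_injective] at h2
    intro s s' h
    exact (Prod.mk.inj (Option.some_injective _ h)).2
  -- The slices without errors. There is one, as each of the `T` slices would otherwise contain one
  -- of fewer than `T` errors; the last of them is chosen.
  let S : Finset (Fin T) := Finset.univ.filter fun s => ∀ v, slice v = some (b, s) → f v = 0
  have hS : S.Nonempty := by
    by_contra hS
    have := hcard Finset.univ (by
      intro s _
      by_contra! hc
      exact hS ⟨s, Finset.mem_filter.2 ⟨Finset.mem_univ _, hc⟩⟩)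
    rw [Finset.card_univ, Fintype.card_fin] at this
    omega
  obtain ⟨s, hs, hmax⟩ := Finset.exists_max_image S id hS
  refine ⟨s, (Finset.mem_filter.1 hs).2, fun s' hs' => ?_⟩
  -- Every slice from `s'` on contains an error, so the distance `T - s'` to the data is at most the
  -- number of errors.
  have := hcard (Finset.Ici s') (by
    intro r hr
    by_contra! hc
    have := hmax r (Finset.mem_filter.2 ⟨Finset.mem_univ _, hc⟩)
    exact absurd (hs'.trans_le (Finset.mem_Ici.1 hr)) (not_lt.2 this))
  rwa [Fin.card_Ici] at this

/-- Projecting the sites to their columns does not increase cardinality. Thus a vector on one block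
that is produced by fewer than `d` flips has weight below `d`. -/
theorem card_bitSupp_le_of_sites {V E : Type} [Fintype V] [Fintype E] [DecidableEq V]
    [DecidableEq E] (f : Bits (Sites n κ V E)) (y : Bits (Fin n))
    (h : ∀ i, y i ≠ 0 → ∃ x, f (x, .inl i) ≠ 0) : (bitSupp y).card ≤ (bitSupp f).card := by
  have h1 : (bitSupp y).image Sum.inl ⊆ (bitSupp f).image Prod.snd := by
    intro x hx
    obtain ⟨i, hi, rfl⟩ := Finset.mem_image.1 hx
    obtain ⟨x, hx⟩ := h i (mem_bitSupp.1 hi)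
    exact Finset.mem_image.2 ⟨_, mem_bitSupp.2 hx, rfl⟩
  have h2 := (Finset.card_le_card h1).trans Finset.card_image_le
  rwa [Finset.card_image_of_injective _ Sum.inl_injective] at h2

/-- Assembles bits on the data and on the ancillas. -/
def foliBits {V E : Type} (D : Fin N → Bits (Fin n)) (P : V → Bits (Fin n)) (q : V → Bits κ)
    (R : E → Bits (Fin n)) (r : E → Bits κ) : Bits (Data N n ⊕ Sites n κ V E)
  | .inl (b, i) => D b i
  | .inr (.inl v, .inl i) => P v i
  | .inr (.inl v, .inr c) => q v c
  | .inr (.inr e, .inl i) => R e i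
  | .inr (.inr e, .inr c) => r e c

variable {Q : CSSCode n} {ℓ : ℕ}

/-- The foliated graph of the sparse checks. Its outcome checks hold because `A` and `B` are
orthogonal, and its small clusters are decoded by the two chain lemmas. The term `(ℓ + 4)²` bounds
the graph of outcome checks and `12 + 2ℓ` the graph of the CNOT gates. -/
theorem exists_gadget (L : LogicalBasis Q) (hQ : Q.IsLDPC ℓ) (hT : 0 < T)
    (init : Fin N → BlockInit) :
    ∃ G : Gadget (Data N n) (min T Q.dist) ((ℓ + 4) * (ℓ + 4) + 12 + 2 * ℓ)
      {y | (∀ b, Q.HZ *ᵥ (fun i => y (b, i)) = 0) ∧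
        (∀ b, init b = .zero → L.LZ *ᵥ (fun i => y (b, i)) = 0) ∧
        (∀ b b' c, init b = .ghz c → init b' = .ghz c →
          L.LZ *ᵥ (fun i => y (b, i)) = L.LZ *ᵥ (fun i => y (b', i)))},
      Fintype.card G.α ≤ 3 * (ℓ + 1) * N * n * T := by
  classical
  obtain ⟨κ, _, _, A, B, hcard, hA, hB, hA', hB', hAs, hBs⟩ := hQ.exists_checks
  have hW : ∀ y, y ∈ rowSpace Q.HX ↔ ∃ r, r ᵥ* A = y := fun y => by
    rw [← hAs]; exact mem_span_row_iff A y
  have hWZ : ∀ y, y ∈ rowSpace Q.HZ ↔ ∃ r, r ᵥ* B = y := fun y => by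
    rw [← hBs]; exact mem_span_row_iff B y
  have hA0 := fun y => mulVec_eq_zero_iff_of_span hAs y
  have hB0 := fun y => mulVec_eq_zero_iff_of_span hBs y
  have hBA : ∀ r, B *ᵥ (r ᵥ* A) = 0 := fun r =>
    (hB0 _).2 (mulVec_eq_zero_of_mem_rowSpace Q.orth ((hW _).2 ⟨r, rfl⟩))
  have hAB : ∀ r, A *ᵥ (r ᵥ* B) = 0 := fun r =>
    (hA0 _).2 (mulVec_eq_zero_of_mem_rowSpace Q.orth' ((hWZ _).2 ⟨r, rfl⟩))
  refine ⟨{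
    α := Sites n κ (ChainV N T) (ChainE T init)
    fin := inferInstance
    dec := inferInstance
    ctrl := foliCtrl
    graph := foliGraph A B (chainInc init) (chainLst init)
    basis := foliBasis
    symm := foliGraph_symm _ _ _ _
    bipartite := foliGraph_bipartite _ _ _ _
    data := fun i => trivial
    had_iff := ?_
    bdd := ?_
    nbrs := foliNbrs A B (chainInc init)
    nbrs_symm := foliNbrs_symm A B _
    card_nbrs := ?_
    Loc := foliLoc A B (chainInc init) (chainLst init)
    isLocal := isLocal_foliLoc _ _ _ _
    flips_mem := ?_
    root := IsRoot
    dep := depth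
    root_inj := fun i i' v h h' => h.inj h'
    one_le_dep := one_le_depth hT
    root_bdd := root_depth_bdd
    exists_stabilizer := ?_
    code_eq := ?_ }, ?_⟩
  · rintro ⟨v | e, i | c⟩ <;> simp [foliBasis, foliCtrl]
  · refine (foliGraph_bdd A B _ _ hA hB hA' hB' (chainInc_bdd init) (chainInc_bdd' init)
      (chainLst_bdd init) (chainLst_bdd' init)).mono (fun _ _ h => h) ?_
    nlinarith
  · intro x
    refine (card_foliNbrs_le A B _ hA hB hA' hB' (chainInc_bdd init) (chainInc_bdd' init) x).trans ?_
    omega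
  · intro P h1 h2
    rw [mem_foliCode_iff] at h1
    rw [mem_foliCode_dual_iff] at h2
    rw [mem_foliLoc_iff]
    constructor
    · intro v
      refine (congrArg (A *ᵥ ·) (h2.2.2 v)).trans ?_
      rw [Matrix.mulVec_add, hAB, add_zero, Matrix.mulVec_sum]
      refine Finset.sum_congr rfl fun e _ => ?_
      rw [Matrix.mulVec_smul, ← h2.2.1 e]
      rfl
    · intro e he
      refine (congrArg (B *ᵥ ·) (h1.2 e)).trans ?_
      rw [Matrix.mulVec_add, hBA, add_zero, Finset.sum_eq_zero fun b _ => by rw [he, zero_smul],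
        zero_add, Matrix.mulVec_sum]
      refine Finset.sum_congr rfl fun v _ => ?_
      rw [Matrix.mulVec_smul, ← h1.1 v]
      rfl
  · intro f hf hlt
    rw [mem_foliLoc_iff] at hf
    -- Fewer than `T` flips provide the cut in each chain, and fewer than `Q.dist` flips make the
    -- leftover vectors trivial; this is the role of the minimum.
    choose st hst hst' using exists_last_empty_slice f (by omega)
    obtain ⟨P, r, D, hP, hr, hD⟩ := chain_decode_X (A := A) (B := B) hT
      (fun e i => f (.inr e, .inl i)) (fun v c => f (.inl v, .inr c)) hf.2 st
      (fun b => funext fun i => hst b _ rfl) (fun b => funext fun c => hst b _ rfl) (by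
        intro y hy hBy
        rw [← hW]
        refine Q.mem_rowSpace_HX_of_card_lt ((hB0 y).1 hBy) ?_
        have := card_bitSupp_le_of_sites f y fun i hi => by
          obtain ⟨e, he⟩ := hy i hi
          exact ⟨_, he⟩
        omega)
    obtain ⟨R, q, hR, hq, hDZ⟩ := chain_decode_Z (A := A) (B := B) hT
      (fun v i => f (.inl v, .inl i)) (fun e c => f (.inr e, .inr c)) hf.1 st
      (fun b => funext fun c => hst b _ rfl) (by
        intro y hy hAy
        rw [← hWZ]
        refine Q.mem_rowSpace_HZ_of_card_lt ((hA0 y).1 hAy) ?_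
        have := card_bitSupp_le_of_sites f y fun i hi => by
          obtain ⟨e, he⟩ := hy i hi
          exact ⟨_, he⟩
        omega)
    refine ⟨(foliBits D P (fun v c => f (.inl v, .inr c)) (fun e i => f (.inr e, .inl i)) r,
      foliBits (fun b => ∑ e, chainLst init b e • R e) (fun v i => f (.inl v, .inl i)) q R
        fun e c => f (.inr e, .inr c)), ?_, ?_, ?_, ?_⟩
    · rw [mem_foliCode_iff]
      exact ⟨hP, hr⟩
    · rw [mem_foliCode_dual_iff]
      exact ⟨fun b => rfl, hR, hq⟩
    · funext v
      rcases v with ⟨v | e, i | c⟩ <;> rfl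
    · rintro ⟨b, i⟩ hqs
      rcases mem_pauliSupp.1 hqs with h | h
      · obtain ⟨s, hs, hs'⟩ := hD b i h
        exact ⟨_, mem_bitSupp.2 hs', ⟨rfl, s, rfl⟩, hst' b s hs⟩
      · obtain ⟨s, hs, hs'⟩ := hDZ b i h
        exact ⟨_, mem_bitSupp.2 hs', ⟨rfl, s, rfl⟩, hst' b s hs⟩
  · ext z
    have h1 := chain_code_iff (init := init) hT hBA hW fun b i => z (b, i)
    have h2 : (∃ a ∈ graphCode foliCtrl (foliGraph A B (chainInc (T := T) init) (chainLst init)),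
        a ∘ Sum.inl = z ∧ ∀ v, foliBasis v = .std → a (.inr v) = 0) ↔
        ∃ (P : ChainV N T → Bits (Fin n)) (r : ChainE T init → Bits κ), (∀ v, 0 = B *ᵥ P v) ∧
          ∀ e, 0 = ∑ b, chainLst init b e • (fun i => z (b, i)) +
            ∑ v, chainInc init v e • P v + r e ᵥ* A := by
      constructor
      · rintro ⟨a, ha, rfl, h0⟩
        rw [mem_foliCode_iff] at ha
        refine ⟨fun v i => a (.inr (.inl v, .inl i)), fun e c => a (.inr (.inr e, .inr c)),
          fun v => ?_, fun e => ?_⟩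
        · rw [← ha.1 v]
          exact funext fun c => (h0 _ rfl).symm
        · refine Eq.trans ?_ (ha.2 e)
          exact funext fun c => (h0 _ rfl).symm
      · rintro ⟨P, r, hP, hr⟩
        refine ⟨foliBits (fun b i => z (b, i)) P 0 0 r, ?_, rfl, ?_⟩
        · rw [mem_foliCode_iff]
          exact ⟨hP, hr⟩
        · rintro ⟨v | e, i | c⟩ h
          · cases h
          · rfl
          · rfl
          · cases h
    refine (h2.trans h1).trans ?_
    have hL := L.mem_rowSpace_iff
    constructor
    · rintro ⟨h3, h4, h5⟩
      refine ⟨fun b => (hB0 _).1 (h3 b), fun b hb => ((hL _).1 (h4 b hb)).2, ?_⟩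
      intro b b' c hb hb'
      have h6 := ((hL _).1 (h5 b b' (Or.inr ⟨c, hb', hb⟩))).2
      rw [Matrix.mulVec_add] at h6
      linear_combination h6 - (L.LZ *ᵥ fun i => z (b', i)) * two_eq_zero_bits
    · rintro ⟨h3, h4, h5⟩
      refine ⟨fun b => (hB0 _).2 (h3 b), fun b hb => (hL _).2 ⟨h3 b, h4 b hb⟩, ?_⟩
      intro b b' h
      rcases h with rfl | ⟨c, hb', hb⟩
      · rw [bits_add_self]
        exact Submodule.zero_mem _
      · refine (hL _).2 ⟨?_, ?_⟩
        · rw [Matrix.mulVec_add, h3, h3, add_zero]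
        · rw [Matrix.mulVec_add, h5 b' b c hb' hb]
          exact bits_add_self _
  · have h1 : Fintype.card {j // HasJunction init j} ≤ N :=
      (Fintype.card_subtype_le _).trans (by simp)
    have h2 : Fintype.card (Sites n κ (ChainV N T) (ChainE T init)) =
        (N * T + (N * T + Fintype.card {j // HasJunction init j})) * (n + Fintype.card κ) := by
      simp [Sites, ChainV, ChainE]
    refine h2.le.trans ?_
    -- As `T ≥ 1`, the at most `N` junctions cost no more than one further copy of the chains.
    have h3 : N ≤ N * T := Nat.le_mul_of_pos_right _ hT
    calc (N * T + (N * T + Fintype.card {j // HasJunction init j})) * (n + Fintype.card κ)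
        ≤ (3 * (N * T)) * (n + ℓ * n) := Nat.mul_le_mul (by omega) (by omega)
      _ = 3 * (ℓ + 1) * N * n * T := by ring

end

/-! ### Renaming the ancillas of a gadget -/

section
variable {δ : Type} [Fintype δ] [DecidableEq δ] {τ Δ : ℕ} {𝒟 : Set (Bits δ)}

theorem mem_graphCode_comp {ι ι' : Type} [Fintype ι] [DecidableEq ι] [Fintype ι'] [DecidableEq ι']
    (e : ι' ≃ ι) (ctrl : ι → Prop) (M : ι → ι → ZMod 2) (a : Bits ι) :
    a ∘ e ∈ graphCode (fun x => ctrl (e x)) (fun x y => M (e x) (e y)) ↔ a ∈ graphCode ctrl M := by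
  refine e.forall_congr fun t => imp_congr_right fun _ => ?_
  rw [← e.sum_comp fun y => M (e t) y * a y]
  rfl

theorem bitSupp_comp {α β : Type} [Fintype α] [DecidableEq α] [Fintype β] [DecidableEq β]
    (e : β ≃ α) (f : Bits β) : bitSupp (f ∘ e.symm) = (bitSupp f).map e.toEmbedding := by
  ext v
  rw [Finset.mem_map_equiv, mem_bitSupp, mem_bitSupp]
  rfl

theorem BddRel.comp {X Y X' Y' : Type} {r : X → Y → Prop} {Δ : ℕ} (h : BddRel r Δ) (f : X' → X)
    (e : Y' ≃ Y) : BddRel (fun x y => r (f x) (e y)) Δ := by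
  intro x
  obtain ⟨s, hs, hs'⟩ := h (f x)
  exact ⟨s.map e.symm.toEmbedding, by rwa [Finset.card_map], fun y hy => by
    rw [Finset.mem_map_equiv]; exact hs' _ hy⟩

/-- The gadget with renamed ancillas. -/
def Gadget.reindex (G : Gadget δ τ Δ 𝒟) {β : Type} [Fintype β] [DecidableEq β] (e : β ≃ G.α) :
    Gadget δ τ Δ 𝒟 where
  α := β
  fin := inferInstance
  dec := inferInstance
  ctrl x := G.ctrl ((Equiv.refl δ).sumCongr e x)
  graph x y := G.graph ((Equiv.refl δ).sumCongr e x) ((Equiv.refl δ).sumCongr e y)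
  basis v := G.basis (e v)
  symm _ _ := G.symm _ _
  bipartite _ _ h := G.bipartite _ _ h
  data i := G.data i
  had_iff v := G.had_iff (e v)
  bdd := G.bdd.comp _ _
  nbrs v := (G.nbrs (e v)).map e.symm.toEmbedding
  nbrs_symm x y h := by
    rw [Finset.mem_map_equiv] at h ⊢
    exact G.nbrs_symm _ _ h
  card_nbrs x := by
    rw [Finset.card_map]
    exact G.card_nbrs _
  Loc := G.Loc.comap (LinearMap.funLeft (ZMod 2) (ZMod 2) e.symm)
  isLocal := by
    intro b hb K hK hcl
    have h := G.isLocal _ hb (K.map e.toEmbedding) (by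
      refine (Finset.map_subset_map.2 hK).trans ?_
      exact (bitSupp_comp e b).symm.subset) (by
      intro x hx y hy hxy
      rw [Finset.mem_map_equiv] at hx ⊢
      have hy' := mem_bitSupp.1 hy
      refine hcl _ hx _ (mem_bitSupp.2 hy') ?_
      rw [Finset.mem_map_equiv, Equiv.symm_symm, e.apply_symm_apply, e.apply_symm_apply]
      exact hxy)
    change _ ∈ G.Loc
    convert h using 1
    funext v
    by_cases hv : e.symm v ∈ K
    · exact (if_pos hv).trans (if_pos (Finset.mem_map_equiv.2 hv)).symm
    · exact (if_neg hv).trans (if_neg (mt Finset.mem_map_equiv.1 hv)).symm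
  flips_mem P h1 h2 := by
    change _ ∈ G.Loc
    have h := G.flips_mem (P.1 ∘ ((Equiv.refl δ).sumCongr e).symm,
      P.2 ∘ ((Equiv.refl δ).sumCongr e).symm) (by
        rw [← mem_graphCode_comp ((Equiv.refl δ).sumCongr e), Function.comp_assoc,
          Equiv.symm_comp_self]
        exact h1) (by
        rw [← mem_graphCode_comp ((Equiv.refl δ).sumCongr e), Function.comp_assoc,
          Equiv.symm_comp_self]
        exact h2)
    convert h using 1
    funext v
    change (match G.basis (e (e.symm v)) with | .std => _ | .had => _) = _
    rw [e.apply_symm_apply]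
    rfl
  root i v := G.root i (e v)
  dep v := G.dep (e v)
  root_inj i i' v h h' := G.root_inj i i' _ h h'
  one_le_dep v := G.one_le_dep _
  root_bdd k := (G.root_bdd k).comp id e
  exists_stabilizer := by
    intro f hf hlt
    have hcard : (bitSupp (f ∘ e.symm)).card = (bitSupp f).card := by
      rw [bitSupp_comp, Finset.card_map]
    obtain ⟨P, h1, h2, h3, h4⟩ := G.exists_stabilizer (f ∘ e.symm) hf (by rwa [hcard])
    refine ⟨(P.1 ∘ (Equiv.refl δ).sumCongr e, P.2 ∘ (Equiv.refl δ).sumCongr e),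
      (mem_graphCode_comp _ _ _ _).2 h1,
      (mem_graphCode_comp ((Equiv.refl δ).sumCongr e) (fun x => ¬ G.ctrl x) _ _).2 h2, ?_, ?_⟩
    · funext v
      have := congrFun h3 (e v)
      simp only [Function.comp, e.symm_apply_apply] at this
      exact this
    · intro q hq
      obtain ⟨v, hv, hr, hd⟩ := h4 q hq
      rw [hcard] at hd
      have hv' := mem_bitSupp.1 hv
      refine ⟨e.symm v, mem_bitSupp.2 hv', ?_, ?_⟩
      · rw [e.apply_symm_apply]; exact hr
      · rw [e.apply_symm_apply]; exact hd
  code_eq := by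
    refine Eq.trans ?_ G.code_eq
    ext z
    constructor
    · rintro ⟨a, ha, rfl, h0⟩
      refine ⟨a ∘ ((Equiv.refl δ).sumCongr e).symm, ?_, rfl, fun v hv => ?_⟩
      · rw [← mem_graphCode_comp ((Equiv.refl δ).sumCongr e), Function.comp_assoc,
          Equiv.symm_comp_self]
        exact ha
      · exact h0 (e.symm v) (by rw [e.apply_symm_apply]; exact hv)
    · rintro ⟨a, ha, rfl, h0⟩
      exact ⟨a ∘ (Equiv.refl δ).sumCongr e, (mem_graphCode_comp _ _ _ _).2 ha, rfl,
        fun v hv => h0 (e v) hv⟩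

/-! ### Decoding a gadget -/

variable (G : Gadget δ τ Δ 𝒟)

/-- A stabilizer of the state of the gadget. -/
def Gadget.IsStabilizer (P : Pauli (δ ⊕ G.α)) : Prop :=
  P.1 ∈ graphCode G.ctrl G.graph ∧ P.2 ∈ graphCode (fun x => ¬ G.ctrl x) G.graph

variable {G}

theorem Gadget.IsStabilizer.add {P P' : Pauli (δ ⊕ G.α)} (h : G.IsStabilizer P)
    (h' : G.IsStabilizer P') : G.IsStabilizer (P + P') :=
  ⟨add_mem_graphCode h.1 h'.1, add_mem_graphCode h.2 h'.2⟩

theorem Gadget.IsStabilizer.sum {X : Type} (s : Finset X) {P : X → Pauli (δ ⊕ G.α)}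
    (h : ∀ x ∈ s, G.IsStabilizer (P x)) : G.IsStabilizer (∑ x ∈ s, P x) := by
  constructor
  · rw [Prod.fst_sum]
    exact sum_mem_graphCode s _ fun x hx => (h x hx).1
  · rw [Prod.snd_sum]
    exact sum_mem_graphCode s _ fun x hx => (h x hx).2

variable (G)

/-- The residual of minimum weight decoding. -/
def Gadget.rest (e : Bits G.α) : Bits G.α := e + minWeight G.Loc e

theorem Gadget.rest_mem (e : Bits G.α) : G.rest e ∈ G.Loc := (minWeight_spec G.Loc e).1

/-- The clusters of errors that are left by minimum weight decoding. -/
def Gadget.restClusters (e : Bits G.α) : Finset (Finset G.α) :=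
  components G.nbrs (bitSupp (G.rest e))

/-- All clusters that are left are small. -/
def Gadget.Small (e : Bits G.α) : Prop := ∀ K ∈ G.restClusters e, K.card < τ

open Classical in
/-- A stabilizer that explains a cluster of flips. -/
def Gadget.stab (f : Bits G.α) : Pauli (δ ⊕ G.α) :=
  if h : f ∈ G.Loc ∧ (bitSupp f).card < τ then (G.exists_stabilizer f h.1 h.2).choose else 0

/-- A stabilizer that explains the residual of minimum weight decoding. -/
def Gadget.residual (e : Bits G.α) : Pauli (δ ⊕ G.α) :=
  ∑ K ∈ G.restClusters e, G.stab (restr (G.rest e) K)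

open Classical in
/-- A stabilizer that explains the outcomes, after the correction of a minimum weight error. -/
def Gadget.recovery (s : Bits G.α) : Pauli (δ ⊕ G.α) :=
  if h : ∃ P, G.IsStabilizer P ∧ flips G.basis P.right = G.rest s then h.choose else 0

variable {G}

theorem Gadget.restr_rest {e : Bits G.α} {K : Finset G.α} (hK : K ∈ G.restClusters e) :
    restr (G.rest e) K ∈ G.Loc ∧ bitSupp (restr (G.rest e) K) = K :=
  ⟨restr_mem_of_mem_components G.isLocal (G.rest_mem e) hK,
    bitSupp_restr (subset_of_mem_components hK)⟩

/-- The residual is the sum of its restrictions to clusters; each satisfies all checks by locality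
and is explained separately, so the stabilizers add up. -/
theorem Gadget.Small.residual {e : Bits G.α} (h : G.Small e) :
    G.IsStabilizer (G.residual e) ∧ flips G.basis (G.residual e).right = G.rest e := by
  have hK : ∀ K ∈ G.restClusters e, restr (G.rest e) K ∈ G.Loc ∧
      (bitSupp (restr (G.rest e) K)).card < τ := fun K hK =>
    ⟨(G.restr_rest hK).1, by rw [(G.restr_rest hK).2]; exact h K hK⟩
  constructor
  · refine Gadget.IsStabilizer.sum _ fun K hK' => ?_
    rw [Gadget.stab, dif_pos (hK K hK')]
    have := (G.exists_stabilizer _ (hK K hK').1 (hK K hK').2).choose_spec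
    exact ⟨this.1, this.2.1⟩
  · rw [Gadget.residual, Pauli.right_sum, flips_sum]
    refine Eq.trans ?_ (sum_restr_components G.nbrs_symm (G.rest e))
    refine Finset.sum_congr rfl fun K hK' => ?_
    rw [Gadget.stab, dif_pos (hK K hK')]
    exact (G.exists_stabilizer _ (hK K hK').1 (hK K hK').2).choose_spec.2.2.1

theorem Gadget.exists_of_mem_residual {e : Bits G.α} {q : δ}
    (hq : q ∈ pauliSupp (G.residual e).left) :
    ∃ K ∈ G.restClusters e, ∃ v ∈ K, G.root q v ∧ G.dep v ≤ K.card := by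
  rw [Gadget.residual, Pauli.left_sum] at hq
  obtain ⟨K, hK, hq⟩ := pauliSupp_sum _ _ hq
  refine ⟨K, hK, ?_⟩
  obtain ⟨h1, h2⟩ := G.restr_rest hK
  rw [Gadget.stab] at hq
  split_ifs at hq with h
  · obtain ⟨v, hv, hr, hd⟩ := (G.exists_stabilizer _ h.1 h.2).choose_spec.2.2.2 q hq
    rw [h2] at hv hd
    exact ⟨v, hv, hr, hd⟩
  · exact absurd hq (notMem_pauliSupp.2 ⟨rfl, rfl⟩)

/-- With small clusters of errors, each outcome leaves the prepared state up to a known correction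
and a residual error that does not depend on the outcome. -/
theorem Gadget.Small.postMeasure {e : Bits G.α} (h : G.Small e) (s : Bits G.α) : ∃ γ : ℂ,
    postMeasure G.basis (indicatorState (graphCode G.ctrl G.graph)) (s + e) =
      γ • (pauliOp ((G.recovery s).left + (G.residual e).left) *ᵥ indicatorState 𝒟) := by
  -- An outcome of amplitude zero never occurs, and the scalar zero settles it.
  by_cases h0 : ShallowFT.postMeasure G.basis (indicatorState (graphCode G.ctrl G.graph)) (s + e) = 0
  · exact ⟨0, by rw [h0, zero_smul]⟩
  obtain ⟨P, hP1, hP2, hP⟩ := exists_mem_graphCode_of_postMeasure_ne_zero G.basis G.ctrl G.graph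
    G.symm G.bipartite G.data G.had_iff h0
  obtain ⟨hres, hres'⟩ := h.residual
  have hloc : s + e ∈ G.Loc := hP ▸ G.flips_mem P hP1 hP2
  have hs : s = (s + e) + e := (bits_add_cancel _ _).symm
  -- The true outcome `s + e` satisfies all checks, so observed outcome and error lie in the same
  -- coset.
  have hmw : minWeight G.Loc s = minWeight G.Loc e := by
    conv_lhs => rw [hs]
    exact minWeight_add hloc e
  have hrest : G.rest s = (s + e) + G.rest e := by
    rw [Gadget.rest, Gadget.rest, hmw, ← add_assoc, bits_add_cancel]
  -- The recovery is only defined if the corrected outcome is explained by some stabilizer. Here one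
  -- exists, built from the true outcome and the residual; the recovery may pick a different one, as
  -- only its flips matter.
  have hex : ∃ P, G.IsStabilizer P ∧ flips G.basis P.right = G.rest s :=
    ⟨P + G.residual e, Gadget.IsStabilizer.add ⟨hP1, hP2⟩ hres, by
      rw [Pauli.right_add, flips_add, hP, hres', hrest]⟩
  have hrec : G.IsStabilizer (G.recovery s) ∧ flips G.basis (G.recovery s).right = G.rest s := by
    rw [Gadget.recovery, dif_pos hex]
    exact hex.choose_spec
  have hfl : flips G.basis (G.recovery s + G.residual e).right = s + e := by
    rw [Pauli.right_add, flips_add, hrec.2, hres', hrest, bits_add_cancel]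
  have hst := hrec.1.add hres
  obtain ⟨σ, hσ⟩ := postMeasure_pauliOp G.basis (G.recovery s + G.residual e) (s + e)
  have h1 := hσ (indicatorState (graphCode G.ctrl G.graph))
  rw [pauliOp_graphCode G.ctrl G.graph G.symm G.bipartite hst.1 hst.2, hfl, bits_add_self] at h1
  obtain ⟨c, hc⟩ := postMeasure_graphCode_zero G.basis G.ctrl G.graph
  rw [G.code_eq] at hc
  refine ⟨bsign σ * c, ?_⟩
  rw [h1, hc, Matrix.mulVec_smul, smul_smul]
  rfl

/-! ### Noise in a gadget -/

variable {Ω : Type} [Fintype Ω] (μ : PMF Ω)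

theorem Gadget.prob_not_small_le (hΔ : 1 ≤ Δ) {e : Ω → Bits G.α} {p : ℝ} (hp : 0 ≤ p)
    (he : LocalStochastic μ (fun ω => bitSupp (e ω)) p) (hsmall : Δ ^ 2 * rate 2 p ≤ 1 / 2) :
    prob μ {ω | ¬ G.Small (e ω)} ≤ Fintype.card G.α * (2 * (Δ ^ 2 * rate 2 p) ^ τ) := by
  refine (prob_mono μ ?_).trans
    (prob_large_cluster_le μ hΔ G.card_nbrs G.nbrs_symm hp he hsmall τ)
  intro ω hω
  simp only [Set.mem_ofPred_eq, Gadget.Small] at hω ⊢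
  push Not at hω
  obtain ⟨K, hK, hle⟩ := hω
  obtain ⟨v, hv, rfl⟩ := Finset.mem_image.1 hK
  exact ⟨_, v, isCluster_component hv, hle, card_component_le G.isLocal (e ω) hK⟩

theorem Gadget.localStochastic_residual (hΔ : 1 ≤ Δ) {e : Ω → Bits G.α} {p : ℝ} (hp : 0 ≤ p)
    (he : LocalStochastic μ (fun ω => bitSupp (e ω)) p)
    (hsmall : Δ ^ 2 * rate 2 (rate 2 p) ≤ 1 / 8) :
    LocalStochastic μ (fun ω => pauliSupp (G.residual (e ω)).left) (2 * rate 2 (rate 2 p)) :=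
  localStochastic_of_clusters μ hΔ G.card_nbrs G.nbrs_symm hp he G.root G.root_inj G.dep
    G.one_le_dep G.root_bdd _ (fun ω => ↑(G.restClusters (e ω)))
    (fun _ _ hK _ hK' hne => components_disjoint G.nbrs_symm hK hK' hne)
    (fun ω _ hK => ⟨fun _ hv => isCluster_of_mem_components G.nbrs_symm hK hv,
      card_component_le G.isLocal (e ω) hK⟩)
    (fun _ _ hi => Gadget.exists_of_mem_residual hi) hsmall

end

/-! ### The readout of the code blocks -/

section
variable {n N : ℕ} {Q : CSSCode n} {ℓ : ℕ}

/-- Joining the `X` and `Z` supports of each generator gives one graph that serves both measurement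
bases. -/
theorem CSSCode.IsLDPC.exists_readout (h : Q.IsLDPC ℓ) :
    ∃ f : Fin n → Finset (Fin n), (∀ x y, y ∈ f x → x ∈ f y) ∧
      (∀ i, (f i).card ≤ (2 * ℓ) * (2 * ℓ)) ∧ ∀ m, IsLocal f (Q.outcomes m) := by
  classical
  obtain ⟨κ, _, _, A, B, -, hA, hB, hA', hB', hAs, hBs⟩ := h.exists_checks
  let H : κ → Finset (Fin n) := fun c => bitSupp (A c) ∪ bitSupp (B c)
  refine ⟨checkNbrs H, fun x y hxy => ?_, card_checkNbrs_le (fun i => ?_) (fun c => ?_), fun m => ?_⟩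
  · obtain ⟨c, h1, h2⟩ := mem_checkNbrs.1 hxy
    exact mem_checkNbrs.2 ⟨c, h2, h1⟩
  · obtain ⟨s, hs, hs'⟩ := hA'.or hB' i
    refine (Finset.card_le_card fun c hc => hs' c ?_).trans (hs.trans (by omega))
    simpa [H, mem_bitSupp] using hc
  · refine (Finset.card_union_le _ _).trans ?_
    have := hA c
    have := hB c
    omega
  · cases m with
    | std =>
      refine isLocal_of_checks (H := H) (fun c => B c)
        (fun c => ⟨c, Finset.subset_union_right⟩) fun b => ?_
      rw [Q.mem_outcomes]
      change Q.HZ *ᵥ b = 0 ↔ _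
      rw [← mulVec_eq_zero_iff_of_span hBs, funext_iff]
      rfl
    | had =>
      refine isLocal_of_checks (H := H) (fun c => A c)
        (fun c => ⟨c, Finset.subset_union_left⟩) fun b => ?_
      rw [Q.mem_outcomes]
      change Q.HX *ᵥ b = 0 ↔ _
      rw [← mulVec_eq_zero_iff_of_span hAs, funext_iff]
      rfl

/-- No large cluster of a block is half filled by the set `R`. -/
def Readable (Q : CSSCode n) (f : Fin n → Finset (Fin n)) (R : Finset (Data N n)) : Prop :=
  ∀ b, ¬ ∃ K v, IsCluster f K v ∧ Q.dist ≤ K.card ∧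
    K.card ≤ 2 * ((Finset.univ.filter fun i => (b, i) ∈ R) ∩ K).card

theorem Readable.sum_weight (L : LogicalBasis Q) {f : Fin n → Finset (Fin n)}
    (hsymm : ∀ x y, y ∈ f x → x ∈ f y) (hloc : ∀ m, IsLocal f (Q.outcomes m))
    {R : Finset (Data N n)} (hR : Readable Q f R) {F : Op (Data N n)}
    (hF : F ∈ pauliSpan (R : Set (Data N n))) (hU : F ∈ Matrix.unitaryGroup (Bits (Data N n)) ℂ)
    (m : Fin N → Basis) (φ : State (Fin N × Fin Q.k)) (y : Bits (Fin N × Fin Q.k)) :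
    ∑ z, (if decodeBlocks L.decoder m z = y then
      weight (fun q => m q.1) (F *ᵥ (L.enc (Fin N) *ᵥ φ)) z else 0) =
      weight (fun q => m q.1) φ y := by
  refine L.sum_weight_decode m hF hU _ (fun z e he hz => ?_) φ y
  funext ⟨b, j⟩
  refine (congrFun (L.decoder_eq hsymm (m b) (hloc (m b)) (hR b)
    (z := fun i => z (b, i)) (e := fun i => e (b, i)) ?_ (hz b)) j).symm
  intro i hi
  have hi' := mem_bitSupp.1 hi
  exact Finset.mem_filter.2 ⟨Finset.mem_univ _, he _ hi'⟩

variable {Ω : Type} [Fintype Ω] (μ : PMF Ω)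

/-- Union bound over the blocks; the restriction of a local stochastic set to a block is local
stochastic of the same rate. -/
theorem prob_not_readable_le {f : Fin n → Finset (Fin n)} {Δ : ℕ} (hΔ : 1 ≤ Δ)
    (hf : ∀ v, (f v).card ≤ Δ) (hsymm : ∀ x y, y ∈ f x → x ∈ f y) {R : Ω → Finset (Data N n)}
    {p : ℝ} (hp : 0 ≤ p) (hR : LocalStochastic μ R p) (hsmall : Δ ^ 2 * rate 2 p ≤ 1 / 2) :
    prob μ {ω | ¬ Readable Q f (R ω)} ≤ N * (n * (2 * (Δ ^ 2 * rate 2 p) ^ Q.dist)) := by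
  classical
  refine (prob_le_sum μ Finset.univ (fun b : Fin N => {ω | ∃ K v, IsCluster f K v ∧
    Q.dist ≤ K.card ∧ K.card ≤ 2 * ((Finset.univ.filter fun i => (b, i) ∈ R ω) ∩ K).card})
    fun ω hω => ?_).trans ?_
  · simp only [Set.mem_ofPred_eq, Readable, not_forall, not_not] at hω
    obtain ⟨b, hb⟩ := hω
    exact ⟨b, Finset.mem_univ _, hb⟩
  · refine (Finset.sum_le_card_nsmul _ _ (n * (2 * (Δ ^ 2 * rate 2 p) ^ Q.dist)) fun b _ => ?_).trans
      (by rw [nsmul_eq_mul, Finset.card_univ, Fintype.card_fin])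
    have h := prob_large_cluster_le μ hΔ hf hsymm
      (e := fun ω => Finset.univ.filter fun i => (b, i) ∈ R ω) hp (fun S => ?_) hsmall Q.dist
    · rwa [Fintype.card_fin] at h
    · have h1 := hR (S.map ⟨fun i => (b, i), fun i j h => (Prod.mk.inj h).2⟩)
      rw [Finset.card_map] at h1
      refine (prob_mono μ fun ω hω => ?_).trans h1
      intro q hq
      obtain ⟨i, hi, rfl⟩ := Finset.mem_map.1 hq
      exact (Finset.mem_filter.1 (hω hi)).2

end

/-! ### Total variation distance -/

section
variable {Ω : Type} [Fintype Ω] (μ : PMF Ω)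

open Classical in
-- It suffices that, for good faults and each `s`, the decoded distribution is proportional to the
-- ideal one. The factors may depend on `s`; normalization makes their sum one, so good faults
-- contribute no error at all.
theorem tvDist_outDist_le {S Z Y : Type} [Fintype S] [Fintype Z] [Fintype Y] {q : Ω → S → Z → ℝ}
    {out : S → Z → Y} {ideal : Y → ℝ} (hq0 : ∀ E s z, 0 ≤ q E s z)
    (hq1 : ∀ E, ∑ s, ∑ z, q E s z = 1) (hi0 : ∀ y, 0 ≤ ideal y) (hi1 : ∑ y, ideal y = 1)
    (Good : Set Ω) (hgood : ∀ E ∈ Good, ∀ s, ∃ g : ℝ, ∀ y,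
      ∑ z, (if out s z = y then q E s z else 0) = g * ideal y) :
    tvDist (outDist μ q out) ideal ≤ prob μ Goodᶜ := by
  set d : Ω → Y → ℝ := fun E y => ∑ s, ∑ z, if out s z = y then q E s z else 0 with hd
  have hd0 : ∀ E y, 0 ≤ d E y := fun E y => Finset.sum_nonneg fun s _ =>
    Finset.sum_nonneg fun z _ => by
      split_ifs
      · exact hq0 E s z
      · exact le_rfl
  have hd1 : ∀ E, ∑ y, d E y = 1 := by
    intro E
    rw [← hq1 E, hd]
    simp only
    rw [Finset.sum_comm]
    refine Finset.sum_congr rfl fun s _ => ?_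
    rw [Finset.sum_comm]
    refine Finset.sum_congr rfl fun z _ => ?_
    rw [Finset.sum_ite_eq Finset.univ (out s z), if_pos (Finset.mem_univ _)]
  have hdg : ∀ E ∈ Good, ∀ y, d E y = ideal y := by
    intro E hE y
    choose g hg using hgood E hE
    have h1 : ∀ y, d E y = (∑ s, g s) * ideal y := by
      intro y
      rw [hd]
      simp only
      rw [Finset.sum_mul]
      exact Finset.sum_congr rfl fun s _ => hg s y
    have h2 := hd1 E
    simp_rw [h1] at h2
    rw [← Finset.mul_sum, hi1, mul_one] at h2
    rw [h1, h2, one_mul]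
  have hb : ∀ E, ∑ y, |d E y - ideal y| ≤ Goodᶜ.indicator (fun _ => 2) E := by
    intro E
    by_cases hE : E ∈ Good
    · rw [Set.indicator_of_notMem (Set.notMem_compl_iff.2 hE)]
      refine (Finset.sum_eq_zero fun y _ => ?_).le
      rw [hdg E hE, sub_self, abs_zero]
    · rw [Set.indicator_of_mem (show E ∈ Goodᶜ from hE)]
      calc ∑ y, |d E y - ideal y| ≤ ∑ y, (d E y + ideal y) := Finset.sum_le_sum fun y _ => by
            have := hd0 E y
            have := hi0 y
            rw [abs_le]
            constructor <;> linarith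
        _ = 2 := by rw [Finset.sum_add_distrib, hd1, hi1]; norm_num
  have hy : ∀ y, |outDist μ q out y - ideal y| ≤ ∑ E, (μ E).toReal * |d E y - ideal y| := by
    intro y
    have h1 : outDist μ q out y - ideal y = ∑ E, (μ E).toReal * (d E y - ideal y) := by
      simp_rw [mul_sub]
      rw [Finset.sum_sub_distrib, ← Finset.sum_mul, sum_toReal_pmf, one_mul]
      rfl
    rw [h1]
    refine (Finset.abs_sum_le_sum_abs _ _).trans (Finset.sum_le_sum fun E _ => ?_)
    rw [abs_mul, abs_of_nonneg ENNReal.toReal_nonneg]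
  calc tvDist (outDist μ q out) ideal
      ≤ (1 / 2) * ∑ y, ∑ E, (μ E).toReal * |d E y - ideal y| :=
        mul_le_mul_of_nonneg_left (Finset.sum_le_sum fun y _ => hy y) (by norm_num)
    _ = (1 / 2) * ∑ E, (μ E).toReal * ∑ y, |d E y - ideal y| := by
        rw [Finset.sum_comm]
        simp_rw [Finset.mul_sum]
    _ ≤ (1 / 2) * ∑ E, (μ E).toReal * Goodᶜ.indicator (fun _ => 2) E :=
        mul_le_mul_of_nonneg_left (Finset.sum_le_sum fun E _ =>
          mul_le_mul_of_nonneg_left (hb E) ENNReal.toReal_nonneg) (by norm_num)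
    _ = prob μ Goodᶜ := by
        rw [prob, Finset.mul_sum]
        refine Finset.sum_congr rfl fun E _ => ?_
        by_cases hE : E ∈ Goodᶜ
        · rw [Set.indicator_of_mem hE, Set.indicator_of_mem hE]
          ring
        · rw [Set.indicator_of_notMem hE, Set.indicator_of_notMem hE]
          ring

theorem weight_pauliOp {ι : Type} [Fintype ι] [DecidableEq ι] (m : ι → Basis) (P : Pauli ι)
    (ψ : State ι) (z : Bits ι) :
    weight m (pauliOp P *ᵥ ψ) z = weight m ψ (z + flips m P) := by
  obtain ⟨τ, hτ⟩ := amplitude_pauliOp m P z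
  rw [weight, weight, hτ, norm_mul, norm_bsign, one_mul]

theorem weight_smul {ι : Type} [Fintype ι] [DecidableEq ι] (m : ι → Basis) (c : ℂ) (ψ : State ι)
    (z : Bits ι) : weight m (c • ψ) z = ‖c‖ ^ 2 * weight m ψ z := by
  rw [weight, weight, amplitude_smul, norm_mul, mul_pow]

end

/-! ### Preparation of the initial state -/

/-- A Clifford circuit of constant depth on the code blocks and `b` ancillas that prepares the
encoded initial state of `C`, up to a Pauli operator that is computed from the outcomes of the
ancillas. -/
structure Preparation {n N : ℕ} {Q : CSSCode n} (L : LogicalBasis Q) (C : LogicalCircuit N Q.k)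
    (τ Δ b : ℕ) where
  basis : Fin b → Basis
  layers : List (List (Gate (Data N n ⊕ Fin b)))
  state : State (Data N n ⊕ Fin b)
  Small : Bits (Fin b) → Prop
  recovery : Bits (Fin b) → Pauli (Data N n)
  residual : Bits (Fin b) → Pauli (Data N n)
  length_le : layers.length ≤ 1 + Δ * Δ
  disjoint : ∀ l ∈ layers, DisjointGates l
  arity_le : ∀ l ∈ layers, ∀ g ∈ l, g.arity ≤ 2
  clifford : ∀ l ∈ layers, ∀ g ∈ l, IsClifford g.op
  foldl_eq : layers.foldl (fun ψ l => layerListOp l *ᵥ ψ) (zeroState _) = state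
  postMeasure_eq : ∀ e, Small e → ∀ s, ∃ γ : ℂ, postMeasure basis state (s + e) =
    γ • (pauliOp (recovery s + residual e) *ᵥ (L.enc (Fin N) *ᵥ C.initState))
  prob_not_small_le : ∀ (Ω : Type) [Fintype Ω] (μ : PMF Ω) (e : Ω → Bits (Fin b)) (p : ℝ), 0 ≤ p →
    LocalStochastic μ (fun ω => bitSupp (e ω)) p → Δ ^ 2 * rate 2 p ≤ 1 / 2 →
    prob μ {ω | ¬ Small (e ω)} ≤ b * (2 * (Δ ^ 2 * rate 2 p) ^ τ)
  localStochastic_residual : ∀ (Ω : Type) [Fintype Ω] (μ : PMF Ω) (e : Ω → Bits (Fin b)) (p : ℝ),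
    0 ≤ p → LocalStochastic μ (fun ω => bitSupp (e ω)) p → Δ ^ 2 * rate 2 (rate 2 p) ≤ 1 / 8 →
    LocalStochastic μ (fun ω => pauliSupp (residual (e ω))) (2 * rate 2 (rate 2 p))

section
variable {n N : ℕ} {Q : CSSCode n} {ℓ : ℕ}

theorem Gadget.exists_preparation (L : LogicalBasis Q) (C : LogicalCircuit N Q.k) {τ Δ b : ℕ}
    (hΔ : 1 ≤ Δ) (G : Gadget (Data N n) τ Δ {y | (∀ b, Q.HZ *ᵥ (fun i => y (b, i)) = 0) ∧
        (∀ b, C.init b = .zero → L.LZ *ᵥ (fun i => y (b, i)) = 0) ∧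
        (∀ b b' c, C.init b = .ghz c → C.init b' = .ghz c →
          L.LZ *ᵥ (fun i => y (b, i)) = L.LZ *ᵥ (fun i => y (b', i)))})
    (e : G.α ≃ Fin b) : Nonempty (Preparation L C τ Δ b) := by
  classical
  obtain ⟨c0, hc0, henc⟩ := L.exists_enc_initState C
  obtain ⟨Ls, hlen, hLs, c, hc⟩ := exists_graphCode_layers (G.reindex e.symm).ctrl
    (G.reindex e.symm).graph (G.reindex e.symm).symm (G.reindex e.symm).bipartite Δ fun x => by
      obtain ⟨s, hs, hs'⟩ := (G.reindex e.symm).bdd x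
      exact ⟨s, hs', hs⟩
  refine ⟨⟨(G.reindex e.symm).basis, Ls, _, (G.reindex e.symm).Small,
    fun s => ((G.reindex e.symm).recovery s).left, fun s => ((G.reindex e.symm).residual s).left,
    hlen, fun l hl => (hLs l hl).1, fun l hl g hg => ((hLs l hl).2 g hg).1,
    fun l hl g hg => ((hLs l hl).2 g hg).2, hc, fun f hf s => ?_, fun Ω _ μ f p hp hf h => ?_,
    fun Ω _ μ f p hp hf h => ?_⟩⟩
  · obtain ⟨γ, hγ⟩ := Gadget.Small.postMeasure hf s
    have h1 := congrArg (c • ·) hγ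
    -- The scalars come from the circuit, the measurement and the normalization of the encoded
    -- state, of which the last must be inverted.
    refine ⟨c * γ * c0⁻¹, (postMeasure_smul _ _ _ _).trans (h1.trans ?_)⟩
    rw [henc]
    have h2 : (fun y : Bits (Data N n) =>
        if (∀ b, Q.HZ *ᵥ (fun i => y (b, i)) = 0) ∧
          (∀ b, C.init b = .zero → L.LZ *ᵥ (fun i => y (b, i)) = 0) ∧
          (∀ b b' c, C.init b = .ghz c → C.init b' = .ghz c →
            L.LZ *ᵥ (fun i => y (b, i)) = L.LZ *ᵥ (fun i => y (b', i)))
        then c0 else 0) = c0 • indicatorState {y | (∀ b, Q.HZ *ᵥ (fun i => y (b, i)) = 0) ∧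
        (∀ b, C.init b = .zero → L.LZ *ᵥ (fun i => y (b, i)) = 0) ∧
        (∀ b b' c, C.init b = .ghz c → C.init b' = .ghz c →
          L.LZ *ᵥ (fun i => y (b, i)) = L.LZ *ᵥ (fun i => y (b', i)))} := by
      funext y
      rw [Pi.smul_apply, smul_eq_mul, indicatorState]
      split_ifs with h h' h'
      · rw [mul_one]
      · exact absurd h h'
      · exact absurd h' h
      · rw [mul_zero]
    have h3 : ∀ χ : State (Data N n), c • γ • χ = (c * γ * c0⁻¹) • c0 • χ := fun χ => by
      rw [smul_smul, smul_smul, inv_mul_cancel_right₀ hc0]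
    rw [h2, Matrix.mulVec_smul]
    exact h3 _
  · exact (Gadget.prob_not_small_le (G := G.reindex e.symm) μ hΔ hp hf h).trans_eq
      (congrArg (fun k : ℕ => (k : ℝ) * (2 * (Δ ^ 2 * rate 2 p) ^ τ)) (Fintype.card_fin b))
  · exact Gadget.localStochastic_residual (G := G.reindex e.symm) μ hΔ hp hf h

theorem exists_preparation (L : LogicalBasis Q) (hQ : Q.IsLDPC ℓ) (C : LogicalCircuit N Q.k)
    {T : ℕ} (hT : 0 < T) : ∃ b, b ≤ 3 * (ℓ + 1) * N * n * T ∧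
      Nonempty (Preparation L C (min T Q.dist) ((ℓ + 4) * (ℓ + 4) + 12 + 2 * ℓ) b) := by
  obtain ⟨G, hG⟩ := exists_gadget L hQ hT C.init
  exact ⟨_, hG, G.exists_preparation L C (by omega) (Fintype.equivFin G.α)⟩

end

/-! ### Equality up to scalars -/

/-- The vector `φ` is a multiple of `ψ`. -/
def IsMultiple {X : Type} (φ ψ : X → ℂ) : Prop := ∃ c : ℂ, φ = c • ψ

theorem IsMultiple.refl {X : Type} (φ : X → ℂ) : IsMultiple φ φ := ⟨1, (one_smul ℂ φ).symm⟩

theorem IsMultiple.trans {X : Type} {φ ψ χ : X → ℂ} (h : IsMultiple φ ψ) (h' : IsMultiple ψ χ) :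
    IsMultiple φ χ := by
  obtain ⟨c, rfl⟩ := h
  obtain ⟨c', rfl⟩ := h'
  exact ⟨c * c', smul_smul _ _ _⟩

section
variable {ι : Type} [Fintype ι] [DecidableEq ι]

theorem IsMultiple.mulVec {φ ψ : State ι} (h : IsMultiple φ ψ) (U : Op ι) :
    IsMultiple (U *ᵥ φ) (U *ᵥ ψ) := by
  obtain ⟨c, rfl⟩ := h
  exact ⟨c, Matrix.mulVec_smul _ _ _⟩

theorem IsMultiple.run {φ ψ : State ι} (h : IsMultiple φ ψ) (C : Circuit ι) (E : C.Faults) :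
    IsMultiple (C.run E φ) (C.run E ψ) := by
  obtain ⟨c, rfl⟩ := h
  exact ⟨c, C.run_smul E c ψ⟩

theorem isMultiple_pauliOp_pauliOp (P P' : Pauli ι) (φ : State ι) :
    IsMultiple (pauliOp P *ᵥ (pauliOp P' *ᵥ φ)) (pauliOp (P + P') *ᵥ φ) :=
  ⟨_, by rw [Matrix.mulVec_mulVec, pauliOp_mul, Matrix.smul_mulVec]⟩

theorem isMultiple_pauliOp_add (P P' : Pauli ι) (φ : State ι) :
    IsMultiple (pauliOp (P + P') *ᵥ φ) (pauliOp P *ᵥ (pauliOp P' *ᵥ φ)) :=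
  ⟨(bsign (∑ i, P.2 i * P'.1 i))⁻¹, by
    rw [Matrix.mulVec_mulVec, pauliOp_mul, Matrix.smul_mulVec, smul_smul,
      inv_mul_cancel₀ (bsign_ne_zero _), one_smul]⟩

theorem isMultiple_postMeasure_pauliOp {δ β : Type} [Fintype δ] [DecidableEq δ] [Fintype β]
    [DecidableEq β] (m : β → Basis) (P : Pauli (δ ⊕ β)) (ψ : State (δ ⊕ β)) (s : Bits β) :
    IsMultiple (postMeasure m (pauliOp P *ᵥ ψ) s)
      (pauliOp P.left *ᵥ postMeasure m ψ (s + flips m P.right)) := by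
  obtain ⟨τ, hτ⟩ := postMeasure_pauliOp m P s
  exact ⟨_, hτ ψ⟩

/-! ### Pauli operators through Clifford circuits -/

theorem Circuit.run_zero (C : Circuit ι) (φ : State ι) : C.run 0 φ = C.unitaryOp *ᵥ φ := by
  unfold Circuit.run Circuit.unitaryOp
  generalize Fin.last C.depth = t
  induction t using Fin.induction with
  | zero => simp
  | succ t ih =>
    rw [Fin.induction_succ, Fin.induction_succ, ih, Pi.zero_apply, pauliOp_zero, Matrix.one_mulVec,
      Matrix.mulVec_mulVec]

/-- The Pauli on the input is regarded as a fault before the first layer of an otherwise perfect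
run, so the support bound for faults applies to it. -/
theorem Circuit.exists_conj_pauli (C : Circuit ι) (hC : C.Clifford) (P : Pauli ι) :
    ∃ P' : Pauli ι, (∀ x ∈ pauliSupp P', ∃ y ∈ pauliSupp P, relPow C.touch C.depth y x) ∧
      ∀ φ, IsMultiple (C.unitaryOp *ᵥ (pauliOp P *ᵥ φ)) (pauliOp P' *ᵥ (C.unitaryOp *ᵥ φ)) := by
  obtain ⟨P', c', hsupp, hP'⟩ := C.exists_run_eq_pauli hC (Function.update 0 0 P)
  refine ⟨P', fun x hx => ?_, fun φ => ?_⟩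
  · obtain ⟨t, y, hy, hxy⟩ := hsupp hx
    by_cases ht : t = 0
    · subst ht
      rw [Function.update_self] at hy
      exact ⟨y, hy, hxy⟩
    · rw [Function.update_of_ne ht] at hy
      simp [pauliSupp] at hy
  · obtain ⟨c, hc⟩ := C.run_pauliOp 0 P φ
    rw [← C.run_zero, hc]
    refine IsMultiple.trans ⟨c, rfl⟩ ⟨c', ?_⟩
    rw [Pi.zero_apply, zero_add]
    exact hP' φ

/-! ### Circuits on a part of the qubits -/

/-- A gate on a part of the qubits as a gate on all of them. -/
def Gate.map {α ι : Type} (e : α ↪ ι) (g : Gate α) : Gate ι where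
  arity := g.arity
  pos := g.pos.trans e
  op := g.op
  unitary := g.unitary

theorem DisjointGates.map {α ι : Type} (e : α ↪ ι) {l : List (Gate α)} (h : DisjointGates l) :
    DisjointGates (l.map (Gate.map e)) := by
  refine List.pairwise_map.2 (h.imp fun {g g'} hgg => ?_)
  change Disjoint (Set.range (e ∘ g.pos)) (Set.range (e ∘ g'.pos))
  rw [Set.range_comp, Set.range_comp]
  exact (Set.disjoint_image_iff e.injective).2 hgg

variable {δ β : Type} [Fintype δ] [DecidableEq δ] [Fintype β] [DecidableEq β]

theorem postMeasure_layer_map_inl (m : β → Basis) (l : List (Gate δ)) (ψ : State (δ ⊕ β))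
    (s : Bits β) : postMeasure m (layerListOp (l.map (Gate.map Function.Embedding.inl)) *ᵥ ψ) s =
      layerListOp l *ᵥ postMeasure m ψ s := by
  unfold layerListOp
  induction l with
  | nil => simp
  | cons g l ih =>
    simp only [List.map_cons, List.prod_cons]
    rw [← Matrix.mulVec_mulVec, ← Matrix.mulVec_mulVec, ← ih]
    change postMeasure m (liftOp (g.pos.trans Function.Embedding.inl) g.op *ᵥ _) s = _
    rw [liftOp_trans, postMeasure_liftOp_inl]

theorem postMeasure_layers_map_inl (m : β → Basis) (Ls : List (List (Gate δ))) (ψ : State (δ ⊕ β))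
    (s : Bits β) :
    postMeasure m ((Ls.map (List.map (Gate.map Function.Embedding.inl))).foldl
      (fun ψ l => layerListOp l *ᵥ ψ) ψ) s =
      Ls.foldl (fun ψ l => layerListOp l *ᵥ ψ) (postMeasure m ψ s) := by
  induction Ls generalizing ψ with
  | nil => rfl
  | cons l Ls ih =>
    rw [List.map_cons, List.foldl_cons, List.foldl_cons, ih, postMeasure_layer_map_inl]

end

/-! ### The noise rates -/

/-- The exponent of the rate of faults that spread through a circuit of depth `K` with gates on at
most `w` qubits. -/
def spreadExp (K w : ℕ) : ℕ := (K + 3) * (1 + (1 + K * w) ^ K)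

/-- The exponent of the rate of the residual noise. -/
def noiseExp (K w : ℕ) : ℕ := 16 * (spreadExp K w * spreadExp K w)

/-- The degree of the graph of local checks in the preparation of the initial state. -/
def prepDegree (ℓ : ℕ) : ℕ := (ℓ + 4) * (ℓ + 4) + 12 + 2 * ℓ

/-- The degree of the graph of checks in a block. -/
def blockDegree (ℓ : ℕ) : ℕ := 2 * ℓ * (2 * ℓ) + 1

/-- The noise rate must be smaller than the threshold by this factor. -/
def margin (ℓ : ℕ) : ℕ := 12 * (ℓ + 1) * (prepDegree ℓ ^ 2 + blockDegree ℓ ^ 2)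

theorem one_le_spreadExp (K w : ℕ) : 1 ≤ spreadExp K w := by
  unfold spreadExp
  exact Nat.one_le_iff_ne_zero.2 (by positivity)

theorem one_le_noiseExp (K w : ℕ) : 1 ≤ noiseExp K w := by
  have := one_le_spreadExp K w
  unfold noiseExp
  nlinarith

theorem one_le_margin (ℓ : ℕ) : 1 ≤ margin ℓ := by
  unfold margin blockDegree
  exact Nat.one_le_iff_ne_zero.2 (by positivity)

/-- The threshold. -/
def threshold (ℓ K w : ℕ) : ℝ := (((2 * margin ℓ * noiseExp K w : ℕ) : ℝ) ^ noiseExp K w)⁻¹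

theorem threshold_pos (ℓ K w : ℕ) : 0 < threshold ℓ K w := by
  have := one_le_noiseExp K w
  have := one_le_margin ℓ
  unfold threshold
  positivity

theorem threshold_lt_one (ℓ K w : ℕ) : threshold ℓ K w < 1 := by
  have h1 := one_le_noiseExp K w
  have h2 := one_le_margin ℓ
  unfold threshold
  refine inv_lt_one_of_one_lt₀ (one_lt_pow₀ ?_ (by omega))
  rw [Nat.one_lt_cast]
  nlinarith

theorem two_mul_rate_le {a : ℕ} (ha : 1 ≤ a) {p : ℝ} (hp : 0 ≤ p) (hp1 : p ≤ 1) :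
    2 * rate a p ≤ rate (2 * a) p := by
  unfold rate
  rw [Nat.cast_mul, Nat.cast_two, mul_assoc]
  refine mul_le_mul_of_nonneg_left (mul_le_mul_of_nonneg_left ?_ (Nat.cast_nonneg _)) zero_le_two
  have ha' : (1 : ℝ) ≤ a := by exact_mod_cast ha
  rcases hp.eq_or_lt with rfl | h0
  · rw [Real.zero_rpow (by positivity)]
    exact Real.rpow_nonneg le_rfl _
  · refine Real.rpow_le_rpow_of_exponent_ge h0 hp1 ?_
    exact one_div_le_one_div_of_le (by linarith) (by linarith)

/-- The threshold is defined so that this is an equality: the rate that remains after all losses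
becomes a power of `p / threshold`. -/
theorem two_mul_margin_mul_rate {ℓ K w : ℕ} {p : ℝ} (hp : 0 ≤ p) :
    2 * margin ℓ * rate (noiseExp K w) p =
      (p / threshold ℓ K w) ^ ((1 : ℝ) / noiseExp K w) := by
  have h1 := one_le_noiseExp K w
  unfold threshold
  rw [div_inv_eq_mul, Real.mul_rpow hp (by positivity), one_div,
    Real.pow_rpow_inv_natCast (Nat.cast_nonneg _) (by omega)]
  unfold rate
  push_cast
  rw [one_div]
  ring

/-- The sum of the failure probabilities of the preparation and of the readout. -/
theorem failure_le {ℓ N n T d b : ℕ} (hb : b ≤ 3 * (ℓ + 1) * N * n * T) (hT : 1 ≤ T)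
    {x u v q : ℝ} (hx0 : 0 ≤ x) (hx1 : x ≤ 1) (hu0 : 0 ≤ u) (hu : u * (12 * (ℓ + 1)) ≤ x)
    (hv0 : 0 ≤ v) (hv : v * (12 * (ℓ + 1)) ≤ x) (hq1 : q ≤ 1)
    (hq : q ≤ b * (2 * u ^ min T d) + N * (n * (2 * v ^ d))) :
    q ≤ N * n * T * x ^ min T d := by
  have hb' : (b : ℝ) ≤ 3 * (ℓ + 1) * N * n * T := by exact_mod_cast hb
  have hT' : (1 : ℝ) ≤ T := by exact_mod_cast hT
  have hNn : (0 : ℝ) ≤ N * n := by positivity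
  -- A power with positive exponent of `12 * (ℓ + 1)` dominates the constant itself, so prefactors
  -- are absorbed into the base.
  have key : ∀ {t : ℝ} {k : ℕ}, 0 ≤ t → t * (12 * (ℓ + 1)) ≤ x → k ≠ 0 →
      t ^ k * (12 * (ℓ + 1)) ≤ x ^ k := by
    intro t k ht h hk
    have h12 : (1 : ℝ) ≤ 12 * (ℓ + 1) := by
      have : (0 : ℝ) ≤ ℓ := Nat.cast_nonneg ℓ
      linarith
    calc t ^ k * (12 * (ℓ + 1)) ≤ t ^ k * (12 * (ℓ + 1)) ^ k :=
          mul_le_mul_of_nonneg_left (le_self_pow₀ h12 hk) (by positivity)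
      _ = (t * (12 * (ℓ + 1))) ^ k := (mul_pow _ _ _).symm
      _ ≤ x ^ k := pow_le_pow_left₀ (by positivity) h k
  -- For `d = 0` the bound is `N n T`, which is trivial unless there are no data qubits; then there
  -- are no ancillas either.
  rcases Nat.eq_zero_or_pos d with rfl | hd
  · rw [Nat.min_zero, pow_zero, mul_one]
    rcases Nat.eq_zero_or_pos (N * n) with h0 | h0
    · have hNn0 : (N : ℝ) * n = 0 := by exact_mod_cast h0
      have hb0 : (b : ℝ) ≤ 0 := hb'.trans_eq (by
        rw [mul_assoc (3 * ((ℓ : ℝ) + 1)), hNn0]; ring)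
      have hb0' : (b : ℝ) = 0 := le_antisymm hb0 (Nat.cast_nonneg b)
      refine hq.trans_eq ?_
      rw [hb0', hNn0, ← mul_assoc (N : ℝ), hNn0]
      ring
    · have h1 : (1 : ℝ) ≤ N * n := by exact_mod_cast h0
      nlinarith
  · have hm : min T d ≠ 0 := by omega
    have hu' := key hu0 hu hm
    have hv' := key hv0 hv hd.ne'
    have hxd : x ^ d ≤ x ^ min T d := pow_le_pow_of_le_one hx0 hx1 (min_le_right T d)
    have hℓ : (0 : ℝ) ≤ ℓ := Nat.cast_nonneg ℓ
    have hut : 0 ≤ u ^ min T d := by positivity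
    have hvt : 0 ≤ v ^ d := by positivity
    have h1 : (b : ℝ) * (2 * u ^ min T d) ≤ N * n * T * (x ^ min T d / 2) := by
      calc (b : ℝ) * (2 * u ^ min T d)
          ≤ (3 * (ℓ + 1) * N * n * T) * (2 * u ^ min T d) :=
            mul_le_mul_of_nonneg_right hb' (by positivity)
        _ = N * n * T * (u ^ min T d * (12 * (ℓ + 1)) / 2) := by ring
        _ ≤ _ := mul_le_mul_of_nonneg_left (by linarith) (by positivity)
    have h2 : (N : ℝ) * (n * (2 * v ^ d)) ≤ N * n * T * (x ^ min T d / 2) := by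
      have h4 : 4 * v ^ d ≤ x ^ min T d := by nlinarith
      calc (N : ℝ) * (n * (2 * v ^ d)) = N * n * 1 * (4 * v ^ d / 2) := by ring
        _ ≤ N * n * 1 * (x ^ min T d / 2) :=
            mul_le_mul_of_nonneg_left (by linarith) (by positivity)
        _ ≤ _ := mul_le_mul_of_nonneg_right (mul_le_mul_of_nonneg_left hT' hNn) (by positivity)
    calc q ≤ _ := hq
      _ ≤ N * n * T * (x ^ min T d / 2) + N * n * T * (x ^ min T d / 2) := add_le_add h1 h2
      _ = _ := by ring

section
variable {ι : Type} [Fintype ι] [DecidableEq ι] {Ω : Type} [Fintype Ω] (μ : PMF Ω)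

/-- Within a circuit of constant depth a point is reached from boundedly many others, so spreading
falls under `LocalStochastic.spread`. The bound `K + 3` leaves room for `K + 1` fault times and two
further sources of errors. -/
theorem Circuit.localStochastic_touch (C : Circuit ι) {K w : ℕ} (hK : C.depth ≤ K)
    (hw : C.FanIn w) {S : Type} [Fintype S] [DecidableEq S] (hS : Fintype.card S ≤ K + 3)
    {A : S → Ω → Finset ι} {p : ℝ} (hp : 0 ≤ p) (hA : ∀ t, LocalStochastic μ (A t) p)
    {R : Ω → Finset ι}
    (hR : ∀ ω, ∀ x ∈ R ω, ∃ t, ∃ y ∈ A t ω, x = y ∨ relPow C.touch C.depth y x) :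
    LocalStochastic μ R (rate (spreadExp K w) p) := by
  have hb : BddRel (relPow C.touch C.depth) ((1 + K * w) ^ K) :=
    ((C.touch_bdd hw).relPow C.depth).mono (fun _ _ h => h)
      ((Nat.pow_le_pow_left (by gcongr) _).trans (Nat.pow_le_pow_right (by omega) hK))
  have hsymm := relPow_symm (C.touch_symm) C.depth
  refine LocalStochastic.spread μ hp hA
    (r := fun x y => x = y ∨ relPow C.touch C.depth y x) (Δ := 1 + (1 + K * w) ^ K)
    (BddRel.eq.or (hb.mono (fun x y h => hsymm _ _ h) le_rfl))
    ((BddRel.eq.mono (fun x y h => h.symm) le_rfl).or hb) hR (one_le_spreadExp K w) ?_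
  exact Nat.mul_le_mul_right _ hS

theorem localStochastic_bitSupp_flips {δ β : Type} [Fintype δ] [DecidableEq δ] [Fintype β]
    [DecidableEq β] (m : β → Basis) {P : Ω → Pauli (δ ⊕ β)} {p : ℝ}
    (h : LocalStochastic μ (fun ω => pauliSupp (P ω)) p) :
    LocalStochastic μ (fun ω => bitSupp (flips m (P ω).right)) p := by
  intro S
  have h1 := h (S.map Function.Embedding.inr)
  rw [Finset.card_map] at h1
  refine (prob_mono μ fun ω hω => ?_).trans h1
  intro q hq
  obtain ⟨i, hi, rfl⟩ := Finset.mem_map.1 hq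
  have h2 := mem_bitSupp.1 (hω hi)
  exact mem_pauliSupp_right.1 (mem_pauliSupp_of_flips h2)

theorem localStochastic_left {δ β : Type} [Fintype δ] [DecidableEq δ] [Fintype β]
    [DecidableEq β] {P : Ω → Pauli (δ ⊕ β)} {p : ℝ}
    (h : LocalStochastic μ (fun ω => pauliSupp (P ω)) p) :
    LocalStochastic μ (fun ω => pauliSupp (P ω).left) p := by
  intro S
  have h1 := h (S.map Function.Embedding.inl)
  rw [Finset.card_map] at h1
  refine (prob_mono μ fun ω hω => ?_).trans h1
  intro q hq
  obtain ⟨i, hi, rfl⟩ := Finset.mem_map.1 hq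
  exact mem_pauliSupp_left.1 (hω hi)

end

section
variable {n N : ℕ} {Q : CSSCode n} {L : LogicalBasis Q} {C : LogicalCircuit N Q.k} {ℓ T b : ℕ}
variable {Ω : Type} [Fintype Ω] (μ : PMF Ω)

/-- The residual noise, and the probability that the preparation or the readout fails, if the
ancillas and the code blocks suffer the error `P` before the last gates, given by the circuit `V`,
during which there are further errors `A`. -/
theorem Preparation.noise (prep : Preparation L C (min T Q.dist) (prepDegree ℓ) b)
    (hb : b ≤ 3 * (ℓ + 1) * N * n * T) (hT : 1 ≤ T) {f : Fin n → Finset (Fin n)}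
    (hsymm : ∀ x y, y ∈ f x → x ∈ f y) (hf : ∀ i, (f i).card ≤ 2 * ℓ * (2 * ℓ))
    (V : Circuit (Data N n)) {K w : ℕ} (hK : V.depth ≤ K) (hw : V.FanIn w) {p : ℝ} (hp : 0 ≤ p)
    (hpt : p < threshold ℓ K w) {P : Ω → Pauli (Data N n ⊕ Fin b)}
    (hP : LocalStochastic μ (fun ω => pauliSupp (P ω)) (rate (spreadExp K w) p))
    {S : Type} [Fintype S] [DecidableEq S] (hS : Fintype.card S ≤ K + 1)
    {A : S → Ω → Finset (Data N n)} (hA : ∀ t, LocalStochastic μ (A t) p)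
    {R : Ω → Finset (Data N n)} (hR : ∀ ω, ∀ x ∈ R ω,
      (∃ t, ∃ y ∈ A t ω, relPow V.touch V.depth y x) ∨ x ∈ pauliSupp (P ω).left ∨
      ∃ y, (y ∈ pauliSupp (P ω).left ∨
        y ∈ pauliSupp (prep.residual (flips prep.basis (P ω).right))) ∧
          relPow V.touch V.depth y x) :
    LocalStochastic μ R (rate (noiseExp K w) p) ∧
    prob μ {ω | prep.Small (flips prep.basis (P ω).right) ∧ Readable Q f (R ω)}ᶜ ≤
      N * n * T * ((p / threshold ℓ K w) ^ ((1 : ℝ) / noiseExp K w)) ^ min T Q.dist := by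
  have ha := one_le_spreadExp K w
  have hp1 : p ≤ 1 := hpt.le.trans (threshold_lt_one ℓ K w).le
  set a := spreadExp K w with ha_def
  have hr0 : 0 ≤ rate (noiseExp K w) p := rate_nonneg _ hp
  have hx := two_mul_margin_mul_rate (ℓ := ℓ) (K := K) (w := w) hp
  set x := (p / threshold ℓ K w) ^ ((1 : ℝ) / noiseExp K w) with hx_def
  have hx1 : x ≤ 1 := Real.rpow_le_one (div_nonneg hp (threshold_pos ℓ K w).le)
    ((div_le_one (threshold_pos ℓ K w)).2 hpt.le) (by positivity)
  have hx0 : 0 ≤ x := by rw [← hx]; positivity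
  have hmono : ∀ k, 1 ≤ k → k ≤ 16 * (a * a) → rate k p ≤ rate (noiseExp K w) p :=
    fun k hk hk' => rate_mono_left hk hk' hp hp1
  have haa : a ≤ a * a := Nat.le_mul_self a
  set r := rate (noiseExp K w) p with hr
  have hℓ : (0 : ℝ) ≤ ℓ := Nat.cast_nonneg ℓ
  have hmargin : (margin ℓ : ℝ) = 12 * (ℓ + 1) * (prepDegree ℓ ^ 2 + blockDegree ℓ ^ 2) := by
    unfold margin
    push_cast
    ring
  -- As `2 * margin ℓ * r = x`, any rate up to `r` multiplied by a squared degree and by the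
  -- prefactor `12 * (ℓ + 1)` is at most `x / 2`.
  have hD : ∀ {t y : ℝ}, 0 ≤ y → y ≤ r → t ≤ prepDegree ℓ ^ 2 + blockDegree ℓ ^ 2 →
      t * y * (12 * (ℓ + 1)) ≤ x / 2 := by
    intro t y hy0 hy ht
    calc t * y * (12 * (ℓ + 1)) = (12 * (ℓ + 1)) * t * y := by ring
      _ ≤ (12 * (ℓ + 1)) * (prepDegree ℓ ^ 2 + blockDegree ℓ ^ 2) * r := by gcongr
      _ = x / 2 := by rw [← hmargin, ← hx]; ring
  have hD' : ∀ {t y : ℝ}, 0 ≤ y → 0 ≤ t → y ≤ r → t ≤ prepDegree ℓ ^ 2 + blockDegree ℓ ^ 2 →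
      t * y ≤ 1 / 8 := by
    intro t y hy0 ht0 hy ht
    have h1 := hD hy0 hy ht
    have h2 : t * y * 12 ≤ t * y * (12 * (ℓ + 1)) :=
      mul_le_mul_of_nonneg_left (by linarith) (by positivity)
    linarith
  have hs1 : (prepDegree ℓ : ℝ) ^ 2 ≤ prepDegree ℓ ^ 2 + blockDegree ℓ ^ 2 :=
    le_add_of_nonneg_right (by positivity)
  have hs2 : (blockDegree ℓ : ℝ) ^ 2 ≤ prepDegree ℓ ^ 2 + blockDegree ℓ ^ 2 :=
    le_add_of_nonneg_left (by positivity)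
  have hq0 : 0 ≤ rate a p := rate_nonneg _ hp
  have he := localStochastic_bitSupp_flips μ prep.basis hP
  have e1 : rate 2 (rate a p) ≤ rate (2 * a) p := rate_rate (by norm_num) ha hp
  have e2 : rate 2 (rate 2 (rate a p)) ≤ rate (2 * (2 * a)) p :=
    (rate_mono 2 (rate_nonneg _ hq0) e1).trans (rate_rate (by norm_num) (by omega) hp)
  -- Starting from the exponent `a`, the two square roots of the cluster estimate and the factor two
  -- in front each double it.
  have e3 : 2 * rate 2 (rate 2 (rate a p)) ≤ rate (8 * a) p := by
    have h := two_mul_rate_le (a := 2 * (2 * a)) (by omega) hp hp1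
    have h8 : 2 * (2 * (2 * a)) = 8 * a := by ring
    rw [h8] at h
    linarith
  have e4 : p ≤ rate (8 * a) p := by
    have h : rate 1 p = p := by simp [rate]
    exact h.symm.le.trans (rate_mono_left le_rfl (by omega) hp hp1)
  have e5 : rate a p ≤ rate (8 * a) p := rate_mono_left ha (by omega) hp hp1
  have g1 := prep.prob_not_small_le Ω μ _ _ hq0 he
    ((hD' (rate_nonneg _ hq0) (by positivity) (e1.trans (hmono _ (by omega) (by omega))) hs1).trans
      (by norm_num))
  have g2 := prep.localStochastic_residual Ω μ _ _ hq0 he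
    (hD' (rate_nonneg _ (rate_nonneg _ hq0)) (by positivity)
      (e2.trans (hmono _ (by omega) (by omega))) hs1)
  -- The two values of `Bool` stand for the data part of the error and for the residual of the
  -- decoding, in addition to the errors during `V`.
  have hR1 : LocalStochastic μ R (rate a (rate (8 * a) p)) := by
    refine V.localStochastic_touch μ hK hw (S := S ⊕ Bool) ?_ (rate_nonneg _ hp)
      (A := fun t ω => t.elim (fun t => A t ω) fun c => bif c then pauliSupp (P ω).left else
        pauliSupp (prep.residual (flips prep.basis (P ω).right))) ?_ ?_
    · rw [Fintype.card_sum, Fintype.card_bool]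
      omega
    · rintro (t | _ | _)
      · exact (hA t).mono μ (fun _ => le_rfl) hp e4
      · exact g2.mono μ (fun _ => le_rfl)
          (mul_nonneg zero_le_two (rate_nonneg _ (rate_nonneg _ hq0))) e3
      · exact (localStochastic_left μ hP).mono μ (fun _ => le_rfl) hq0 e5
    · intro ω z hz
      rcases hR ω z hz with ⟨t, y, hy, h⟩ | h | ⟨y, hy | hy, h⟩
      · exact ⟨.inl t, y, hy, .inr h⟩
      · exact ⟨.inr true, z, h, .inl rfl⟩
      · exact ⟨.inr true, y, hy, .inr h⟩
      · exact ⟨.inr false, y, hy, .inr h⟩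
  have hp2 : 0 ≤ rate (8 * a) p := rate_nonneg _ hp
  have e6 : rate a (rate (8 * a) p) ≤ rate (a * (8 * a)) p := rate_rate ha (by omega) hp
  have e8 : a * (8 * a) = 8 * (a * a) := by ring
  -- Spreading through `V` multiplies `8 * a` by `a`, and the estimate for half-filled clusters
  -- doubles the result; this explains the value `16 * (a * a)` of `noiseExp`.
  have e7 : rate 2 (rate a (rate (8 * a) p)) ≤ r := by
    refine (rate_mono 2 (rate_nonneg _ hp2) e6).trans
      ((rate_rate (by norm_num) (by rw [e8]; omega) hp).trans (hmono _ ?_ ?_))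
    · rw [e8]; omega
    · rw [e8]; omega
  refine ⟨hR1.mono μ (fun _ => le_rfl) (rate_nonneg _ hp2) (e6.trans (hmono _ ?_ ?_)), ?_⟩
  · rw [e8]; omega
  · rw [e8]; omega
  have g3 := prob_not_readable_le μ (Q := Q) (Δ := blockDegree ℓ) (by unfold blockDegree; omega)
    (fun v => (hf v).trans (Nat.le_succ _)) hsymm (rate_nonneg _ hp2) hR1
    ((hD' (rate_nonneg _ (rate_nonneg _ hp2)) (by positivity) e7 hs2).trans (by norm_num))
  refine failure_le hb hT hx0 hx1 (u := prepDegree ℓ ^ 2 * rate 2 (rate a p))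
    (v := blockDegree ℓ ^ 2 * rate 2 (rate a (rate (8 * a) p)))
    (mul_nonneg (by positivity) (rate_nonneg _ hq0)) ?_
    (mul_nonneg (by positivity) (rate_nonneg _ (rate_nonneg _ hp2))) ?_ (prob_le_one μ _) ?_
  · exact (hD (rate_nonneg _ hq0) (e1.trans (hmono _ (by omega) (by omega))) hs1).trans
      (by linarith)
  · exact (hD (rate_nonneg _ (rate_nonneg _ hp2)) e7 hs2).trans (by linarith)
  · refine (prob_le_sum μ (Finset.univ : Finset Bool) (fun c => bif c then
      {ω | ¬ prep.Small (flips prep.basis (P ω).right)} else {ω | ¬ Readable Q f (R ω)})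
      fun ω hω => ?_).trans ?_
    · by_cases h : prep.Small (flips prep.basis (P ω).right)
      · exact ⟨false, Finset.mem_univ _, fun h' => hω ⟨h, h'⟩⟩
      · exact ⟨true, Finset.mem_univ _, h⟩
    · rw [Fintype.sum_bool]
      exact add_le_add g1 g3

end

/-! ### The two implementations -/

section
variable {n N : ℕ} {Q : CSSCode n} {L : LogicalBasis Q} {C : LogicalCircuit N Q.k} {ℓ T b : ℕ}

theorem normSqSum_zeroState (ι : Type) [Fintype ι] [DecidableEq ι] :
    normSqSum (zeroState ι) = 1 :=
  normSqSum_uniformState (Set.singleton_nonempty 0)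

theorem LogicalCircuit.sum_idealDist (hC : ∀ t, ∀ g ∈ C.layers t,
    g.op ∈ Matrix.unitaryGroup (Bits (Fin g.arity × Fin Q.k)) ℂ) : ∑ y, C.idealDist y = 1 := by
  unfold LogicalCircuit.idealDist
  rw [sum_weight, C.normSqSum_finalState hC]

theorem sum_weight_of_isMultiple {f : Fin n → Finset (Fin n)}
    (hsymm : ∀ x y, y ∈ f x → x ∈ f y) (hloc : ∀ m, IsLocal f (Q.outcomes m))
    {R : Finset (Data N n)} (hR : Readable Q f R) {F : Op (Data N n)}
    (hF : F ∈ pauliSpan (R : Set (Data N n))) (hU : F ∈ Matrix.unitaryGroup (Bits (Data N n)) ℂ)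
    {ψ : State (Data N n)} (hψ : IsMultiple ψ (F *ᵥ (L.enc (Fin N) *ᵥ C.finalState))) :
    ∃ g : ℝ, ∀ y, ∑ z, (if decodeBlocks L.decoder C.meas z = y then
      weight (C.dataBasis n) ψ z else 0) = g * C.idealDist y := by
  obtain ⟨c, rfl⟩ := hψ
  refine ⟨‖c‖ ^ 2, fun y => ?_⟩
  rw [LogicalCircuit.idealDist, ← hR.sum_weight L hsymm hloc hF hU, Finset.mul_sum]
  refine Finset.sum_congr rfl fun z _ => ?_
  rw [weight_smul, mul_ite, mul_zero]
  rfl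

/-- The state of the code blocks after the measurement of the ancillas. -/
theorem Preparation.isMultiple_postMeasure {τ Δ : ℕ} (prep : Preparation L C τ Δ b)
    {e : Bits (Fin b)} (he : prep.Small e) (s : Bits (Fin b)) :
    IsMultiple (postMeasure prep.basis prep.state (s + e))
      (pauliOp (prep.recovery s) *ᵥ (pauliOp (prep.residual e) *ᵥ
        (L.enc (Fin N) *ᵥ C.initState))) :=
  IsMultiple.trans (prep.postMeasure_eq e he s) (isMultiple_pauliOp_add _ _ _)

theorem isMultiple_pauliOp_cancel {ι : Type} [Fintype ι] [DecidableEq ι] (A B : Pauli ι)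
    (φ : State ι) :
    IsMultiple (pauliOp A *ᵥ (pauliOp B *ᵥ (pauliOp A *ᵥ φ))) (pauliOp B *ᵥ φ) := by
  refine ((isMultiple_pauliOp_pauliOp B A φ).mulVec _).trans
    ((isMultiple_pauliOp_pauliOp _ _ _).trans ?_)
  have h : A + (B + A) = B := by
    rw [add_comm]
    ext1
    · exact bits_add_cancel _ _
    · exact bits_add_cancel _ _
  rw [h]
  exact IsMultiple.refl _

/-- The preparation is followed by the transversal gates before anything is measured. `V` denotes
these gates as a circuit on the data alone; the correction and the residual error are both
conjugated through it, and remain Paulis because the gates are Clifford. -/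
theorem Preparation.isImplementation
    (prep : Preparation L C (min T Q.dist) (prepDegree ℓ) b)
    (hb : b ≤ 3 * (ℓ + 1) * N * n * T) (hT : 1 ≤ T) {f : Fin n → Finset (Fin n)}
    (hsymm : ∀ x y, y ∈ f x → x ∈ f y) (hf : ∀ i, (f i).card ≤ 2 * ℓ * (2 * ℓ))
    (hloc : ∀ m, IsLocal f (Q.outcomes m)) {w K : ℕ} (hw : C.FanIn w)
    (hC : C.TransversalClifford L) (hK : 1 + prepDegree ℓ * prepDegree ℓ + C.depth ≤ K) :
    ∃ W : Circuit (Data N n ⊕ Fin b), W.depth ≤ K ∧ W.FanIn (max 2 w) ∧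
      IsImplementation L L.decoder C W prep.basis (threshold ℓ K (max 2 w))
        (fun p => N * n * T * ((p / threshold ℓ K (max 2 w)) ^
          ((1 : ℝ) / noiseExp K (max 2 w))) ^ min T Q.dist)
        (rate (noiseExp K (max 2 w))) := by
  classical
  obtain ⟨Ls, hlen, hdis, hLs, hfold⟩ := L.exists_layers C hw (fun _ U => IsClifford U)
    (fun _ _ h => h.1) fun t g hg => (hC t g hg).2
  have hdis' : ∀ l ∈ prep.layers ++ Ls.map (List.map (Gate.map Function.Embedding.inl)),
      DisjointGates l := by
    intro l hl
    rcases List.mem_append.1 hl with h | h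
    · exact prep.disjoint l h
    · obtain ⟨l', hl', rfl⟩ := List.mem_map.1 h
      exact (hdis l' hl').map _
  let W := Circuit.ofLayers _ hdis'
  let V := Circuit.ofLayers Ls hdis
  have hVC : V.Clifford := Circuit.clifford_ofLayers _ _ fun l hl g hg => (hLs l hl g hg).2
  have hVw : V.FanIn (max 2 w) := Circuit.fanIn_ofLayers _ _ fun l hl g hg =>
    (hLs l hl g hg).1.trans (le_max_right _ _)
  have hVK : V.depth ≤ K := by
    change Ls.length ≤ K
    omega
  have hWK : W.depth ≤ K := by
    change (prep.layers ++ Ls.map (List.map (Gate.map Function.Embedding.inl))).length ≤ K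
    have := prep.length_le
    rw [List.length_append, List.length_map]
    omega
  have hWw : W.FanIn (max 2 w) := by
    refine Circuit.fanIn_ofLayers _ _ fun l hl g hg => ?_
    rcases List.mem_append.1 hl with h | h
    · exact (prep.arity_le l h g hg).trans (le_max_left _ _)
    · obtain ⟨l', hl', rfl⟩ := List.mem_map.1 h
      obtain ⟨g', hg', rfl⟩ := List.mem_map.1 hg
      exact (hLs l' hl' g' hg').1.trans (le_max_right _ _)
  have hWC : W.Clifford := by
    refine Circuit.clifford_ofLayers _ _ fun l hl g hg => ?_
    rcases List.mem_append.1 hl with h | h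
    · exact prep.clifford l h g hg
    · obtain ⟨l', hl', rfl⟩ := List.mem_map.1 h
      obtain ⟨g', hg', rfl⟩ := List.mem_map.1 hg
      exact (hLs l' hl' g' hg').2
  choose P cP hPs hPr using W.exists_run_eq_pauli hWC
  choose conj hconj hconj' using V.exists_conj_pauli hVC
  have hpost : ∀ s, postMeasure prep.basis (W.unitaryOp *ᵥ zeroState _) s =
      V.unitaryOp *ᵥ postMeasure prep.basis prep.state s := by
    intro s
    rw [Circuit.unitaryOp_ofLayers, List.foldl_append, prep.foldl_eq, postMeasure_layers_map_inl,
      Circuit.unitaryOp_ofLayers]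
  have hVf : V.unitaryOp *ᵥ (L.enc (Fin N) *ᵥ C.initState) = L.enc (Fin N) *ᵥ C.finalState := by
    rw [Circuit.unitaryOp_ofLayers, hfold]
  let Rep : W.Faults → Pauli (Data N n) := fun E =>
    (P E).left + conj (prep.residual (flips prep.basis (P E).right))
  let Good : Set W.Faults := {E | prep.Small (flips prep.basis (P E).right) ∧
    Readable Q f (pauliSupp (Rep E))}
  have hstate : ∀ E ∈ Good, ∀ s, IsMultiple
      (pauliOp (conj (prep.recovery s)) *ᵥ postMeasure prep.basis (W.run E (zeroState _)) s)
      (pauliOp (Rep E) *ᵥ (L.enc (Fin N) *ᵥ C.finalState)) := by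
    intro E hE s
    have h1 : IsMultiple (postMeasure prep.basis (W.run E (zeroState _)) s)
        (postMeasure prep.basis (pauliOp (P E) *ᵥ (W.unitaryOp *ᵥ zeroState _)) s) :=
      ⟨cP E, by rw [hPr, postMeasure_smul]⟩
    have h2 := h1.trans (isMultiple_postMeasure_pauliOp _ _ _ _)
    rw [hpost] at h2
    have h3 := ((prep.isMultiple_postMeasure hE.1 s).mulVec V.unitaryOp).trans (hconj' _ _)
    have h4 := h3.trans ((hconj' _ _).mulVec _)
    rw [hVf] at h4
    exact ((h2.trans (h4.mulVec _)).mulVec _).trans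
      ((isMultiple_pauliOp_cancel _ _ _).trans (isMultiple_pauliOp_pauliOp _ _ _))
  refine ⟨W, hWK, hWw, fun s => conj (prep.recovery s), Rep, Good, hstate, fun p μ hp hpt hμ => ?_⟩
  have hP : LocalStochastic μ (fun E => pauliSupp (P E)) (rate (spreadExp K (max 2 w)) p) := by
    refine W.localStochastic_touch μ hWK hWw (S := Fin (W.depth + 1))
      (by rw [Fintype.card_fin]; omega) hp hμ fun E x hx => ?_
    obtain ⟨t, y, hy, h⟩ := hPs E hx
    exact ⟨t, y, hy, .inr h⟩
  -- The faults during the transversal layers are faults of `W` and already part of `P`, so no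
  -- separate errors during `V` are supplied.
  obtain ⟨hres, hgood⟩ := prep.noise μ hb hT hsymm hf V hVK hVw hp hpt hP
    (S := Empty) (A := fun _ _ => ∅) (by simp) (fun t => t.elim)
    (R := fun E => pauliSupp (Rep E)) fun E x hx => by
      rcases Finset.mem_union.1 (pauliSupp_add _ _ hx) with h | h
      · exact .inr (.inl h)
      · obtain ⟨y, hy, hyx⟩ := hconj _ x h
        exact .inr (.inr ⟨y, .inr hy, hyx⟩)
  refine ⟨hgood, hres, le_trans ?_ hgood⟩
  refine tvDist_outDist_le μ (fun _ _ _ => weight_nonneg _ _ _)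
    (fun E => ?_) (fun y => weight_nonneg _ _ _)
    (LogicalCircuit.sum_idealDist fun t g hg => (hC t g hg).1.1) Good fun E hE s => ?_
  · simp_rw [sum_weight]
    rw [sum_normSqSum_postMeasure, W.normSqSum_run, normSqSum_zeroState]
  · obtain ⟨g, hg⟩ := sum_weight_of_isMultiple hsymm hloc hE.2
      (pauliOp_mem_pauliSpan (P := Rep E) le_rfl) (pauliOp_unitary _) (hstate E hE s)
    -- Flipping the classical outcomes has the same effect as applying the correction before the
    -- measurement.
    refine ⟨g, fun y => (Fintype.sum_equiv (Equiv.addRight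
      (flips (C.dataBasis n) (conj (prep.recovery s)))) _ _ fun z => ?_).trans (hg y)⟩
    rw [Equiv.coe_addRight, weight_pauliOp, add_assoc, bits_add_self, add_zero]
    by_cases h : decodeBlocks L.decoder C.meas
        (z + flips (C.dataBasis n) (conj (prep.recovery s))) = y
    · exact (if_pos h).trans (if_pos h).symm
    · exact (if_neg h).trans (if_neg h).symm

set_option maxHeartbeats 1000000 in
-- Conjugation by a general gate would not keep the correction a Pauli, so it is applied before `V`.
-- What remains on the input of `V` does not depend on the outcome and is treated as a fault of `V`
-- before its first layer.
theorem Preparation.isAdaptiveImplementation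
    (prep : Preparation L C (min T Q.dist) (prepDegree ℓ) b)
    (hb : b ≤ 3 * (ℓ + 1) * N * n * T) (hT : 1 ≤ T) {f : Fin n → Finset (Fin n)}
    (hsymm : ∀ x y, y ∈ f x → x ∈ f y) (hf : ∀ i, (f i).card ≤ 2 * ℓ * (2 * ℓ))
    (hloc : ∀ m, IsLocal f (Q.outcomes m)) {w K : ℕ} (hw : C.FanIn w)
    (hC : C.Transversal L) (hK : 1 + prepDegree ℓ * prepDegree ℓ + C.depth ≤ K) :
    ∃ (W : Circuit (Data N n ⊕ Fin b)) (V : Circuit (Data N n)), W.depth + V.depth ≤ K ∧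
      W.FanIn (max 2 w) ∧ V.FanIn (max 2 w) ∧
      IsAdaptiveImplementation L L.decoder C W V prep.basis (threshold ℓ K (max 2 w))
        (fun p => N * n * T * ((p / threshold ℓ K (max 2 w)) ^
          ((1 : ℝ) / noiseExp K (max 2 w))) ^ min T Q.dist)
        (rate (noiseExp K (max 2 w))) := by
  classical
  obtain ⟨Ls, hlen, hdis, hLs, hfold⟩ := L.exists_layers C hw
    (fun r U => U ∈ Matrix.unitaryGroup (Bits (Fin r)) ℂ)
    (fun _ _ h => h) fun t g hg => (hC t g hg).2
  let W := Circuit.ofLayers prep.layers prep.disjoint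
  let V := Circuit.ofLayers Ls hdis
  have hVw : V.FanIn (max 2 w) := Circuit.fanIn_ofLayers _ _ fun l hl g hg =>
    (hLs l hl g hg).1.trans (le_max_right _ _)
  have hWw : W.FanIn (max 2 w) := Circuit.fanIn_ofLayers _ _ fun l hl g hg =>
    (prep.arity_le l hl g hg).trans (le_max_left _ _)
  have hWC : W.Clifford := Circuit.clifford_ofLayers _ _ prep.clifford
  have hWV : W.depth + V.depth ≤ K := by
    change prep.layers.length + Ls.length ≤ K
    have := prep.length_le
    omega
  choose P cP hPs hPr using W.exists_run_eq_pauli hWC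
  have hVf : V.unitaryOp *ᵥ (L.enc (Fin N) *ᵥ C.initState) = L.enc (Fin N) *ᵥ C.finalState := by
    rw [Circuit.unitaryOp_ofLayers, hfold]
  have hWs : W.unitaryOp *ᵥ zeroState _ = prep.state := by
    rw [Circuit.unitaryOp_ofLayers, prep.foldl_eq]
  let B : W.Faults → Pauli (Data N n) := fun E =>
    (P E).left + prep.residual (flips prep.basis (P E).right)
  -- The error left by the preparation is merged into the first fault of `V`, so one spreading bound
  -- covers both.
  let E' : W.Faults × V.Faults → V.Faults := fun E => Function.update E.2 0 (E.2 0 + B E.1)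
  choose F hFu hFs hFr _ using V.exists_run_eq
  let R : W.Faults × V.Faults → Finset (Data N n) := fun E => (V.spread (E' E) V.depth).toFinset
  have hFR : ∀ E, F (E' E) ∈ pauliSpan (R E : Set (Data N n)) := fun E => by
    rw [Set.coe_toFinset]
    exact hFs _
  let Good : Set (W.Faults × V.Faults) := {E | prep.Small (flips prep.basis (P E.1).right) ∧
    Readable Q f (R E)}
  have hstate : ∀ E ∈ Good, ∀ s, IsMultiple
      (V.run E.2 (pauliOp (prep.recovery s) *ᵥ
        postMeasure prep.basis (W.run E.1 (zeroState _)) s))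
      (F (E' E) *ᵥ (L.enc (Fin N) *ᵥ C.finalState)) := by
    intro E hE s
    have h1 : IsMultiple (postMeasure prep.basis (W.run E.1 (zeroState _)) s)
        (postMeasure prep.basis (pauliOp (P E.1) *ᵥ (W.unitaryOp *ᵥ zeroState _)) s) :=
      ⟨cP E.1, by rw [hPr, postMeasure_smul]⟩
    have h2 := h1.trans (isMultiple_postMeasure_pauliOp _ _ _ _)
    rw [hWs] at h2
    have h3 := ((h2.trans ((prep.isMultiple_postMeasure hE.1 s).mulVec _)).mulVec
      (pauliOp (prep.recovery s))).trans
      ((isMultiple_pauliOp_cancel _ _ _).trans (isMultiple_pauliOp_pauliOp _ _ _))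
    refine (h3.run V E.2).trans (IsMultiple.trans (V.run_pauliOp E.2 (B E.1) _) ?_)
    rw [← hVf, ← hFr]
    exact IsMultiple.refl _
  refine ⟨W, V, hWV, hWw, hVw, prep.recovery, R, Good,
    fun E hE => ⟨F (E' E), hFu _, supportedOn_of_mem_pauliSpan (hFR E), hstate E hE⟩,
    fun p μ hp hpt hμ hμ' => ?_⟩
  have hP : LocalStochastic μ (fun E => pauliSupp (P E.1)) (rate (spreadExp K (max 2 w)) p) := by
    refine W.localStochastic_touch μ (by omega) hWw (S := Fin (W.depth + 1))
      (by rw [Fintype.card_fin]; omega) hp hμ fun E x hx => ?_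
    obtain ⟨t, y, hy, h⟩ := hPs E.1 hx
    exact ⟨t, y, hy, .inr h⟩
  obtain ⟨hres, hgood⟩ := prep.noise μ hb hT hsymm hf V (by omega) hVw hp hpt hP
    (S := Fin (V.depth + 1)) (by rw [Fintype.card_fin]; omega) hμ' (R := R) fun E x hx => by
      obtain ⟨t, y, hy, hyx⟩ := Set.mem_toFinset.1 hx
      by_cases ht : t = 0
      · subst ht
        simp only [E', Function.update_self] at hy
        rcases Finset.mem_union.1 (pauliSupp_add _ _ hy) with h | h
        · exact .inl ⟨0, y, h, hyx⟩
        · exact .inr (.inr ⟨y, Finset.mem_union.1 (pauliSupp_add _ _ h), hyx⟩)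
      · simp only [E', Function.update_of_ne ht] at hy
        exact .inl ⟨t, y, hy, hyx⟩
  refine ⟨hgood, hres, le_trans ?_ hgood⟩
  refine tvDist_outDist_le μ (fun _ _ _ => weight_nonneg _ _ _)
    (fun E => ?_) (fun y => weight_nonneg _ _ _)
    (LogicalCircuit.sum_idealDist fun t g hg => (hC t g hg).1) Good fun E hE s => ?_
  · simp_rw [sum_weight, V.normSqSum_run, normSqSum_unitary (pauliOp_unitary _)]
    rw [sum_normSqSum_postMeasure, W.normSqSum_run, normSqSum_zeroState]
  · obtain ⟨g, hg⟩ := sum_weight_of_isMultiple hsymm hloc hE.2 (hFR E) (hFu _) (hstate E hE s)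
    refine ⟨g, fun y => (Finset.sum_congr rfl fun z _ => ?_).trans (hg y)⟩
    by_cases h : decodeBlocks L.decoder C.meas z = y
    · exact (if_pos h).trans (if_pos h).symm
    · exact (if_neg h).trans (if_neg h).symm

end

end ShallowFT

end

/-! ### The choice of the constants -/

open ShallowFT in
theorem mainTheorem5 (ℓ D w : ℕ) :
    ∃ (K : ℕ) (pstar c c₁ c₂ : ℝ),
      0 < pstar ∧ pstar < 1 ∧ 0 < c ∧ 0 < c₁ ∧ 0 < c₂ ∧
      ∀ (n : ℕ) (Q : CSSCode n) (L : LogicalBasis Q), Q.IsLDPC ℓ →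
        ∃ dec : ShallowFT.Basis → Bits (Fin n) → Bits (Fin Q.k),
          ∀ (N : ℕ) (C : LogicalCircuit N Q.k) (T : ℕ),
            C.depth ≤ D → C.FanIn w → 1 ≤ T →
            (C.TransversalClifford L →
              ∃ (b : ℕ) (W : Circuit (Data N n ⊕ Fin b)) (m : Fin b → ShallowFT.Basis),
                W.depth ≤ K ∧ W.FanIn (max 2 w) ∧ b ≤ K * N * n * T ∧
                IsImplementation L dec C W m pstar
                  (fun p => N * n * T * (p / pstar) ^ (c * (min T Q.dist : ℕ)))
                  (fun p => c₁ * p ^ c₂)) ∧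
            (C.Transversal L →
              ∃ (b : ℕ) (W : Circuit (Data N n ⊕ Fin b)) (V : Circuit (Data N n))
                (m : Fin b → ShallowFT.Basis),
                W.depth + V.depth ≤ K ∧ W.FanIn (max 2 w) ∧ V.FanIn (max 2 w) ∧
                b ≤ K * N * n * T ∧
                IsAdaptiveImplementation L dec C W V m pstar
                  (fun p => N * n * T * (p / pstar) ^ (c * (min T Q.dist : ℕ)))
                  (fun p => c₁ * p ^ c₂)) := by
  have hpow : ∀ {x a : ℝ} (k : ℕ), 0 ≤ x → x ^ (a * (k : ℝ)) = (x ^ a) ^ k := fun k hx => by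
    rw [Real.rpow_mul hx, Real.rpow_natCast]
  -- The first three summands bound the depth of preparation and logical gates; the last one bounds
  -- the number of ancillas.
  set K := 1 + prepDegree ℓ * prepDegree ℓ + D + 3 * (ℓ + 1) with hK
  have ha : (0 : ℝ) < noiseExp K (max 2 w) := by
    exact_mod_cast one_le_noiseExp K (max 2 w)
  refine ⟨K, threshold ℓ K (max 2 w), 1 / noiseExp K (max 2 w), noiseExp K (max 2 w),
    1 / noiseExp K (max 2 w), threshold_pos _ _ _, threshold_lt_one _ _ _, by positivity, ha,
    by positivity, fun n Q L hQ => ⟨L.decoder, fun N C T hD hw hT => ?_⟩⟩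
  obtain ⟨f, hsymm, hf, hloc⟩ := hQ.exists_readout
  obtain ⟨b, hb, ⟨prep⟩⟩ := exists_preparation L hQ C hT
  have hbK : b ≤ K * N * n * T := hb.trans (by gcongr; omega)
  refine ⟨fun hC => ?_, fun hC => ?_⟩
  · obtain ⟨W, hWK, hWw, Rec, Rep, Good, h1, h2⟩ :=
      prep.isImplementation hb hT hsymm hf hloc hw hC (K := K) (by omega)
    refine ⟨b, W, prep.basis, hWK, hWw, hbK, Rec, Rep, Good, h1, fun p μ hp hpt hμ => ?_⟩
    have h := h2 p μ hp hpt hμ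
    beta_reduce at h ⊢
    rw [hpow _ (div_nonneg hp (threshold_pos _ _ _).le)]
    exact h
  · obtain ⟨W, V, hK', hWw, hVw, Rec, R, Good, h1, h2⟩ :=
      prep.isAdaptiveImplementation hb hT hsymm hf hloc hw hC (K := K) (by omega)
    refine ⟨b, W, V, prep.basis, hK', hWw, hVw, hbK, Rec, R, Good, h1,
      fun p μ hp hpt hμ hμ' => ?_⟩
    have h := h2 p μ hp hpt hμ hμ'
    beta_reduce at h ⊢
    rw [hpow _ (div_nonneg hp (threshold_pos _ _ _).le)]
    exact h
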